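/- **Notation.** All spaces are complex and $\mathbb Z/2$-graded ($\mathbb Z_2$-graded); subspaces, subquotients and direct sums are graded, and $\epsilon$ is the parity endomorphism ($v\mapsto(-1)^{|v|}v$). On $\mathbb C[x,\xi]$ ($x$ even, $\xi$ odd, $\xi^2=0$) put $F'=\partial_xF$, $D=\partial_\xi+\xi\partial_x$, $\overline D=\partial_\xi-\xi\partial_x$, so $\overline D^2=-\partial_x$. *The algebra.* $\mathcal K$ is the Lie superalgebra of polynomial contact vector fields of $\mathbb R^{1|1}$, i.e. those $X$ with $[X,\mathbb C[x,\xi]\overline D]\subset\mathbb C[x,\xi]\overline D$. For $F=f+\xi g$ with $f,g\in\mathbb C[x]$ let $$\mathbb X(F)=f\partial_x+\tfrac12 f'\xi\partial_\xi+\tfrac12 gD .$$ Then $F\mapsto\mathbb X(F)$ is a parity-preserving linear bijection $\mathbb C[x,\xi]\to\mathcal K$. Put $e_{k-1}=\mathbb X(x^k)$ and $e_{k-1/2}=2\mathbb X(\xi x^k)$ for $k\in\mathbb N$. The conformal subalgebra is $\mathfrak s=\mathrm{span}\{e_{-1},e_{-1/2},e_0,e_{1/2},e_1\}\cong\mathfrak{osp}_{1|2}$.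 *Modules.* For $\lambda\in\mathbb C$, the tensor density module $\mathbb F(\lambda)=\omega^\lambda\mathbb C[x,\xi]$ (the symbol $\omega^\lambda$ is even) carries the action $\pi_\lambda(\mathbb X(F))\,\omega^\lambda G=\omega^\lambda\bigl(\mathbb X(F)G+\lambda F'G\bigr)$. For $n\in\mathbb Z$, $V^{n\Pi}$ is $V$ with the same action and with the grading reversed if $n$ is odd. For $\lambda\in\mathbb C$ and $p_1,\dots,p_n\in\frac12\mathbb Z$, a *$(\lambda;p_1,\dots,p_n)$ extension* is a $\mathcal K$-module $W$ with an invariant flag $W=W_0\supseteq W_1\supseteq\cdots\supseteq W_{n+1}=0$ such that, for $0\le r\le n$, $W_r/W_{r+1}$ is evenly equivalent to $\mathbb F(\lambda+p_1+\cdots+p_r)^{2(p_1+\cdots+p_r)\Pi}$. It is *$\mathfrak s$-split* if every $W_r\to W_r/W_{r+1}$ has an even $\mathfrak s$-equivariant section. A module is *uniserial* if all of its subquotients are indecomposable (not the direct sum of two non-zero submodules). *Cochains.* Let $\sigma_{\lambda,p}$ be the usual action of $\mathcal K$ on $\mathrm{Hom}(\mathbb F(\lambda),\mathbb F(\lambda+p))$,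 $\sigma_{\lambda,p}(X)T=\pi_{\lambda+p}(X)T-(-1)^{|X||T|}T\pi_\lambda(X)$. A 1-cochain (linear map from $\mathcal K$ to a $\mathcal K$-module) is $\mathfrak s$-relative if it vanishes on $\mathfrak s$ and is $\mathfrak s$-equivariant. For $2p\in\{3,4,5,\dots\}$ let $\overline\beta_p(\lambda):\mathcal K\to\mathrm{Hom}(\mathbb F(\lambda),\mathbb F(\lambda+p))$ be the $\mathfrak s$-relative 1-cochain of parity $2p \bmod 2$ that vanishes on $\mathfrak s$ and satisfies $$\overline\beta_p(\lambda)\bigl(\mathrm{ad}(e_{1/2})^m e_{3/2}\bigr)=4(-1)^{2pm}\,\sigma_{\lambda,p}(e_{1/2})^m\bigl(\omega^p\overline D^{\,2p-3}\bigr)\qquad(m\in\mathbb N).$$ Define the even $\mathfrak s$-relative 1-cochain $\beta_p(\lambda):\mathcal K\to\mathrm{Hom}(\mathbb F(\lambda),\mathbb F(\lambda+p)^{2p\Pi})$ by $\beta_p(\lambda)(X)=\overline\beta_p(\lambda)(X)$ if $2p$ is even, $\beta_p(\lambda)(X)=\epsilon\circ\overline\beta_p(\lambda)(X)$ with $\epsilon$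 the parity endomorphism of $\mathbb C[x,\xi]$ if $2p$ is odd, and put $\beta_p(\lambda)=0$ for $2p\notin\{3,4,5,\dots\}$. For even 1-cochains, $(\alpha\cup\beta)(X,Y)=\alpha(X)\beta(Y)-(-1)^{|X||Y|}\alpha(Y)\beta(X)$ and $\partial\phi(X,Y)=X\cdot\phi(Y)-(-1)^{|X||Y|}\,Y\cdot\phi(X)-\phi([X,Y])$, where $\cdot$ is the action on $\mathrm{Hom}$. The cup product $\beta_{p_2}(\lambda+p_1)\cup\beta_{p_1}(\lambda)$ *is a 2-coboundary* if it equals $\partial\phi$ for some even $\mathfrak s$-relative 1-cochain $\phi$ of $\mathcal K$ with values in $\mathrm{Hom}\bigl(\mathbb F(\lambda),\mathbb F(\lambda+p_1+p_2)^{2(p_1+p_2)\Pi}\bigr)$. *Pseudodifferential operators.* For $z\in\mathbb C$ let $\overline D^z_0$ and $\overline D^z_1$ denote non-zero multiples of the formal symbols $\partial_x^{z/2}$ and $\partial_x^{(z-1)/2}\overline D$, composed with functions by $\partial_x^w\circ H=\sum_{j\ge0}\binom wj(\partial_x^jH)\,\partial_x^{w-j}$ and $\overline D\circ H=\overline D(H)+\epsilon(H)\overline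 D$. For $\nu,q,k\in\mathbb C$ and $\ell\in\mathbb Z_2$, $\Psi^k_\ell(\nu,q)$ is the space of formal series $\omega^q\sum_{j\in\mathbb N}G_j\overline D^{2k-j}_{\ell-j}$, $G_j\in\mathbb C[x,\xi]$, with the action $X\cdot T=\pi_{\nu+q}(X)\circ T-(-1)^{|X||T|}\,T\circ\pi_\nu(X)$ of $\mathcal K$. A module *is a $\Psi$DO subquotient* if it is equivalent, by a possibly odd equivalence, to a subquotient of some $\Psi^k_\ell(\nu,q)$. **Proposition 6.7.** Let $\lambda\in\mathbb C$ and $p_1,p_2\in\frac12\mathbb Z$. There exists a uniserial $\mathfrak s$-split $(\lambda;p_1,p_2)$ extension if and only if there exist uniserial $\mathfrak s$-split $(\lambda;p_1)$ and $(\lambda+p_1;p_2)$ extensions and $\beta_{p_2}(\lambda+p_1)\cup\beta_{p_1}(\lambda)$ is a 2-coboundary. When such an extension exists, it is unique up to even equivalence; call it $\mathbb F(\lambda;p_1,p_2)$. (a) $\mathbb F(\lambda;\frac32,\frac32)$ exists if and only if $-2\lambda\notin\{0,1,4,5\}$. It is a $\Psi$DO subquotient for $-2\lambda\notin\{0,\dots,5\}$.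 (b) $\mathbb F(\lambda;2,\frac32)$ exists if and only if $-2\lambda\notin\{0,3,5\}$. It is a $\Psi$DO subquotient for $-2\lambda\notin\{0,\dots,6\}$. (c) $\mathbb F(\lambda;\frac32,2)$ exists if and only if $-2\lambda\notin\{1,3\}$. It is a $\Psi$DO subquotient for $-2\lambda\notin\{0,\dots,6\}$. (d) $\mathbb F(\lambda;\frac52,\frac32)$ exists if and only if $-4\lambda\notin\{0,4,12,7\pm\sqrt{33}\}$. It is a $\Psi$DO subquotient for $-2\lambda\notin\{0,\dots,7\}$ and $4\lambda\ne-7\pm\sqrt{33}$. (e) $\mathbb F(\lambda;\frac32,\frac52)$ exists if and only if $-4\lambda\notin\{2,6,10,7\pm\sqrt{33}\}$. It is a $\Psi$DO subquotient for $-2\lambda\notin\{0,\dots,7\}$ and $4\lambda\ne-7\pm\sqrt{33}$. (f) $\mathbb F(\lambda;2,2)$ exists if and only if $-4\lambda\notin\{0,8,7\pm\sqrt{33}\}$. It is a $\Psi$DO subquotient for $-2\lambda\notin\{0,\dots,7\}$ and $4\lambda\ne-7\pm\sqrt{33}$. (g) $\mathbb F(\lambda;\frac52,2)$ exists if and only if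 $-4\lambda\notin\{0,4,8,10\}$. It is a $\Psi$DO subquotient for $-2\lambda\notin\{0,\dots,8\}$. (h) $\mathbb F(\lambda;2,\frac52)$ exists if and only if $-4\lambda\notin\{0,8,12\}$. It is a $\Psi$DO subquotient for $-2\lambda\notin\{0,\dots,8\}$. (i) $\mathbb F(-4;\frac32,3)$, $\mathbb F(-\frac92;\frac52,\frac52)$ and $\mathbb F(-\frac92;2,3)$ exist. -/

import Mathlib

namespace SuperK

noncomputable section

open Polynomial TrivSqZeroExt

/-! ## Polynomial functions and contact vector fields on the superline -/

/-- The superalgebra `ℂ[x, ξ]` with `ξ ^ 2 = 0`.  An element is `f + ξ g`, with even part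
`f = F.fst` and odd part `ξ g`, `g = F.snd`. -/
abbrev SFun : Type := DualNumber ℂ[X]

/-- The parity endomorphism `f + ξ g ↦ f - ξ g` of `ℂ[x, ξ]`. -/
def parity : SFun →ₗ[ℂ] SFun where
  toFun F := inl F.fst - inr F.snd
  map_add' F G := by ext <;> simp [add_comm]
  map_smul' c F := by ext <;> simp

/-- The projection `f + ξ g ↦ f` to the even part. -/
def evenPart : SFun →ₗ[ℂ] SFun where
  toFun F := inl F.fst
  map_add' F G := by ext <;> simp
  map_smul' c F := by ext <;> simp

/-- The projection `f + ξ g ↦ ξ g` to the odd part. -/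
def oddPart : SFun →ₗ[ℂ] SFun where
  toFun F := inr F.snd
  map_add' F G := by ext <;> simp
  map_smul' c F := by ext <;> simp

/-- The vector field `∂_x`; `dx F` is also written `F'`. -/
def dx : Module.End ℂ SFun where
  toFun F := inl (derivative F.fst) + inr (derivative F.snd)
  map_add' F G := by ext <;> simp
  map_smul' c F := by ext <;> simp

/-- The vector field `∂_ξ`. -/
def dxi : Module.End ℂ SFun where
  toFun F := inl F.snd
  map_add' F G := by ext <;> simp
  map_smul' c F := by ext <;> simp

/-- Multiplication operators on `ℂ[x, ξ]`. -/
def mul : SFun →ₐ[ℂ] Module.End ℂ SFun := Algebra.lmul ℂ SFun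

/-- The odd coordinate `ξ`. -/
def xi : SFun := inr 1

/-- `D = ∂_ξ + ξ ∂_x`. -/
def D : Module.End ℂ SFun := dxi + mul xi * dx

/-- `D̄ = ∂_ξ - ξ ∂_x`. -/
def Dbar : Module.End ℂ SFun := dxi - mul xi * dx

@[simp] lemma parity_fst (F : SFun) : (parity F).fst = F.fst := by simp [parity]
@[simp] lemma parity_snd (F : SFun) : (parity F).snd = -F.snd := by simp [parity]
@[simp] lemma evenPart_fst (F : SFun) : (evenPart F).fst = F.fst := by simp [evenPart]
@[simp] lemma evenPart_snd (F : SFun) : (evenPart F).snd = 0 := by simp [evenPart]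
@[simp] lemma oddPart_fst (F : SFun) : (oddPart F).fst = 0 := by simp [oddPart]
@[simp] lemma oddPart_snd (F : SFun) : (oddPart F).snd = F.snd := by simp [oddPart]
@[simp] lemma dx_fst (F : SFun) : (dx F).fst = derivative F.fst := by simp [dx]
@[simp] lemma dx_snd (F : SFun) : (dx F).snd = derivative F.snd := by simp [dx]
@[simp] lemma dxi_fst (F : SFun) : (dxi F).fst = F.snd := by simp [dxi]
@[simp] lemma dxi_snd (F : SFun) : (dxi F).snd = 0 := by simp [dxi]
@[simp] lemma mul_apply' (F G : SFun) : mul F G = F * G := rfl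
@[simp] lemma xi_fst : xi.fst = 0 := by simp [xi]
@[simp] lemma xi_snd : xi.snd = 1 := by simp [xi]
@[simp] lemma D_fst (F : SFun) : (D F).fst = F.snd := by simp [D]
@[simp] lemma D_snd (F : SFun) : (D F).snd = derivative F.fst := by simp [D]
@[simp] lemma Dbar_fst (F : SFun) : (Dbar F).fst = F.snd := by simp [Dbar]
@[simp] lemma Dbar_snd (F : SFun) : (Dbar F).snd = -derivative F.fst := by simp [Dbar]

@[simp] lemma mul_fst (F G : SFun) : (F * G).fst = F.fst * G.fst := rfl
@[simp] lemma mul_snd (F G : SFun) : (F * G).snd = F.fst * G.snd + F.snd * G.fst := by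
  simp [mul_comm]

/-- The sign `(-1) ^ d`, for a parity `d`. -/
def sgn (d : ZMod 2) : ℂ := (-1) ^ d.val

@[simp] lemma sgn_zero : sgn 0 = 1 := by simp [sgn]
@[simp] lemma sgn_one : sgn 1 = -1 := by simp [sgn, ZMod.val_one]

/-- `F` is homogeneous of parity `d`. -/
def Homog (d : ZMod 2) (F : SFun) : Prop := parity F = sgn d • F

/-- The contact vector field of contact Hamiltonian `f + ξ g`, namely
`𝕏(f + ξ g) = (f ∂_x + ½ f' ξ ∂_ξ) + ½ g D`. -/
def vf (F : SFun) : Module.End ℂ SFun :=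
  mul (inl F.fst) * dx + (1 / 2 : ℂ) • (mul (inl (derivative F.fst)) * mul xi * dxi) +
    (1 / 2 : ℂ) • (mul (inl F.snd) * D)

/-- The contact bracket `{F, G} = F G' - F' G - ½ (-1)^|G| D(F) D(G)`.  With this bracket
`ℂ[x, ξ]` is identified with the Lie superalgebra `𝒦` of contact vector fields, through `vf`
(see `vf_bracket`, `vf_injective` and `mem_range_vf_iff`). -/
def cbracket (F G : SFun) : SFun :=
  F * dx G - dx F * G - (1 / 2 : ℂ) • (D F * D (parity G))

lemma vf_eq (F : SFun) : vf F = mul F * dx + (1 / 2 : ℂ) • (mul (D F) * Dbar) := by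
  refine LinearMap.ext fun G => TrivSqZeroExt.ext ?_ ?_
  · simp [vf]
  · simp [vf, -smul_add]
    algebra with ℂ

lemma homog_zero {F : SFun} (h : Homog 0 F) : F.snd = 0 := by
  have := congrArg TrivSqZeroExt.snd h
  simp at this
  exact self_eq_neg.mp this.symm

lemma homog_one {F : SFun} (h : Homog 1 F) : F.fst = 0 := by
  have := congrArg TrivSqZeroExt.fst h
  simp at this
  exact self_eq_neg.mp this

lemma parity_homog {d : ZMod 2} {F : SFun} (h : Homog d F) : parity F = sgn d • F := h

lemma mul_of_relations {E : Type*} [Ring E] [Algebra ℂ E] (m : SFun →ₐ[ℂ] E) (d δ : E)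
    (h1 : ∀ F, d * m F = m F * d + m (dx F))
    (h2 : ∀ F, δ * m F = m (Dbar F) + m (parity F) * δ)
    (h3 : δ * δ = -d) (h4 : d * δ = δ * d) (l : ℂ) (F G : SFun) :
    (m F * d + (1 / 2 : ℂ) • (m (D F) * δ) + l • m (dx F)) *
      (m G * d + (1 / 2 : ℂ) • (m (D G) * δ) + l • m (dx G)) =
      m (F * G) * (d * d) + m ((1 / 2 : ℂ) • (F * D G + D F * parity G)) * (δ * d) +
      m (F * dx G + l • (F * dx G) + (1 / 2 : ℂ) • (D F * Dbar G)
        - (1 / 4 : ℂ) • (D F * parity (D G)) + l • (dx F * G)) * d +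
      m ((1 / 2 : ℂ) • (F * dx (D G)) + (1 / 4 : ℂ) • (D F * Dbar (D G)) +
        (l / 2) • (D F * parity (dx G)) + (l / 2) • (dx F * D G)) * δ +
      m (l • (F * dx (dx G)) + (l / 2) • (D F * Dbar (dx G)) + (l * l) • (dx F * dx G)) := by
  have e1 : ∀ H Z, d * (m H * Z) = m H * (d * Z) + m (dx H) * Z := by
    intro H Z; rw [← mul_assoc, h1]; noncomm_ring
  have e2 : ∀ H Z, δ * (m H * Z) = m (Dbar H) * Z + m (parity H) * (δ * Z) := by
    intro H Z; rw [← mul_assoc, h2]; noncomm_ring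
  simp only [add_mul, mul_add, mul_assoc, smul_mul_assoc, mul_smul_comm, e1, e2, h1, h2, h3, h4,
    map_add, map_sub, map_smul, map_mul, smul_add, mul_neg, sub_mul, smul_neg]
  match_scalars <;> ring

lemma homog_cases {i : ZMod 2} {F : SFun} (h : Homog i F) :
    (i = 0 ∧ ∃ f, F = inl f) ∨ (i = 1 ∧ ∃ f, F = inr f) := by
  fin_cases i
  · exact Or.inl ⟨rfl, F.fst, TrivSqZeroExt.ext (by simp) (by simp [homog_zero h])⟩
  · exact Or.inr ⟨rfl, F.snd, TrivSqZeroExt.ext (by simp [homog_one h]) (by simp)⟩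

set_option linter.unusedSimpArgs false in
set_option maxHeartbeats 1000000 in
lemma bracket_coeffs (l : ℂ) (i j : ZMod 2) (F G : SFun) (hF : Homog i F) (hG : Homog j G) :
    (F * G = sgn (i * j) • (G * F)) ∧
    ((1 / 2 : ℂ) • (F * D G + D F * parity G) =
      sgn (i * j) • ((1 / 2 : ℂ) • (G * D F + D G * parity F))) ∧
    (cbracket F G = (F * dx G + l • (F * dx G) + (1 / 2 : ℂ) • (D F * Dbar G)
        - (1 / 4 : ℂ) • (D F * parity (D G)) + l • (dx F * G)) - sgn (i * j) •
       (G * dx F + l • (G * dx F) + (1 / 2 : ℂ) • (D G * Dbar F)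
        - (1 / 4 : ℂ) • (D G * parity (D F)) + l • (dx G * F))) ∧
    ((1 / 2 : ℂ) • D (cbracket F G) =
      ((1 / 2 : ℂ) • (F * dx (D G)) + (1 / 4 : ℂ) • (D F * Dbar (D G)) +
        (l / 2) • (D F * parity (dx G)) + (l / 2) • (dx F * D G)) - sgn (i * j) •
      ((1 / 2 : ℂ) • (G * dx (D F)) + (1 / 4 : ℂ) • (D G * Dbar (D F)) +
        (l / 2) • (D G * parity (dx F)) + (l / 2) • (dx G * D F))) ∧
    (l • dx (cbracket F G) =
      (l • (F * dx (dx G)) + (l / 2) • (D F * Dbar (dx G)) + (l * l) • (dx F * dx G)) -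
      sgn (i * j) •
      (l • (G * dx (dx F)) + (l / 2) • (D G * Dbar (dx F)) + (l * l) • (dx G * dx F))) := by
  rcases homog_cases hF with ⟨rfl, f, rfl⟩ | ⟨rfl, f, rfl⟩ <;>
  rcases homog_cases hG with ⟨rfl, g, rfl⟩ | ⟨rfl, g, rfl⟩ <;>
  refine ⟨?_, ?_, ?_, ?_, ?_⟩ <;>
  refine TrivSqZeroExt.ext ?_ ?_ <;>
  simp only [cbracket, mul_one, mul_zero, zero_mul, sgn_zero, sgn_one, mul_fst, mul_snd, D_fst,
    D_snd, Dbar_fst, Dbar_snd, dx_fst, dx_snd, parity_fst, parity_snd, fst_inl, snd_inl, fst_inr,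
    snd_inr, fst_add, snd_add, fst_sub, snd_sub, fst_smul, snd_smul, derivative_mul, map_zero,
    map_add, map_sub, map_neg, map_smul, smul_zero, add_zero, zero_add, sub_zero, neg_zero,
    one_smul, derivative_smul, smul_eq_C_mul, C_neg, C_1, C_mul, zero_sub] <;>
  (apply Polynomial.funext; intro r; simp only [eval_add, eval_sub, eval_mul, eval_neg, eval_C,
      eval_one, eval_zero]; ring)

/-- If multiplication operators `m F`, an operator `d` and an operator `δ` satisfy the relations of
`ℂ[x, ξ]`, `∂_x` and `D̄`, then the operators `𝕏(F) + l F'` built from them satisfy the bracket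
relations of `𝒦`. -/
lemma bracket_of_relations {E : Type*} [Ring E] [Algebra ℂ E] (m : SFun →ₐ[ℂ] E) (d δ : E)
    (h1 : ∀ F, d * m F = m F * d + m (dx F))
    (h2 : ∀ F, δ * m F = m (Dbar F) + m (parity F) * δ)
    (h3 : δ * δ = -d) (h4 : d * δ = δ * d) (l : ℂ) (i j : ZMod 2) (F G : SFun)
    (hF : Homog i F) (hG : Homog j G) :
    (m (cbracket F G) * d + (1 / 2 : ℂ) • (m (D (cbracket F G)) * δ) +
      l • m (dx (cbracket F G))) =
    (m F * d + (1 / 2 : ℂ) • (m (D F) * δ) + l • m (dx F)) *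
      (m G * d + (1 / 2 : ℂ) • (m (D G) * δ) + l • m (dx G)) -
    sgn (i * j) • ((m G * d + (1 / 2 : ℂ) • (m (D G) * δ) + l • m (dx G)) *
      (m F * d + (1 / 2 : ℂ) • (m (D F) * δ) + l • m (dx F))) := by
  rw [mul_of_relations m d δ h1 h2 h3 h4, mul_of_relations m d δ h1 h2 h3 h4]
  have e0 : ∀ a₁ b₁ c₁ d₁ f₁ a₂ b₂ c₂ d₂ f₂ c d' f : SFun, ∀ s : ℂ,
      a₁ = s • a₂ → b₁ = s • b₂ → c = c₁ - s • c₂ → d' = d₁ - s • d₂ → f = f₁ - s • f₂ →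
      m c * d + m d' * δ + m f =
      (m a₁ * (d * d) + m b₁ * (δ * d) + m c₁ * d + m d₁ * δ + m f₁) -
      s • (m a₂ * (d * d) + m b₂ * (δ * d) + m c₂ * d + m d₂ * δ + m f₂) := by
    rintro a₁ b₁ c₁ d₁ f₁ a₂ b₂ c₂ d₂ f₂ c d' f s rfl rfl rfl rfl rfl
    simp only [map_sub, map_smul, sub_mul, smul_add, smul_mul_assoc]
    abel
  rw [show (1 / 2 : ℂ) • (m (D (cbracket F G)) * δ) = m ((1 / 2 : ℂ) • D (cbracket F G)) * δ by
    rw [map_smul, smul_mul_assoc], ← map_smul m l]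
  obtain ⟨k1, k2, k3, k4, k5⟩ := bracket_coeffs l i j F G hF hG
  exact e0 _ _ _ _ _ _ _ _ _ _ _ _ _ _ k1 k2 k3 k4 k5

lemma dx_mul (F G : SFun) : dx (F * G) = dx F * G + F * dx G := by
  refine TrivSqZeroExt.ext ?_ ?_
  · simp [derivative_mul]
  · simp [derivative_mul]
    ring

lemma Dbar_mul (F G : SFun) : Dbar (F * G) = Dbar F * G + parity F * Dbar G := by
  refine TrivSqZeroExt.ext ?_ ?_
  · simp
    ring
  · simp [derivative_mul]
    ring

lemma dx_comp_mul (F : SFun) : dx * mul F = mul F * dx + mul (dx F) :=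
  LinearMap.ext fun G => by simp [dx_mul, add_comm]

lemma Dbar_comp_mul (F : SFun) : Dbar * mul F = mul (Dbar F) + mul (parity F) * Dbar :=
  LinearMap.ext fun G => by simp [Dbar_mul]

lemma Dbar_sq : Dbar * Dbar = -dx :=
  LinearMap.ext fun G => by refine TrivSqZeroExt.ext ?_ ?_ <;> simp

lemma dx_comp_Dbar : dx * Dbar = Dbar * dx :=
  LinearMap.ext fun G => by refine TrivSqZeroExt.ext ?_ ?_ <;> simp

/-- On homogeneous `F` and `G`, `𝕏({F, G})` is the superbracket of `𝕏(F)` and `𝕏(G)`. -/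
lemma vf_bracket (i j : ZMod 2) (F G : SFun) (hF : Homog i F) (hG : Homog j G) :
    vf (cbracket F G) = vf F * vf G - sgn (i * j) • (vf G * vf F) := by
  have := bracket_of_relations mul dx Dbar dx_comp_mul Dbar_comp_mul Dbar_sq dx_comp_Dbar 0 i j
    F G hF hG
  simpa only [zero_smul, add_zero, ← vf_eq] using this

/-- The endomorphism `X ↦ ε X ε` of the space of operators on `ℂ[x, ξ]`. -/
def opParity (X : Module.End ℂ SFun) : Module.End ℂ SFun := parity ∘ₗ X ∘ₗ parity

/-- The superbracket of operators on `ℂ[x, ξ]`, extended bilinearly from homogeneous operators: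
`[X, Y] = X Y - (Y X_even + (ε Y ε) X_odd)`. -/
def sbracket (X Y : Module.End ℂ SFun) : Module.End ℂ SFun :=
  X * Y - (Y * ((1 / 2 : ℂ) • (X + opParity X)) + opParity Y * ((1 / 2 : ℂ) • (X - opParity X)))

lemma vf_injective : Function.Injective vf := by
  intro F G h
  have e := LinearMap.congr_fun h (inl X)
  have e1 := congrArg TrivSqZeroExt.fst e
  have e2 := congrArg TrivSqZeroExt.snd e
  refine TrivSqZeroExt.ext ?_ ?_
  · simpa [vf] using e1
  · simpa [vf] using e2

lemma vf_stabilizes (H G : SFun) :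
    sbracket (vf H) (mul G * Dbar) = mul (vf H G - (1 / 2 : ℂ) • (dx H * G)) * Dbar := by
  refine LinearMap.ext fun Z => TrivSqZeroExt.ext ?_ ?_ <;>
  simp only [sbracket, opParity, vf_eq, LinearMap.sub_apply, LinearMap.add_apply,
    Module.End.mul_apply, LinearMap.comp_apply, LinearMap.smul_apply, mul_apply', mul_fst, mul_snd,
    D_fst, D_snd, Dbar_fst, Dbar_snd, dx_fst, dx_snd, parity_fst, parity_snd, fst_add, snd_add,
    fst_sub, snd_sub, fst_smul, snd_smul, derivative_mul, map_add, map_sub, map_neg,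
    derivative_smul] <;>
  (apply Polynomial.funext; intro r
   simp only [eval_add, eval_sub, eval_mul, eval_neg, eval_smul, smul_eq_mul]; ring)

/-- A polynomial vector field `a ∂_x + b ∂_ξ` is contact, that is to say, it stabilizes the space
`ℂ[x, ξ] D̄`, if and only if it is `𝕏(H)` for some contact Hamiltonian `H`. -/
lemma mem_range_vf_iff (a b : SFun) :
    (∀ G, ∃ F, sbracket (mul a * dx + mul b * dxi) (mul G * Dbar) = mul F * Dbar) ↔
      ∃ H, vf H = mul a * dx + mul b * dxi := by
  constructor
  · intro h
    obtain ⟨F, hF⟩ := h 1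
    have h1 := LinearMap.congr_fun hF (inl X)
    have h2 := LinearMap.congr_fun hF (inr 1)
    have h1f := congrArg TrivSqZeroExt.fst h1
    have h1s := congrArg TrivSqZeroExt.snd h1
    have h2f := congrArg TrivSqZeroExt.fst h2
    have h2s := congrArg TrivSqZeroExt.snd h2
    simp [sbracket, opParity] at h1f h1s h2f h2s
    have k1 : fst b = snd a := by
      apply Polynomial.funext; intro r
      have := congrArg (eval r) h1f
      simp at this
      linear_combination -this
    have k2 : derivative (fst a) = (2 : ℂ) • snd b := by
      apply Polynomial.funext; intro r
      have := congrArg (eval r) h1s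
      have h' := congrArg (eval r) h2f
      simp at this h'
      simp
      linear_combination this + h'
    refine ⟨inl (fst a) + inr ((2 : ℂ) • snd a), ?_⟩
    refine LinearMap.ext fun Z => TrivSqZeroExt.ext ?_ ?_
    · simp [vf, k1]
    · simp [vf, k1, k2]
      ring
  · rintro ⟨H, hH⟩ G
    exact ⟨_, hH ▸ vf_stabilizes H G⟩

/-! ## Representations of `𝒦` -/

/-- A `ℤ/2`-graded representation of the Lie superalgebra `𝒦` on a complex vector space `V`: the
parity operator `par` of `V` (equal to `1` on even and to `-1` on odd vectors), and the even
action of contact Hamiltonians, which intertwines superbrackets. -/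
structure KRep (V : Type*) [AddCommGroup V] [Module ℂ V] where
  /-- the parity operator of `V` -/
  par : V →ₗ[ℂ] V
  /-- the operator by which the contact vector field with Hamiltonian `F` acts -/
  act : SFun →ₗ[ℂ] Module.End ℂ V
  par_par : ∀ v, par (par v) = v
  par_act : ∀ F v, par (act F v) = act (parity F) (par v)
  act_bracket : ∀ (i j : ZMod 2) (F G : SFun), Homog i F → Homog j G →
    act (cbracket F G) = act F * act G - sgn (i * j) • (act G * act F)

/-- The operators `π_l(𝕏(F)) = 𝕏(F) + l F'`. -/
def densityOp (l : ℂ) : SFun →ₗ[ℂ] Module.End ℂ SFun where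
  toFun F := vf F + l • mul (dx F)
  map_add' F G := by
    simp only [vf_eq, map_add, add_mul, smul_add]
    abel
  map_smul' c F := by
    simp only [vf_eq, map_smul, smul_mul_assoc, RingHom.id_apply, smul_add, smul_comm c]

lemma densityOp_apply (l : ℂ) (F : SFun) : densityOp l F = vf F + l • mul (dx F) := rfl

/-- The tensor density module `𝔽(l) = ℂ[x, ξ] ω^l`. -/
def density (l : ℂ) : KRep SFun where
  par := parity
  act := densityOp l
  par_par F := by refine TrivSqZeroExt.ext ?_ ?_ <;> simp
  par_act F G := by
    refine TrivSqZeroExt.ext ?_ ?_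
    · simp [densityOp, vf_eq]
    · simp [densityOp, vf_eq, -smul_add, -smul_neg]
      module
  act_bracket i j F G hF hG := by
    have := bracket_of_relations mul dx Dbar dx_comp_mul Dbar_comp_mul Dbar_sq dx_comp_Dbar l i j
      F G hF hG
    simpa only [← vf_eq, ← densityOp_apply] using this

namespace KRep

variable {V W X : Type*} [AddCommGroup V] [Module ℂ V] [AddCommGroup W] [Module ℂ W]
  [AddCommGroup X] [Module ℂ X]

/-- The parity shift `V^Π`: the same action, and the opposite grading. -/
def shift (ρ : KRep V) : KRep V where
  par := -ρ.par
  act := ρ.act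
  par_par v := by simp [ρ.par_par]
  par_act F v := by simp [ρ.par_act]
  act_bracket := ρ.act_bracket

/-- The iterated parity shift `V^{nΠ}`. -/
def piShift (n : ℤ) (ρ : KRep V) : KRep V := if Odd n then ρ.shift else ρ

/-- Invariant subspaces are graded subspaces stable under the action. -/
def IsInvariant (ρ : KRep V) (M : Submodule ℂ V) : Prop :=
  (∀ v ∈ M, ρ.par v ∈ M) ∧ ∀ F, ∀ v ∈ M, ρ.act F v ∈ M

/-- The subrepresentation on an invariant subspace. -/
def sub (ρ : KRep V) (M : Submodule ℂ V) (hM : ρ.IsInvariant M) : KRep M where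
  par := ρ.par.restrict hM.1
  act :=
    { toFun := fun F => (ρ.act F).restrict (hM.2 F)
      map_add' := fun F G => by ext v; simp
      map_smul' := fun c F => by ext v; simp }
  par_par v := by ext; simp [ρ.par_par]
  par_act F v := by ext; simp [ρ.par_act]
  act_bracket i j F G hF hG := by
    ext v
    simp [ρ.act_bracket i j F G hF hG]

/-- `𝒦`-maps of parity `d`. -/
def IsIntertwiner (ρ : KRep V) (σ : KRep W) (d : ZMod 2) (T : V →ₗ[ℂ] W) : Prop :=
  (∀ v, σ.par (T v) = sgn d • T (ρ.par v)) ∧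
    ∀ (e : ZMod 2) (F : SFun), Homog e F → ∀ v, σ.act F (T v) = sgn (e * d) • T (ρ.act F v)

/-- Even equivalence of representations. -/
def Equiv (ρ : KRep V) (σ : KRep W) : Prop :=
  ∃ T : V →ₗ[ℂ] W, Function.Bijective T ∧ ρ.IsIntertwiner σ 0 T

/-- `σ` is the image of a subrepresentation of `ρ` under a `𝒦`-map of parity `d`, that is to say,
`σ` is equivalent to a subquotient of `ρ` through an equivalence of parity `d`. -/
def IsSubquotient (σ : KRep W) (ρ : KRep V) (d : ZMod 2) : Prop :=
  ∃ (M : Submodule ℂ V) (hM : ρ.IsInvariant M) (T : M →ₗ[ℂ] W),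
    Function.Surjective T ∧ (ρ.sub M hM).IsIntertwiner σ d T

/-- A representation is indecomposable if it is not the direct sum of two non-zero invariant
subspaces. -/
def IsIndecomposable (ρ : KRep V) : Prop :=
  ∀ M N : Submodule ℂ V, ρ.IsInvariant M → ρ.IsInvariant N → IsCompl M N → M = ⊥ ∨ N = ⊥

/-- A representation is uniserial, or completely indecomposable, if all of its subquotients are
indecomposable. -/
def IsUniserial {V : Type} [AddCommGroup V] [Module ℂ V] (ρ : KRep V) : Prop :=
  ∀ (X : Type) [AddCommGroup X] [Module ℂ X] (σ : KRep X),
    σ.IsSubquotient ρ 0 → σ.IsIndecomposable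

end KRep

/-! ## Pseudodifferential operators -/

/-- Symbols of formal pseudodifferential operators.  The symbol `T` stands for the formal sum
`∑ z, ((T z).1 ∂_x ^ z + (T z).2 ∂_x ^ z D̄)`. -/
def PsiSym : Type := ℂ → SFun × SFun

instance : AddCommGroup PsiSym := inferInstanceAs (AddCommGroup (ℂ → SFun × SFun))

instance : Module ℂ PsiSym := inferInstanceAs (Module ℂ (ℂ → SFun × SFun))

@[simp] lemma psi_zero_apply (z : ℂ) : (0 : PsiSym) z = 0 := rfl
@[simp] lemma psi_add_apply (S T : PsiSym) (z : ℂ) : (S + T) z = S z + T z := rfl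
@[simp] lemma psi_neg_apply (T : PsiSym) (z : ℂ) : (-T) z = -T z := rfl
@[simp] lemma psi_sub_apply (S T : PsiSym) (z : ℂ) : (S - T) z = S z - T z := rfl
@[simp] lemma psi_smul_apply (a : ℂ) (T : PsiSym) (z : ℂ) : (a • T) z = a • T z := rfl

/-- Operators on symbols, given coefficientwise. -/
def psiEnd (f : PsiSym → ℂ → SFun × SFun) (hadd : ∀ S T z, f (S + T) z = f S z + f T z)
    (hsmul : ∀ (a : ℂ) T z, f (a • T) z = a • f T z) : Module.End ℂ PsiSym where
  toFun T z := f T z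
  map_add' S T := funext fun z => hadd S T z
  map_smul' a T := funext fun z => hsmul a T z

/-- The binomial coefficient `w (w - 1) ⋯ (w - j + 1) / j!`. -/
def binom (w : ℂ) (j : ℕ) : ℂ := (∏ i ∈ Finset.range j, (w - i)) / (j.factorial : ℂ)

/-- A bound on the order of vanishing derivatives. -/
def degBound (H : SFun) : ℕ := H.fst.natDegree + H.snd.natDegree + 1

/-- The coefficient of `∂_x ^ z` in `∑ w, c w ∂_x ^ w ∘ H`, given by the generalized Leibniz rule
`∂_x ^ w ∘ H = ∑ j, binom w j * H ^ (j) ∂_x ^ (w - j)`.  The derivatives of `H` of order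
`degBound H` and more are zero. -/
def leibniz (c : ℂ → SFun) (H : SFun) (z : ℂ) : SFun :=
  ∑ j ∈ Finset.range (degBound H), binom (z + j) j • (c (z + j) * (dx ^ j) H)

lemma dx_pow_fst (n : ℕ) (H : SFun) : ((dx ^ n) H).fst = derivative^[n] H.fst := by
  induction n with
  | zero => rfl
  | succ n ih => rw [pow_succ', Module.End.mul_apply, dx_fst, ih, Function.iterate_succ_apply']

lemma dx_pow_snd (n : ℕ) (H : SFun) : ((dx ^ n) H).snd = derivative^[n] H.snd := by
  induction n with
  | zero => rfl
  | succ n ih => rw [pow_succ', Module.End.mul_apply, dx_snd, ih, Function.iterate_succ_apply']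

lemma dx_pow_eq_zero {n : ℕ} {H : SFun} (h : degBound H ≤ n) : (dx ^ n) H = 0 := by
  unfold degBound at h
  refine TrivSqZeroExt.ext ?_ ?_
  · rw [dx_pow_fst, iterate_derivative_eq_zero (by omega)]; rfl
  · rw [dx_pow_snd, iterate_derivative_eq_zero (by omega)]; rfl

lemma leibniz_eq (c : ℂ → SFun) (H : SFun) (z : ℂ) {n : ℕ} (h : degBound H ≤ n) :
    leibniz c H z = ∑ j ∈ Finset.range n, binom (z + j) j • (c (z + j) * (dx ^ j) H) := by
  refine Finset.sum_subset (Finset.range_mono h) fun j _ hj => ?_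
  rw [dx_pow_eq_zero (by simpa using hj), mul_zero, smul_zero]

lemma leibniz_add_left (c d : ℂ → SFun) (H : SFun) (z : ℂ) :
    leibniz (c + d) H z = leibniz c H z + leibniz d H z := by
  simp [leibniz, add_mul, Finset.sum_add_distrib]

lemma leibniz_smul_left (a : ℂ) (c : ℂ → SFun) (H : SFun) (z : ℂ) :
    leibniz (a • c) H z = a • leibniz c H z := by
  simp only [leibniz, Finset.smul_sum, Pi.smul_apply, smul_mul_assoc, smul_comm a]

lemma leibniz_add_right (c : ℂ → SFun) (G H : SFun) (z : ℂ) :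
    leibniz c (G + H) z = leibniz c G z + leibniz c H z := by
  set n := max (degBound (G + H)) (max (degBound G) (degBound H))
  rw [leibniz_eq c (G + H) z (n := n) (by simp [n]), leibniz_eq c G z (n := n) (by simp [n]),
    leibniz_eq c H z (n := n) (by simp [n])]
  simp [mul_add, Finset.sum_add_distrib]

lemma leibniz_smul_right (a : ℂ) (c : ℂ → SFun) (H : SFun) (z : ℂ) :
    leibniz c (a • H) z = a • leibniz c H z := by
  set n := max (degBound (a • H)) (degBound H)
  rw [leibniz_eq c (a • H) z (n := n) (by simp [n]), leibniz_eq c H z (n := n) (by simp [n])]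
  simp only [map_smul, mul_smul_comm, Finset.smul_sum, smul_comm a]

lemma leibniz_zero_right (c : ℂ → SFun) (z : ℂ) : leibniz c 0 z = 0 := by
  simpa using leibniz_smul_right 0 c 0 z

lemma leibniz_zero_left (H : SFun) (z : ℂ) : leibniz 0 H z = 0 := by
  simp [leibniz]

lemma leibniz_const (c : ℂ → SFun) (H : SFun) (hH : dx H = 0) (z : ℂ) :
    leibniz c H z = c z * H := by
  unfold leibniz degBound
  rw [Finset.sum_range_succ', Finset.sum_eq_zero]
  · simp [binom]
  · intro j _
    rw [pow_succ, Module.End.mul_apply, hH, map_zero, mul_zero, smul_zero]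

lemma binom_add (z : ℂ) (j : ℕ) :
    binom (z + j) j * (j.factorial : ℂ) = (ascPochhammer ℂ j).eval (z + 1) := by
  unfold binom
  rw [div_mul_cancel₀ _ (by exact_mod_cast j.factorial_ne_zero)]
  induction j generalizing z with
  | zero => simp
  | succ j ih =>
    rw [ascPochhammer_succ_eval, ← ih, Finset.prod_range_succ']
    push_cast
    congr 1
    · refine Finset.prod_congr rfl fun i _ => by ring
    · ring

lemma binom_pascal (z : ℂ) (j : ℕ) :
    binom (z + (j + 1 : ℕ)) (j + 1) - binom (z - 1 + (j + 1 : ℕ)) (j + 1) = binom (z + j) j := by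
  have hj : ((j + 1).factorial : ℂ) ≠ 0 := by exact_mod_cast (j + 1).factorial_ne_zero
  have e1 := binom_add z (j + 1)
  have e2 := binom_add (z - 1) (j + 1)
  have e3 := binom_add z j
  rw [ascPochhammer_succ_eval, ← e3] at e1
  rw [ascPochhammer_succ_left, eval_mul, eval_X, eval_comp] at e2
  simp only [eval_add, eval_X, eval_one, sub_add_cancel] at e2
  rw [← e3] at e2
  rw [Nat.factorial_succ] at e1 e2 hj
  push_cast at e1 e2 hj ⊢
  have h1 := mul_ne_zero_iff.mp hj
  apply mul_right_cancel₀ hj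
  linear_combination e1 - e2

lemma binom_mul_binom (z : ℂ) (i j : ℕ) :
    binom (z + i) i * binom (z + i + j) j =
      binom (z + (i + j : ℕ)) (i + j) * ((i + j).choose i : ℂ) := by
  have h : ∀ k : ℕ, (k.factorial : ℂ) ≠ 0 := fun k => by exact_mod_cast k.factorial_ne_zero
  have e1 := binom_add z i
  have e2 := binom_add (z + i) j
  have e3 := binom_add z (i + j)
  have e4 := congrArg (eval (z + 1)) (ascPochhammer_mul ℂ i j)
  have e5 : ((i + j).choose i : ℂ) * i.factorial * j.factorial = (i + j).factorial := by
    rw [Nat.choose_symm_add]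
    exact_mod_cast Nat.add_choose_mul_factorial_mul_factorial i j
  simp only [eval_mul, eval_comp, eval_add, eval_X, eval_natCast] at e4
  rw [show z + i + 1 = z + 1 + i by ring] at e2
  rw [← e1, ← e2, ← e3] at e4
  apply mul_right_cancel₀ (mul_ne_zero (h i) (h j))
  linear_combination e4 - binom (z + (i + j : ℕ)) (i + j) * e5

lemma dx_pow_mul (n : ℕ) (G H : SFun) :
    (dx ^ n) (G * H) = ∑ p ∈ Finset.HasAntidiagonal.antidiagonal n,
      n.choose p.1 • ((dx ^ p.1) G * (dx ^ p.2) H) := by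
  induction n with
  | zero => simp
  | succ n ih =>
    rw [Finset.sum_antidiagonal_choose_succ_nsmul (fun i j => (dx ^ i) G * (dx ^ j) H) n,
      pow_succ', Module.End.mul_apply, ih, map_sum, ← Finset.sum_add_distrib]
    refine Finset.sum_congr rfl fun p hp => ?_
    rw [map_nsmul, dx_mul, pow_succ' dx p.1, pow_succ' dx p.2, Module.End.mul_apply,
      Module.End.mul_apply, Nat.choose_symm_of_eq_add (Finset.HasAntidiagonal.mem_antidiagonal.mp hp).symm,
      smul_add, add_comm]

lemma leibniz_leibniz (c : ℂ → SFun) (G H : SFun) (z : ℂ) :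
    leibniz (leibniz c G) H z = leibniz c (G * H) z := by
  set n := max (degBound G) (degBound H) + degBound (G * H) with hn
  set f : ℕ → ℕ → SFun := fun i j =>
    (binom (z + i) i * binom (z + i + j) j) • (c (z + i + j) * ((dx ^ j) G * (dx ^ i) H)) with hf
  have h1 : leibniz (leibniz c G) H z =
      ∑ p ∈ Finset.range n ×ˢ Finset.range n, f p.1 p.2 := by
    rw [Finset.sum_product, leibniz_eq _ H z (n := n) (by omega)]
    refine Finset.sum_congr rfl fun i _ => ?_
    rw [leibniz_eq c G _ (n := n) (by omega), Finset.sum_mul, Finset.smul_sum]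
    refine Finset.sum_congr rfl fun j _ => ?_
    simp only [hf, smul_mul_assoc, mul_smul, mul_assoc]
  have h2 : leibniz c (G * H) z =
      ∑ m ∈ Finset.range (2 * n), ∑ p ∈ Finset.HasAntidiagonal.antidiagonal m, f p.1 p.2 := by
    rw [leibniz_eq c _ z (n := 2 * n) (by omega)]
    refine Finset.sum_congr rfl fun m _ => ?_
    rw [mul_comm G H, dx_pow_mul, Finset.mul_sum, Finset.smul_sum]
    refine Finset.sum_congr rfl fun p hp => ?_
    obtain rfl := Finset.HasAntidiagonal.mem_antidiagonal.mp hp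
    simp only [hf]
    rw [binom_mul_binom, mul_comm ((dx ^ p.2) G), mul_smul, ← Nat.cast_smul_eq_nsmul ℂ,
      mul_smul_comm, add_assoc]
    push_cast
    rfl
  rw [h1, h2, ← Finset.sum_fiberwise_of_maps_to (s := Finset.range n ×ˢ Finset.range n)
    (t := Finset.range (2 * n)) (g := fun p => p.1 + p.2)]
  · refine Finset.sum_congr rfl fun m _ => Finset.sum_subset ?_ ?_
    · intro p hp
      simp only [Finset.mem_filter] at hp
      simpa using hp.2
    · intro p hp hp'
      rw [Finset.HasAntidiagonal.mem_antidiagonal] at hp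
      simp only [Finset.mem_filter, Finset.mem_product, Finset.mem_range, not_and_or] at hp'
      simp only [hf]
      rcases hp' with (h | h) | h
      · rw [dx_pow_eq_zero (H := H) (by omega)]; simp
      · rw [dx_pow_eq_zero (H := G) (by omega)]; simp
      · exact absurd hp h
  · intro p hp
    simp only [Finset.mem_product, Finset.mem_range] at hp ⊢
    omega

lemma leibniz_shift (c : ℂ → SFun) (H : SFun) (z : ℂ) :
    leibniz (fun w => c (w - 1)) H z = leibniz c H (z - 1) + leibniz c (dx H) z := by
  set n := max (degBound H) (degBound (dx H))
  rw [leibniz_eq _ H z (n := n + 1) (by simp [n]; omega),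
    leibniz_eq _ H (z - 1) (n := n + 1) (by simp [n]; omega),
    leibniz_eq c (dx H) z (n := n) (by simp [n]), Finset.sum_range_succ', Finset.sum_range_succ',
    add_right_comm, ← Finset.sum_add_distrib]
  congr 1
  · refine Finset.sum_congr rfl fun j _ => ?_
    have a1 : c (z + ((j + 1 : ℕ) : ℂ) - 1) = c (z + j) := by congr 1; push_cast; ring
    have a2 : c (z - 1 + ((j + 1 : ℕ) : ℂ)) = c (z + j) := by congr 1; push_cast; ring
    rw [a1, a2, ← binom_pascal z j, ← Module.End.mul_apply, ← pow_succ, ← add_smul]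
    congr 1
    ring
  · simp [binom]

/-- Left multiplication of symbols by functions. -/
def psiMul : SFun →ₐ[ℂ] Module.End ℂ PsiSym where
  toFun F := psiEnd (fun T z => (F * (T z).1, F * (T z).2))
    (fun S T z => by refine Prod.ext ?_ ?_ <;> simp [mul_add])
    (fun a T z => by refine Prod.ext ?_ ?_ <;> simp)
  map_one' := LinearMap.ext fun T => funext fun z => Prod.ext (one_mul _) (one_mul _)
  map_mul' F G := LinearMap.ext fun T => funext fun z =>
    Prod.ext (mul_assoc _ _ _) (mul_assoc _ _ _)
  map_zero' := LinearMap.ext fun T => funext fun z => Prod.ext (zero_mul _) (zero_mul _)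
  map_add' F G := LinearMap.ext fun T => funext fun z => Prod.ext (add_mul _ _ _) (add_mul _ _ _)
  commutes' a := LinearMap.ext fun T => funext fun z =>
    Prod.ext (Algebra.smul_def a _).symm (Algebra.smul_def a _).symm

/-- Left composition `T ↦ ∂_x ∘ T`. -/
def psiDx : Module.End ℂ PsiSym :=
  psiEnd (fun T z => (dx (T z).1 + (T (z - 1)).1, dx (T z).2 + (T (z - 1)).2))
    (fun S T z => by
      refine Prod.ext ?_ ?_ <;> simp <;> abel)
    (fun a T z => by
      refine Prod.ext ?_ ?_ <;> simp)

/-- Left composition `T ↦ D̄ ∘ T`. -/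
def psiDbar : Module.End ℂ PsiSym :=
  psiEnd (fun T z => (Dbar (T z).1 - parity (T (z - 1)).2, Dbar (T z).2 + parity (T z).1))
    (fun S T z => by
      refine Prod.ext ?_ ?_ <;> simp <;> abel)
    (fun a T z => by
      refine Prod.ext ?_ ?_ <;> simp [smul_sub])

/-- Right composition `T ↦ T ∘ ∂_x`. -/
def psiDxR : Module.End ℂ PsiSym :=
  psiEnd (fun T z => ((T (z - 1)).1, (T (z - 1)).2))
    (fun S T z => by
      refine Prod.ext ?_ ?_ <;> simp)
    (fun a T z => by
      refine Prod.ext ?_ ?_ <;> simp)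

/-- Right composition `T ↦ T ∘ D̄`. -/
def psiDbarR : Module.End ℂ PsiSym :=
  psiEnd (fun T z => (-(T (z - 1)).2, (T z).1))
    (fun S T z => by
      refine Prod.ext ?_ ?_ <;> simp; abel)
    (fun a T z => by
      refine Prod.ext ?_ ?_ <;> simp)

/-- Right composition `T ↦ T ∘ H` with multiplication by a function, given by the generalized
Leibniz rule and `D̄ ∘ H = D̄(H) + ε(H) D̄`. -/
def psiMulROp (H : SFun) : Module.End ℂ PsiSym :=
  psiEnd (fun T z => (leibniz (fun w => (T w).1) H z + leibniz (fun w => (T w).2) (Dbar H) z,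
    leibniz (fun w => (T w).2) (parity H) z))
    (fun S T z => by
      have h1 := leibniz_add_left (fun w => (S w).1) (fun w => (T w).1) H z
      have h2 := leibniz_add_left (fun w => (S w).2) (fun w => (T w).2) (Dbar H) z
      have h3 := leibniz_add_left (fun w => (S w).2) (fun w => (T w).2) (parity H) z
      refine Prod.ext (Eq.trans (congrArg₂ (· + ·) h1 h2) ?_) h3
      exact add_add_add_comm _ _ _ _)
    (fun a T z => by
      have h1 := leibniz_smul_left a (fun w => (T w).1) H z
      have h2 := leibniz_smul_left a (fun w => (T w).2) (Dbar H) z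
      have h3 := leibniz_smul_left a (fun w => (T w).2) (parity H) z
      refine Prod.ext (Eq.trans (congrArg₂ (· + ·) h1 h2) ?_) h3
      exact (smul_add _ _ _).symm)

lemma psiMulROp_fst (H : SFun) (T : PsiSym) (z : ℂ) : (psiMulROp H T z).1 =
    leibniz (fun w => (T w).1) H z + leibniz (fun w => (T w).2) (Dbar H) z := rfl

lemma psiMulROp_snd (H : SFun) (T : PsiSym) (z : ℂ) : (psiMulROp H T z).2 =
    leibniz (fun w => (T w).2) (parity H) z := rfl

lemma psiDxR_apply (T : PsiSym) (z : ℂ) :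
    psiDxR T z = ((T (z - 1)).1, (T (z - 1)).2) := rfl

lemma psiDbarR_apply (T : PsiSym) (z : ℂ) :
    psiDbarR T z = (-(T (z - 1)).2, (T z).1) := rfl

lemma psiDx_apply (T : PsiSym) (z : ℂ) :
    psiDx T z = (dx (T z).1 + (T (z - 1)).1, dx (T z).2 + (T (z - 1)).2) := rfl

lemma psiDbar_apply (T : PsiSym) (z : ℂ) :
    psiDbar T z = (Dbar (T z).1 - parity (T (z - 1)).2, Dbar (T z).2 + parity (T z).1) := rfl

lemma psiMul_apply (F : SFun) (T : PsiSym) (z : ℂ) :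
    psiMul F T z = (F * (T z).1, F * (T z).2) := rfl

lemma parity_mul (F G : SFun) : parity (F * G) = parity F * parity G := by
  refine TrivSqZeroExt.ext ?_ ?_
  · simp
  · simp
    ring

lemma leibniz_neg_left (c : ℂ → SFun) (H : SFun) (z : ℂ) :
    leibniz (fun w => -c w) H z = -leibniz c H z := by
  have := leibniz_smul_left (-1) c H z
  simp only [neg_smul, one_smul] at this
  exact this

lemma leibniz_neg_right (c : ℂ → SFun) (H : SFun) (z : ℂ) :
    leibniz c (-H) z = -leibniz c H z := by
  have := leibniz_smul_right (-1) c H z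
  simpa only [neg_smul, one_smul] using this

lemma psiMulROp_add (G H : SFun) : psiMulROp (G + H) = psiMulROp G + psiMulROp H := by
  refine LinearMap.ext fun T => funext fun z => Prod.ext ?_ ?_
  · simp only [psiMulROp_fst, LinearMap.add_apply, psi_add_apply, Prod.fst_add, map_add,
      leibniz_add_right]
    abel
  · simp only [psiMulROp_snd, LinearMap.add_apply, psi_add_apply, Prod.snd_add, map_add,
      leibniz_add_right]

lemma psiMulROp_smul (a : ℂ) (H : SFun) : psiMulROp (a • H) = a • psiMulROp H := by
  refine LinearMap.ext fun T => funext fun z => Prod.ext ?_ ?_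
  · simp only [psiMulROp_fst, LinearMap.smul_apply, psi_smul_apply, Prod.smul_fst, map_smul,
      leibniz_smul_right, smul_add]
  · simp only [psiMulROp_snd, LinearMap.smul_apply, psi_smul_apply, Prod.smul_snd, map_smul,
      leibniz_smul_right]

lemma psiMulROp_one : psiMulROp 1 = 1 := by
  have h0 : dx 1 = 0 := by refine TrivSqZeroExt.ext ?_ ?_ <;> simp
  have h1 : Dbar 1 = 0 := by refine TrivSqZeroExt.ext ?_ ?_ <;> simp
  have h2 : parity 1 = 1 := by refine TrivSqZeroExt.ext ?_ ?_ <;> simp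
  refine LinearMap.ext fun T => funext fun z => Prod.ext ?_ ?_
  · rw [psiMulROp_fst, h1, leibniz_zero_right, leibniz_const _ _ h0, mul_one, add_zero,
      Module.End.one_apply]
  · rw [psiMulROp_snd, h2, leibniz_const _ _ h0, mul_one, Module.End.one_apply]

lemma psiMulROp_mul (G H : SFun) : psiMulROp (G * H) = psiMulROp H * psiMulROp G := by
  refine LinearMap.ext fun T => funext fun z => Prod.ext ?_ ?_
  · rw [Module.End.mul_apply, psiMulROp_fst, psiMulROp_fst]
    have h : (fun w => (psiMulROp G T w).1) = leibniz (fun w => (T w).1) G +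
      leibniz (fun w => (T w).2) (Dbar G) := rfl
    have h' : (fun w => (psiMulROp G T w).2) = leibniz (fun w => (T w).2) (parity G) := rfl
    rw [h, h', leibniz_add_left, leibniz_leibniz, leibniz_leibniz, leibniz_leibniz,
      Dbar_mul, leibniz_add_right, add_assoc]
  · rw [Module.End.mul_apply, psiMulROp_snd, psiMulROp_snd]
    have h' : (fun w => (psiMulROp G T w).2) = leibniz (fun w => (T w).2) (parity G) := rfl
    rw [h', leibniz_leibniz, ← parity_mul]

/-- Right composition with multiplication operators, as a homomorphism to the opposite algebra. -/
def psiMulR : SFun →ₐ[ℂ] (Module.End ℂ PsiSym)ᵐᵒᵖ where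
  toFun H := MulOpposite.op (psiMulROp H)
  map_one' := by rw [psiMulROp_one, MulOpposite.op_one]
  map_mul' G H := by rw [psiMulROp_mul, MulOpposite.op_mul]
  map_zero' := by
    have := psiMulROp_smul 0 0
    rw [zero_smul, zero_smul] at this
    rw [this, MulOpposite.op_zero]
  map_add' G H := by rw [psiMulROp_add, MulOpposite.op_add]
  commutes' a := by
    rw [Algebra.algebraMap_eq_smul_one, Algebra.algebraMap_eq_smul_one, psiMulROp_smul,
      psiMulROp_one, MulOpposite.op_smul, MulOpposite.op_one]

lemma psiMulR_eq (H : SFun) : psiMulR H = MulOpposite.op (psiMulROp H) := rfl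

lemma leibniz_parity (c : ℂ → SFun) (H : SFun) (z : ℂ) :
    parity (leibniz c H z) = leibniz (fun w => parity (c w)) (parity H) z := by
  have h : ∀ n, parity ((dx ^ n) H) = (dx ^ n) (parity H) := by
    intro n
    refine TrivSqZeroExt.ext ?_ ?_
    · simp [dx_pow_fst]
    · simp [dx_pow_snd]
  unfold leibniz
  rw [map_sum]
  have hb : degBound (parity H) = degBound H := by simp [degBound]
  rw [hb]
  refine Finset.sum_congr rfl fun j _ => ?_
  rw [map_smul, parity_mul, h]

lemma psiDx_psiMul (F : SFun) : psiDx * psiMul F = psiMul F * psiDx + psiMul (dx F) := by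
  refine LinearMap.ext fun T => funext fun z => Prod.ext ?_ ?_ <;>
  simp only [Module.End.mul_apply, LinearMap.add_apply, psi_add_apply, Prod.fst_add, Prod.snd_add,
    psiDx_apply, psiMul_apply, dx_mul] <;> ring

lemma psiDbar_psiMul (F : SFun) :
    psiDbar * psiMul F = psiMul (Dbar F) + psiMul (parity F) * psiDbar := by
  refine LinearMap.ext fun T => funext fun z => Prod.ext ?_ ?_ <;>
  simp only [Module.End.mul_apply, LinearMap.add_apply, psi_add_apply, Prod.fst_add, Prod.snd_add,
    psiDbar_apply, psiMul_apply, Dbar_mul, parity_mul] <;> ring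

lemma psiDbar_sq : psiDbar * psiDbar = -psiDx := by
  have h1 : ∀ G, Dbar (parity G) = -parity (Dbar G) := by
    intro G; refine TrivSqZeroExt.ext ?_ ?_ <;> simp
  have h2 : ∀ G, Dbar (Dbar G) = -dx G := fun G => LinearMap.congr_fun Dbar_sq G
  have h3 : ∀ G, parity (parity G) = G := by
    intro G; refine TrivSqZeroExt.ext ?_ ?_ <;> simp
  refine LinearMap.ext fun T => funext fun z => Prod.ext ?_ ?_ <;>
  simp only [Module.End.mul_apply, LinearMap.neg_apply, psi_neg_apply, Prod.fst_neg, Prod.snd_neg,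
    psiDbar_apply, psiDx_apply, map_add, map_sub, h1, h2, h3] <;> ring

lemma psiDx_psiDbar : psiDx * psiDbar = psiDbar * psiDx := by
  have h1 : ∀ G, dx (parity G) = parity (dx G) := by
    intro G; refine TrivSqZeroExt.ext ?_ ?_ <;> simp
  have h2 : ∀ G, dx (Dbar G) = Dbar (dx G) := fun G => LinearMap.congr_fun dx_comp_Dbar G
  refine LinearMap.ext fun T => funext fun z => Prod.ext ?_ ?_ <;>
  simp only [Module.End.mul_apply, psiDbar_apply, psiDx_apply, map_add, map_sub, h1, h2] <;> ring

lemma psiDxR_psiMulR (F : SFun) :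
    psiMulROp F * psiDxR = psiDxR * psiMulROp F + psiMulROp (dx F) := by
  have h1 : Dbar (dx F) = dx (Dbar F) := (LinearMap.congr_fun dx_comp_Dbar F).symm
  have h2 : parity (dx F) = dx (parity F) := by
    refine TrivSqZeroExt.ext ?_ ?_ <;> simp
  refine LinearMap.ext fun T => funext fun z => Prod.ext ?_ ?_
  · simp only [Module.End.mul_apply, LinearMap.add_apply, psi_add_apply, Prod.fst_add,
      psiMulROp_fst, psiDxR_apply, h1]
    rw [leibniz_shift (fun w => (T w).1), leibniz_shift (fun w => (T w).2)]
    abel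
  · simp only [Module.End.mul_apply, LinearMap.add_apply, psi_add_apply, Prod.snd_add,
      psiMulROp_snd, psiDxR_apply, h2]
    rw [leibniz_shift (fun w => (T w).2)]

lemma psiDbarR_psiMulR (F : SFun) :
    psiMulROp F * psiDbarR = psiMulROp (Dbar F) + psiDbarR * psiMulROp (parity F) := by
  have h1 : Dbar (parity F) = -parity (Dbar F) := by
    refine TrivSqZeroExt.ext ?_ ?_ <;> simp
  have h2 : Dbar (Dbar F) = -dx F := LinearMap.congr_fun Dbar_sq F
  have h3 : parity (parity F) = F := by
    refine TrivSqZeroExt.ext ?_ ?_ <;> simp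
  refine LinearMap.ext fun T => funext fun z => Prod.ext ?_ ?_
  · simp only [Module.End.mul_apply, LinearMap.add_apply, psi_add_apply, Prod.fst_add,
      psiMulROp_fst, psiMulROp_snd, psiDbarR_apply, h2, h3]
    rw [leibniz_neg_left (fun w => (T (w - 1)).2), leibniz_shift (fun w => (T w).2),
      leibniz_neg_right]
    abel
  · simp only [Module.End.mul_apply, LinearMap.add_apply, psi_add_apply, Prod.snd_add,
      psiMulROp_fst, psiMulROp_snd, psiDbarR_apply, h1]
    rw [leibniz_neg_right]
    abel

lemma psiDbarR_sq : psiDbarR * psiDbarR = -psiDxR := by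
  refine LinearMap.ext fun T => funext fun z => Prod.ext ?_ ?_ <;>
  simp [psiDbarR_apply, psiDxR_apply]

lemma psiDxR_psiDbarR : psiDbarR * psiDxR = psiDxR * psiDbarR := by
  refine LinearMap.ext fun T => funext fun z => Prod.ext ?_ ?_ <;>
  simp [psiDbarR_apply, psiDxR_apply]

/-- The parity operator on symbols. -/
def psiPar : Module.End ℂ PsiSym :=
  psiEnd (fun T z => (parity (T z).1, -parity (T z).2))
    (fun S T z => by
      refine Prod.ext ?_ ?_ <;> simp; abel)
    (fun a T z => by
      refine Prod.ext ?_ ?_ <;> simp)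

lemma psiPar_apply (T : PsiSym) (z : ℂ) :
    psiPar T z = (parity (T z).1, -parity (T z).2) := rfl

/-- Left composition `T ↦ π_l(𝕏(F)) ∘ T`, where `π_l(𝕏(F)) = F ∂_x + ½ D(F) D̄ + l F'`. -/
def psiLeft (l : ℂ) : SFun →ₗ[ℂ] Module.End ℂ PsiSym where
  toFun F := psiMul F * psiDx + (1 / 2 : ℂ) • (psiMul (D F) * psiDbar) + l • psiMul (dx F)
  map_add' F G := by
    simp only [map_add, add_mul, smul_add]
    abel
  map_smul' c F := by
    simp only [map_smul, smul_mul_assoc, RingHom.id_apply, smul_add, smul_comm c]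

/-- Right composition `T ↦ T ∘ π_l(𝕏(F))`, where `π_l(𝕏(F)) = F ∂_x + ½ D(F) D̄ + l F'`. -/
def psiRight (l : ℂ) : SFun →ₗ[ℂ] Module.End ℂ PsiSym where
  toFun F := psiDxR * psiMulROp F + (1 / 2 : ℂ) • (psiDbarR * psiMulROp (D F)) +
    l • psiMulROp (dx F)
  map_add' F G := by
    simp only [map_add, psiMulROp_add, mul_add, smul_add]
    abel
  map_smul' c F := by
    simp only [map_smul, psiMulROp_smul, mul_smul_comm, RingHom.id_apply, smul_add, smul_comm c]

lemma psiLeft_bracket (l : ℂ) (i j : ZMod 2) (F G : SFun) (hF : Homog i F) (hG : Homog j G) :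
    psiLeft l (cbracket F G) =
      psiLeft l F * psiLeft l G - sgn (i * j) • (psiLeft l G * psiLeft l F) :=
  bracket_of_relations psiMul psiDx psiDbar psiDx_psiMul psiDbar_psiMul psiDbar_sq
    psiDx_psiDbar l i j F G hF hG

lemma psiRight_bracket (l : ℂ) (i j : ZMod 2) (F G : SFun) (hF : Homog i F) (hG : Homog j G) :
    psiRight l (cbracket F G) =
      psiRight l G * psiRight l F - sgn (i * j) • (psiRight l F * psiRight l G) :=
  MulOpposite.op_injective
    (bracket_of_relations psiMulR (MulOpposite.op psiDxR) (MulOpposite.op psiDbarR)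
      (fun F => congrArg MulOpposite.op (psiDxR_psiMulR F))
      (fun F => congrArg MulOpposite.op (psiDbarR_psiMulR F))
      (congrArg MulOpposite.op psiDbarR_sq) (congrArg MulOpposite.op psiDxR_psiDbarR)
      l i j F G hF hG)

lemma leibniz_mul_left (F : SFun) (c : ℂ → SFun) (H : SFun) (z : ℂ) :
    leibniz (fun w => F * c w) H z = F * leibniz c H z := by
  simp only [leibniz, Finset.mul_sum, mul_smul_comm, mul_assoc]

lemma dx_leibniz (c : ℂ → SFun) (H : SFun) (z : ℂ) :
    dx (leibniz c H z) = leibniz (fun w => dx (c w)) H z + leibniz c (dx H) z := by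
  set n := max (degBound H) (degBound (dx H))
  rw [leibniz_eq c H z (n := n) (by simp [n]), leibniz_eq _ H z (n := n) (by simp [n]),
    leibniz_eq c (dx H) z (n := n) (by simp [n]), map_sum, ← Finset.sum_add_distrib]
  refine Finset.sum_congr rfl fun j _ => ?_
  rw [map_smul, dx_mul, smul_add, ← Module.End.mul_apply dx, ← Module.End.mul_apply (dx ^ j),
    ← pow_succ', ← pow_succ]

lemma Dbar_leibniz (c : ℂ → SFun) (H : SFun) (z : ℂ) :
    Dbar (leibniz c H z) =
      leibniz (fun w => Dbar (c w)) H z + leibniz (fun w => parity (c w)) (Dbar H) z := by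
  have h : ∀ j, Dbar ((dx ^ j) H) = (dx ^ j) (Dbar H) := fun j =>
    LinearMap.congr_fun ((show Commute dx Dbar from dx_comp_Dbar).pow_left j).eq.symm H
  set n := max (degBound H) (degBound (Dbar H))
  rw [leibniz_eq c H z (n := n) (by simp [n]), leibniz_eq _ H z (n := n) (by simp [n]),
    leibniz_eq _ (Dbar H) z (n := n) (by simp [n]), map_sum, ← Finset.sum_add_distrib]
  refine Finset.sum_congr rfl fun j _ => ?_
  rw [map_smul, Dbar_mul, smul_add, h]

lemma psiMul_comm_right (F H : SFun) : Commute (psiMul F) (psiMulROp H) := by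
  refine LinearMap.ext fun T => funext fun z => Prod.ext ?_ ?_
  · simp only [Module.End.mul_apply, psiMul_apply, psiMulROp_fst, leibniz_mul_left, mul_add]
  · simp only [Module.End.mul_apply, psiMul_apply, psiMulROp_snd, leibniz_mul_left]

lemma psiDx_comm_right (H : SFun) : Commute psiDx (psiMulROp H) := by
  have h1 : Dbar (dx H) = dx (Dbar H) := (LinearMap.congr_fun dx_comp_Dbar H).symm
  refine LinearMap.ext fun T => funext fun z => Prod.ext ?_ ?_
  · simp only [Module.End.mul_apply, psiDx_apply, psiMulROp_fst, map_add, dx_leibniz]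
    have e1 := leibniz_add_left (fun w => dx (T w).1) (fun w => (T (w - 1)).1) H z
    have e2 := leibniz_add_left (fun w => dx (T w).2) (fun w => (T (w - 1)).2) (Dbar H) z
    have e3 := leibniz_shift (fun w => (T w).1) H z
    have e4 := leibniz_shift (fun w => (T w).2) (Dbar H) z
    refine Eq.trans ?_ (congrArg₂ (· + ·) e1 e2).symm
    simp only [e3, e4]
    abel
  · simp only [Module.End.mul_apply, psiDx_apply, psiMulROp_snd, dx_leibniz]
    have e2 := leibniz_add_left (fun w => dx (T w).2) (fun w => (T (w - 1)).2) (parity H) z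
    have e4 := leibniz_shift (fun w => (T w).2) (parity H) z
    refine Eq.trans ?_ e2.symm
    simp only [e4]
    abel

lemma psiDbar_comm_right (H : SFun) : Commute psiDbar (psiMulROp H) := by
  have h1 : Dbar (parity H) = -parity (Dbar H) := by
    refine TrivSqZeroExt.ext ?_ ?_ <;> simp
  have h2 : Dbar (Dbar H) = -dx H := LinearMap.congr_fun Dbar_sq H
  have h3 : parity (parity H) = H := by
    refine TrivSqZeroExt.ext ?_ ?_ <;> simp
  refine LinearMap.ext fun T => funext fun z => Prod.ext ?_ ?_
  · simp only [Module.End.mul_apply, psiDbar_apply, psiMulROp_fst, psiMulROp_snd, map_add,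
      Dbar_leibniz, leibniz_parity, h2, h3]
    have e0 := leibniz_neg_left (fun w => parity (T (w - 1)).2) H z
    have e1 := leibniz_add_left (fun w => Dbar (T w).1) (fun w => -parity (T (w - 1)).2) H z
    have e2 := leibniz_add_left (fun w => Dbar (T w).2) (fun w => parity (T w).1) (Dbar H) z
    have e3 := leibniz_shift (fun w => parity (T w).2) H z
    have e4 := leibniz_neg_right (fun w => parity (T w).2) (dx H) z
    have e5 : (fun w => Dbar (T w).1 - parity (T (w - 1)).2) =
      (fun w => Dbar (T w).1) + (fun w => -parity (T (w - 1)).2) :=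
      funext fun w => sub_eq_add_neg _ _
    rw [e5]
    refine Eq.trans ?_ (congrArg₂ (· + ·) e1 e2).symm
    simp only [e0, e3, e4]
    abel
  · simp only [Module.End.mul_apply, psiDbar_apply, psiMulROp_fst, psiMulROp_snd, map_add,
      Dbar_leibniz, leibniz_parity, h1]
    have e2 := leibniz_add_left (fun w => Dbar (T w).2) (fun w => parity (T w).1) (parity H) z
    have e4 := leibniz_neg_right (fun w => parity (T w).2) (parity (Dbar H)) z
    refine Eq.trans ?_ e2.symm
    simp only [e4]
    abel

lemma psiMul_comm_psiDxR (F : SFun) : Commute (psiMul F) psiDxR := by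
  refine LinearMap.ext fun T => funext fun z => Prod.ext ?_ ?_ <;>
  simp only [Module.End.mul_apply, psiMul_apply, psiDxR_apply]

lemma psiMul_comm_psiDbarR (F : SFun) : Commute (psiMul F) psiDbarR := by
  refine LinearMap.ext fun T => funext fun z => Prod.ext ?_ ?_ <;>
  simp only [Module.End.mul_apply, psiMul_apply, psiDbarR_apply, mul_neg]

lemma psiDx_comm_psiDxR : Commute psiDx psiDxR := by
  refine LinearMap.ext fun T => funext fun z => Prod.ext ?_ ?_ <;>
  simp only [Module.End.mul_apply, psiDx_apply, psiDxR_apply]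

lemma psiDx_comm_psiDbarR : Commute psiDx psiDbarR := by
  refine LinearMap.ext fun T => funext fun z => Prod.ext ?_ ?_ <;>
  simp only [Module.End.mul_apply, psiDx_apply, psiDbarR_apply, map_neg, neg_add]

lemma psiDbar_comm_psiDxR : Commute psiDbar psiDxR := by
  refine LinearMap.ext fun T => funext fun z => Prod.ext ?_ ?_ <;>
  simp only [Module.End.mul_apply, psiDbar_apply, psiDxR_apply]

lemma psiDbar_comm_psiDbarR : Commute psiDbar psiDbarR := by
  refine LinearMap.ext fun T => funext fun z => Prod.ext ?_ ?_ <;>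
  simp only [Module.End.mul_apply, psiDbar_apply, psiDbarR_apply, map_neg] <;> abel

lemma psiLeft_comm_psiRight (k l : ℂ) (F G : SFun) : Commute (psiLeft k F) (psiRight l G) := by
  have key : ∀ Z : Module.End ℂ PsiSym, (∀ F, Commute (psiMul F) Z) → Commute psiDx Z →
      Commute psiDbar Z → Commute (psiLeft k F) Z := fun Z h1 h2 h3 =>
    (((h1 F).mul_left h2).add_left (((h1 (D F)).mul_left h3).smul_left _)).add_left
      ((h1 (dx F)).smul_left _)
  have k1 := key psiDxR psiMul_comm_psiDxR psiDx_comm_psiDxR psiDbar_comm_psiDxR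
  have k2 := key psiDbarR psiMul_comm_psiDbarR psiDx_comm_psiDbarR psiDbar_comm_psiDbarR
  have k3 := fun H => key (psiMulROp H) (fun F => psiMul_comm_right F H) (psiDx_comm_right H)
    (psiDbar_comm_right H)
  exact ((k1.mul_right (k3 G)).add_right ((k2.mul_right (k3 (D G))).smul_right _)).add_right
    ((k3 (dx G)).smul_right _)

lemma psiPar_sq : psiPar * psiPar = 1 := by
  have h3 : ∀ G, parity (parity G) = G := by
    intro G; refine TrivSqZeroExt.ext ?_ ?_ <;> simp
  refine LinearMap.ext fun T => funext fun z => Prod.ext ?_ ?_ <;>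
  simp only [Module.End.mul_apply, psiPar_apply, map_neg, neg_neg, h3, Module.End.one_apply]

lemma zmod_cases (i : ZMod 2) : i = 0 ∨ i = 1 := by
  revert i; decide

lemma psiPar_psiLeft (l : ℂ) (F : SFun) :
    psiPar * psiLeft l F = psiLeft l (parity F) * psiPar := by
  have h1 : ∀ G, dx (parity G) = parity (dx G) := by
    intro G; refine TrivSqZeroExt.ext ?_ ?_ <;> simp
  have h2 : ∀ G, D (parity G) = (-1 : ℂ) • parity (D G) := by
    intro G; refine TrivSqZeroExt.ext ?_ ?_ <;> simp
  have h4 : ∀ G, Dbar (parity G) = -parity (Dbar G) := by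
    intro G; refine TrivSqZeroExt.ext ?_ ?_ <;> simp
  have k1 : ∀ G, psiPar * psiMul G = psiMul (parity G) * psiPar := by
    intro G
    refine LinearMap.ext fun T => funext fun z => Prod.ext ?_ ?_ <;>
    simp only [Module.End.mul_apply, psiPar_apply, psiMul_apply, parity_mul, mul_neg]
  have k2 : psiPar * psiDx = psiDx * psiPar := by
    refine LinearMap.ext fun T => funext fun z => Prod.ext ?_ ?_ <;>
    simp only [Module.End.mul_apply, psiPar_apply, psiDx_apply, map_add, h1, map_neg, neg_add]
  have k3 : psiPar * psiDbar = (-1 : ℂ) • (psiDbar * psiPar) := by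
    refine LinearMap.ext fun T => funext fun z => Prod.ext ?_ ?_ <;>
    simp only [Module.End.mul_apply, psiPar_apply, psiDbar_apply, map_add, map_sub, h4, map_neg,
      LinearMap.smul_apply, psi_smul_apply, Prod.smul_fst, Prod.smul_snd] <;> simp only [neg_smul, one_smul] <;> abel
  change psiPar * (psiMul F * psiDx + (1 / 2 : ℂ) • (psiMul (D F) * psiDbar) +
    l • psiMul (dx F)) = (psiMul (parity F) * psiDx + (1 / 2 : ℂ) •
    (psiMul (D (parity F)) * psiDbar) + l • psiMul (dx (parity F))) * psiPar
  simp only [mul_add, add_mul, mul_smul_comm, smul_mul_assoc, k1, ← mul_assoc, h1, h2, map_smul]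
  simp only [mul_assoc, k2, k3, mul_smul_comm]

lemma psiPar_psiRight (l : ℂ) (F : SFun) :
    psiPar * psiRight l F = psiRight l (parity F) * psiPar := by
  have h1 : ∀ G, dx (parity G) = parity (dx G) := by
    intro G; refine TrivSqZeroExt.ext ?_ ?_ <;> simp
  have h2 : ∀ G, D (parity G) = (-1 : ℂ) • parity (D G) := by
    intro G; refine TrivSqZeroExt.ext ?_ ?_ <;> simp
  have h4 : ∀ G, Dbar (parity G) = -parity (Dbar G) := by
    intro G; refine TrivSqZeroExt.ext ?_ ?_ <;> simp
  have k1 : ∀ G, psiPar * psiMulROp G = psiMulROp (parity G) * psiPar := by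
    intro G
    refine LinearMap.ext fun T => funext fun z => Prod.ext ?_ ?_
    · simp only [Module.End.mul_apply, psiPar_apply, psiMulROp_fst, map_add, leibniz_parity, h4]
      rw [leibniz_neg_left, leibniz_neg_right, neg_neg]
    · simp only [Module.End.mul_apply, psiPar_apply, psiMulROp_snd, leibniz_parity]
      rw [leibniz_neg_left]
  have k2 : psiPar * psiDxR = psiDxR * psiPar := by
    refine LinearMap.ext fun T => funext fun z => Prod.ext ?_ ?_ <;>
    simp only [Module.End.mul_apply, psiPar_apply, psiDxR_apply]
  have k3 : psiPar * psiDbarR = (-1 : ℂ) • (psiDbarR * psiPar) := by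
    refine LinearMap.ext fun T => funext fun z => Prod.ext ?_ ?_ <;>
    simp only [Module.End.mul_apply, psiPar_apply, psiDbarR_apply, map_neg,
      LinearMap.smul_apply, psi_smul_apply, Prod.smul_fst, Prod.smul_snd, neg_neg] <;> simp only [neg_smul, one_smul]
  change psiPar * (psiDxR * psiMulROp F + (1 / 2 : ℂ) • (psiDbarR * psiMulROp (D F)) +
    l • psiMulROp (dx F)) = (psiDxR * psiMulROp (parity F) + (1 / 2 : ℂ) •
    (psiDbarR * psiMulROp (D (parity F))) + l • psiMulROp (dx (parity F))) * psiPar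
  simp only [mul_add, add_mul, mul_smul_comm, smul_mul_assoc, ← mul_assoc, k2, k3, h1, h2,
    psiMulROp_smul]
  simp only [mul_assoc, k1]

/-- The operators of the action of `𝒦` on pseudodifferential operators from `𝔽(ν)` to `𝔽(ν + q)`,
`T ↦ π_{ν+q}(X) ∘ T - (-1) ^ (|X| |T|) T ∘ π_ν(X)`. -/
def psiOp (ν q : ℂ) : SFun →ₗ[ℂ] Module.End ℂ PsiSym where
  toFun F := psiLeft (ν + q) F -
    (psiRight ν (evenPart F) + psiRight ν (oddPart F) * psiPar)
  map_add' F G := by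
    simp only [map_add, add_mul]
    abel
  map_smul' c F := by
    simp only [map_smul, smul_mul_assoc, RingHom.id_apply, smul_sub, smul_add]

lemma psiOp_even (ν q : ℂ) {F : SFun} (h : Homog 0 F) :
    psiOp ν q F = psiLeft (ν + q) F - psiRight ν F := by
  have h1 : evenPart F = F := TrivSqZeroExt.ext (by simp) (by simp [homog_zero h])
  have h2 : oddPart F = 0 := TrivSqZeroExt.ext (by simp) (by simp [homog_zero h])
  change psiLeft (ν + q) F - (psiRight ν (evenPart F) + psiRight ν (oddPart F) * psiPar) = _
  rw [h1, h2, map_zero, zero_mul, add_zero]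

lemma psiOp_odd (ν q : ℂ) {F : SFun} (h : Homog 1 F) :
    psiOp ν q F = psiLeft (ν + q) F - psiRight ν F * psiPar := by
  have h1 : evenPart F = 0 := TrivSqZeroExt.ext (by simp [homog_one h]) (by simp)
  have h2 : oddPart F = F := TrivSqZeroExt.ext (by simp [homog_one h]) (by simp)
  change psiLeft (ν + q) F - (psiRight ν (evenPart F) + psiRight ν (oddPart F) * psiPar) = _
  rw [h1, h2, map_zero, zero_add]

lemma psiOp_homog (ν q : ℂ) {i : ZMod 2} {F : SFun} (h : Homog i F) :
    psiOp ν q F = psiLeft (ν + q) F - psiRight ν F * psiPar ^ i.val := by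
  rcases zmod_cases i with rfl | rfl
  · rw [psiOp_even ν q h, ZMod.val_zero, pow_zero, mul_one]
  · rw [psiOp_odd ν q h, ZMod.val_one, pow_one]

lemma homog_cbracket {i j : ZMod 2} {F G : SFun} (hF : Homog i F) (hG : Homog j G) :
    Homog (i + j) (cbracket F G) := by
  rcases homog_cases hF with ⟨rfl, f, rfl⟩ | ⟨rfl, f, rfl⟩ <;>
  rcases homog_cases hG with ⟨rfl, g, rfl⟩ | ⟨rfl, g, rfl⟩ <;>
  refine TrivSqZeroExt.ext ?_ ?_ <;> simp [cbracket, show (1 : ZMod 2) + 1 = 0 from rfl] <;>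
  algebra with ℂ

lemma super_commutator {E : Type*} [Ring E] [Algebra ℂ E] (i j : ZMod 2) {A B R S P : E}
    (c1 : A * S = S * A) (c2 : B * R = R * B) (p1 : P * A = sgn i • (A * P))
    (p2 : P * B = sgn j • (B * P)) (p3 : P * R = sgn i • (R * P)) (p4 : P * S = sgn j • (S * P))
    (ps : P * P = 1) :
    A * B - sgn (i * j) • (B * A) - (S * R - sgn (i * j) • (R * S)) * P ^ (i + j).val =
      (A - R * P ^ i.val) * (B - S * P ^ j.val) -
        sgn (i * j) • ((B - S * P ^ j.val) * (A - R * P ^ i.val)) := by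
  have q3 : ∀ Z, P * (R * Z) = sgn i • (R * (P * Z)) := fun Z => by
    rw [← mul_assoc, p3, smul_mul_assoc, mul_assoc]
  have q4 : ∀ Z, P * (S * Z) = sgn j • (S * (P * Z)) := fun Z => by
    rw [← mul_assoc, p4, smul_mul_assoc, mul_assoc]
  have q6 : ∀ Z, A * (S * Z) = S * (A * Z) := fun Z => by rw [← mul_assoc, c1, mul_assoc]
  have q7 : ∀ Z, B * (R * Z) = R * (B * Z) := fun Z => by rw [← mul_assoc, c2, mul_assoc]
  have v0 : (0 : ZMod 2).val = 0 := rfl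
  have v1 : (1 : ZMod 2).val = 1 := rfl
  have v2 : (1 : ZMod 2) + 1 = 0 := rfl
  rcases zmod_cases i with rfl | rfl <;> rcases zmod_cases j with rfl | rfl <;>
  simp [v0, v1, v2, -mul_eq_zero] at p1 p2 p3 p4 q3 q4 ⊢ <;>
  simp [mul_sub, sub_mul, mul_assoc, p1, p2, p3, p4, ps, q3, q4, q6, q7, c1, c2] <;> abel

lemma super_commutator_end {V : Type*} [AddCommGroup V] [Module ℂ V] (i j : ZMod 2)
    {A B R S P : Module.End ℂ V}
    (c1 : A * S = S * A) (c2 : B * R = R * B) (p1 : P * A = sgn i • (A * P))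
    (p2 : P * B = sgn j • (B * P)) (p3 : P * R = sgn i • (R * P)) (p4 : P * S = sgn j • (S * P))
    (ps : P * P = 1) :
    A * B - sgn (i * j) • (B * A) - (S * R - sgn (i * j) • (R * S)) * P ^ (i + j).val =
      (A - R * P ^ i.val) * (B - S * P ^ j.val) -
        sgn (i * j) • ((B - S * P ^ j.val) * (A - R * P ^ i.val)) :=
  super_commutator i j c1 c2 p1 p2 p3 p4 ps

lemma psiOp_bracket (ν q : ℂ) (i j : ZMod 2) (F G : SFun) (hF : Homog i F) (hG : Homog j G) :
    psiOp ν q (cbracket F G) =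
      psiOp ν q F * psiOp ν q G - sgn (i * j) • (psiOp ν q G * psiOp ν q F) := by
  have p1 := psiPar_psiLeft (ν + q) F
  have p2 := psiPar_psiLeft (ν + q) G
  have p3 := psiPar_psiRight ν F
  have p4 := psiPar_psiRight ν G
  rw [parity_homog hF, map_smul, smul_mul_assoc] at p1 p3
  rw [parity_homog hG, map_smul, smul_mul_assoc] at p2 p4
  have key := super_commutator_end i j (psiLeft_comm_psiRight (ν + q) ν F G).eq
    (psiLeft_comm_psiRight (ν + q) ν G F).eq p1 p2 p3 p4 psiPar_sq
  rw [psiOp_homog ν q hF, psiOp_homog ν q hG, psiOp_homog ν q (homog_cbracket hF hG),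
    psiLeft_bracket (ν + q) i j F G hF hG, psiRight_bracket ν i j F G hF hG]
  exact key

/-- The module `Ψ(ν, q)` of all pseudodifferential operators from `𝔽(ν)` to `𝔽(ν + q)`. -/
def psiRep (ν q : ℂ) : KRep PsiSym where
  par := psiPar
  act := psiOp ν q
  par_par T := LinearMap.congr_fun psiPar_sq T
  par_act F T := by
    have h1 : evenPart (parity F) = parity (evenPart F) := by
      refine TrivSqZeroExt.ext ?_ ?_ <;> simp
    have h2 : oddPart (parity F) = parity (oddPart F) := by
      refine TrivSqZeroExt.ext ?_ ?_ <;> simp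
    have h : psiPar * psiOp ν q F = psiOp ν q (parity F) * psiPar := by
      change psiPar * (psiLeft (ν + q) F - (psiRight ν (evenPart F) +
        psiRight ν (oddPart F) * psiPar)) = (psiLeft (ν + q) (parity F) -
        (psiRight ν (evenPart (parity F)) + psiRight ν (oddPart (parity F)) * psiPar)) * psiPar
      rw [h1, h2, mul_sub, mul_add, sub_mul, add_mul, psiPar_psiLeft, psiPar_psiRight,
        ← mul_assoc psiPar, psiPar_psiRight]
    exact LinearMap.congr_fun h T
  act_bracket := psiOp_bracket ν q

/-- The space `Ψ^k_ℓ` of symbols `∑ j, G_j D̄^{2k-j}_{ℓ-j}`, where `D̄^z_0` and `D̄^z_1` are non-zero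
multiples of `∂_x ^ (z / 2)` and of `∂_x ^ ((z - 1) / 2) D̄`. -/
def psiSub (k : ℂ) (ℓ : ZMod 2) : Submodule ℂ PsiSym where
  carrier := {T | ∀ z : ℂ,
    ((T z).1 ≠ 0 → ∃ j : ℕ, ℓ - (j : ZMod 2) = 0 ∧ z = (2 * k - j) / 2) ∧
    ((T z).2 ≠ 0 → ∃ j : ℕ, ℓ - (j : ZMod 2) = 1 ∧ z = (2 * k - j - 1) / 2)}
  zero_mem' z := by simp
  add_mem' {S T} hS hT z := by
    refine ⟨fun h => ?_, fun h => ?_⟩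
    · by_cases h' : (S z).1 = 0
      · exact (hT z).1 fun h'' => h (by simp [h', h''])
      · exact (hS z).1 h'
    · by_cases h' : (S z).2 = 0
      · exact (hT z).2 fun h'' => h (by simp [h', h''])
      · exact (hS z).2 h'
  smul_mem' a T hT z :=
    ⟨fun h => (hT z).1 fun h' => h (by simp [h']), fun h => (hT z).2 fun h' => h (by simp [h'])⟩

/-- `σ` is a subquotient of a module `Ψ^k_ℓ(ν, q)` of pseudodifferential operators, up to a
possibly odd equivalence. -/
def KRep.IsPsiDOSubquotient {W : Type*} [AddCommGroup W] [Module ℂ W] (σ : KRep W) : Prop :=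
  ∃ (ν q k : ℂ) (ℓ d : ZMod 2) (M : Submodule ℂ PsiSym) (hM : (psiRep ν q).IsInvariant M)
    (T : M →ₗ[ℂ] W), M ≤ psiSub k ℓ ∧ Function.Surjective T ∧
      ((psiRep ν q).sub M hM).IsIntertwiner σ d T

/-! ## Extensions -/

/-- The conformal subalgebra `𝔰`, spanned by the contact Hamiltonians `1, x, x², ξ, ξ x`. -/
def conformal : Submodule ℂ SFun :=
  Submodule.span ℂ {inl 1, inl X, inl (X ^ 2), inr 1, inr X}

/-- `ρ` is an `𝔰`-split extension of `χ 0 → χ 1 → ⋯ → χ (n - 1)`: it has an invariant flag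
`⊤ = Fl 0 ⊇ Fl 1 ⊇ ⋯ ⊇ Fl n = ⊥` with `Fl r / Fl (r + 1)` evenly equivalent to `χ r`, such that the
projections `Fl r → χ r` have even `𝔰`-equivariant sections. -/
def KRep.IsSplitExtension {W : Type*} [AddCommGroup W] [Module ℂ W] (ρ : KRep W) {n : ℕ}
    (χ : Fin n → KRep SFun) : Prop :=
  ∃ Fl : Fin (n + 1) → Submodule ℂ W, Fl 0 = ⊤ ∧ Fl (Fin.last n) = ⊥ ∧
    ∀ r : Fin n, Fl r.succ ≤ Fl r.castSucc ∧
      ∃ (h : ρ.IsInvariant (Fl r.castSucc)) (π : Fl r.castSucc →ₗ[ℂ] SFun)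
        (s : SFun →ₗ[ℂ] Fl r.castSucc),
        (ρ.sub _ h).IsIntertwiner (χ r) 0 π ∧
        LinearMap.ker π = (Fl r.succ).comap (Fl r.castSucc).subtype ∧
        (∀ v, π (s v) = v) ∧
        (∀ v, (ρ.sub _ h).par (s v) = s ((χ r).par v)) ∧
        ∀ F ∈ conformal, ∀ v, (ρ.sub _ h).act F (s v) = s ((χ r).act F v)

/-- The composition data of `(l; p₁, …, p_n)` extensions: the modules
`𝔽(l + p₁ + ⋯ + p_r)^{2 (p₁ + ⋯ + p_r) Π}` for `0 ≤ r ≤ n`.  The half-integers `p_i` are given by the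
list of the integers `2 p_i`. -/
def densityChain (l : ℂ) (p : List ℤ) (r : Fin (p.length + 1)) : KRep SFun :=
  (density (l + ((p.take r).sum : ℂ) / 2)).piShift (p.take r).sum

/-- `ρ` is a uniserial `𝔰`-split `(l; p₁, …, p_n)` extension, where `p` is the list of the `2 p_i`. -/
def KRep.IsUniserialExt {W : Type} [AddCommGroup W] [Module ℂ W] (ρ : KRep W) (l : ℂ)
    (p : List ℤ) : Prop :=
  ρ.IsSplitExtension (densityChain l p) ∧ ρ.IsUniserial

/-- There is a uniserial `𝔰`-split `(l; p₁, …, p_n)` extension, where `p` is the list of the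
`2 p_i`. -/
def ExistsUniserialExt (l : ℂ) (p : List ℤ) : Prop :=
  ∃ (W : Type) (_ : AddCommGroup W) (_ : Module ℂ W) (ρ : KRep W), ρ.IsUniserialExt l p

/-- There is a uniserial `𝔰`-split `(l; p₁, …, p_n)` extension which is a subquotient of a module of
pseudodifferential operators, where `p` is the list of the `2 p_i`. -/
def ExistsPsiDOUniserialExt (l : ℂ) (p : List ℤ) : Prop :=
  ∃ (W : Type) (_ : AddCommGroup W) (_ : Module ℂ W) (ρ : KRep W),
    ρ.IsUniserialExt l p ∧ ρ.IsPsiDOSubquotient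

/-! ## Relative cochains -/

section Cochains

variable {V W X : Type*} [AddCommGroup V] [Module ℂ V] [AddCommGroup W] [Module ℂ W]
  [AddCommGroup X] [Module ℂ X]

/-- The action of a contact Hamiltonian `F` of parity `i` on a linear map `T : V → W` of
parity `j`. -/
def homAct (χ : KRep V) (ω : KRep W) (i j : ZMod 2) (F : SFun) (T : V →ₗ[ℂ] W) : V →ₗ[ℂ] W :=
  ω.act F ∘ₗ T - sgn (i * j) • (T ∘ₗ χ.act F)

/-- Even `𝔰`-relative 1-cochains of `𝒦` with values in `Hom(V, W)`: even linear maps which vanish on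
`𝔰` and are `𝔰`-equivariant. -/
def IsEvenRelCochain (χ : KRep V) (ω : KRep W) (φ : SFun →ₗ[ℂ] (V →ₗ[ℂ] W)) : Prop :=
  (∀ F v, ω.par (φ F v) = φ (parity F) (χ.par v)) ∧
  (∀ F ∈ conformal, φ F = 0) ∧
  ∀ (i j : ZMod 2) (F G : SFun), Homog i F → Homog j G → F ∈ conformal →
    homAct χ ω i j F (φ G) = φ (cbracket F G)

/-- The coboundary `∂φ(F ∧ G)` of an even 1-cochain `φ`, for `F` of parity `i` and `G` of
parity `j`. -/
def coboundary (χ : KRep V) (ω : KRep W) (φ : SFun →ₗ[ℂ] (V →ₗ[ℂ] W)) (i j : ZMod 2)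
    (F G : SFun) : V →ₗ[ℂ] W :=
  homAct χ ω i j F (φ G) - sgn (i * j) • homAct χ ω j i G (φ F) - φ (cbracket F G)

/-- The cup product `(α ∪ β)(F ∧ G)` of even 1-cochains, for `F` of parity `i` and `G` of
parity `j`. -/
def cup (α : SFun →ₗ[ℂ] (W →ₗ[ℂ] X)) (β : SFun →ₗ[ℂ] (V →ₗ[ℂ] W)) (i j : ZMod 2)
    (F G : SFun) : V →ₗ[ℂ] X :=
  α F ∘ₗ β G - sgn (i * j) • (α G ∘ₗ β F)

end Cochains

/-- The odd action `T ↦ π_{l+n/2}(e_{1/2}) T - (-1) ^ |T| T π_l(e_{1/2})` of `e_{1/2} = 2 𝕏(ξ x)` on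
linear maps from `𝔽(l)` to `𝔽(l + n / 2)`. -/
def sigmaHalf (l : ℂ) (n : ℕ) (T : Module.End ℂ SFun) : Module.End ℂ SFun :=
  densityOp (l + n / 2) (inr (2 * X)) * T - opParity T * densityOp l (inr (2 * X))

/-- The value of the cochain `β̄_{n/2}(l)`, with `3 ≤ n`, on `e_{(m + 3) / 2}`.  It is determined by
`β̄(ad(e_{1/2}) ^ m e_{3/2}) = 4 (-1) ^ (n m) σ(e_{1/2}) ^ m (D̄ ^ (n - 3))` and
`ad(e_{1/2}) ^ m e_{3/2} = 2 ^ (m % 2) (m / 2)! e_{(m + 3) / 2}`. -/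
def betaBarValue (l : ℂ) (n m : ℕ) : Module.End ℂ SFun :=
  (4 * (-1) ^ (n * m) / (2 ^ (m % 2) * ((m / 2).factorial : ℂ))) •
    (sigmaHalf l n)^[m] (Dbar ^ (n - 3))

/-- The `𝔰`-relative 1-cochain `β̄_{n/2}(l)` with values in `Hom(𝔽(l), 𝔽(l + n / 2))`, for `3 ≤ n`.
It vanishes on `𝔰`, and is given by `betaBarValue` on the vectors `e_{k-1} = 𝕏(x ^ k)`, `3 ≤ k`, and
`e_{k-1/2} = 2 𝕏(ξ x ^ k)`, `2 ≤ k`. -/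
def betaBar (l : ℂ) (n : ℕ) : SFun →ₗ[ℂ] Module.End ℂ SFun where
  toFun F :=
    (F.fst.sum fun k c => if 3 ≤ k then c • betaBarValue l n (2 * k - 5) else 0) +
    F.snd.sum fun k c => if 2 ≤ k then (c / 2) • betaBarValue l n (2 * k - 4) else 0
  map_add' F G := by
    rw [fst_add, snd_add, sum_add_index, sum_add_index, add_add_add_comm]
    · intro k; simp
    · intro k a b; split_ifs <;> simp [add_div, add_smul]
    · intro k; simp
    · intro k a b; split_ifs <;> simp [add_smul]
  map_smul' c F := by
    rw [fst_smul, snd_smul, sum_smul_index, sum_smul_index, RingHom.id_apply, smul_add, sum_def,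
      sum_def, sum_def, sum_def, Finset.smul_sum, Finset.smul_sum]
    · congr 1 <;> refine Finset.sum_congr rfl fun k _ => ?_ <;>
      split_ifs <;> simp [mul_smul, mul_div_assoc]
    · intro k; simp
    · intro k; simp

/-- The even `𝔰`-relative 1-cochain `β_{n/2}(l)` with values in
`Hom(𝔽(l), 𝔽(l + n / 2)^{nΠ})`: for `n` even it is `β̄_{n/2}(l)`, and for `n` odd it is
`F ↦ (-1) ^ |T| T ε = ε T` with `T = β̄_{n/2}(l)(F)`.  It is zero for `n < 3`, when there are no
non-zero `𝔰`-relative 1-cochains. -/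
def beta (l : ℂ) (n : ℤ) : SFun →ₗ[ℂ] Module.End ℂ SFun :=
  if n < 3 then 0
  else if Even n then betaBar l n.toNat
  else LinearMap.mulLeft ℂ (parity : Module.End ℂ SFun) ∘ₗ betaBar l n.toNat

/-- The cup product `β_{p₂}(l + p₁) ∪ β_{p₁}(l)` is a 2-coboundary in the complex of `𝔰`-relative
cochains with values in `Hom(𝔽(l), 𝔽(l + p₁ + p₂)^{2 (p₁ + p₂) Π})`, where `n₁ = 2 p₁` and
`n₂ = 2 p₂`. -/
def CupIsCoboundary (l : ℂ) (n₁ n₂ : ℤ) : Prop :=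
  ∃ φ : SFun →ₗ[ℂ] Module.End ℂ SFun,
    IsEvenRelCochain (density l)
      ((density (l + ((n₁ + n₂ : ℤ) : ℂ) / 2)).piShift (n₁ + n₂)) φ ∧
    ∀ (i j : ZMod 2) (F G : SFun), Homog i F → Homog j G →
      cup (beta (l + (n₁ : ℂ) / 2) n₂) (beta l n₁) i j F G =
        coboundary (density l) ((density (l + ((n₁ + n₂ : ℤ) : ℂ) / 2)).piShift (n₁ + n₂))
          φ i j F G

end

end SuperK

namespace SuperK

noncomputable section

open Polynomial TrivSqZeroExt

/-! ## The monomial basis -/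

/-- The monomial basis `1, ξ, x, ξ x, x², …` of `ℂ[x, ξ]`. -/
def bv (k : ℕ) : SFun := if Even k then inl (X ^ (k / 2)) else inr (X ^ (k / 2))

lemma bv_even (k : ℕ) : bv (2 * k) = inl (X ^ k) := by
  simp [bv]

lemma bv_odd (k : ℕ) : bv (2 * k + 1) = inr (X ^ k) := by
  have : ¬ Even (2 * k + 1) := by simp
  rw [bv, if_neg this]
  congr 2
  omega

lemma bv_zero : bv 0 = inl 1 := by simpa using bv_even 0
lemma bv_one : bv 1 = inr 1 := by simpa using bv_odd 0
lemma bv_two : bv 2 = inl X := by simpa using bv_even 1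
lemma bv_three : bv 3 = inr X := by simpa using bv_odd 1
lemma bv_four : bv 4 = inl (X ^ 2) := bv_even 2
lemma bv_five : bv 5 = inr (X ^ 2) := bv_odd 2

lemma bv_ne_zero (k : ℕ) : bv k ≠ 0 := by
  rcases Nat.even_or_odd' k with ⟨q, rfl | rfl⟩
  · rw [bv_even]; intro h
    have := congrArg TrivSqZeroExt.fst h
    simp at this
  · rw [bv_odd]; intro h
    have := congrArg TrivSqZeroExt.snd h
    simp at this

lemma zmod_two_mul (q : ℕ) : ((2 * q : ℕ) : ZMod 2) = 0 := by
  rw [Nat.cast_mul]; exact (by decide : ∀ a : ZMod 2, ((2 : ℕ) : ZMod 2) * a = 0) _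

lemma zmod_two_mul_add_one (q : ℕ) : ((2 * q + 1 : ℕ) : ZMod 2) = 1 := by
  rw [Nat.cast_add, zmod_two_mul, zero_add, Nat.cast_one]

lemma homog_inl (f : ℂ[X]) : Homog 0 (inl f : SFun) := by
  refine TrivSqZeroExt.ext ?_ ?_ <;> simp

lemma homog_inr (f : ℂ[X]) : Homog 1 (inr f : SFun) := by
  refine TrivSqZeroExt.ext ?_ ?_ <;> simp

lemma homog_bv (k : ℕ) : Homog (k : ZMod 2) (bv k) := by
  rcases Nat.even_or_odd' k with ⟨q, rfl | rfl⟩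
  · rw [zmod_two_mul, bv_even]; exact homog_inl _
  · rw [zmod_two_mul_add_one, bv_odd]; exact homog_inr _

lemma inl_mem_span (f : ℂ[X]) :
    (inl f : SFun) ∈ Submodule.span ℂ (bv '' {k | (k : ZMod 2) = 0}) := by
  induction f using Polynomial.induction_on' with
  | add p q hp hq => rw [inl_add]; exact add_mem hp hq
  | monomial n a =>
    have : (inl (a • X ^ n) : SFun) = a • bv (2 * n) := by rw [bv_even, inl_smul]
    rw [← C_mul_X_pow_eq_monomial, ← smul_eq_C_mul, this]
    exact Submodule.smul_mem _ _ (Submodule.subset_span ⟨2 * n, zmod_two_mul n, rfl⟩)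

lemma inr_mem_span (f : ℂ[X]) :
    (inr f : SFun) ∈ Submodule.span ℂ (bv '' {k | (k : ZMod 2) = 1}) := by
  induction f using Polynomial.induction_on' with
  | add p q hp hq => rw [inr_add]; exact add_mem hp hq
  | monomial n a =>
    have : (inr (a • X ^ n) : SFun) = a • bv (2 * n + 1) := by rw [bv_odd, inr_smul]
    rw [← C_mul_X_pow_eq_monomial, ← smul_eq_C_mul, this]
    exact Submodule.smul_mem _ _ (Submodule.subset_span ⟨2 * n + 1, zmod_two_mul_add_one n, rfl⟩)

lemma homog_mem_span {i : ZMod 2} {F : SFun} (h : Homog i F) :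
    F ∈ Submodule.span ℂ (bv '' {k | (k : ZMod 2) = i}) := by
  rcases homog_cases h with ⟨rfl, f, rfl⟩ | ⟨rfl, f, rfl⟩
  · exact inl_mem_span f
  · exact inr_mem_span f

/-- Induction principle for homogeneous functions. -/
lemma homog_induction {i : ZMod 2} (p : Submodule ℂ SFun)
    (hb : ∀ k : ℕ, (k : ZMod 2) = i → bv k ∈ p) {F : SFun} (h : Homog i F) : F ∈ p := by
  refine Submodule.span_le.2 ?_ (homog_mem_span h)
  rintro _ ⟨k, hk, rfl⟩
  exact hb k hk

lemma eq_top_of_bv (p : Submodule ℂ SFun) (hb : ∀ k, bv k ∈ p) : p = ⊤ := by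
  refine eq_top_iff.2 fun F _ => ?_
  have : F = inl F.fst + inr F.snd := (inl_fst_add_inr_snd_eq F).symm
  rw [this]
  exact add_mem (homog_induction p (fun k _ => hb k) (homog_inl _))
    (homog_induction p (fun k _ => hb k) (homog_inr _))

lemma lin_ext {V : Type*} [AddCommGroup V] [Module ℂ V] {S T : SFun →ₗ[ℂ] V}
    (h : ∀ k, S (bv k) = T (bv k)) : S = T := by
  have := eq_top_of_bv (LinearMap.eqLocus S T) h
  exact LinearMap.ext fun F => (this ▸ Submodule.mem_top : F ∈ LinearMap.eqLocus S T)

/-! ## Brackets of basis elements -/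

lemma cbracket_add_left (F G H : SFun) : cbracket (F + G) H = cbracket F H + cbracket G H := by
  simp only [cbracket, map_add, add_mul, smul_add]; abel

lemma cbracket_smul_left (c : ℂ) (F H : SFun) : cbracket (c • F) H = c • cbracket F H := by
  simp only [cbracket, map_smul, smul_mul_assoc, smul_sub, smul_comm c]

lemma cbracket_add_right (F G H : SFun) : cbracket F (G + H) = cbracket F G + cbracket F H := by
  simp only [cbracket, map_add, mul_add, smul_add]; abel

lemma cbracket_smul_right (c : ℂ) (F H : SFun) : cbracket F (c • H) = c • cbracket F H := by
  simp only [cbracket, map_smul, mul_smul_comm, smul_sub, smul_comm c]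

lemma der_X_pow (k : ℕ) : derivative (X ^ k : ℂ[X]) = (k : ℂ) • X ^ (k - 1) := by
  rw [derivative_X_pow, smul_eq_C_mul]

lemma cbracket_even_even (i k : ℕ) : cbracket (inl (X ^ i)) (inl (X ^ k)) =
    ((k : ℂ) - i) • inl (X ^ (i + k - 1)) := by
  refine TrivSqZeroExt.ext ?_ ?_
  · simp only [cbracket, fst_sub, fst_smul, mul_fst, D_fst, dx_fst, parity_snd, fst_inl, snd_inl,
      der_X_pow, zero_mul, smul_zero, sub_zero]
    rcases i with _ | i <;> rcases k with _ | k
    · simp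
    · simp
    · simp; module
    · rw [mul_smul_comm, smul_mul_assoc, ← pow_add, ← pow_add, sub_smul]
      congr 3 <;> omega
  · simp [cbracket]

lemma cbracket_even_odd (i k : ℕ) : cbracket (inl (X ^ i)) (inr (X ^ k)) =
    ((k : ℂ) - i / 2) • inr (X ^ (i + k - 1)) := by
  refine TrivSqZeroExt.ext ?_ ?_
  · simp [cbracket]
  · simp only [cbracket, snd_sub, snd_smul, mul_snd, D_fst, D_snd, dx_fst, dx_snd, parity_snd,
      parity_fst, fst_inl, snd_inl, fst_inr, snd_inr, der_X_pow, snd_inr]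
    rcases i with _ | i <;> rcases k with _ | k
    · simp
    · simp
    · simp; module
    · simp only [mul_smul_comm, smul_mul_assoc, ← pow_add, Nat.add_sub_cancel]
      rw [show i + 1 + (k + 1) - 1 = i + 1 + k by omega, show i + (k + 1) = i + 1 + k by omega]
      simp only [mul_neg, smul_mul_assoc, ← pow_add,
        show i + (k + 1) = i + 1 + k by omega, zero_mul, add_zero, map_neg, zero_add, mul_zero]
      module

lemma cbracket_odd_even (i k : ℕ) : cbracket (inr (X ^ i)) (inl (X ^ k)) =
    ((k : ℂ) / 2 - i) • inr (X ^ (i + k - 1)) := by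
  refine TrivSqZeroExt.ext ?_ ?_
  · simp [cbracket]
  · simp only [cbracket, snd_sub, snd_smul, mul_snd, D_fst, D_snd, dx_fst, dx_snd, parity_snd,
      parity_fst, fst_inl, snd_inl, fst_inr, snd_inr, der_X_pow, snd_inr]
    rcases i with _ | i <;> rcases k with _ | k
    · simp
    · simp; module
    · simp; module
    · simp only [mul_smul_comm, smul_mul_assoc, ← pow_add, Nat.add_sub_cancel]
      rw [show i + 1 + (k + 1) - 1 = i + 1 + k by omega, show i + (k + 1) = i + 1 + k by omega]
      simp only [map_zero, zero_mul, mul_zero, zero_add, add_zero]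
      module

lemma cbracket_odd_odd (i k : ℕ) : cbracket (inr (X ^ i)) (inr (X ^ k)) =
    (1 / 2 : ℂ) • inl (X ^ (i + k)) := by
  refine TrivSqZeroExt.ext ?_ ?_
  · simp [cbracket, pow_add]
  · simp [cbracket]

lemma cbracket_bv1_bv1 : cbracket (bv 1) (bv 1) = (1 / 2 : ℂ) • bv 0 := by
  rw [bv_one, bv_zero]; simpa using cbracket_odd_odd 0 0

lemma cbracket_bv1_bv3 : cbracket (bv 1) (bv 3) = (1 / 2 : ℂ) • bv 2 := by
  rw [bv_one, bv_three, bv_two]; simpa using cbracket_odd_odd 0 1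

lemma cbracket_bv3_bv3 : cbracket (bv 3) (bv 3) = (1 / 2 : ℂ) • bv 4 := by
  rw [bv_three, bv_four]; simpa using cbracket_odd_odd 1 1

lemma cbracket_bv1_even (k : ℕ) : cbracket (bv 1) (bv (2 * (k + 1))) =
    ((k + 1 : ℂ) / 2) • bv (2 * k + 1) := by
  rw [bv_one, bv_even, bv_odd]; simpa using cbracket_odd_even 0 (k + 1)

lemma cbracket_bv1_odd (k : ℕ) : cbracket (bv 1) (bv (2 * k + 1)) = (1 / 2 : ℂ) • bv (2 * k) := by
  rw [bv_one, bv_even, bv_odd]; simpa using cbracket_odd_odd 0 k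

lemma cbracket_bv3_even (k : ℕ) : cbracket (bv 3) (bv (2 * k)) =
    ((k : ℂ) / 2 - 1) • bv (2 * k + 1) := by
  rw [bv_three, bv_even, bv_odd]; simpa using cbracket_odd_even 1 k

lemma cbracket_bv3_odd (k : ℕ) : cbracket (bv 3) (bv (2 * k + 1)) =
    (1 / 2 : ℂ) • bv (2 * (k + 1)) := by
  rw [bv_three, bv_even, bv_odd]; simpa [add_comm] using cbracket_odd_odd 1 k

lemma cbracket_bv2 (k : ℕ) : cbracket (bv 2) (bv k) = (((k : ℂ) - 2) / 2) • bv k := by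
  rcases Nat.even_or_odd' k with ⟨q, rfl | rfl⟩
  · rw [bv_two, bv_even]
    have := cbracket_even_even 1 q
    rw [pow_one, Nat.add_sub_cancel_left] at this
    rw [this]; push_cast; congr 1; ring
  · rw [bv_two, bv_odd]
    have := cbracket_even_odd 1 q
    rw [pow_one, Nat.add_sub_cancel_left] at this
    rw [this]; push_cast; congr 1; ring

/-- `𝒦` is generated by `𝕏(ξ)`, `𝕏(ξ x)` and `𝕏(ξ x²)`. -/
theorem eq_top_of_generators (p : Submodule ℂ SFun) (h1 : bv 1 ∈ p) (h3 : bv 3 ∈ p)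
    (h5 : bv 5 ∈ p) (hb : ∀ (i j : ZMod 2) (F G : SFun), Homog i F → Homog j G → F ∈ p → G ∈ p →
      cbracket F G ∈ p) : p = ⊤ := by
  have br : ∀ i j, bv i ∈ p → bv j ∈ p → cbracket (bv i) (bv j) ∈ p := fun i j hi hj =>
    hb _ _ _ _ (homog_bv i) (homog_bv j) hi hj
  have sm : ∀ (c : ℂ) F, c ≠ 0 → c • F ∈ p → F ∈ p := fun c F hc h => by
    simpa [smul_smul, inv_mul_cancel₀ hc] using p.smul_mem c⁻¹ h
  have h0 : bv 0 ∈ p := sm (1 / 2) _ (by norm_num) (cbracket_bv1_bv1 ▸ br 1 1 h1 h1)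
  have h2 : bv 2 ∈ p := sm (1 / 2) _ (by norm_num) (cbracket_bv1_bv3 ▸ br 1 3 h1 h3)
  have h4 : bv 4 ∈ p := sm (1 / 2) _ (by norm_num) (cbracket_bv3_bv3 ▸ br 3 3 h3 h3)
  have key : ∀ k, bv (2 * (k + 2) + 1) ∈ p := by
    intro k
    induction k with
    | zero => exact h5
    | succ k ih =>
      have e1 : bv (2 * (k + 2 + 1)) ∈ p :=
        sm (1 / 2) _ (by norm_num) (cbracket_bv3_odd (k + 2) ▸ br 3 _ h3 ih)
      refine sm _ _ ?_ (cbracket_bv3_even (k + 2 + 1) ▸ br 3 _ h3 e1)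
      push_cast
      have : (k : ℂ) + 1 ≠ 0 := by exact_mod_cast Nat.succ_ne_zero k
      intro h; apply this; linear_combination 2 * h
  refine eq_top_of_bv p fun k => ?_
  rcases Nat.even_or_odd' k with ⟨q, rfl | rfl⟩
  · rcases q with _ | _ | _ | q
    · exact h0
    · exact h2
    · exact h4
    · exact sm (1 / 2) _ (by norm_num) (cbracket_bv3_odd (q + 2) ▸ br 3 _ h3 (key q))
  · rcases q with _ | _ | q
    · exact h1
    · exact h3
    · exact key q

/-! ## Generators acting on densities -/

/-- Multiplication by `x`. -/
def xm : Module.End ℂ SFun := mul (inl X)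
/-- Multiplication by `ξ`. -/
def xim : Module.End ℂ SFun := mul xi
/-- Twice the action of `𝕏(ξ x)` on `𝔽(l)`. -/
def Eo (l : ℂ) : Module.End ℂ SFun := xm * D + (2 * l) • xim
/-- Twice the action of `𝕏(ξ x²)` on `𝔽(l)`. -/
def Fo (l : ℂ) : Module.End ℂ SFun := xm * xm * D + (4 * l) • (xm * xim)
/-- The parity endomorphism as an element of the endomorphism algebra. -/
def eps : Module.End ℂ SFun := parity
/-- The action of the Euler field `𝕏(x)` on `𝔽(0)`. -/
def Nop : Module.End ℂ SFun := densityOp 0 (bv 2)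

lemma eps_apply (v : SFun) : eps v = parity v := rfl
lemma xm_fst (v : SFun) : (xm v).fst = X * v.fst := by simp [xm]
lemma xm_snd (v : SFun) : (xm v).snd = X * v.snd := by simp [xm]
lemma xim_fst (v : SFun) : (xim v).fst = 0 := by simp [xim]
lemma xim_snd (v : SFun) : (xim v).snd = v.fst := by simp [xim]
@[simp] lemma eps_fst (v : SFun) : (eps v).fst = v.fst := by simp [eps]
@[simp] lemma eps_snd (v : SFun) : (eps v).snd = -v.snd := by simp [eps]

lemma end_ext {S T : Module.End ℂ SFun} (h : ∀ v, (S v).fst = (T v).fst)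
    (h' : ∀ v, (S v).snd = (T v).snd) : S = T :=
  LinearMap.ext fun v => TrivSqZeroExt.ext (h v) (h' v)

lemma D_xm : D * xm = xm * D + xim := by
  refine end_ext ?_ ?_ <;> intro v <;> simp [xm_fst, xm_snd, xim_fst, xim_snd]
  ring
lemma D_xim : D * xim = 1 - xim * D := by
  refine end_ext ?_ ?_ <;> intro v <;> simp [xim_fst, xim_snd]
lemma xim_D : xim * D = (1 / 2 : ℂ) • (1 - eps) := by
  refine end_ext ?_ ?_ <;> intro v <;> simp [xim_fst, xim_snd]
  module
lemma eps_D : eps * D = -(D * eps) := by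
  refine end_ext ?_ ?_ <;> intro v <;> simp
lemma xim_eps : xim * eps = xim := by
  refine end_ext ?_ ?_ <;> intro v <;> simp [xim_fst, xim_snd]
lemma xim_xim : xim * xim = 0 := by
  refine end_ext ?_ ?_ <;> intro v <;> simp [xim_fst, xim_snd]
lemma xim_xm : xim * xm = xm * xim := by
  refine end_ext ?_ ?_ <;> intro v <;> simp [xim_fst, xim_snd, xm_fst, xm_snd]
lemma eps_eps : eps * eps = 1 := by
  refine end_ext ?_ ?_ <;> intro v <;> simp
lemma eps_Dbar : eps * Dbar = D := by
  refine end_ext ?_ ?_ <;> intro v <;> simp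
lemma eps_Eo (l : ℂ) : eps * Eo l = -(Eo l * eps) := by
  refine end_ext ?_ ?_ <;> intro v <;> simp [Eo, xm_fst, xm_snd, xim_fst, xim_snd]
  ring

lemma densityOp_bv1 (l : ℂ) : densityOp l (bv 1) = (1 / 2 : ℂ) • D := by
  rw [bv_one]
  refine end_ext ?_ ?_ <;> intro v <;> simp [densityOp_apply, vf]

lemma densityOp_bv3 (l : ℂ) : densityOp l (bv 3) = (1 / 2 : ℂ) • Eo l := by
  rw [bv_three]
  refine end_ext ?_ ?_ <;> intro v <;>
    simp [densityOp_apply, vf, Eo, xm_fst, xm_snd, xim_fst, xim_snd]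
  apply Polynomial.funext; intro r; simp; ring

lemma densityOp_bv5 (l : ℂ) : densityOp l (bv 5) = (1 / 2 : ℂ) • Fo l := by
  rw [bv_five]
  refine end_ext ?_ ?_ <;> intro v <;>
    simp [densityOp_apply, vf, Fo, xm_fst, xm_snd, xim_fst, xim_snd] <;>
    (apply Polynomial.funext; intro r; simp; ring)

lemma densityOp_bv2 (l : ℂ) : densityOp l (bv 2) = Nop + l • 1 := by
  rw [Nop, bv_two]
  refine end_ext ?_ ?_ <;> intro v <;> simp [densityOp_apply, vf]

lemma D_bv_zero : D (bv 0) = 0 := by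
  rw [bv_zero]; refine TrivSqZeroExt.ext ?_ ?_ <;> simp
lemma D_bv_even (k : ℕ) : D (bv (2 * (k + 1))) = (k + 1 : ℂ) • bv (2 * k + 1) := by
  rw [bv_even, bv_odd]
  refine TrivSqZeroExt.ext ?_ ?_ <;> simp [smul_eq_C_mul]
lemma D_bv_odd (k : ℕ) : D (bv (2 * k + 1)) = bv (2 * k) := by
  rw [bv_even, bv_odd]
  refine TrivSqZeroExt.ext ?_ ?_ <;> simp
lemma eps_bv_even (k : ℕ) : eps (bv (2 * k)) = bv (2 * k) := by
  rw [bv_even]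
  refine TrivSqZeroExt.ext ?_ ?_ <;> simp
lemma eps_bv_odd (k : ℕ) : eps (bv (2 * k + 1)) = -bv (2 * k + 1) := by
  rw [bv_odd]
  refine TrivSqZeroExt.ext ?_ ?_ <;> simp
lemma Eo_bv_even (l : ℂ) (k : ℕ) : Eo l (bv (2 * k)) = (k + 2 * l) • bv (2 * k + 1) := by
  rw [bv_even, bv_odd]
  refine TrivSqZeroExt.ext ?_ ?_
  · simp [Eo, xm_fst, xim_fst]
  · rcases k with _ | k <;> simp [Eo, xm_snd, xim_snd, derivative_X_pow]
    apply Polynomial.funext; intro r; simp [pow_succ]; ring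
lemma Eo_bv_odd (l : ℂ) (k : ℕ) : Eo l (bv (2 * k + 1)) = bv (2 * (k + 1)) := by
  rw [bv_even, bv_odd]
  refine TrivSqZeroExt.ext ?_ ?_ <;> simp [Eo, xm_fst, xim_fst, xm_snd, xim_snd, pow_succ, mul_comm]
lemma Fo_bv_even (l : ℂ) (k : ℕ) : Fo l (bv (2 * k)) = (k + 4 * l) • bv (2 * (k + 1) + 1) := by
  rw [bv_even, bv_odd]
  refine TrivSqZeroExt.ext ?_ ?_
  · simp [Fo, xm_fst, xim_fst]
  · rcases k with _ | k <;> simp [Fo, xm_snd, xim_snd, derivative_X_pow]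
    all_goals
      apply Polynomial.funext; intro r; simp [pow_succ]; try ring
lemma Fo_bv_odd (l : ℂ) (k : ℕ) : Fo l (bv (2 * k + 1)) = bv (2 * (k + 2)) := by
  rw [bv_even, bv_odd]
  refine TrivSqZeroExt.ext ?_ ?_ <;>
    simp [Fo, xm_fst, xim_fst, xm_snd, xim_snd, pow_succ]; ring
lemma Nop_bv (k : ℕ) : Nop (bv k) = ((k : ℂ) / 2) • bv k := by
  rw [Nop, bv_two]
  rcases Nat.even_or_odd' k with ⟨q, rfl | rfl⟩
  · rw [bv_even]
    refine TrivSqZeroExt.ext ?_ ?_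
    · rcases q with _ | q <;> simp [densityOp_apply, vf, derivative_X_pow]
      apply Polynomial.funext; intro r; simp [pow_succ]; ring
    · simp [densityOp_apply, vf]
  · rw [bv_odd]
    refine TrivSqZeroExt.ext ?_ ?_
    · simp [densityOp_apply, vf]
    · apply Polynomial.funext; intro r
      rcases q with _ | q <;> simp [densityOp_apply, vf, derivative_X_pow]; simp [pow_succ]; ring

lemma eq_of_D_eq_zero {v : SFun} (h : D v = 0) : ∃ c : ℂ, v = c • bv 0 := by
  have h1 : v.snd = 0 := by simpa using congrArg TrivSqZeroExt.fst h
  have h2 : derivative v.fst = 0 := by simpa using congrArg TrivSqZeroExt.snd h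
  refine ⟨v.fst.coeff 0, ?_⟩
  rw [bv_zero]
  refine TrivSqZeroExt.ext ?_ ?_
  · rw [fst_smul, fst_inl, smul_eq_C_mul, mul_one]
    exact eq_C_of_derivative_eq_zero h2
  · simpa using h1

/-- A vector in the kernel of `D` which is an eigenvector of the Euler operator with non-zero
eigenvalue vanishes. -/
lemma eq_zero_of_D_of_Nop {v : SFun} {c : ℂ} (h : D v = 0) (hN : Nop v = c • v) (hc : c ≠ 0) :
    v = 0 := by
  obtain ⟨a, rfl⟩ := eq_of_D_eq_zero h
  rw [map_smul, Nop_bv] at hN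
  simp only [Nat.cast_zero, zero_div, zero_smul, smul_zero] at hN
  exact (smul_eq_zero.1 hN.symm).resolve_left hc

lemma D_Nop : D * Nop = Nop * D + (1 / 2 : ℂ) • D := by
  refine LinearMap.ext fun v => ?_
  refine LinearMap.congr_fun (lin_ext (fun k => ?_)) v
  simp only [Module.End.mul_apply, LinearMap.add_apply, LinearMap.smul_apply, Nop_bv, map_smul]
  rcases Nat.even_or_odd' k with ⟨q, rfl | rfl⟩
  · rcases q with _ | q
    · simp [D_bv_zero]
    · rw [D_bv_even, map_smul, Nop_bv]; push_cast; module
  · rw [D_bv_odd, Nop_bv]; push_cast; module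

/-- An operator which commutes or anticommutes with `D` and is homogeneous of degree `s`, and which
kills the basis vector `bv r` with `r = -s`, vanishes. -/
lemma eq_zero_of_comm {S : Module.End ℂ SFun} {κ s : ℂ} (hD : D * S = κ • (S * D))
    (hN : Nop * S = S * Nop + (s / 2) • S) (h0 : ∀ r : ℕ, (r : ℂ) + s = 0 → S (bv r) = 0) :
    S = 0 := by
  refine lin_ext fun k => ?_
  have hD' : ∀ v, D (S v) = κ • S (D v) := fun v => LinearMap.congr_fun hD v
  have hN' : ∀ v, Nop (S v) = S (Nop v) + (s / 2) • S v := fun v => LinearMap.congr_fun hN v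
  have step : ∀ k, S (D (bv k)) = 0 → S (bv k) = 0 := by
    intro k hk
    by_cases hs : (k : ℂ) + s = 0
    · exact h0 k hs
    · refine eq_zero_of_D_of_Nop (c := ((k : ℂ) + s) / 2) (by rw [hD', hk, smul_zero]) ?_
        (by simpa using hs)
      rw [hN', Nop_bv, map_smul]; module
  change S (bv k) = 0
  induction k with
  | zero => exact step 0 (by rw [D_bv_zero, map_zero])
  | succ k ih =>
    refine step _ ?_
    rcases Nat.even_or_odd' k with ⟨q, rfl | rfl⟩
    · rw [D_bv_odd, ih]
    · rw [show 2 * q + 1 + 1 = 2 * (q + 1) by ring, D_bv_even, map_smul, ih, smul_zero]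

/-! ## Generalities on representations -/

lemma sgn_mul_self (i : ZMod 2) : sgn i * sgn i = 1 := by
  rcases zmod_cases i with rfl | rfl <;> simp

lemma inl_add_inr (F : SFun) : F = inl F.fst + inr F.snd := (inl_fst_add_inr_snd_eq F).symm

namespace KRep

section General

variable {V W X : Type*} [AddCommGroup V] [Module ℂ V] [AddCommGroup W] [Module ℂ W]
  [AddCommGroup X] [Module ℂ X]

/-- The invariant subspaces form a chain. -/
def IsChain (ρ : KRep V) : Prop :=
  ∀ M N : Submodule ℂ V, ρ.IsInvariant M → ρ.IsInvariant N → M ≤ N ∨ N ≤ M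

lemma isInvariant_of_generators (ρ : KRep V) (M : Submodule ℂ V) (hp : ∀ v ∈ M, ρ.par v ∈ M)
    (h1 : ∀ v ∈ M, ρ.act (bv 1) v ∈ M) (h3 : ∀ v ∈ M, ρ.act (bv 3) v ∈ M)
    (h5 : ∀ v ∈ M, ρ.act (bv 5) v ∈ M) : ρ.IsInvariant M := by
  refine ⟨hp, ?_⟩
  let p : Submodule ℂ SFun :=
    { carrier := {F | ∀ v ∈ M, ρ.act F v ∈ M}
      zero_mem' := fun v _ => by simp
      add_mem' := fun hF hG v hv => by
        rw [map_add, LinearMap.add_apply]; exact add_mem (hF v hv) (hG v hv)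
      smul_mem' := fun c F hF v hv => by
        rw [map_smul, LinearMap.smul_apply]; exact M.smul_mem c (hF v hv) }
  have hp : p = ⊤ := eq_top_of_generators p h1 h3 h5 fun i j F G hF hG hF' hG' v hv => by
    rw [ρ.act_bracket i j F G hF hG]
    exact sub_mem (hF' _ (hG' v hv)) (M.smul_mem _ (hG' _ (hF' v hv)))
  exact fun F => (hp ▸ Submodule.mem_top : F ∈ p)

lemma isIntertwiner_zero_iff {ρ : KRep V} {σ : KRep W} {T : V →ₗ[ℂ] W} :
    ρ.IsIntertwiner σ 0 T ↔ (∀ v, σ.par (T v) = T (ρ.par v)) ∧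
      ∀ F v, σ.act F (T v) = T (ρ.act F v) := by
  constructor
  · rintro ⟨h1, h2⟩
    refine ⟨fun v => by simpa using h1 v, fun F v => ?_⟩
    have e1 := h2 0 (inl F.fst) (homog_inl _) v
    have e2 := h2 1 (inr F.snd) (homog_inr _) v
    rw [mul_zero, sgn_zero, one_smul] at e1 e2
    rw [inl_add_inr F, map_add, map_add, LinearMap.add_apply, LinearMap.add_apply, e1, e2, map_add]
  · rintro ⟨h1, h2⟩
    exact ⟨fun v => by simpa using h1 v, fun e F _ v => by simpa using h2 F v⟩

lemma isIntertwiner_of_generators {ρ : KRep V} {σ : KRep W} {T : V →ₗ[ℂ] W}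
    (hp : ∀ v, σ.par (T v) = T (ρ.par v)) (h1 : ∀ v, σ.act (bv 1) (T v) = T (ρ.act (bv 1) v))
    (h3 : ∀ v, σ.act (bv 3) (T v) = T (ρ.act (bv 3) v))
    (h5 : ∀ v, σ.act (bv 5) (T v) = T (ρ.act (bv 5) v)) : ρ.IsIntertwiner σ 0 T := by
  refine isIntertwiner_zero_iff.2 ⟨hp, ?_⟩
  let p : Submodule ℂ SFun :=
    { carrier := {F | ∀ v, σ.act F (T v) = T (ρ.act F v)}
      zero_mem' := fun v => by simp
      add_mem' := fun {F G} hF hG v => by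
        rw [map_add, map_add, LinearMap.add_apply, LinearMap.add_apply, hF v, hG v, map_add]
      smul_mem' := fun c F hF v => by
        rw [map_smul, map_smul, LinearMap.smul_apply, LinearMap.smul_apply, hF v, map_smul] }
  have hp : p = ⊤ := eq_top_of_generators p h1 h3 h5 fun i j F G hF hG hF' hG' v => by
    rw [σ.act_bracket i j F G hF hG, ρ.act_bracket i j F G hF hG]
    simp only [LinearMap.sub_apply, Module.End.mul_apply, LinearMap.smul_apply, map_sub, map_smul]
    rw [hG' v, hF' _, hF' v, hG' _]
  exact fun F => (hp ▸ Submodule.mem_top : F ∈ p)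

lemma IsInvariant.comap {ρ : KRep V} {σ : KRep W} {T : V →ₗ[ℂ] W} (hT : ρ.IsIntertwiner σ 0 T)
    {M : Submodule ℂ W} (hM : σ.IsInvariant M) : ρ.IsInvariant (M.comap T) := by
  obtain ⟨h1, h2⟩ := isIntertwiner_zero_iff.1 hT
  exact ⟨fun v hv => by rw [Submodule.mem_comap, ← h1]; exact hM.1 _ hv,
    fun F v hv => by rw [Submodule.mem_comap, ← h2]; exact hM.2 _ _ hv⟩

lemma IsInvariant.map {ρ : KRep V} {σ : KRep W} {T : V →ₗ[ℂ] W} (hT : ρ.IsIntertwiner σ 0 T)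
    {M : Submodule ℂ V} (hM : ρ.IsInvariant M) : σ.IsInvariant (M.map T) := by
  obtain ⟨h1, h2⟩ := isIntertwiner_zero_iff.1 hT
  refine ⟨?_, ?_⟩
  · rintro _ ⟨v, hv, rfl⟩; exact ⟨_, hM.1 _ hv, (h1 v).symm⟩
  · rintro F _ ⟨v, hv, rfl⟩; exact ⟨_, hM.2 F _ hv, (h2 F v).symm⟩

lemma isIntertwiner_subtype (ρ : KRep V) (M : Submodule ℂ V) (hM : ρ.IsInvariant M) :
    (ρ.sub M hM).IsIntertwiner ρ 0 M.subtype :=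
  isIntertwiner_zero_iff.2 ⟨fun _ => rfl, fun _ _ => rfl⟩

lemma isInvariant_bot (ρ : KRep V) : ρ.IsInvariant ⊥ :=
  ⟨fun v hv => by rw [Submodule.mem_bot] at hv ⊢; rw [hv, map_zero],
   fun F v hv => by rw [Submodule.mem_bot] at hv ⊢; rw [hv, map_zero]⟩

lemma isInvariant_ker {ρ : KRep V} {σ : KRep W} {T : V →ₗ[ℂ] W} (hT : ρ.IsIntertwiner σ 0 T) :
    ρ.IsInvariant (LinearMap.ker T) := (isInvariant_bot σ).comap hT

lemma IsInvariant.sup {ρ : KRep V} {M N : Submodule ℂ V} (hM : ρ.IsInvariant M)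
    (hN : ρ.IsInvariant N) : ρ.IsInvariant (M ⊔ N) := by
  refine ⟨fun v hv => ?_, fun F v hv => ?_⟩ <;>
  obtain ⟨a, ha, b, hb, rfl⟩ := Submodule.mem_sup.1 hv <;> rw [map_add]
  · exact Submodule.add_mem_sup (hM.1 _ ha) (hN.1 _ hb)
  · exact Submodule.add_mem_sup (hM.2 F _ ha) (hN.2 F _ hb)

lemma IsInvariant.inf {ρ : KRep V} {M N : Submodule ℂ V} (hM : ρ.IsInvariant M)
    (hN : ρ.IsInvariant N) : ρ.IsInvariant (M ⊓ N) :=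
  ⟨fun v hv => ⟨hM.1 _ hv.1, hN.1 _ hv.2⟩, fun F v hv => ⟨hM.2 F _ hv.1, hN.2 F _ hv.2⟩⟩

/-- Descent of an endomorphism along a surjection. -/
def descend (T : V →ₗ[ℂ] W) (hT : Function.Surjective T) (A : Module.End ℂ V)
    (hA : ∀ v ∈ LinearMap.ker T, A v ∈ LinearMap.ker T) : Module.End ℂ W :=
  (LinearMap.ker T).liftQ (T ∘ₗ A) (fun v hv => hA v hv) ∘ₗ
    (T.quotKerEquivOfSurjective hT).symm.toLinearMap

lemma descend_apply (T : V →ₗ[ℂ] W) (hT : Function.Surjective T) (A : Module.End ℂ V)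
    (hA : ∀ v ∈ LinearMap.ker T, A v ∈ LinearMap.ker T) (v : V) : descend T hT A hA (T v) = T (A v) := by
  have : (T.quotKerEquivOfSurjective hT).symm (T v) = (LinearMap.ker T).mkQ v := by
    rw [LinearEquiv.symm_apply_eq]; rfl
  simp only [descend, LinearMap.comp_apply, LinearEquiv.coe_coe]
  rw [this]; rfl

/-- The quotient representation on the image of a surjection with invariant kernel. -/
def ofSurjective (ρ : KRep V) (T : V →ₗ[ℂ] W) (hT : Function.Surjective T)
    (hk : ρ.IsInvariant (LinearMap.ker T)) : KRep W where
  par := descend T hT ρ.par hk.1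
  act :=
    { toFun := fun F => descend T hT (ρ.act F) (hk.2 F)
      map_add' := fun F G => LinearMap.ext fun w => by
        obtain ⟨v, rfl⟩ := hT w
        simp [descend_apply]
      map_smul' := fun c F => LinearMap.ext fun w => by
        obtain ⟨v, rfl⟩ := hT w
        simp [descend_apply] }
  par_par w := by
    obtain ⟨v, rfl⟩ := hT w
    rw [descend_apply, descend_apply, ρ.par_par]
  par_act F w := by
    obtain ⟨v, rfl⟩ := hT w
    change descend T hT ρ.par hk.1 (descend T hT (ρ.act F) (hk.2 _) (T v)) =
      descend T hT (ρ.act (parity F)) (hk.2 _) (descend T hT ρ.par hk.1 (T v))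
    rw [descend_apply, descend_apply, descend_apply, descend_apply, ρ.par_act]
  act_bracket i j F G hF hG := by
    refine LinearMap.ext fun w => ?_
    obtain ⟨v, rfl⟩ := hT w
    change descend T hT (ρ.act (cbracket F G)) (hk.2 _) (T v) =
      descend T hT (ρ.act F) (hk.2 _) (descend T hT (ρ.act G) (hk.2 _) (T v)) -
      sgn (i * j) • descend T hT (ρ.act G) (hk.2 _) (descend T hT (ρ.act F) (hk.2 _) (T v))
    rw [descend_apply, descend_apply, descend_apply, descend_apply, descend_apply,
      ρ.act_bracket i j F G hF hG]
    simp

lemma ofSurjective_isIntertwiner (ρ : KRep V) (T : V →ₗ[ℂ] W) (hT : Function.Surjective T)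
    (hk : ρ.IsInvariant (LinearMap.ker T)) : ρ.IsIntertwiner (ρ.ofSurjective T hT hk) 0 T :=
  isIntertwiner_zero_iff.2 ⟨fun v => descend_apply T hT _ _ v, fun _ v => descend_apply T hT _ _ v⟩

lemma IsIntertwiner.comp {ρ : KRep V} {σ : KRep W} {τ : KRep X} {S : W →ₗ[ℂ] X} {T : V →ₗ[ℂ] W}
    (hS : σ.IsIntertwiner τ 0 S) (hT : ρ.IsIntertwiner σ 0 T) : ρ.IsIntertwiner τ 0 (S ∘ₗ T) := by
  rw [isIntertwiner_zero_iff] at *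
  exact ⟨fun v => by simp [hS.1, hT.1], fun F v => by simp [hS.2, hT.2]⟩

lemma Equiv.symm {ρ : KRep V} {σ : KRep W} (h : ρ.Equiv σ) : σ.Equiv ρ := by
  obtain ⟨T, hT, hi⟩ := h
  rw [isIntertwiner_zero_iff] at hi
  let e := LinearEquiv.ofBijective T hT
  refine ⟨e.symm.toLinearMap, e.symm.bijective, isIntertwiner_zero_iff.2 ⟨fun v => ?_, fun F v => ?_⟩⟩
  · obtain ⟨w, rfl⟩ := e.surjective v
    apply e.injective
    change T (ρ.par (e.symm (e w))) = T (e.symm (σ.par (e w)))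
    rw [e.symm_apply_apply, ← hi.1]; exact (e.apply_symm_apply _).symm
  · obtain ⟨w, rfl⟩ := e.surjective v
    apply e.injective
    change T (ρ.act F (e.symm (e w))) = T (e.symm (σ.act F (e w)))
    rw [e.symm_apply_apply, ← hi.2]; exact (e.apply_symm_apply _).symm

lemma Equiv.trans {ρ : KRep V} {σ : KRep W} {τ : KRep X} (h : ρ.Equiv σ) (h' : σ.Equiv τ) :
    ρ.Equiv τ := by
  obtain ⟨T, hT, hi⟩ := h
  obtain ⟨S, hS, hj⟩ := h'
  exact ⟨S ∘ₗ T, hS.comp hT, hj.comp hi⟩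

/-- If the kernel of a surjective `𝒦`-map is contained in both of two subspaces, they are comparable
as soon as the invariant subspaces of the image form a chain. -/
lemma IsChain.comparable_of_ker_le {ρ : KRep V} {σ : KRep W} {T : V →ₗ[ℂ] W}
    (hT : ρ.IsIntertwiner σ 0 T) (hσ : σ.IsChain) {M N : Submodule ℂ V}
    (hM : ρ.IsInvariant M) (hN : ρ.IsInvariant N) (hM' : LinearMap.ker T ≤ M)
    (hN' : LinearMap.ker T ≤ N) : M ≤ N ∨ N ≤ M := by
  have key : ∀ A B : Submodule ℂ V, LinearMap.ker T ≤ B → A.map T ≤ B.map T → A ≤ B := by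
    intro A B hB h v hv
    obtain ⟨w, hw, e⟩ := h ⟨v, hv, rfl⟩
    have : v - w ∈ B := hB (by rw [LinearMap.mem_ker, map_sub, e, sub_self])
    simpa using add_mem this hw
  exact (hσ _ _ (hM.map hT) (hN.map hT)).imp (key _ _ hN') (key _ _ hM')

lemma IsChain.of_surjective {ρ : KRep V} {σ : KRep W} {T : V →ₗ[ℂ] W}
    (hT : ρ.IsIntertwiner σ 0 T) (hs : Function.Surjective T) (hρ : ρ.IsChain) : σ.IsChain := by
  intro M N hM hN
  rcases hρ _ _ (hM.comap hT) (hN.comap hT) with h | h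
  · exact Or.inl ((Submodule.comap_le_comap_iff_of_surjective hs).1 h)
  · exact Or.inr ((Submodule.comap_le_comap_iff_of_surjective hs).1 h)

lemma IsChain.comparable_of_le_range {ρ : KRep V} {σ : KRep W} {T : V →ₗ[ℂ] W}
    (hT : ρ.IsIntertwiner σ 0 T) (hρ : ρ.IsChain) {M N : Submodule ℂ W}
    (hM : σ.IsInvariant M) (hN : σ.IsInvariant N) (hM' : M ≤ LinearMap.range T)
    (hN' : N ≤ LinearMap.range T) : M ≤ N ∨ N ≤ M := by
  have key : ∀ A B : Submodule ℂ W, A ≤ LinearMap.range T → A.comap T ≤ B.comap T → A ≤ B := by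
    intro A B hA h v hv
    obtain ⟨w, rfl⟩ := hA hv
    exact h hv
  exact (hρ _ _ (hM.comap hT) (hN.comap hT)).imp (key _ _ hM') (key _ _ hN')

lemma IsChain.of_injective {ρ : KRep V} {σ : KRep W} {T : V →ₗ[ℂ] W}
    (hT : ρ.IsIntertwiner σ 0 T) (hi : Function.Injective T) (hσ : σ.IsChain) : ρ.IsChain := by
  intro M N hM hN
  exact (hσ _ _ (hM.map hT) (hN.map hT)).imp (Submodule.map_le_map_iff_of_injective hi _ _).1
    (Submodule.map_le_map_iff_of_injective hi _ _).1

lemma IsChain.equiv {ρ : KRep V} {σ : KRep W} (h : ρ.Equiv σ) (hρ : ρ.IsChain) : σ.IsChain := by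
  obtain ⟨T, hT, hi⟩ := h
  exact hρ.of_surjective hi hT.2

/-- If `A` is a proper subspace of `B`, the invariant subspaces inside `B` form a chain, and
those that contain `A` form a chain, then all invariant subspaces form a chain. -/
lemma isChain_of_flag {ρ : KRep V} {A B : Submodule ℂ V} (hA : ρ.IsInvariant A)
    (hB : ρ.IsInvariant B) (hAB : A < B)
    (h1 : ∀ M N, ρ.IsInvariant M → ρ.IsInvariant N → M ≤ B → N ≤ B → M ≤ N ∨ N ≤ M)
    (h2 : ∀ M N, ρ.IsInvariant M → ρ.IsInvariant N → A ≤ M → A ≤ N → M ≤ N ∨ N ≤ M) :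
    ρ.IsChain := by
  have key : ∀ M, ρ.IsInvariant M → A ≤ M ∨ M ≤ A := by
    intro M hM
    rcases h1 (M ⊓ B) A (hM.inf hB) hA inf_le_right hAB.le with h | h
    · rcases h2 (M ⊔ A) B (hM.sup hA) hB le_sup_right hAB.le with h' | h'
      · exact Or.inr ((le_inf le_rfl (le_sup_left.trans h')).trans h)
      · exfalso
        refine hAB.not_ge fun b hb => ?_
        obtain ⟨m, hm, a, ha, rfl⟩ := Submodule.mem_sup.1 (h' hb)
        have hmB : m ∈ B := by simpa using sub_mem hb (hAB.le ha)
        exact add_mem (h ⟨hm, hmB⟩) ha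
    · exact Or.inl (h.trans inf_le_left)
  intro M N hM hN
  rcases key M hM with h | h <;> rcases key N hN with h' | h'
  · exact h2 M N hM hN h h'
  · exact Or.inr (h'.trans h)
  · exact Or.inl (h.trans h')
  · exact h1 M N hM hN (h.trans hAB.le) (h'.trans hAB.le)

end General

/-- A representation is uniserial if and only if its invariant subspaces form a chain. -/
theorem isUniserial_iff_isChain {V : Type} [AddCommGroup V] [Module ℂ V] (ρ : KRep V) :
    ρ.IsUniserial ↔ ρ.IsChain := by
  constructor
  · intro h M N hM hN
    have hS := hM.sup hN
    set S := M ⊔ N with hSdef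
    set Q : Submodule ℂ S := (M ⊓ N).comap S.subtype with hQ
    have hQi : (ρ.sub S hS).IsInvariant Q := (hM.inf hN).comap (isIntertwiner_subtype ρ S hS)
    have hk : (ρ.sub S hS).IsInvariant (LinearMap.ker Q.mkQ) := by rwa [Submodule.ker_mkQ]
    have hT := ofSurjective_isIntertwiner (ρ.sub S hS) Q.mkQ (Submodule.mkQ_surjective Q) hk
    have hI := h _ ((ρ.sub S hS).ofSurjective Q.mkQ (Submodule.mkQ_surjective Q) hk)
      ⟨S, hS, Q.mkQ, Submodule.mkQ_surjective Q, hT⟩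
    have hM' := ((hM.comap (isIntertwiner_subtype ρ S hS)).map hT)
    have hN' := ((hN.comap (isIntertwiner_subtype ρ S hS)).map hT)
    have mem : ∀ A : Submodule ℂ V, M ⊓ N ≤ A → ∀ x : S,
        Q.mkQ x ∈ (A.comap S.subtype).map Q.mkQ → (x : V) ∈ A := by
      rintro A hA x ⟨y, hy, e⟩
      have : y - x ∈ Q := (Submodule.Quotient.eq Q).1 e
      have h2 := sub_mem hy (hA this)
      simpa using h2
    have hc : IsCompl ((M.comap S.subtype).map Q.mkQ) ((N.comap S.subtype).map Q.mkQ) := by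
      constructor
      · rw [Submodule.disjoint_def]
        intro x hx hx'
        obtain ⟨x, rfl⟩ := Submodule.mkQ_surjective Q x
        rw [Submodule.mkQ_apply, Submodule.Quotient.mk_eq_zero]
        exact ⟨mem M inf_le_left x hx, mem N inf_le_right x hx'⟩
      · rw [codisjoint_iff, eq_top_iff]
        rintro x -
        obtain ⟨⟨x, hx⟩, rfl⟩ := Submodule.mkQ_surjective Q x
        obtain ⟨a, ha, b, hb, rfl⟩ := Submodule.mem_sup.1 hx
        have e : (⟨a + b, hx⟩ : S) = ⟨a, Submodule.mem_sup_left ha⟩ + ⟨b, Submodule.mem_sup_right hb⟩ :=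
          rfl
        rw [e, map_add]
        exact Submodule.add_mem_sup ⟨_, ha, rfl⟩ ⟨_, hb, rfl⟩
    have fin : ∀ A : Submodule ℂ V, A ≤ S → (A.comap S.subtype).map Q.mkQ = ⊥ → A ≤ M ⊓ N := by
      intro A hA h0 a ha
      have : Q.mkQ ⟨a, hA ha⟩ = 0 := by
        rw [← Submodule.mem_bot ℂ, ← h0]; exact ⟨⟨a, hA ha⟩, ha, rfl⟩
      rw [Submodule.mkQ_apply, Submodule.Quotient.mk_eq_zero] at this
      exact this
    rcases hI _ _ hM' hN' hc with h0 | h0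
    · exact Or.inl ((fin M le_sup_left h0).trans inf_le_right)
    · exact Or.inr ((fin N le_sup_right h0).trans inf_le_left)
  · rintro h X _ _ σ ⟨M, hM, T, hs, hT⟩ A B hA hB hc
    have hsub : (ρ.sub M hM).IsChain :=
      h.of_injective (isIntertwiner_subtype ρ M hM) M.injective_subtype
    rcases (hsub.of_surjective hT hs) A B hA hB with h | h
    · exact Or.inl (by rw [← hc.inf_eq_bot, inf_eq_left.2 h])
    · exact Or.inr (by rw [← hc.inf_eq_bot, inf_eq_right.2 h])

end KRep

/-! ## Tensor densities with shifted parity -/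

/-- The sign `(-1) ^ n`. -/
def sgnZ (n : ℤ) : ℂ := if Odd n then -1 else 1

lemma sgnZ_add (m n : ℤ) : sgnZ (m + n) = sgnZ m * sgnZ n := by
  unfold sgnZ
  by_cases hm : Odd m <;> by_cases hn : Odd n <;> simp [hm, hn, Int.odd_add, ← Int.not_odd_iff_even]

lemma sgnZ_mul_self (m : ℤ) : sgnZ m * sgnZ m = 1 := by
  unfold sgnZ; split_ifs <;> simp

/-- The density module `𝔽(l)^{nΠ}`. -/
abbrev dens (l : ℂ) (n : ℤ) : KRep SFun := (density l).piShift n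

lemma dens_act (l : ℂ) (n : ℤ) : (dens l n).act = densityOp l := by
  unfold dens KRep.piShift; split_ifs <;> rfl

lemma dens_par (l : ℂ) (n : ℤ) (v : SFun) : (dens l n).par v = sgnZ n • parity v := by
  unfold dens KRep.piShift sgnZ
  split_ifs
  · change -(parity v) = _; rw [neg_smul, one_smul]
  · rw [one_smul]; rfl

lemma densityOp_parity (l : ℂ) (F v : SFun) :
    parity (densityOp l F v) = densityOp l (parity F) (parity v) := (density l).par_act F v

lemma densityOp_bracket (l : ℂ) (i j : ZMod 2) (F G : SFun) (hF : Homog i F) (hG : Homog j G) :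
    densityOp l (cbracket F G) =
      densityOp l F * densityOp l G - sgn (i * j) • (densityOp l G * densityOp l F) :=
  (density l).act_bracket i j F G hF hG

/-- The operator `ε D^{n-3}`, understood as zero for `n < 3`. -/
def Dp (n : ℤ) : Module.End ℂ SFun := if n < 3 then 0 else eps * D ^ (n - 3).toNat

lemma parity_parity (v : SFun) : parity (parity v) = v := by
  refine TrivSqZeroExt.ext ?_ ?_ <;> simp

lemma D_pow_D (k : ℕ) : D * D ^ k = D ^ k * D := (pow_succ' D k).symm.trans (pow_succ D k)

lemma Nop_eps : Nop * eps = eps * Nop := by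
  refine lin_ext fun k => ?_
  simp only [Module.End.mul_apply, Nop_bv, map_smul]
  rcases Nat.even_or_odd' k with ⟨q, rfl | rfl⟩
  · rw [eps_bv_even, Nop_bv]
  · rw [eps_bv_odd, map_neg, Nop_bv, smul_neg]

lemma Nop_D_pow (k : ℕ) : Nop * D ^ k = D ^ k * Nop + (-(k : ℂ) / 2) • D ^ k := by
  induction k with
  | zero => simp
  | succ k ih =>
    rw [pow_succ, ← mul_assoc, ih, add_mul, smul_mul_assoc, mul_assoc, mul_assoc,
      ← sub_eq_iff_eq_add.2 D_Nop, mul_sub, mul_smul_comm]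
    push_cast
    module

lemma D_Dp (n : ℤ) : D * Dp n = -(Dp n * D) := by
  unfold Dp
  split_ifs
  · simp
  · rw [← mul_assoc, ← neg_eq_iff_eq_neg.2 eps_D, neg_mul, mul_assoc, D_pow_D, mul_assoc]

lemma Nop_Dp (n : ℤ) : Nop * Dp n = Dp n * Nop + ((3 - n : ℂ) / 2) • Dp n := by
  unfold Dp
  split_ifs with h
  · simp
  · rw [← mul_assoc, Nop_eps, mul_assoc, Nop_D_pow, mul_add, mul_smul_comm, mul_assoc]
    congr 2
    have : ((n - 3).toNat : ℂ) = n - 3 := by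
      have h2 : (((n - 3).toNat : ℤ) : ℂ) = ((n - 3 : ℤ) : ℂ) := by
        rw [Int.toNat_of_nonneg (by omega)]
      push_cast at h2; exact h2
    rw [this]; ring

lemma D_pow_bv_lt {j k : ℕ} (h : j < k) : (D ^ k) (bv j) = 0 := by
  induction j generalizing k with
  | zero => rcases k with _ | k
            · omega
            · rw [pow_succ, Module.End.mul_apply, D_bv_zero, map_zero]
  | succ j ih =>
    rcases k with _ | k
    · omega
    · rw [pow_succ, Module.End.mul_apply]
      rcases Nat.even_or_odd' j with ⟨q, rfl | rfl⟩
      · rw [D_bv_odd]; exact ih (by omega)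
      · rw [show 2 * q + 1 + 1 = 2 * (q + 1) by ring, D_bv_even, map_smul, ih (by omega), smul_zero]

lemma D_pow_bv_self (k : ℕ) : ∃ c : ℂ, c ≠ 0 ∧ (D ^ k) (bv k) = c • bv 0 := by
  induction k with
  | zero => exact ⟨1, one_ne_zero, by simp⟩
  | succ k ih =>
    obtain ⟨c, hc, e⟩ := ih
    rw [pow_succ, Module.End.mul_apply]
    rcases Nat.even_or_odd' k with ⟨q, rfl | rfl⟩
    · exact ⟨c, hc, by rw [D_bv_odd, e]⟩
    · refine ⟨(q + 1) * c, mul_ne_zero (by exact_mod_cast Nat.succ_ne_zero q) hc, ?_⟩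
      rw [show 2 * q + 1 + 1 = 2 * (q + 1) by ring, D_bv_even, map_smul, e, smul_smul]

/-- Operators which anticommute with `D` and have the degree of `ε D^{n-3}` are multiples of it. -/
lemma exists_eq_smul_Dp {S : Module.End ℂ SFun} (n : ℤ) (hD : D * S = -(S * D))
    (hN : Nop * S = S * Nop + ((3 - n : ℂ) / 2) • S) : ∃ c : ℂ, S = c • Dp n := by
  by_cases h : n < 3
  · refine ⟨0, ?_⟩
    rw [zero_smul]
    refine eq_zero_of_comm (κ := -1) (s := 3 - n) (by rw [hD]; module) hN fun r hr => ?_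
    exfalso
    have : (r : ℤ) + (3 - n) = 0 := by exact_mod_cast hr
    omega
  · obtain ⟨k, hk⟩ : ∃ k : ℕ, n = k + 3 := ⟨(n - 3).toNat, by omega⟩
    obtain ⟨c, hc, e⟩ := D_pow_bv_self k
    have hconst : ∃ a : ℂ, S (bv k) = a • bv 0 := by
      have hlt : ∀ j, j < k → S (bv j) = 0 := by
        intro j
        induction j with
        | zero =>
          intro hj
          refine eq_zero_of_D_of_Nop (c := -(k : ℂ) / 2) ?_ ?_ ?_
          · have := LinearMap.congr_fun hD (bv 0)
            simpa [D_bv_zero] using this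
          · have := LinearMap.congr_fun hN (bv 0)
            simp only [Module.End.mul_apply, LinearMap.add_apply, LinearMap.smul_apply, Nop_bv,
              map_smul] at this
            rw [this, hk]; push_cast; module
          · have : (k : ℂ) ≠ 0 := by exact_mod_cast hj.ne'
            intro h0; apply this; linear_combination -2 * h0
        | succ j ih =>
          intro hj
          have hDj : S (D (bv (j + 1))) = 0 := by
            rcases Nat.even_or_odd' j with ⟨q, rfl | rfl⟩
            · rw [D_bv_odd]; exact ih (by omega)
            · rw [show 2 * q + 1 + 1 = 2 * (q + 1) by ring, D_bv_even, map_smul, ih (by omega),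
                smul_zero]
          refine eq_zero_of_D_of_Nop (c := ((j + 1 : ℕ) - (k : ℂ)) / 2) ?_ ?_ ?_
          · have := LinearMap.congr_fun hD (bv (j + 1))
            simpa [hDj] using this
          · have := LinearMap.congr_fun hN (bv (j + 1))
            simp only [Module.End.mul_apply, LinearMap.add_apply, LinearMap.smul_apply, Nop_bv,
              map_smul] at this
            rw [this, hk]; push_cast; module
          · intro h0
            have : ((j + 1 : ℕ) : ℂ) = k := by linear_combination 2 * h0
            have : j + 1 = k := by exact_mod_cast this
            omega
      have hDk : S (D (bv k)) = 0 := by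
        rcases k with _ | k
        · rw [D_bv_zero, map_zero]
        · rcases Nat.even_or_odd' k with ⟨q, rfl | rfl⟩
          · rw [D_bv_odd]; exact hlt _ (by omega)
          · rw [show 2 * q + 1 + 1 = 2 * (q + 1) by ring, D_bv_even, map_smul, hlt _ (by omega),
              smul_zero]
      refine eq_of_D_eq_zero ?_
      have := LinearMap.congr_fun hD (bv k)
      simpa [hDk] using this
    obtain ⟨a, ha⟩ := hconst
    refine ⟨a / c, ?_⟩
    rw [← sub_eq_zero]
    refine eq_zero_of_comm (κ := -1) (s := 3 - n) ?_ ?_ fun r hr => ?_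
    · rw [mul_sub, sub_mul, hD, mul_smul_comm, smul_mul_assoc, D_Dp]; module
    · rw [mul_sub, sub_mul, hN, mul_smul_comm, smul_mul_assoc, Nop_Dp]; module
    · have hrk : r = k := by
        have : (r : ℤ) + (3 - n) = 0 := by exact_mod_cast hr
        omega
      have e0 : eps (bv 0) = bv 0 := eps_bv_even 0
      have hD' : Dp n (bv k) = c • bv 0 := by
        rw [Dp, if_neg h, hk, show ((k : ℤ) + 3 - 3).toNat = k by omega, Module.End.mul_apply, e,
          map_smul, e0]
      rw [hrk, LinearMap.sub_apply, LinearMap.smul_apply, ha, hD', smul_smul,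
        div_mul_cancel₀ _ hc, sub_self]

/-! ## Relative cochains with values in operators between densities -/

/-- Even `𝔰`-relative 1-cochains with values in `Hom(𝔽(l), 𝔽(μ)^{nΠ})`. -/
structure IsRelCochain (l μ : ℂ) (n : ℤ) (φ : SFun →ₗ[ℂ] Module.End ℂ SFun) : Prop where
  parity : ∀ F v, sgnZ n • parity (φ F v) = φ (parity F) (parity v)
  conformal : ∀ F ∈ conformal, φ F = 0
  equivariant : ∀ (i j : ZMod 2) (F G : SFun), Homog i F → Homog j G → F ∈ SuperK.conformal →
    densityOp μ F * φ G - sgn (i * j) • (φ G * densityOp l F) = φ (cbracket F G)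

lemma isEvenRelCochain_iff {l μ : ℂ} {n : ℤ} {φ : SFun →ₗ[ℂ] Module.End ℂ SFun} :
    IsEvenRelCochain (density l) (dens μ n) φ ↔ IsRelCochain l μ n φ := by
  unfold IsEvenRelCochain homAct
  rw [dens_act]
  constructor
  · rintro ⟨h1, h2, h3⟩
    exact ⟨fun F v => by rw [← dens_par μ n]; exact h1 F v, h2, h3⟩
  · rintro ⟨h1, h2, h3⟩
    exact ⟨fun F v => by rw [dens_par μ n]; exact h1 F v, h2, h3⟩

lemma bv_mem_conformal {k : ℕ} (h : k < 5) : bv k ∈ conformal := by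
  unfold conformal
  interval_cases k
  · rw [bv_zero]; exact Submodule.subset_span (by simp)
  · rw [bv_one]; exact Submodule.subset_span (by simp)
  · rw [bv_two]; exact Submodule.subset_span (by simp)
  · rw [bv_three]; exact Submodule.subset_span (by simp)
  · rw [bv_four]; exact Submodule.subset_span (by simp)

lemma conformal_le {p : Submodule ℂ SFun} (h : ∀ k < 5, bv k ∈ p) : conformal ≤ p := by
  refine Submodule.span_le.2 ?_
  rintro F (rfl | rfl | rfl | rfl | rfl)
  · exact bv_zero ▸ h 0 (by norm_num)
  · exact bv_two ▸ h 2 (by norm_num)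
  · exact bv_four ▸ h 4 (by norm_num)
  · exact bv_one ▸ h 1 (by norm_num)
  · exact bv_three ▸ h 3 (by norm_num)

/-- The conformal subalgebra is generated by `𝕏(ξ)` and `𝕏(ξ x)`. -/
lemma conformal_le_of_generators {p : Submodule ℂ SFun} (h1 : bv 1 ∈ p) (h3 : bv 3 ∈ p)
    (hb : ∀ (i j : ZMod 2) (F G : SFun), Homog i F → Homog j G → F ∈ p → G ∈ p →
      cbracket F G ∈ p) : conformal ≤ p := by
  have br : ∀ i j, bv i ∈ p → bv j ∈ p → cbracket (bv i) (bv j) ∈ p := fun i j hi hj =>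
    hb _ _ _ _ (homog_bv i) (homog_bv j) hi hj
  have sm : ∀ (c : ℂ) F, c ≠ 0 → c • F ∈ p → F ∈ p := fun c F hc h => by
    simpa [smul_smul, inv_mul_cancel₀ hc] using p.smul_mem c⁻¹ h
  refine conformal_le fun k hk => ?_
  interval_cases k
  · exact sm (1 / 2) _ (by norm_num) (cbracket_bv1_bv1 ▸ br 1 1 h1 h1)
  · exact h1
  · exact sm (1 / 2) _ (by norm_num) (cbracket_bv1_bv3 ▸ br 1 3 h1 h3)
  · exact h3
  · exact sm (1 / 2) _ (by norm_num) (cbracket_bv3_bv3 ▸ br 3 3 h3 h3)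

lemma cbracket_bv1_bv5 : cbracket (bv 1) (bv 5) = (1 / 2 : ℂ) • bv 4 := cbracket_bv1_odd 2

lemma homog_one_bv1 : Homog 1 (bv 1) := bv_one ▸ homog_inr _
lemma homog_one_bv3 : Homog 1 (bv 3) := bv_three ▸ homog_inr _
lemma homog_one_bv5 : Homog 1 (bv 5) := bv_five ▸ homog_inr _
lemma homog_zero_bv2 : Homog 0 (bv 2) := bv_two ▸ homog_inl _

lemma sgn_one_mul_one : sgn (1 * 1) = -1 := by rw [mul_one, sgn_one]

/-- The value of an `𝔰`-relative cochain on `𝕏(ξ x²)` is a multiple of `ε D^{n-3}`. -/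
lemma IsRelCochain.exists_eq_smul_Dp {l : ℂ} {n : ℤ} {φ : SFun →ₗ[ℂ] Module.End ℂ SFun}
    (h : IsRelCochain l (l + n / 2) n φ) : ∃ c : ℂ, φ (bv 5) = c • Dp n := by
  refine SuperK.exists_eq_smul_Dp n ?_ ?_
  · have := h.equivariant 1 1 (bv 1) (bv 5) homog_one_bv1 homog_one_bv5 (bv_mem_conformal (by norm_num))
    rw [cbracket_bv1_bv5, map_smul, h.conformal _ (bv_mem_conformal (by norm_num : 4 < 5)), smul_zero,
      sgn_one_mul_one, densityOp_bv1, densityOp_bv1, smul_mul_assoc, mul_smul_comm] at this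
    linear_combination (norm := module) (2 : ℂ) • this
  · have := h.equivariant 0 1 (bv 2) (bv 5) homog_zero_bv2 homog_one_bv5 (bv_mem_conformal (by norm_num))
    rw [cbracket_bv2, map_smul, zero_mul, sgn_zero, one_smul, densityOp_bv2, densityOp_bv2,
      add_mul, mul_add, smul_mul_assoc, mul_smul_comm, one_mul, mul_one, sub_eq_iff_eq_add] at this
    rw [eq_sub_of_add_eq this]
    push_cast
    module

/-- Two `𝔰`-relative cochains with the same value on `𝕏(ξ x²)` are equal. -/
lemma IsRelCochain.ext {l μ : ℂ} {n n' : ℤ} {φ ψ : SFun →ₗ[ℂ] Module.End ℂ SFun}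
    (h : IsRelCochain l μ n φ) (h' : IsRelCochain l μ n' ψ) (e : φ (bv 5) = ψ (bv 5)) : φ = ψ := by
  have st : ∀ (j : ZMod 2) (G : SFun) , Homog j G → φ G = ψ G →
      φ (cbracket (bv 3) G) = ψ (cbracket (bv 3) G) := fun j G hG hh => by
    rw [← h.equivariant 1 j _ _ homog_one_bv3 hG (bv_mem_conformal (by norm_num)), ←
      h'.equivariant 1 j _ _ homog_one_bv3 hG (bv_mem_conformal (by norm_num)), hh]
  have sm : ∀ (c : ℂ) F, c ≠ 0 → φ (c • F) = ψ (c • F) → φ F = ψ F := fun c F hc hh => by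
    rw [map_smul, map_smul] at hh
    exact smul_right_injective _ hc hh
  have key : ∀ k, φ (bv (2 * (k + 2) + 1)) = ψ (bv (2 * (k + 2) + 1)) ∧
      φ (bv (2 * (k + 3))) = ψ (bv (2 * (k + 3))) := by
    intro k
    have ev : ∀ k, φ (bv (2 * (k + 2) + 1)) = ψ (bv (2 * (k + 2) + 1)) →
      φ (bv (2 * (k + 3))) = ψ (bv (2 * (k + 3))) := fun k hk =>
        sm (1 / 2) _ (by norm_num) (cbracket_bv3_odd (k + 2) ▸ st _ _ (homog_bv _) hk)
    induction k with
    | zero => exact ⟨e, ev 0 e⟩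
    | succ k ih =>
      have : φ (bv (2 * (k + 3) + 1)) = ψ (bv (2 * (k + 3) + 1)) := by
        refine sm _ _ ?_ (cbracket_bv3_even (k + 3) ▸ st _ _ (homog_bv _) ih.2)
        push_cast
        have : (k : ℂ) + 1 ≠ 0 := by exact_mod_cast Nat.succ_ne_zero k
        intro h; apply this; linear_combination 2 * h
      exact ⟨this, ev (k + 1) this⟩
  refine lin_ext fun k => ?_
  by_cases hk : k < 5
  · rw [h.conformal _ (bv_mem_conformal hk), h'.conformal _ (bv_mem_conformal hk)]
  · rcases Nat.even_or_odd' k with ⟨q, rfl | rfl⟩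
    · obtain ⟨q, rfl⟩ : ∃ r, q = r + 3 := ⟨q - 3, by omega⟩
      exact (key q).2
    · obtain ⟨q, rfl⟩ : ∃ r, q = r + 2 := ⟨q - 2, by omega⟩
      exact (key q).1

lemma IsRelCochain.smul {l μ : ℂ} {n : ℤ} {φ : SFun →ₗ[ℂ] Module.End ℂ SFun}
    (h : IsRelCochain l μ n φ) (c : ℂ) : IsRelCochain l μ n (c • φ) := by
  refine ⟨fun F v => ?_, fun F hF => ?_, fun i j F G hF hG hFc => ?_⟩
  · simp only [LinearMap.smul_apply, map_smul]; rw [smul_comm, h.parity]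
  · rw [LinearMap.smul_apply, h.conformal F hF, smul_zero]
  · rw [LinearMap.smul_apply, LinearMap.smul_apply, ← h.equivariant i j F G hF hG hFc]
    simp only [mul_smul_comm, smul_mul_assoc, smul_sub, smul_comm c]

/-! ## Triangular models -/

namespace KRep

variable {m : ℕ}

/-- The matrix entries of a representation on a direct sum of copies of `ℂ[x, ξ]`. -/
def entry (σ : KRep (Fin m → SFun)) (i j : Fin m) : SFun →ₗ[ℂ] Module.End ℂ SFun where
  toFun F := LinearMap.proj i ∘ₗ σ.act F ∘ₗ LinearMap.single ℂ (fun _ => SFun) j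
  map_add' F G := by ext1 v; simp
  map_smul' c F := by ext1 v; simp

lemma entry_apply (σ : KRep (Fin m → SFun)) (i j : Fin m) (F v : SFun) :
    σ.entry i j F v = σ.act F (Pi.single j v) i := rfl

lemma act_eq_sum_entry (σ : KRep (Fin m → SFun)) (F : SFun) (u : Fin m → SFun) (i : Fin m) :
    σ.act F u i = ∑ j, σ.entry i j F (u j) := by
  conv_lhs => rw [← Finset.univ_sum_single u, map_sum, Finset.sum_apply]
  rfl

lemma entry_bracket (σ : KRep (Fin m → SFun)) (i k : Fin m) {a b : ZMod 2} {F G : SFun}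
    (hF : Homog a F) (hG : Homog b G) : σ.entry i k (cbracket F G) =
      (∑ j, σ.entry i j F * σ.entry j k G) -
        sgn (a * b) • ∑ j, σ.entry i j G * σ.entry j k F := by
  refine LinearMap.ext fun v => ?_
  rw [entry_apply, σ.act_bracket a b F G hF hG]
  simp only [LinearMap.sub_apply, LinearMap.smul_apply, Module.End.mul_apply, Pi.sub_apply,
    Pi.smul_apply, act_eq_sum_entry σ F (σ.act G (Pi.single k v)),
    act_eq_sum_entry σ G (σ.act F (Pi.single k v)), LinearMap.sum_apply, entry_apply]

/-- Representations on `⊕ᵢ 𝔽(l + Nᵢ/2)^{NᵢΠ}` which are diagonal on the conformal subalgebra and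
triangular on `𝕏(ξ x²)`. -/
structure IsTri (σ : KRep (Fin m → SFun)) (l : ℂ) (N : Fin m → ℤ) (b : Fin m → Fin m → ℂ) :
    Prop where
  par : ∀ u i, σ.par u i = sgnZ (N i) • parity (u i)
  act1 : ∀ u i, σ.act (bv 1) u i = (1 / 2 : ℂ) • D (u i)
  act3 : ∀ u i, σ.act (bv 3) u i = (1 / 2 : ℂ) • Eo (l + N i / 2) (u i)
  act5 : ∀ u i, σ.act (bv 5) u i = (1 / 2 : ℂ) • (Fo (l + N i / 2) (u i) +
    ∑ j, if j < i then b i j • Dp (N i - N j) (u j) else 0)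

namespace IsTri

variable {σ : KRep (Fin m → SFun)} {l : ℂ} {N : Fin m → ℤ} {b : Fin m → Fin m → ℂ}

lemma entry_bv5 (h : σ.IsTri l N b) {i j : Fin m} (hij : j < i) :
    σ.entry i j (bv 5) = (b i j / 2) • Dp (N i - N j) := by
  refine LinearMap.ext fun v => ?_
  rw [entry_apply, h.act5, Finset.sum_eq_single j]
  · rw [Pi.single_eq_of_ne hij.ne', map_zero, zero_add, if_pos hij, Pi.single_eq_same, smul_smul,
      LinearMap.smul_apply]
    congr 1; ring
  · intro k _ hk
    rw [Pi.single_eq_of_ne hk, map_zero, smul_zero, ite_self]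
  · simp

lemma entry_of_le (h : σ.IsTri l N b) (F : SFun) : (∀ i j, i < j → σ.entry i j F = 0) ∧
    ∀ i, σ.entry i i F = densityOp (l + N i / 2) F := by
  let p : Submodule ℂ SFun :=
    { carrier := {F | (∀ i j, i < j → σ.entry i j F = 0) ∧
        ∀ i, σ.entry i i F = densityOp (l + N i / 2) F}
      zero_mem' := by simp
      add_mem' := fun {F G} hF hG => ⟨fun i j hij => by
        rw [map_add, hF.1 i j hij, hG.1 i j hij, add_zero], fun i => by
        rw [map_add, map_add, hF.2, hG.2]⟩
      smul_mem' := fun c F hF => ⟨fun i j hij => by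
        rw [map_smul, hF.1 i j hij, smul_zero], fun i => by
        rw [map_smul, map_smul, hF.2]⟩ }
  have hp : p = ⊤ := by
    refine eq_top_of_generators p ?_ ?_ ?_ ?_
    · refine ⟨fun i j hij => LinearMap.ext fun v => ?_, fun i => LinearMap.ext fun v => ?_⟩
      · rw [entry_apply, h.act1, Pi.single_eq_of_ne hij.ne, map_zero, smul_zero]; rfl
      · rw [entry_apply, h.act1, Pi.single_eq_same, densityOp_bv1]; rfl
    · refine ⟨fun i j hij => LinearMap.ext fun v => ?_, fun i => LinearMap.ext fun v => ?_⟩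
      · rw [entry_apply, h.act3, Pi.single_eq_of_ne hij.ne, map_zero, smul_zero]; rfl
      · rw [entry_apply, h.act3, Pi.single_eq_same, densityOp_bv3]; rfl
    · refine ⟨fun i j hij => LinearMap.ext fun v => ?_, fun i => LinearMap.ext fun v => ?_⟩
      · rw [entry_apply, h.act5, Pi.single_eq_of_ne hij.ne, map_zero, zero_add,
          Finset.sum_eq_zero, smul_zero]; · rfl
        intro k _
        split_ifs with hk
        · rw [Pi.single_eq_of_ne (hk.trans hij).ne, map_zero, smul_zero]
        · rfl
      · rw [entry_apply, h.act5, Pi.single_eq_same, Finset.sum_eq_zero, add_zero, densityOp_bv5]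
        · rfl
        intro k _
        split_ifs with hk
        · rw [Pi.single_eq_of_ne hk.ne, map_zero, smul_zero]
        · rfl
    · intro a c F G hF hG hF' hG'
      have z : ∀ i j k, i < k ∨ (i = k ∧ j ≠ i) →
          σ.entry i j F * σ.entry j k G = 0 ∧ σ.entry i j G * σ.entry j k F = 0 := by
        intro i j k hik
        rcases lt_or_ge i j with hj | hj
        · rw [hF'.1 i j hj, hG'.1 i j hj]; simp
        · have : j < k := by
            rcases hik with hik | ⟨rfl, hne⟩
            · exact hj.trans_lt hik
            · exact lt_of_le_of_ne hj hne
          rw [hF'.1 j k this, hG'.1 j k this]; simp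
      refine ⟨fun i k hik => ?_, fun i => ?_⟩
      · rw [entry_bracket σ i k hF hG, Finset.sum_eq_zero fun j _ => (z i j k (Or.inl hik)).1,
          Finset.sum_eq_zero fun j _ => (z i j k (Or.inl hik)).2, smul_zero, sub_zero]
      · rw [entry_bracket σ i i hF hG,
          Finset.sum_eq_single i (fun j _ hj => (z i j i (Or.inr ⟨rfl, hj⟩)).1) (by simp),
          Finset.sum_eq_single i (fun j _ hj => (z i j i (Or.inr ⟨rfl, hj⟩)).2) (by simp), hF'.2,
          hG'.2, densityOp_bracket _ a c F G hF hG]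
  exact (hp ▸ Submodule.mem_top : F ∈ p)

lemma entry_of_lt (h : σ.IsTri l N b) (F : SFun) {i j : Fin m} (hij : i < j) :
    σ.entry i j F = 0 := (h.entry_of_le F).1 i j hij

lemma entry_self (h : σ.IsTri l N b) (F : SFun) (i : Fin m) :
    σ.entry i i F = densityOp (l + N i / 2) F := (h.entry_of_le F).2 i

/-- The conformal subalgebra acts diagonally. -/
lemma act_conformal (h : σ.IsTri l N b) {F : SFun} (hF : F ∈ conformal) (u : Fin m → SFun)
    (i : Fin m) : σ.act F u i = densityOp (l + N i / 2) F (u i) := by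
  let p : Submodule ℂ SFun :=
    { carrier := {F | ∀ u i, σ.act F u i = densityOp (l + N i / 2) F (u i)}
      zero_mem' := by simp
      add_mem' := fun {F G} hF hG u i => by
        rw [map_add, LinearMap.add_apply, Pi.add_apply, hF u i, hG u i, map_add,
          LinearMap.add_apply]
      smul_mem' := fun c F hF u i => by
        rw [map_smul, LinearMap.smul_apply, Pi.smul_apply, hF u i, map_smul,
          LinearMap.smul_apply] }
  refine (conformal_le_of_generators (p := p) ?_ ?_ ?_ : conformal ≤ p) hF u i
  · intro u i; rw [h.act1, densityOp_bv1]; rfl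
  · intro u i; rw [h.act3, densityOp_bv3]; rfl
  · intro a c F G hF hG hF' hG' u i
    rw [σ.act_bracket a c F G hF hG, densityOp_bracket _ a c F G hF hG]
    simp only [LinearMap.sub_apply, LinearMap.smul_apply, Module.End.mul_apply, Pi.sub_apply,
      Pi.smul_apply]
    rw [hF' _ i, hG' u i, hG' _ i, hF' u i]

lemma entry_conformal (h : σ.IsTri l N b) {F : SFun} (hF : F ∈ conformal) {i j : Fin m}
    (hij : i ≠ j) : σ.entry i j F = 0 := by
  refine LinearMap.ext fun v => ?_
  rw [entry_apply, h.act_conformal hF, Pi.single_eq_of_ne hij, map_zero]; rfl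

lemma isRelCochain_entry (h : σ.IsTri l N b) {i j : Fin m} (hij : j < i) :
    IsRelCochain (l + N j / 2) (l + N i / 2) (N i - N j) (σ.entry i j) := by
  refine ⟨fun F v => ?_, fun F hF => h.entry_conformal hF hij.ne', fun a c F G hF hG hFc => ?_⟩
  · have e := congrFun (σ.par_act F (Pi.single j v)) i
    have e2 : σ.par (Pi.single j v) = Pi.single j (sgnZ (N j) • SuperK.parity v) := by
      funext k
      rw [h.par]
      by_cases hk : k = j
      · subst hk; simp
      · simp [Pi.single_eq_of_ne hk]
    rw [h.par, e2, ← entry_apply, ← entry_apply, map_smul] at e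
    have e3 : sgnZ (N i) = sgnZ (N i - N j) * sgnZ (N j) := by rw [← sgnZ_add]; congr 1; ring
    rw [e3] at e
    have := congrArg (sgnZ (N j) • ·) e
    simp only [smul_smul, sgnZ_mul_self, one_smul] at this
    rw [← this]; congr 1
    rw [mul_comm (sgnZ (N i - N j)), ← mul_assoc, sgnZ_mul_self, one_mul]
  · rw [entry_bracket σ i j hF hG, Finset.sum_eq_single i, Finset.sum_eq_single j, h.entry_self,
      h.entry_self]
    · intro k _ hk; rw [h.entry_conformal hFc hk, mul_zero]
    · simp
    · intro k _ hk; rw [h.entry_conformal hFc hk.symm, zero_mul]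
    · simp

lemma isSplitExtension (h : σ.IsTri l N b) :
    σ.IsSplitExtension fun r => dens (l + N r / 2) (N r) := by
  let Fl : Fin (m + 1) → Submodule ℂ (Fin m → SFun) := fun r =>
    { carrier := {u | ∀ j : Fin m, j.castSucc < r → u j = 0}
      zero_mem' := fun j _ => rfl
      add_mem' := fun {u v} hu hv j hj => by rw [Pi.add_apply, hu j hj, hv j hj, add_zero]
      smul_mem' := fun c u hu j hj => by rw [Pi.smul_apply, hu j hj, smul_zero] }
  have inv : ∀ r, σ.IsInvariant (Fl r) := by
    refine fun r => ⟨fun u hu j hj => ?_, fun F u hu i hi => ?_⟩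
    · rw [h.par, hu j hj, map_zero, smul_zero]
    · rw [act_eq_sum_entry]
      refine Finset.sum_eq_zero fun j _ => ?_
      rcases lt_or_ge i j with hj | hj
      · rw [h.entry_of_lt F hj]; rfl
      · rw [hu j (lt_of_le_of_lt (Fin.castSucc_le_castSucc_iff.2 hj) hi), map_zero]
  have hlast : Fl (Fin.last m) = ⊥ := by
    refine eq_bot_iff.2 fun u hu => ?_
    rw [Submodule.mem_bot]
    exact funext fun j => hu j (Fin.castSucc_lt_last j)
  have hle : ∀ r : Fin m, Fl r.succ ≤ Fl r.castSucc := fun r u hu j hj =>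
    hu j (hj.trans (Fin.castSucc_lt_succ))
  refine ⟨Fl, ?_, hlast, fun r => ⟨hle r, inv _, LinearMap.proj r ∘ₗ (Fl r.castSucc).subtype,
    LinearMap.codRestrict _ (LinearMap.single ℂ (fun _ => SFun) r) ?_, ?_, ?_, ?_, ?_, ?_⟩⟩
  · exact eq_top_iff.2 fun u _ j hj => absurd hj (Fin.not_lt_zero _)
  · intro v j hj
    change (Pi.single r v : Fin m → SFun) j = 0
    exact Pi.single_eq_of_ne (Fin.castSucc_lt_castSucc_iff.1 hj).ne _
  · refine isIntertwiner_zero_iff.2 ⟨fun u => ?_, fun F u => ?_⟩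
    · rw [dens_par]; exact (h.par u.1 r).symm
    · rw [dens_act]
      change densityOp _ F (u.1 r) = σ.act F u.1 r
      rw [act_eq_sum_entry, Finset.sum_eq_single r, h.entry_self]
      · intro j _ hj
        rcases lt_or_gt_of_ne hj with hj | hj
        · rw [u.2 j (Fin.castSucc_lt_castSucc_iff.2 hj), map_zero]
        · rw [h.entry_of_lt F hj]; rfl
      · simp
  · ext u
    rw [LinearMap.mem_ker, Submodule.mem_comap]
    constructor
    · intro hu j hj
      rcases (Fin.castSucc_lt_succ_iff.1 hj).lt_or_eq with hj | rfl
      · exact u.2 j (Fin.castSucc_lt_castSucc_iff.2 hj)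
      · exact hu
    · exact fun hu => hu r (Fin.castSucc_lt_succ)
  · intro v
    change (Pi.single r v : Fin m → SFun) r = v
    exact Pi.single_eq_same _ _
  · intro v
    refine Subtype.ext (funext fun j => ?_)
    change σ.par (Pi.single r v) j = (Pi.single r ((dens _ _).par v) : Fin m → SFun) j
    rw [h.par, dens_par]
    by_cases hj : j = r
    · subst hj; simp
    · simp [Pi.single_eq_of_ne hj]
  · intro F hF v
    refine Subtype.ext (funext fun j => ?_)
    change σ.act F (Pi.single r v) j = (Pi.single r ((dens _ _).act F v) : Fin m → SFun) j
    rw [h.act_conformal hF, dens_act]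
    by_cases hj : j = r
    · subst hj; simp
    · simp [Pi.single_eq_of_ne hj]

end IsTri

/-- Every split extension of densities is equivalent to a triangular model. -/
theorem IsSplitExtension.exists_isTri {W : Type*} [AddCommGroup W] [Module ℂ W] {ρ : KRep W}
    {l : ℂ} {N : Fin m → ℤ} (h : ρ.IsSplitExtension fun r => dens (l + N r / 2) (N r)) :
    ∃ (σ : KRep (Fin m → SFun)) (b : Fin m → Fin m → ℂ), σ.IsTri l N b ∧ ρ.Equiv σ := by
  obtain ⟨Fl, h0, hl, h⟩ := h
  choose hle inv π s hπ hker hs hpar hact using h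
  have hanti : Antitone Fl := Fin.antitone_iff_succ_le.2 hle
  let e : (Fin m → SFun) →ₗ[ℂ] W :=
    ∑ r, (Fl r.castSucc).subtype ∘ₗ s r ∘ₗ LinearMap.proj r
  have he : ∀ u, e u = ∑ r, (s r (u r) : W) := fun u => by simp [e]
  have hmem : ∀ (i : Fin m) (u : Fin m → SFun), (∀ j, j < i → u j = 0) →
      ∃ hm : e u ∈ Fl i.castSucc, π i ⟨e u, hm⟩ = u i := by
    intro i u hu
    have hin : ∀ r, (s r (u r) : W) ∈ Fl i.castSucc := by
      intro r
      rcases lt_or_ge r i with hr | hr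
      · rw [hu r hr, map_zero]; exact zero_mem _
      · exact hanti (Fin.castSucc_le_castSucc_iff.2 hr) (s r (u r)).2
    have e1 : e u = ((∑ r, ⟨s r (u r), hin r⟩ : Fl i.castSucc) : W) := by
      rw [he, AddSubmonoidClass.coe_finsetSum]
    refine ⟨by rw [e1]; exact Subtype.prop _, ?_⟩
    have e2 : (⟨e u, by rw [e1]; exact Subtype.prop _⟩ : Fl i.castSucc) =
      ∑ r, ⟨s r (u r), hin r⟩ := Subtype.ext e1
    rw [e2, map_sum, Finset.sum_eq_single i]
    · exact hs i (u i)
    · intro r _ hr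
      rw [← LinearMap.mem_ker, hker, Submodule.mem_comap]
      change (s r (u r) : W) ∈ Fl i.succ
      rcases lt_or_gt_of_ne hr with hr | hr
      · rw [hu r hr, map_zero]; exact zero_mem _
      · refine hanti ?_ (s r (u r)).2
        exact Fin.succ_le_castSucc_iff.2 hr
    · simp
  have hinj : Function.Injective e := by
    rw [← LinearMap.ker_eq_bot, eq_bot_iff]
    intro u hu
    rw [LinearMap.mem_ker] at hu
    rw [Submodule.mem_bot]
    have : ∀ k, ∀ i : Fin m, i.val = k → u i = 0 := by
      intro k
      induction k using Nat.strong_induction_on with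
      | _ k ih =>
        intro i hi
        obtain ⟨hm, hp⟩ := hmem i u fun j hj => ih j.val (hi ▸ hj) j rfl
        rw [← hp]
        have : (⟨e u, hm⟩ : Fl i.castSucc) = 0 := Subtype.ext hu
        rw [this, map_zero]
    exact funext fun i => this _ i rfl
  have hsurj' : ∀ r : Fin (m + 1), ∀ w ∈ Fl r, ∃ u, (∀ j : Fin m, j.castSucc < r → u j = 0) ∧
      e u = w := by
    intro r
    induction r using Fin.reverseInduction with
    | last => intro w hw
              rw [hl, Submodule.mem_bot] at hw
              exact ⟨0, fun _ _ => rfl, by rw [hw, map_zero]⟩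
    | cast i ih =>
      intro w hw
      have h1 : (⟨w, hw⟩ : Fl i.castSucc) - s i (π i ⟨w, hw⟩) ∈ LinearMap.ker (π i) := by
        rw [LinearMap.mem_ker, map_sub, hs, sub_self]
      rw [hker, Submodule.mem_comap] at h1
      obtain ⟨u, hu, e1⟩ := ih _ h1
      refine ⟨u + Pi.single i (π i ⟨w, hw⟩), fun j hj => ?_, ?_⟩
      · rw [Pi.add_apply, hu j (hj.trans Fin.castSucc_lt_succ),
          Pi.single_eq_of_ne (Fin.castSucc_lt_castSucc_iff.1 hj).ne, add_zero]
      · rw [map_add, e1, he, Finset.sum_eq_single i]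
        · simp
        · intro j _ hj; rw [Pi.single_eq_of_ne hj, map_zero]; rfl
        · simp
  have hsurj : Function.Surjective e := fun w => by
    obtain ⟨u, -, hu⟩ := hsurj' 0 w (h0 ▸ Submodule.mem_top)
    exact ⟨u, hu⟩
  let E := LinearEquiv.ofBijective e ⟨hinj, hsurj⟩
  have hk : ρ.IsInvariant (LinearMap.ker E.symm.toLinearMap) := by
    rw [LinearMap.ker_eq_bot.2 E.symm.injective]; exact isInvariant_bot ρ
  let σ := ρ.ofSurjective E.symm.toLinearMap E.symm.surjective hk
  have hσ := isIntertwiner_zero_iff.1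
    (ofSurjective_isIntertwiner ρ E.symm.toLinearMap E.symm.surjective hk)
  have sEq : ∀ u, E.symm (e u) = u := fun u => E.symm_apply_apply u
  have eEq : ∀ w, e (E.symm w) = w := fun w => E.apply_symm_apply w
  have hσp : ∀ u, e (σ.par u) = ρ.par (e u) := fun u => by
    have := hσ.1 (e u)
    simp only [LinearEquiv.coe_coe, sEq] at this
    rw [this, eEq]
  have hσa : ∀ F u, e (σ.act F u) = ρ.act F (e u) := fun F u => by
    have := hσ.2 F (e u)
    simp only [LinearEquiv.coe_coe, sEq] at this
    rw [this, eEq]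
  have par : ∀ u i, σ.par u i = sgnZ (N i) • parity (u i) := by
    intro u i
    have : σ.par u = fun i => sgnZ (N i) • parity (u i) := by
      apply hinj
      rw [hσp, he, he, map_sum]
      refine Finset.sum_congr rfl fun r _ => ?_
      rw [← dens_par (l + N r / 2) (N r), ← hpar]; rfl
    rw [this]
  have conf : ∀ F ∈ conformal, ∀ u i, σ.act F u i = densityOp (l + N i / 2) F (u i) := by
    intro F hF u i
    have : σ.act F u = fun i => densityOp (l + N i / 2) F (u i) := by
      apply hinj
      rw [hσa, he, he, map_sum]
      refine Finset.sum_congr rfl fun r _ => ?_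
      rw [← dens_act (l + N r / 2) (N r), ← hact r F hF]; rfl
    rw [this]
  have tri : ∀ F (j : Fin m) v, (∀ i, i < j → σ.entry i j F v = 0) ∧
      σ.entry j j F v = densityOp (l + N j / 2) F v := by
    intro F j v
    have e0 : e (Pi.single j v) = s j v := by
      rw [he, Finset.sum_eq_single j]
      · simp
      · intro k _ hk; rw [Pi.single_eq_of_ne hk, map_zero]; rfl
      · simp
    have e1 : ρ.act F (s j v) ∈ Fl j.castSucc := (inv j).2 F _ (s j v).2
    obtain ⟨u, hu, e2⟩ := hsurj' _ _ e1
    have e3 : σ.act F (Pi.single j v) = u := hinj (by rw [hσa, e0, e2])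
    have hz : ∀ i, i < j → u i = 0 := fun i hi => hu i (Fin.castSucc_lt_castSucc_iff.2 hi)
    refine ⟨fun i hi => ?_, ?_⟩
    · rw [entry_apply, e3, hz i hi]
    · rw [entry_apply, e3]
      obtain ⟨hm, hp⟩ := hmem j u hz
      rw [← hp]
      have e4 : (⟨e u, hm⟩ : Fl j.castSucc) = (ρ.sub _ (inv j)).act F (s j v) := Subtype.ext e2
      rw [e4, ← (isIntertwiner_zero_iff.1 (hπ j)).2, hs, dens_act]
  have off : ∀ i j, j < i → ∃ c : ℂ, σ.entry i j (bv 5) = c • Dp (N i - N j) := by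
    intro i j hij
    have hd : ∀ F ∈ conformal, ∀ i j : Fin m, i ≠ j → σ.entry i j F = 0 := by
      intro F hF i j hij
      refine LinearMap.ext fun v => ?_
      rw [entry_apply, conf F hF, Pi.single_eq_of_ne hij, map_zero]; rfl
    have hs' : ∀ F i, σ.entry i i F = densityOp (l + N i / 2) F := fun F i =>
      LinearMap.ext fun v => (tri F i v).2
    have br : ∀ (a : ZMod 2) (F : SFun), Homog a F → F ∈ conformal →
        σ.entry i j (cbracket F (bv 5)) = densityOp (l + N i / 2) F * σ.entry i j (bv 5) -
          sgn (a * 1) • (σ.entry i j (bv 5) * densityOp (l + N j / 2) F) := by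
      intro a F hF hFc
      rw [entry_bracket σ i j hF homog_one_bv5, Finset.sum_eq_single i, Finset.sum_eq_single j,
        hs', hs']
      · intro k _ hk; rw [hd F hFc k j hk, mul_zero]
      · simp
      · intro k _ hk; rw [hd F hFc i k hk.symm, zero_mul]
      · simp
    refine SuperK.exists_eq_smul_Dp _ ?_ ?_
    · have := br 1 (bv 1) homog_one_bv1 (bv_mem_conformal (by norm_num))
      rw [cbracket_bv1_bv5, map_smul, hd _ (bv_mem_conformal (by norm_num : 4 < 5)) i j hij.ne',
        smul_zero, sgn_one_mul_one, densityOp_bv1, densityOp_bv1, smul_mul_assoc, mul_smul_comm] at this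
      linear_combination (norm := module) (-2 : ℂ) • this
    · have := br 0 (bv 2) homog_zero_bv2 (bv_mem_conformal (by norm_num))
      rw [cbracket_bv2, map_smul, zero_mul, sgn_zero, one_smul, densityOp_bv2, densityOp_bv2,
        add_mul, mul_add, smul_mul_assoc, mul_smul_comm, one_mul, mul_one, eq_sub_iff_add_eq] at this
      rw [eq_sub_of_add_eq this.symm]
      push_cast
      module
  choose! c hc using off
  refine ⟨σ, fun i j => 2 * c i j, ⟨par, ?_, ?_, ?_⟩, E.symm.toLinearMap, E.symm.bijective,
    ofSurjective_isIntertwiner ρ E.symm.toLinearMap E.symm.surjective hk⟩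
  · intro u i; rw [conf _ (bv_mem_conformal (by norm_num)), densityOp_bv1]; rfl
  · intro u i; rw [conf _ (bv_mem_conformal (by norm_num)), densityOp_bv3]; rfl
  · intro u i
    rw [act_eq_sum_entry, smul_add, Finset.smul_sum]
    have e1 : (1 / 2 : ℂ) • Fo (l + N i / 2) (u i) =
        ∑ j, if j = i then (1 / 2 : ℂ) • Fo (l + N i / 2) (u i) else 0 := by simp
    rw [e1, ← Finset.sum_add_distrib]
    refine Finset.sum_congr rfl fun j _ => ?_
    rcases lt_trichotomy j i with hj | rfl | hj
    · rw [hc i j hj, if_neg hj.ne, if_pos hj, zero_add, smul_smul, LinearMap.smul_apply]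
      congr 1; ring
    · rw [(tri _ j _).2, if_pos rfl, if_neg (lt_irrefl _), smul_zero, add_zero, densityOp_bv5]; rfl
    · rw [(tri _ j _).1 i hj, if_neg hj.ne', if_neg hj.not_gt, smul_zero, add_zero]

end KRep

/-- The partial sums which index the composition data of an extension. -/
def partialSum (p : List ℤ) (r : Fin (p.length + 1)) : ℤ := (p.take r).sum

lemma existsUniserialExt_iff {l : ℂ} {p : List ℤ} : ExistsUniserialExt l p ↔
    ∃ (σ : KRep (Fin (p.length + 1) → SFun)) (b : Fin (p.length + 1) → Fin (p.length + 1) → ℂ),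
      σ.IsTri l (partialSum p) b ∧ σ.IsChain := by
  constructor
  · rintro ⟨W, _, _, ρ, h1, h2⟩
    obtain ⟨σ, b, hσ, he⟩ := KRep.IsSplitExtension.exists_isTri (N := partialSum p) h1
    exact ⟨σ, b, hσ, ((KRep.isUniserial_iff_isChain ρ).1 h2).equiv he⟩
  · rintro ⟨σ, b, h1, h2⟩
    exact ⟨_, _, _, σ, h1.isSplitExtension, (KRep.isUniserial_iff_isChain σ).2 h2⟩

/-! ## Commuting the generators with powers of `D` -/

/-- The coefficient in `E_{l+r/2} D^r = D^r E_l + al_r D^{r-1} ε`. -/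
def al (r : ℕ) (l : ℂ) : ℂ := if Even r then (r : ℂ) / 2 else -(2 * l + ((r : ℂ) - 1) / 2)

/-- The lowest coefficient in the commutation of `F` with `D^r`. -/
def ka (r : ℕ) (l : ℂ) : ℂ :=
  if Even r then -((r : ℂ) / 2 * ((r : ℂ) / 2 - 1))
  else ((r : ℂ) - 1) / 2 * (4 * l + 3 * (((r : ℂ) - 1) / 2) + 1)

lemma al_zero (l : ℂ) : al 0 l = 0 := by simp [al]
lemma al_one (l : ℂ) : al 1 l = -(2 * l) := by simp [al]
lemma al_two_mul (s : ℕ) (l : ℂ) : al (2 * s) l = s := by simp [al]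
lemma al_two_mul_add_one (s : ℕ) (l : ℂ) : al (2 * s + 1) l = -(2 * l + s) := by simp [al]
lemma ka_two_mul (s : ℕ) (l : ℂ) : ka (2 * s) l = -((s : ℂ) * (s - 1)) := by simp [ka]
lemma ka_two_mul_add_one (s : ℕ) (l : ℂ) : ka (2 * s + 1) l = s * (4 * l + 3 * s + 1) := by
  simp [ka]

lemma al_succ (r : ℕ) (l : ℂ) : al (r + 1) l = -(2 * l) - al r (l + 1 / 2) := by
  rcases Nat.even_or_odd' r with ⟨s, rfl | rfl⟩
  · rw [al_two_mul, al_two_mul_add_one]; ring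
  · rw [show 2 * s + 1 + 1 = 2 * (s + 1) by ring, al_two_mul, al_two_mul_add_one]; push_cast; ring

lemma al_add_two (r : ℕ) (l : ℂ) : al (r + 2) l = 1 + al r (l + 1) := by
  rw [al_succ, al_succ]; ring_nf

lemma ka_succ (r : ℕ) (l : ℂ) : ka (r + 1) l =
    -(2 * (al r (l + 1 / 2) * al (r - 1) (l + 1))) - ka r (l + 1 / 2) := by
  rcases Nat.even_or_odd' r with ⟨s, rfl | rfl⟩
  · rcases s with _ | s
    · simp [ka, al]
    · rw [show 2 * (s + 1) - 1 = 2 * s + 1 by omega, ka_two_mul_add_one, ka_two_mul, al_two_mul,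
        al_two_mul_add_one]; push_cast; ring
  · rw [show 2 * s + 1 + 1 = 2 * (s + 1) by ring, show 2 * s + 1 - 1 = 2 * s by omega, ka_two_mul,
      ka_two_mul_add_one, al_two_mul, al_two_mul_add_one]; push_cast; ring

lemma al_two (l : ℂ) : al 2 l = 1 := by simpa using al_two_mul 1 l
lemma al_three (l : ℂ) : al 3 l = -(2 * l + 1) := by simpa using al_two_mul_add_one 1 l
lemma ka_one (l : ℂ) : ka 1 l = 0 := by simp [ka]
lemma ka_two (l : ℂ) : ka 2 l = 0 := by simp [ka]

lemma eps_D_smul : eps * D = (-1 : ℂ) • (D * eps) := by rw [eps_D]; module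

lemma Eo_D (l : ℂ) : Eo (l + 1 / 2) * D = D * Eo l + (-(2 * l)) • eps := by
  have h := xim_D
  have h2 : eps = 1 - (2 : ℂ) • (xim * D) := by rw [h]; module
  simp only [Eo, add_mul, mul_add, smul_mul_assoc, mul_smul_comm, ← mul_assoc, D_xm, D_xim]
  rw [h2]; module

lemma Eo_D_pow (r : ℕ) (l : ℂ) :
    Eo (l + r / 2) * D ^ r = D ^ r * Eo l + al r l • (D ^ (r - 1) * eps) := by
  induction r generalizing l with
  | zero => simp [al_zero]
  | succ r ih =>
    have e : l + ((r + 1 : ℕ) : ℂ) / 2 = l + 1 / 2 + r / 2 := by push_cast; ring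
    rw [e, pow_succ, ← mul_assoc, ih, add_mul, mul_assoc, Eo_D, al_succ, smul_mul_assoc, mul_assoc,
      eps_D_smul, Nat.add_sub_cancel]
    rcases r with _ | r
    · simp only [al_zero, pow_zero, zero_smul, add_zero, one_mul]; module
    · rw [Nat.add_sub_cancel, mul_smul_comm, ← mul_assoc, ← pow_succ, mul_add, mul_assoc, mul_smul_comm]
      module

lemma xim_D' : xim * D = D * xim + (-1 : ℂ) • eps := by
  have h := xim_D
  have h2 : eps = 1 - (2 : ℂ) • (xim * D) := by rw [h]; module
  rw [D_xim, h2]; module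

lemma Fo_D (l : ℂ) : Fo (l + 1 / 2) * D = D * Fo l + (-(4 * l)) • (xm * eps) := by
  have h2 : eps = 1 - (2 : ℂ) • (xim * D) := by rw [xim_D]; module
  have e1 : D * (xm * xm * D) = xm * xm * D * D + (2 : ℂ) • (xm * (xim * D)) := by
    simp only [← mul_assoc, D_xm, add_mul]
    rw [mul_assoc xm D xm, D_xm, mul_add, mul_assoc xm xim, mul_assoc xim xm, ← mul_assoc xim xm,
      xim_xm]
    simp only [← mul_assoc, add_mul]; module
  have e2 : D * (xm * xim) = xm - xm * (xim * D) := by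
    rw [← mul_assoc, D_xm, add_mul, xim_xim, add_zero, mul_assoc, D_xim, mul_sub, mul_one]
  simp only [Fo, add_mul, mul_add, smul_mul_assoc, mul_smul_comm, e1, e2, mul_assoc xm xim]
  rw [h2, mul_sub, mul_one, mul_smul_comm]; module

lemma xm_eps_D : xm * eps * D = (-1 : ℂ) • (D * (xm * eps)) + xim := by
  rw [mul_assoc, eps_D_smul, mul_smul_comm, ← mul_assoc, ← mul_assoc, D_xm, add_mul, xim_eps]
  module

lemma Fo_D_pow (r : ℕ) (l : ℂ) : Fo (l + r / 2) * D ^ r = D ^ r * Fo l +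
    (2 * al r l) • (D ^ (r - 1) * (xm * eps)) +
    (2 * (al r l * al (r - 1) (l + 1 / 2))) • (D ^ (r - 2) * xim) +
    ka r l • (D ^ (r - 3) * eps) := by
  induction r generalizing l with
  | zero => simp [al_zero, ka]
  | succ r ih =>
    have e : l + ((r + 1 : ℕ) : ℂ) / 2 = l + 1 / 2 + r / 2 := by push_cast; ring
    have e' : l + 1 / 2 + 1 / 2 = l + 1 := by ring
    rw [e, pow_succ, ← mul_assoc, ih, e']
    simp only [add_mul, smul_mul_assoc, mul_assoc]
    rw [Fo_D, ← mul_assoc xm eps D, xm_eps_D, xim_D', eps_D_smul, ka_succ, Nat.add_sub_cancel]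
    rcases r with _ | _ | _ | r
    · simp only [Nat.reduceAdd, zero_add, Nat.reduceSub, al_zero, al_one, ka, pow_zero, pow_one,
        one_mul]
      simp; module
    · simp only [Nat.reduceAdd, zero_add, Nat.reduceSub, al_zero, al_one, al_two, ka_one, pow_zero,
        pow_one, one_mul, pow_two, mul_add, mul_smul_comm, ← mul_assoc]
      module
    · simp only [Nat.reduceAdd, zero_add, Nat.reduceSub, al_one, al_two, al_three, ka_two,
        pow_zero, pow_one, one_mul, pow_two, mul_add, mul_smul_comm, ← mul_assoc, pow_succ]
      module
    · have h3 : al (r + 3 + 1) l = 1 + al (r + 2) (l + 1) := al_add_two (r + 2) l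
      have h4 : al (r + 3 + 1) l = -(2 * l) - al (r + 3) (l + 1 / 2) := al_succ _ _
      simp only [show r + 1 + 1 + 1 = r + 3 by ring, show r + 3 - 1 = r + 2 by omega,
        show r + 3 - 2 = r + 1 by omega, show r + 3 - 3 = r by omega,
        show r + 3 + 1 - 2 = r + 2 by omega, show r + 3 + 1 - 3 = r + 1 by omega]
      have h5 : 2 * (al (r + 3 + 1) l * al (r + 3) (l + 1 / 2)) =
        2 * al (r + 3) (l + 1 / 2) +
          2 * (al (r + 3) (l + 1 / 2) * al (r + 2) (l + 1)) := by rw [h3]; ring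
      rw [h5, h4]
      simp only [mul_add, mul_smul_comm, ← mul_assoc, ← pow_succ]
      module

/-! ## Subspaces of density modules -/

lemma exists_D_pow_eq_zero (v : SFun) : ∃ k, (D ^ k) v = 0 := by
  have mono : ∀ v : SFun, ∀ k m, (D ^ k) v = 0 → (D ^ (m + k)) v = 0 := fun v k m h => by
    rw [pow_add, Module.End.mul_apply, h, map_zero]
  let p : Submodule ℂ SFun :=
    { carrier := {v | ∃ k, (D ^ k) v = 0}
      zero_mem' := ⟨0, map_zero _⟩
      add_mem' := fun {a b} ⟨k, hk⟩ ⟨m, hm⟩ => ⟨m + k, by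
        rw [map_add, mono a k m hk, add_comm m, mono b m k hm, add_zero]⟩
      smul_mem' := fun c a ⟨k, hk⟩ => ⟨k, by rw [map_smul, hk, smul_zero]⟩ }
  have : p = ⊤ := eq_top_of_bv p fun k => ⟨k + 1, D_pow_bv_lt (Nat.lt_succ_self k)⟩
  exact (this ▸ Submodule.mem_top : v ∈ p)

/-- A non-zero vector has a multiple of the constant `1` among its derivatives. -/
lemma exists_D_pow_eq {v : SFun} (hv : v ≠ 0) : ∃ k, ∃ c : ℂ, c ≠ 0 ∧ (D ^ k) v = c • bv 0 := by
  classical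
  have h := exists_D_pow_eq_zero v
  have h1 := Nat.find_spec h
  obtain ⟨k, hk⟩ : ∃ k, Nat.find h = k + 1 := by
    refine Nat.exists_eq_succ_of_ne_zero fun h0 => hv ?_
    rw [h0] at h1; simpa using h1
  have h2 : (D ^ k) v ≠ 0 := Nat.find_min h (by omega)
  rw [hk, pow_succ', Module.End.mul_apply] at h1
  obtain ⟨c, hc⟩ := eq_of_D_eq_zero h1
  exact ⟨k, c, fun h0 => h2 (by rw [hc, h0, zero_smul]), hc⟩

/-- Subspaces of `𝔽(μ)` stable under the generators. -/
structure StableUnder (μ : ℂ) (M : Submodule ℂ SFun) : Prop where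
  D : ∀ a ∈ M, D a ∈ M
  E : ∀ a ∈ M, Eo μ a ∈ M
  F : ∀ a ∈ M, Fo μ a ∈ M

namespace StableUnder

variable {μ : ℂ} {M : Submodule ℂ SFun}

lemma D_pow (h : StableUnder μ M) (k : ℕ) {a : SFun} (ha : a ∈ M) : (SuperK.D ^ k) a ∈ M := by
  induction k with
  | zero => simpa
  | succ k ih => rw [pow_succ', Module.End.mul_apply]; exact h.D _ ih

lemma mem_of_smul {c : ℂ} {a : SFun} (hc : c ≠ 0) (h : c • a ∈ M) : a ∈ M := by
  simpa [smul_smul, inv_mul_cancel₀ hc] using M.smul_mem c⁻¹ h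

lemma bv_zero_mem (h : StableUnder μ M) (hM : M ≠ ⊥) : bv 0 ∈ M := by
  obtain ⟨v, hv, hv0⟩ := Submodule.exists_mem_ne_zero_of_ne_bot hM
  obtain ⟨k, c, hc, e⟩ := exists_D_pow_eq hv0
  exact mem_of_smul hc (e ▸ h.D_pow k hv)

lemma eq_top (h : StableUnder μ M) (h0 : bv 0 ∈ M) (h1 : μ ≠ 0 ∨ bv 1 ∈ M) : M = ⊤ := by
  have h1 : bv 1 ∈ M := by
    rcases h1 with h1 | h1
    · have := h.E _ h0
      rw [show bv 0 = bv (2 * 0) from rfl, Eo_bv_even] at this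
      exact mem_of_smul (by simpa using h1) this
    · exact h1
  have key : ∀ k, bv (2 * k) ∈ M ∧ bv (2 * k + 1) ∈ M := by
    intro k
    induction k with
    | zero => exact ⟨h0, h1⟩
    | succ k ih =>
      have e1 : bv (2 * (k + 1)) ∈ M := by have := h.E _ ih.2; rwa [Eo_bv_odd] at this
      refine ⟨e1, ?_⟩
      by_cases hk : (k : ℂ) + 1 + 2 * μ = 0
      · have := h.F _ ih.1
        rw [Fo_bv_even] at this
        refine mem_of_smul ?_ this
        intro h2
        have : (k : ℂ) + 2 = 0 := by linear_combination 2 * hk - h2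
        have : ((k + 2 : ℕ) : ℂ) = 0 := by push_cast; exact this
        exact absurd this (Nat.cast_ne_zero.2 (by omega))
      · have := h.E _ e1
        rw [Eo_bv_even] at this
        exact mem_of_smul (by push_cast; exact hk) this
  refine eq_top_of_bv M fun k => ?_
  rcases Nat.even_or_odd' k with ⟨q, rfl | rfl⟩
  · exact (key q).1
  · exact (key q).2

lemma D_bv_one : SuperK.D (bv 1) = bv 0 := D_bv_odd 0

/-- The stable subspaces are `0`, possibly the constants, and the whole space. -/
lemma cases (h : StableUnder μ M) : M = ⊥ ∨ M = Submodule.span ℂ {bv 0} ∨ M = ⊤ := by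
  by_cases hM : M = ⊥
  · exact Or.inl hM
  right
  have h0 := h.bv_zero_mem hM
  by_cases h1 : bv 1 ∈ M
  · exact Or.inr (h.eq_top h0 (Or.inr h1))
  left
  refine le_antisymm (fun v hv => ?_) (Submodule.span_le.2 (by simpa using h0))
  by_cases hD : SuperK.D v = 0
  · obtain ⟨c, rfl⟩ := eq_of_D_eq_zero hD
    exact Submodule.smul_mem _ _ (Submodule.mem_span_singleton_self _)
  · exfalso
    apply h1
    obtain ⟨k, c, hc, e⟩ := exists_D_pow_eq hD
    rw [← Module.End.mul_apply, ← pow_succ, pow_succ', Module.End.mul_apply] at e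
    have : SuperK.D ((SuperK.D ^ k) v - c • bv 1) = 0 := by
      rw [map_sub, map_smul, D_bv_one, e, sub_self]
    obtain ⟨a, ha⟩ := eq_of_D_eq_zero this
    refine mem_of_smul hc ?_
    rw [← sub_sub_cancel ((SuperK.D ^ k) v) (c • bv 1), ha]
    exact sub_mem (h.D_pow k hv) (M.smul_mem _ h0)

lemma comparable (h : StableUnder μ M) {M' : Submodule ℂ SFun} (h' : StableUnder μ M') :
    M ≤ M' ∨ M' ≤ M := by
  have s : Submodule.span ℂ {bv 0} ≤ (⊤ : Submodule ℂ SFun) := le_top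
  rcases h.cases with h | h | h <;> rcases h'.cases with h' | h' | h' <;> rw [h, h'] <;> simp

end StableUnder

/-! ## Extensions of two density modules -/

lemma Nop_add_injective {c : ℂ} (hc : ∀ k : ℕ, (k : ℂ) / 2 + c ≠ 0) {v : SFun}
    (h : Nop v + c • v = 0) : v = 0 := by
  by_contra hv
  obtain ⟨k, a, ha, e⟩ := exists_D_pow_eq hv
  have h1 := congrArg (D ^ k) h
  have h2 := LinearMap.congr_fun (Nop_D_pow k) v
  simp only [Module.End.mul_apply, LinearMap.add_apply, LinearMap.smul_apply, e, map_smul,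
    map_add, map_zero] at h1 h2
  have h3 : Nop (bv 0) = 0 := by rw [Nop_bv]; simp
  rw [h3, smul_zero] at h2
  have h4 : (((k : ℂ) / 2 + c) * a) • bv 0 = 0 := by
    have : (D ^ k) (Nop v) = ((k : ℂ) / 2) • (a • bv 0) := by
      have := eq_neg_of_add_eq_zero_left h2.symm
      rw [this]; module
    rw [this] at h1
    rw [← h1]; module
  exact (mul_ne_zero (hc k) ha) ((smul_eq_zero.1 h4).resolve_right (bv_ne_zero 0))

/-- Subspaces of an extension of `𝔽(μ)` by `𝔽(μ+n/2)` which are stable under the generators. -/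
structure StablePair (μ : ℂ) (n : ℤ) (β : ℂ) (R : Submodule ℂ (SFun × SFun)) : Prop where
  D : ∀ a b, (a, b) ∈ R → (D a, D b) ∈ R
  E : ∀ a b, (a, b) ∈ R → (Eo μ a, Eo (μ + n / 2) b) ∈ R
  F : ∀ a b, (a, b) ∈ R → (Fo μ a, Fo (μ + n / 2) b + β • Dp n a) ∈ R
  N : ∀ a b, (a, b) ∈ R → (Nop a, Nop b + ((n : ℂ) / 2) • b) ∈ R

namespace StablePair

variable {μ β : ℂ} {n : ℤ} {R : Submodule ℂ (SFun × SFun)}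

lemma stable_fst (h : StablePair μ n β R) : StableUnder μ (R.map (LinearMap.fst ℂ SFun SFun)) := by
  refine ⟨?_, ?_, ?_⟩ <;> rintro _ ⟨⟨a, b⟩, hab, rfl⟩
  exacts [⟨_, h.D _ _ hab, rfl⟩, ⟨_, h.E _ _ hab, rfl⟩, ⟨_, h.F _ _ hab, rfl⟩]

lemma stable_snd (h : StablePair μ n β R) :
    StableUnder (μ + n / 2) (R.comap (LinearMap.inr ℂ SFun SFun)) := by
  refine ⟨fun b hb => ?_, fun b hb => ?_, fun b hb => ?_⟩ <;>
    rw [Submodule.mem_comap, LinearMap.inr_apply] at hb ⊢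
  · simpa using h.D _ _ hb
  · simpa using h.E _ _ hb
  · simpa using h.F _ _ hb

/-- If every stable subspace is comparable with the subextension, stable subspaces form a chain. -/
lemma comparable (h : StablePair μ n β R) {R' : Submodule ℂ (SFun × SFun)}
    (h' : StablePair μ n β R') (c : (∃ v ∈ R, v.1 ≠ 0) → ∀ b, (0, b) ∈ R)
    (c' : (∃ v ∈ R', v.1 ≠ 0) → ∀ b, (0, b) ∈ R') : R ≤ R' ∨ R' ≤ R := by
  have key : ∀ A B : Submodule ℂ (SFun × SFun), (∀ b, (0, b) ∈ B) →
      A.map (LinearMap.fst ℂ SFun SFun) ≤ B.map (LinearMap.fst ℂ SFun SFun) → A ≤ B := by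
    rintro A B hB hle ⟨a, b⟩ hab
    obtain ⟨⟨a', b'⟩, h1, h2⟩ := hle ⟨_, hab, rfl⟩
    have h2 : a' = a := h2
    subst h2
    have := add_mem h1 (hB (b - b'))
    simpa using this
  have key2 : ∀ A B : Submodule ℂ (SFun × SFun), (∀ v ∈ A, v.1 = 0) →
      A.comap (LinearMap.inr ℂ SFun SFun) ≤ B.comap (LinearMap.inr ℂ SFun SFun) → A ≤ B := by
    rintro A B hA hle ⟨a, b⟩ hab
    obtain rfl : a = 0 := hA _ hab
    exact hle hab
  by_cases hR : ∃ v ∈ R, v.1 ≠ 0 <;> by_cases hR' : ∃ v ∈ R', v.1 ≠ 0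
  · exact (h.stable_fst.comparable h'.stable_fst).imp (key _ _ (c' hR')) (key _ _ (c hR))
  · push Not at hR'
    refine Or.inr fun ⟨a, b⟩ hab => ?_
    obtain rfl : a = 0 := hR' _ hab
    exact c hR b
  · push Not at hR
    refine Or.inl fun ⟨a, b⟩ hab => ?_
    obtain rfl : a = 0 := hR _ hab
    exact c' hR' b
  · push Not at hR hR'
    exact (h.stable_snd.comparable h'.stable_snd).imp (key2 _ _ hR) (key2 _ _ hR')

lemma bv_zero_mem (h : StablePair μ n β R) (hn : 3 ≤ n) (hR : ∃ v ∈ R, v.1 ≠ 0) :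
    (bv 0, 0) ∈ R := by
  have hne : R.map (LinearMap.fst ℂ SFun SFun) ≠ ⊥ := by
    obtain ⟨v, hv, hv0⟩ := hR
    intro h0
    exact hv0 ((Submodule.mem_bot ℂ).1 (h0 ▸ ⟨v, hv, rfl⟩))
  obtain ⟨⟨a, w⟩, hw, e⟩ := h.stable_fst.bv_zero_mem hne
  have e : a = bv 0 := e
  subst e
  have hc : ∀ k : ℕ, (k : ℂ) / 2 + n / 2 ≠ 0 := by
    intro k hk
    have : ((k + n : ℤ) : ℂ) = 0 := by push_cast; linear_combination 2 * hk
    have := Int.cast_eq_zero.1 this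
    omega
  have h1 := h.N _ _ hw
  have hw' : w ∈ R.comap (LinearMap.inr ℂ SFun SFun) := by
    have h2 : Nop w + ((n : ℂ) / 2) • w ∈ R.comap (LinearMap.inr ℂ SFun SFun) := by
      rw [Nop_bv] at h1; simpa using h1
    rcases h.stable_snd.cases with h3 | h3 | h3
    · rw [h3, Submodule.mem_bot] at h2
      rw [h3, Submodule.mem_bot]; exact Nop_add_injective hc h2
    · rw [h3, Submodule.mem_span_singleton] at h2 ⊢
      obtain ⟨c, hc'⟩ := h2
      refine ⟨c / (n / 2), ?_⟩
      have hn0 : (n : ℂ) / 2 ≠ 0 := by simpa using hc 0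
      refine (sub_eq_zero.1 (Nop_add_injective hc ?_)).symm
      have h3 : Nop (bv 0) = 0 := by rw [Nop_bv]; simp
      rw [map_sub, map_smul, h3, smul_sub, smul_smul, mul_div_cancel₀ _ hn0, hc']
      simp
    · rw [h3]; exact Submodule.mem_top
  have := sub_mem hw (show (0, w) ∈ R from hw')
  simpa using this

lemma mem_of_smul {c : ℂ} {v : SFun × SFun} (hc : c ≠ 0) (h : c • v ∈ R) : v ∈ R := by
  simpa [smul_smul, inv_mul_cancel₀ hc] using R.smul_mem c⁻¹ h

lemma raise_even (h : StablePair μ n β R) {k : ℕ} (hk : (bv (2 * k), 0) ∈ R)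
    (h0 : (k : ℂ) + 2 * μ ≠ 0) : (bv (2 * k + 1), 0) ∈ R := by
  have := h.E _ _ hk
  rw [Eo_bv_even, map_zero] at this
  exact mem_of_smul h0 (by simpa using this)

lemma raise_odd (h : StablePair μ n β R) {k : ℕ} (hk : (bv (2 * k + 1), 0) ∈ R) :
    (bv (2 * (k + 1)), 0) ∈ R := by
  have := h.E _ _ hk
  rwa [Eo_bv_odd, map_zero] at this

lemma exists_Fo_bv (μ : ℂ) (k : ℕ) : ∃ c : ℂ, Fo μ (bv k) = c • bv (k + 3) := by
  rcases Nat.even_or_odd' k with ⟨q, rfl | rfl⟩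
  · exact ⟨_, Fo_bv_even μ q⟩
  · exact ⟨1, by rw [Fo_bv_odd, one_smul]; rfl⟩

lemma Dp_apply (k : ℕ) (v : SFun) : Dp (k + 3) v = eps ((SuperK.D ^ k) v) := by
  rw [Dp, if_neg (by omega), show ((k : ℤ) + 3 - 3).toNat = k by omega]; rfl

lemma lower (h : StablePair μ n β R) (j : ℕ) (h1 : (bv j, 0) ∈ R) (h2 : (bv (j + 3), 0) ∈ R) :
    (0, β • Dp n (bv j)) ∈ R := by
  obtain ⟨c, hc⟩ := exists_Fo_bv μ j
  have := sub_mem (h.F _ _ h1) (R.smul_mem c h2)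
  rw [hc, map_zero, zero_add] at this
  simpa using this

lemma zero_bv_zero_mem (h : StablePair μ n β R) (hβ : β ≠ 0) (k : ℕ) (hn : n = k + 3)
    (h1 : (bv k, 0) ∈ R) (h2 : (bv (k + 3), 0) ∈ R) : (0, bv 0) ∈ R := by
  have := h.lower k h1 h2
  obtain ⟨c, hc, e⟩ := D_pow_bv_self k
  rw [hn, Dp_apply, e, map_smul, show eps (bv 0) = bv 0 from eps_bv_even 0, smul_smul] at this
  exact mem_of_smul (mul_ne_zero hβ hc) (by simpa using this)

lemma zero_bv_one_mem (h : StablePair μ n β R) (hβ : β ≠ 0) (k : ℕ) (hn : n = k + 3)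
    (h0 : (0, bv 0) ∈ R) (h1 : (bv (k + 1), 0) ∈ R) (h2 : (bv (k + 4), 0) ∈ R) :
    (0, bv 1) ∈ R := by
  have := h.lower (k + 1) h1 h2
  obtain ⟨c, hc, e⟩ := D_pow_bv_self (k + 1)
  rw [pow_succ', Module.End.mul_apply] at e
  have e2 : SuperK.D ((SuperK.D ^ k) (bv (k + 1)) - c • bv 1) = 0 := by
    rw [map_sub, map_smul, StableUnder.D_bv_one, e, sub_self]
  obtain ⟨a, ha⟩ := eq_of_D_eq_zero e2
  rw [hn, Dp_apply, sub_eq_iff_eq_add.1 ha, map_add, map_smul, map_smul,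
    show eps (bv 0) = bv 0 from eps_bv_even 0, show eps (bv 1) = -bv 1 from eps_bv_odd 0] at this
  have h3 := sub_mem this (R.smul_mem (β * a) h0)
  refine mem_of_smul (c := -(β * c)) (neg_ne_zero.2 (mul_ne_zero hβ hc)) ?_
  convert h3 using 1
  refine Prod.ext ?_ ?_
  · simp
  · simp only [Prod.smul_snd, Prod.snd_sub]; module

/-- The weights `μ` for which the extension of `𝔽(μ)` by `𝔽(μ+n/2)` is uniserial; for `n = 6`, only
a sufficient condition. -/
def Good (μ : ℂ) (n : ℤ) : Prop :=
  (n = 3 ∧ μ ≠ -1 / 2) ∨ (n = 4 ∧ μ ≠ 0) ∨ (n = 5 ∧ μ ≠ 0 ∧ μ ≠ -1) ∨ (n = 6 ∧ μ = -5 / 2)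

lemma zero_mem_of_good (h : StablePair μ n β R) (hβ : β ≠ 0) (hg : Good μ n)
    (hR : ∃ v ∈ R, v.1 ≠ 0) (b : SFun) : (0, b) ∈ R := by
  have p0 : (bv 0, 0) ∈ R := h.bv_zero_mem (by rcases hg with h | h | h | h <;> omega) hR
  suffices hs : (0, bv 0) ∈ R ∧ (μ + n / 2 ≠ 0 ∨ (0, bv 1) ∈ R) by
    have := h.stable_snd.eq_top hs.1 hs.2
    exact (this ▸ Submodule.mem_top : b ∈ R.comap (LinearMap.inr ℂ SFun SFun))
  by_cases hμ : μ = 0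
  · subst hμ
    rcases hg with ⟨rfl, -⟩ | ⟨-, h⟩ | ⟨-, h, -⟩ | ⟨-, h⟩
    · refine ⟨?_, Or.inl (by norm_num)⟩
      have := h.F _ _ p0
      rw [show Fo 0 (bv 0) = 0 by rw [show bv 0 = bv (2 * 0) from rfl, Fo_bv_even]; simp,
        map_zero, zero_add, show (3 : ℤ) = ((0 : ℕ) : ℤ) + 3 from rfl, Dp_apply, pow_zero,
        Module.End.one_apply, show eps (bv 0) = bv 0 from eps_bv_even 0] at this
      exact mem_of_smul hβ (by simpa using this)
    · exact absurd rfl h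
    · exact absurd rfl h
    · norm_num at h
  have p1 : (bv 1, 0) ∈ R := h.raise_even (k := 0) p0 (by simpa using hμ)
  have p2 : (bv 2, 0) ∈ R := h.raise_odd (k := 0) p1
  have p3 : (bv 3, 0) ∈ R := by
    by_cases h1 : ((1 : ℕ) : ℂ) + 2 * μ = 0
    · have hn : ∃ k : ℕ, n = k + 1 + 3 := by
        rcases hg with ⟨rfl, h'⟩ | ⟨rfl, -⟩ | ⟨rfl, -, -⟩ | ⟨rfl, h'⟩
        · exact absurd (by push_cast at h1; linear_combination h1 / 2) h'
        · exact ⟨0, by norm_num⟩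
        · exact ⟨1, by norm_num⟩
        · exact ⟨2, by norm_num⟩
      obtain ⟨k, hk⟩ := hn
      have := h.F _ _ p0
      have e : n = ((k + 1 : ℕ) : ℤ) + 3 := by push_cast; exact hk
      rw [show bv 0 = bv (2 * 0) from rfl, Fo_bv_even, e, Dp_apply,
        show (SuperK.D ^ (k + 1)) (bv (2 * 0)) = 0 from D_pow_bv_lt (Nat.succ_pos k)] at this
      exact mem_of_smul (c := 4 * μ) (by simpa using hμ) (by simpa using this)
    · exact h.raise_even (k := 1) p2 h1
  have p4 : (bv 4, 0) ∈ R := h.raise_odd (k := 1) p3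
  rcases hg with ⟨rfl, -⟩ | ⟨rfl, -⟩ | ⟨rfl, -, h1⟩ | ⟨rfl, h1⟩
  · have q := h.zero_bv_zero_mem hβ 0 rfl p0 p3
    exact ⟨q, Or.inr (h.zero_bv_one_mem hβ 0 rfl q p1 p4)⟩
  · have q := h.zero_bv_zero_mem hβ 1 rfl p1 p4
    refine ⟨q, ?_⟩
    by_cases h2 : ((2 : ℕ) : ℂ) + 2 * μ = 0
    · left
      push_cast at h2 ⊢
      intro h3
      have : (2 : ℂ) = 0 := by linear_combination 2 * h3 - h2
      norm_num at this
    · exact Or.inr (h.zero_bv_one_mem hβ 1 rfl q p2 (h.raise_even (k := 2) p4 h2))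
  · have p5 : (bv 5, 0) ∈ R := h.raise_even (k := 2) p4 (by
      intro h2; push_cast at h2; exact h1 (by linear_combination h2 / 2))
    have q := h.zero_bv_zero_mem hβ 2 rfl p2 p5
    exact ⟨q, Or.inr (h.zero_bv_one_mem hβ 2 rfl q p3 (h.raise_odd (k := 2) p5))⟩
  · have p5 : (bv 5, 0) ∈ R := h.raise_even (k := 2) p4 (by rw [h1]; norm_num)
    refine ⟨h.zero_bv_zero_mem hβ 3 rfl p3 (h.raise_odd (k := 2) p5), Or.inl ?_⟩
    rw [h1]; norm_num

end StablePair

lemma eps_D_pow (k : ℕ) : eps * D ^ k = ((-1 : ℂ) ^ k) • (D ^ k * eps) := by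
  induction k with
  | zero => simp
  | succ k ih =>
    rw [pow_succ D, ← mul_assoc, ih, smul_mul_assoc, mul_assoc, eps_D_smul, mul_smul_comm,
      smul_smul, mul_assoc, pow_succ]

namespace KRep

variable {m : ℕ}

/-! ## Constructing representations from their matrix entries -/

/-- The representation with given matrix entries. -/
def ofEntries (N : Fin m → ℤ) (Φ : Fin m → Fin m → SFun →ₗ[ℂ] Module.End ℂ SFun)
    (hp : ∀ i j F v, sgnZ (N i) • parity (Φ i j F v) = Φ i j (parity F) (sgnZ (N j) • parity v))
    (hb : ∀ i k (a c : ZMod 2) F G, Homog a F → Homog c G → Φ i k (cbracket F G) =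
      (∑ j, Φ i j F * Φ j k G) - sgn (a * c) • ∑ j, Φ i j G * Φ j k F) :
    KRep (Fin m → SFun) where
  par := LinearMap.pi fun i => (sgnZ (N i) • parity) ∘ₗ LinearMap.proj i
  act :=
    { toFun := fun F => LinearMap.pi fun i => ∑ j, Φ i j F ∘ₗ LinearMap.proj j
      map_add' := fun F G => by
        refine LinearMap.ext fun u => funext fun i => ?_
        simp [Finset.sum_add_distrib]
      map_smul' := fun c F => by
        refine LinearMap.ext fun u => funext fun i => ?_
        simp [Finset.smul_sum] }
  par_par v := funext fun i => by
    simp only [LinearMap.pi_apply, LinearMap.comp_apply, LinearMap.proj_apply, LinearMap.smul_apply,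
      map_smul, smul_smul, sgnZ_mul_self, one_smul, parity_parity]
  par_act F v := funext fun i => by
    simp only [LinearMap.pi_apply, LinearMap.comp_apply, LinearMap.proj_apply, LinearMap.smul_apply,
      LinearMap.coe_mk, AddHom.coe_mk, LinearMap.sum_apply, map_sum, Finset.smul_sum]
    exact Finset.sum_congr rfl fun j _ => hp i j F (v j)
  act_bracket a c F G hF hG := by
    refine LinearMap.ext fun v => funext fun i => ?_
    simp only [LinearMap.coe_mk, AddHom.coe_mk, LinearMap.sub_apply, LinearMap.smul_apply,
      Module.End.mul_apply, LinearMap.pi_apply, LinearMap.sum_apply, LinearMap.comp_apply,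
      LinearMap.proj_apply, Pi.sub_apply, Pi.smul_apply, map_sum]
    rw [Finset.sum_congr rfl fun k _ => by rw [hb i k a c F G hF hG]]
    simp only [LinearMap.sub_apply, LinearMap.smul_apply, LinearMap.sum_apply,
      Module.End.mul_apply, Finset.sum_sub_distrib, ← Finset.smul_sum]
    rw [Finset.sum_comm, Finset.sum_comm (f := fun k j => (Φ i j G) ((Φ j k F) (v k)))]

lemma isTri_ofEntries {N : Fin m → ℤ} {Φ : Fin m → Fin m → SFun →ₗ[ℂ] Module.End ℂ SFun} {hp hb}
    {l : ℂ} {b : Fin m → Fin m → ℂ} (h0 : ∀ i j, i < j → Φ i j = 0)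
    (h1 : ∀ i, Φ i i = densityOp (l + N i / 2)) (h2 : ∀ i j, j < i → ∀ F ∈ conformal, Φ i j F = 0)
    (h3 : ∀ i j, j < i → Φ i j (bv 5) = (b i j / 2) • Dp (N i - N j)) :
    (ofEntries N Φ hp hb).IsTri l N b := by
  have act : ∀ F u i, (ofEntries N Φ hp hb).act F u i = ∑ j, Φ i j F (u j) := by
    intro F u i; simp [ofEntries]
  have conf : ∀ F ∈ conformal, ∀ u i,
      (ofEntries N Φ hp hb).act F u i = densityOp (l + N i / 2) F (u i) := by
    intro F hF u i
    rw [act, Finset.sum_eq_single i, h1]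
    · intro j _ hj
      rcases lt_or_gt_of_ne hj with hj | hj
      · rw [h2 i j hj F hF]; rfl
      · rw [h0 i j hj]; rfl
    · simp
  refine ⟨fun u i => rfl, fun u i => ?_, fun u i => ?_, fun u i => ?_⟩
  · rw [conf _ (bv_mem_conformal (by norm_num)), densityOp_bv1]; rfl
  · rw [conf _ (bv_mem_conformal (by norm_num)), densityOp_bv3]; rfl
  · rw [act, smul_add, Finset.smul_sum]
    have e1 : (1 / 2 : ℂ) • Fo (l + N i / 2) (u i) =
        ∑ j, if j = i then (1 / 2 : ℂ) • Fo (l + N i / 2) (u i) else 0 := by simp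
    rw [e1, ← Finset.sum_add_distrib]
    refine Finset.sum_congr rfl fun j _ => ?_
    rcases lt_trichotomy j i with hj | rfl | hj
    · rw [h3 i j hj, if_neg hj.ne, if_pos hj, zero_add, smul_smul, LinearMap.smul_apply]
      congr 1; ring
    · rw [h1, if_pos rfl, if_neg (lt_irrefl _), smul_zero, add_zero, densityOp_bv5]; rfl
    · rw [h0 i j hj, if_neg hj.ne', if_neg hj.not_gt, smul_zero, add_zero]; rfl

namespace IsTri

variable {σ σ' : KRep (Fin m → SFun)} {l : ℂ} {N : Fin m → ℤ} {b b' : Fin m → Fin m → ℂ}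

/-- Triangular models whose constants differ by a diagonal conjugation are equivalent. -/
lemma equiv_of_scale (h : σ.IsTri l N b) (h' : σ'.IsTri l N b') (d : Fin m → ℂ)
    (hd : ∀ i, d i ≠ 0) (e : ∀ i j, j < i → b' i j * d j = d i * b i j) : σ.Equiv σ' := by
  let T : (Fin m → SFun) →ₗ[ℂ] (Fin m → SFun) := LinearMap.pi fun i =>
    d i • (LinearMap.proj i : (Fin m → SFun) →ₗ[ℂ] SFun)
  have hT : ∀ (u : Fin m → SFun) (i : Fin m), T u i = d i • u i := fun u i => rfl
  refine ⟨T, ⟨fun u v huv => funext fun i => ?_, fun w => ⟨fun i => (d i)⁻¹ • w i, ?_⟩⟩,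
    isIntertwiner_of_generators (fun u => funext fun i => ?_) (fun u => funext fun i => ?_)
      (fun u => funext fun i => ?_) fun u => funext fun i => ?_⟩
  · have e : d i • u i = d i • v i := congrFun huv i
    exact smul_right_injective SFun (hd i) e
  · funext i; rw [hT, smul_smul, mul_inv_cancel₀ (hd i), one_smul]
  · rw [hT, h'.par, h.par, hT, map_smul, smul_comm]
  · rw [hT, h'.act1, h.act1, hT, map_smul, smul_comm]
  · rw [hT, h'.act3, h.act3, hT, map_smul, smul_comm]
  · have k : ∀ j, (if j < i then b' i j • Dp (N i - N j) (T u j) else 0) =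
        d i • (if j < i then b i j • Dp (N i - N j) (u j) else 0) := by
      intro j
      split_ifs with hj
      · rw [hT, map_smul, smul_smul, e i j hj, mul_smul]
      · rw [smul_zero]
    rw [hT, h'.act5, h.act5, Finset.sum_congr rfl fun j _ => k j, hT, map_smul, ← Finset.smul_sum,
      ← smul_add, smul_comm]

lemma isChain_congr (h : σ.IsTri l N b) (h' : σ'.IsTri l N b') (e : ∀ i j, j < i → b' i j = b i j)
    (hc : σ.IsChain) : σ'.IsChain :=
  hc.equiv (h.equiv_of_scale h' 1 (fun _ => one_ne_zero) fun i j hj => by simp [e i j hj])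

end IsTri

lemma piShift_act {V : Type*} [AddCommGroup V] [Module ℂ V] (ρ : KRep V) (k : ℤ) :
    (ρ.piShift k).act = ρ.act := by
  unfold piShift; split_ifs <;> rfl

lemma piShift_par {V : Type*} [AddCommGroup V] [Module ℂ V] (ρ : KRep V) (k : ℤ) (v : V) :
    (ρ.piShift k).par v = sgnZ k • ρ.par v := by
  unfold piShift sgnZ
  split_ifs
  · change -(ρ.par v) = _; rw [neg_smul, one_smul]
  · rw [one_smul]

lemma isInvariant_piShift {V : Type*} [AddCommGroup V] [Module ℂ V] {ρ : KRep V} (k : ℤ)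
    {M : Submodule ℂ V} : (ρ.piShift k).IsInvariant M ↔ ρ.IsInvariant M := by
  unfold IsInvariant
  rw [piShift_act]
  refine and_congr_left fun _ => ⟨fun h v hv => ?_, fun h v hv => ?_⟩
  · have := M.smul_mem (sgnZ k) (h v hv)
    rwa [piShift_par, smul_smul, sgnZ_mul_self, one_smul] at this
  · rw [piShift_par]; exact M.smul_mem _ (h v hv)

lemma isChain_piShift {V : Type*} [AddCommGroup V] [Module ℂ V] {ρ : KRep V} (k : ℤ) :
    (ρ.piShift k).IsChain ↔ ρ.IsChain := by
  unfold IsChain; simp only [isInvariant_piShift]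

namespace IsTri

lemma piShift {σ : KRep (Fin m → SFun)} {l : ℂ} {N : Fin m → ℤ} {b : Fin m → Fin m → ℂ}
    (h : σ.IsTri l N b) (k : ℤ) (l' : ℂ) (hl : l' = l - k / 2) (N' : Fin m → ℤ)
    (hN : ∀ i, N' i = N i + k) : (σ.piShift k).IsTri l' N' b := by
  have e : ∀ i, l' + (N' i : ℂ) / 2 = l + N i / 2 := fun i => by
    rw [hl, hN]; push_cast; ring
  refine ⟨fun u i => ?_, fun u i => ?_, fun u i => ?_, fun u i => ?_⟩
  · rw [piShift_par, Pi.smul_apply, h.par, hN, sgnZ_add, smul_smul, mul_comm]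
  · rw [piShift_act, h.act1]
  · rw [piShift_act, h.act3, e]
  · rw [piShift_act, h.act5, e]
    congr 3
    funext j
    rw [hN, hN, add_sub_add_right_eq_sub]

/-! ## Truncations -/

variable {σ : KRep (Fin (m + 1) → SFun)} {l : ℂ} {N : Fin (m + 1) → ℤ}
  {b : Fin (m + 1) → Fin (m + 1) → ℂ}

/-- The quotient by the last term of the flag. -/
lemma exists_quotient (h : σ.IsTri l N b) : ∃ τ : KRep (Fin m → SFun),
    τ.IsTri l (fun i => N i.castSucc) (fun i j => b i.castSucc j.castSucc) ∧
      σ.IsIntertwiner τ 0 (LinearMap.funLeft ℂ SFun Fin.castSucc) := by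
  have hs : Function.Surjective (LinearMap.funLeft ℂ SFun (Fin.castSucc (n := m))) :=
    LinearMap.funLeft_surjective_of_injective _ _ _ (Fin.castSucc_injective m)
  have hT : ∀ (u : Fin (m + 1) → SFun) i, LinearMap.funLeft ℂ SFun (Fin.castSucc (n := m)) u i =
    u i.castSucc := fun u i => rfl
  have hk : σ.IsInvariant (LinearMap.ker (LinearMap.funLeft ℂ SFun (Fin.castSucc (n := m)))) := by
    refine ⟨fun u hu => funext fun i => ?_, fun F u hu => funext fun i => ?_⟩
    · have hu : ∀ i, u (Fin.castSucc i) = 0 := fun i => congrFun hu i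
      rw [hT, h.par, hu, map_zero, smul_zero]; rfl
    · have hu : ∀ i, u (Fin.castSucc i) = 0 := fun i => congrFun hu i
      rw [hT, act_eq_sum_entry, Fin.sum_univ_castSucc, h.entry_of_lt F (Fin.castSucc_lt_last i),
        Finset.sum_eq_zero fun j _ => by rw [hu j, map_zero]]
      simp
  have hI := ofSurjective_isIntertwiner σ _ hs hk
  refine ⟨_, ?_, hI⟩
  obtain ⟨i1, i2⟩ := isIntertwiner_zero_iff.1 hI
  refine ⟨fun u i => ?_, fun u i => ?_, fun u i => ?_, fun u i => ?_⟩ <;>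
    obtain ⟨u, rfl⟩ := hs u
  · rw [i1, hT, h.par]; rfl
  · rw [i2, hT, h.act1]; rfl
  · rw [i2, hT, h.act3]; rfl
  · rw [i2, hT, h.act5, Fin.sum_univ_castSucc, if_neg (Fin.castSucc_lt_last i).not_gt, add_zero]; rfl

end IsTri

/-- The inclusion of the last summands. -/
def consZero (m : ℕ) : (Fin m → SFun) →ₗ[ℂ] (Fin (m + 1) → SFun) where
  toFun u := Fin.cons 0 u
  map_add' u v := by funext i; refine Fin.cases ?_ (fun i => ?_) i <;> simp
  map_smul' c u := by funext i; refine Fin.cases ?_ (fun i => ?_) i <;> simp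

@[simp] lemma consZero_zero (u : Fin m → SFun) : consZero m u 0 = 0 := rfl
@[simp] lemma consZero_succ (u : Fin m → SFun) (i : Fin m) : consZero m u i.succ = u i := rfl

namespace IsTri

variable {σ : KRep (Fin (m + 1) → SFun)} {l : ℂ} {N : Fin (m + 1) → ℤ}
  {b : Fin (m + 1) → Fin (m + 1) → ℂ}

/-- The subrepresentation on the second term of the flag. -/
lemma exists_sub (h : σ.IsTri l N b) : ∃ τ : KRep (Fin m → SFun),
    τ.IsTri l (fun i => N i.succ) (fun i j => b i.succ j.succ) ∧
      τ.IsIntertwiner σ 0 (consZero m) := by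
  let M : Submodule ℂ (Fin (m + 1) → SFun) := LinearMap.ker (LinearMap.proj 0)
  have hM : σ.IsInvariant M := by
    refine ⟨fun u hu => ?_, fun F u hu => ?_⟩ <;> have hu : u 0 = 0 := hu
    · change σ.par u 0 = 0
      rw [h.par, hu, map_zero, smul_zero]
    · change σ.act F u 0 = 0
      rw [act_eq_sum_entry, Fin.sum_univ_succ, hu, map_zero, zero_add]
      exact Finset.sum_eq_zero fun j _ => by rw [h.entry_of_lt F (Fin.succ_pos j)]; rfl
  let T : M →ₗ[ℂ] (Fin m → SFun) := LinearMap.funLeft ℂ SFun Fin.succ ∘ₗ M.subtype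
  have hT : ∀ u i, T u i = u.1 (Fin.succ i) := fun u i => rfl
  have hcT : ∀ u : M, consZero m (T u) = u.1 := fun u => by
    funext i
    refine Fin.cases ?_ (fun i => ?_) i
    · exact (show u.1 0 = 0 from u.2).symm
    · rfl
  have hs : Function.Surjective T := fun u => ⟨⟨consZero m u, rfl⟩, rfl⟩
  have hk : (σ.sub M hM).IsInvariant (LinearMap.ker T) := by
    have : LinearMap.ker T = ⊥ := by
      refine LinearMap.ker_eq_bot.2 fun u v huv => Subtype.ext ?_
      rw [← hcT u, ← hcT v, huv]
    rw [this]; exact isInvariant_bot _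
  have hI := ofSurjective_isIntertwiner (σ.sub M hM) T hs hk
  obtain ⟨i1, i2⟩ := isIntertwiner_zero_iff.1 hI
  refine ⟨(σ.sub M hM).ofSurjective T hs hk, ?_,
    isIntertwiner_zero_iff.2 ⟨fun u => ?_, fun F u => ?_⟩⟩
  · refine ⟨fun u i => ?_, fun u i => ?_, fun u i => ?_, fun u i => ?_⟩ <;>
      obtain ⟨u, rfl⟩ := hs u
    · rw [i1]; exact h.par u.1 i.succ
    · rw [i2]; exact h.act1 u.1 i.succ
    · rw [i2]; exact h.act3 u.1 i.succ
    · rw [i2]; refine (h.act5 u.1 i.succ).trans ?_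
      rw [Fin.sum_univ_succ, show u.1 0 = 0 from u.2, map_zero, smul_zero, ite_self, zero_add]
      simp only [Fin.succ_lt_succ_iff]; rfl
  · obtain ⟨u, rfl⟩ := hs u
    rw [i1, hcT, hcT]; rfl
  · obtain ⟨u, rfl⟩ := hs u
    rw [i2, hcT, hcT]; rfl

end IsTri

lemma isInvariant_top {V : Type*} [AddCommGroup V] [Module ℂ V] (ρ : KRep V) : ρ.IsInvariant ⊤ :=
  ⟨fun _ _ => Submodule.mem_top, fun _ _ _ => Submodule.mem_top⟩

/-- A three-step extension is uniserial as soon as its two truncations are. -/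
lemma isChain_three {σ : KRep (Fin 3 → SFun)} {τ τ' : KRep (Fin 2 → SFun)}
    (hq : σ.IsIntertwiner τ 0 (LinearMap.funLeft ℂ SFun Fin.castSucc))
    (hs : τ'.IsIntertwiner σ 0 (consZero 2)) (hτ : τ.IsChain) (hτ' : τ'.IsChain) : σ.IsChain := by
  refine isChain_of_flag (A := LinearMap.ker (LinearMap.funLeft ℂ SFun Fin.castSucc))
    (B := (⊤ : Submodule ℂ (Fin 2 → SFun)).map (consZero 2)) (isInvariant_ker hq)
    ((isInvariant_top τ').map hs) (lt_of_le_of_ne ?_ ?_) ?_ ?_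
  · intro u hu
    refine ⟨fun i => u i.succ, Submodule.mem_top, funext fun i => ?_⟩
    refine Fin.cases ?_ (fun i => ?_) i
    · exact (congrFun (show _ = (0 : Fin 2 → SFun) from hu) 0).symm
    · rfl
  · intro he
    have : consZero 2 (Pi.single 0 (bv 0)) ∈
        LinearMap.ker (LinearMap.funLeft ℂ SFun (Fin.castSucc (n := 2))) :=
      he ▸ ⟨_, Submodule.mem_top, rfl⟩
    have := congrFun (show _ = (0 : Fin 2 → SFun) from this) 1
    exact bv_ne_zero 0 this
  · intro M M' hM hM' h1 h2
    rw [Submodule.map_top] at h1 h2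
    exact hτ'.comparable_of_le_range hs hM hM' h1 h2
  · intro M M' hM hM' h1 h2
    exact hτ.comparable_of_ker_le hq hM hM' h1 h2

/-! ## Uniseriality of two-step extensions -/

section Two

variable {σ : KRep (Fin 2 → SFun)} {l : ℂ} {N : Fin 2 → ℤ} {b : Fin 2 → Fin 2 → ℂ}

lemma IsTri.act5_zero (h : σ.IsTri l N b) (u : Fin 2 → SFun) :
    σ.act (bv 5) u 0 = (1 / 2 : ℂ) • Fo (l + N 0 / 2) (u 0) := by
  rw [h.act5, Fin.sum_univ_two]; simp

lemma IsTri.act5_one (h : σ.IsTri l N b) (u : Fin 2 → SFun) : σ.act (bv 5) u 1 =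
    (1 / 2 : ℂ) • (Fo (l + N 1 / 2) (u 1) + b 1 0 • Dp (N 1 - N 0) (u 0)) := by
  rw [h.act5, Fin.sum_univ_two]; simp

lemma IsTri.stablePair (h : σ.IsTri l N b) {M : Submodule ℂ (Fin 2 → SFun)}
    (hM : σ.IsInvariant M) : StablePair (l + N 0 / 2) (N 1 - N 0) (b 1 0)
      (M.comap (LinearEquiv.finTwoArrow ℂ SFun).symm.toLinearMap) := by
  have hw : l + (N 0 : ℂ) / 2 + ((N 1 - N 0 : ℤ) : ℂ) / 2 = l + N 1 / 2 := by push_cast; ring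
  have key : ∀ (F : SFun) (a c a' c' : SFun), ![a, c] ∈ M →
      (∃ z : ℂ, z ≠ 0 ∧ σ.act F ![a, c] 0 = z • a' ∧ σ.act F ![a, c] 1 = z • c') →
      ![a', c'] ∈ M := by
    rintro F a c a' c' hac ⟨z, hz, e1, e2⟩
    have : ![a', c'] = z⁻¹ • σ.act F ![a, c] := by
      funext i
      fin_cases i
      · change a' = z⁻¹ • (σ.act F ![a, c] 0); rw [e1, smul_smul, inv_mul_cancel₀ hz, one_smul]
      · change c' = z⁻¹ • (σ.act F ![a, c] 1); rw [e2, smul_smul, inv_mul_cancel₀ hz, one_smul]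
    rw [this]; exact M.smul_mem _ (hM.2 F _ hac)
  refine ⟨fun a c hac => ?_, fun a c hac => ?_, fun a c hac => ?_, fun a c hac => ?_⟩ <;>
    have hac : ![a, c] ∈ M := hac
  · change ![_, _] ∈ M
    exact key (bv 1) a c _ _ hac ⟨1 / 2, by norm_num, h.act1 _ 0, h.act1 _ 1⟩
  · change ![_, _] ∈ M
    rw [hw]
    exact key (bv 3) a c _ _ hac ⟨1 / 2, by norm_num, h.act3 _ 0, h.act3 _ 1⟩
  · change ![_, _] ∈ M
    rw [hw]
    exact key (bv 5) a c _ _ hac ⟨1 / 2, by norm_num, h.act5_zero _, h.act5_one _⟩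
  · change ![Nop a, Nop c + (((N 1 - N 0 : ℤ) : ℂ) / 2) • c] ∈ M
    have : ![Nop a, Nop c + (((N 1 - N 0 : ℤ) : ℂ) / 2) • c] =
        σ.act (bv 2) ![a, c] - (l + (N 0 : ℂ) / 2) • ![a, c] := by
      funext i
      rw [Pi.sub_apply, Pi.smul_apply, h.act_conformal (bv_mem_conformal (by norm_num)),
        densityOp_bv2, LinearMap.add_apply, LinearMap.smul_apply, Module.End.one_apply]
      fin_cases i
      · simp
      · change Nop c + (((N 1 - N 0 : ℤ) : ℂ) / 2) • c = Nop c + (l + (N 1 : ℂ) / 2) • c - _ • c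
        push_cast; module
    rw [this]
    exact sub_mem (hM.2 _ _ hac) (M.smul_mem _ hac)

open StablePair in
/-- Two-step extensions with a good weight are uniserial. -/
lemma IsTri.isChain_of_good (h : σ.IsTri l N b) (hb : b 1 0 ≠ 0)
    (hg : Good (l + N 0 / 2) (N 1 - N 0)) : σ.IsChain := by
  intro M M' hM hM'
  have e := (LinearEquiv.finTwoArrow ℂ SFun).symm.surjective
  have k := (h.stablePair hM).comparable (h.stablePair hM')
    ((h.stablePair hM).zero_mem_of_good hb hg) ((h.stablePair hM').zero_mem_of_good hb hg)
  exact k.imp (Submodule.comap_le_comap_iff_of_surjective e).1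
    (Submodule.comap_le_comap_iff_of_surjective e).1

lemma IsTri.isInvariant_of (h : σ.IsTri l N b) (M : Submodule ℂ (Fin 2 → SFun))
    (hP : ∀ u ∈ M, (fun i => sgnZ (N i) • eps (u i)) ∈ M) (hD : ∀ u ∈ M, (fun i => D (u i)) ∈ M)
    (hE : ∀ u ∈ M, (fun i => Eo (l + N i / 2) (u i)) ∈ M)
    (hF : ∀ u ∈ M, ![Fo (l + N 0 / 2) (u 0),
      Fo (l + N 1 / 2) (u 1) + b 1 0 • Dp (N 1 - N 0) (u 0)] ∈ M) : σ.IsInvariant M := by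
  refine isInvariant_of_generators σ M (fun u hu => ?_) (fun u hu => ?_) (fun u hu => ?_)
    fun u hu => ?_
  · convert hP u hu using 1; funext i; exact h.par u i
  · convert M.smul_mem (1 / 2 : ℂ) (hD u hu) using 1; funext i; exact h.act1 u i
  · convert M.smul_mem (1 / 2 : ℂ) (hE u hu) using 1; funext i; exact h.act3 u i
  · convert M.smul_mem (1 / 2 : ℂ) (hF u hu) using 1; funext i
    fin_cases i
    · exact h.act5_zero u
    · exact h.act5_one u

lemma IsTri.not_isChain (h : σ.IsTri l N b) {M : Submodule ℂ (Fin 2 → SFun)}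
    (hM : σ.IsInvariant M) (h1 : ∃ u ∈ M, u 0 ≠ 0) (h2 : ∃ v, ![0, v] ∉ M) : ¬ σ.IsChain := by
  have hW : σ.IsInvariant (LinearMap.ker (LinearMap.proj 0 : (Fin 2 → SFun) →ₗ[ℂ] SFun)) := by
    refine h.isInvariant_of _ ?_ ?_ ?_ ?_ <;> intro u hu <;> have hu : u 0 = 0 := hu <;>
      rw [LinearMap.mem_ker, LinearMap.proj_apply] <;> simp [hu]
  intro hc
  obtain ⟨u, hu, hu0⟩ := h1
  obtain ⟨v, hv⟩ := h2
  rcases hc _ _ hM hW with h3 | h3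
  · exact hu0 (h3 hu)
  · exact hv (h3 rfl)

lemma IsTri.ne_zero_of_isChain (h : σ.IsTri l N b) (hc : σ.IsChain) :
    b 1 0 ≠ 0 ∧ 3 ≤ N 1 - N 0 := by
  by_contra hcon
  have hz : ∀ v, b 1 0 • Dp (N 1 - N 0) v = 0 := by
    intro v
    by_cases hb : b 1 0 = 0
    · rw [hb, zero_smul]
    · have : N 1 - N 0 < 3 := by by_contra h3; exact hcon ⟨hb, by omega⟩
      rw [Dp, if_pos this]; simp
  refine h.not_isChain (M := LinearMap.ker (LinearMap.proj 1 : (Fin 2 → SFun) →ₗ[ℂ] SFun)) ?_ ?_ ?_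
    hc
  · refine h.isInvariant_of _ ?_ ?_ ?_ ?_ <;> intro u hu <;> have hu : u 1 = 0 := hu <;>
      rw [LinearMap.mem_ker, LinearMap.proj_apply] <;> simp [hu, hz]
  · exact ⟨![bv 0, 0], rfl, bv_ne_zero 0⟩
  · exact ⟨bv 0, fun h0 => bv_ne_zero 0 h0⟩

lemma IsTri.not_isChain_of_weight_zero (h : σ.IsTri l N b) (h0 : l + (N 0 : ℂ) / 2 = 0)
    (hn : 4 ≤ N 1 - N 0) : ¬ σ.IsChain := by
  obtain ⟨k, hk⟩ : ∃ k : ℕ, N 1 - N 0 = ((k + 1 : ℕ) : ℤ) + 3 :=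
    ⟨(N 1 - N 0 - 4).toNat, by omega⟩
  refine h.not_isChain (M := LinearMap.ker (LinearMap.proj 1 : (Fin 2 → SFun) →ₗ[ℂ] SFun) ⊓
    LinearMap.ker (D ∘ₗ LinearMap.proj 0 : (Fin 2 → SFun) →ₗ[ℂ] SFun)) ?_ ?_ ?_
  · refine h.isInvariant_of _ ?_ ?_ ?_ ?_ <;> rintro u ⟨hu, hu'⟩ <;> have hu : u 1 = 0 := hu <;>
      have hu' : D (u 0) = 0 := hu' <;> refine ⟨?_, ?_⟩ <;>
      simp only [SetLike.mem_coe, LinearMap.mem_ker, LinearMap.proj_apply, LinearMap.comp_apply]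
    · simp [hu]
    · have := LinearMap.congr_fun eps_D_smul (u 0)
      simp only [Module.End.mul_apply, hu', map_zero, LinearMap.smul_apply] at this
      rw [map_smul, (smul_eq_zero.1 this.symm).resolve_left (by norm_num), smul_zero]
    · simp [hu]
    · simp [hu']
    · simp [hu]
    · simp [h0, Eo, hu']
    · simp only [Matrix.cons_val_one, hu, map_zero, zero_add]
      rw [hk, StablePair.Dp_apply, pow_succ, Module.End.mul_apply, hu']; simp
    · simp [h0, Fo, hu']
  · exact ⟨![bv 0, 0], ⟨rfl, D_bv_zero⟩, bv_ne_zero 0⟩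
  · exact ⟨bv 0, fun h0 => bv_ne_zero 0 h0.1⟩

lemma IsTri.not_isChain_of_odd (h : σ.IsTri l N b) (k : ℕ) (hk : N 1 - N 0 = k + 3)
    (hk' : Even k) (ha : al (k + 3) (l + N 0 / 2) = 0) (hka : ka (k + 3) (l + N 0 / 2) ≠ 0) :
    ¬ σ.IsChain := by
  set μ := l + (N 0 : ℂ) / 2 with hμ
  set t : ℂ := -b 1 0 / ka (k + 3) μ with ht
  have hw : l + (N 1 : ℂ) / 2 = μ + ((k + 3 : ℕ) : ℂ) / 2 := by
    have : (N 1 : ℂ) = N 0 + (k + 3) := by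
      have : N 1 = N 0 + (k + 3) := by omega
      rw [this]; push_cast; ring
    rw [this, hμ]; push_cast; ring
  have hpow : ((-1 : ℂ)) ^ k = 1 := hk'.neg_one_pow
  have hpow3 : ((-1 : ℂ)) ^ (k + 3) = -1 := by rw [pow_add, hpow]; norm_num
  have hs : sgnZ (N 1) = - sgnZ (N 0) := by
    have : N 1 = N 0 + (N 1 - N 0) := by ring
    rw [this, sgnZ_add, hk]
    have : Odd ((k : ℤ) + 3) := by
      obtain ⟨j, rfl⟩ := hk'
      exact ⟨j + 1, by push_cast; ring⟩
    rw [show sgnZ ((k : ℤ) + 3) = -1 by rw [sgnZ, if_pos this]]; ring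
  refine h.not_isChain (M := LinearMap.ker ((LinearMap.proj 1 : (Fin 2 → SFun) →ₗ[ℂ] SFun) -
    t • ((D ^ (k + 3) : Module.End ℂ SFun) ∘ₗ
      (LinearMap.proj 0 : (Fin 2 → SFun) →ₗ[ℂ] SFun)))) ?_ ?_ ?_
  · refine h.isInvariant_of _ ?_ ?_ ?_ ?_ <;> intro u hu <;>
      have hu : u 1 = t • (D ^ (k + 3)) (u 0) := sub_eq_zero.1 hu <;>
      refine sub_eq_zero.2 ?_ <;>
      simp only [LinearMap.proj_apply, LinearMap.smul_apply, LinearMap.comp_apply]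
    · have := LinearMap.congr_fun (eps_D_pow (k + 3)) (u 0)
      simp only [Module.End.mul_apply, LinearMap.smul_apply, hpow3] at this
      rw [hu, map_smul, this, hs, map_smul]; module
    · have := LinearMap.congr_fun (D_pow_D (k + 3)) (u 0)
      simp only [Module.End.mul_apply] at this
      rw [hu, map_smul, this]
    · have := LinearMap.congr_fun (Eo_D_pow (k + 3) μ) (u 0)
      rw [ha, zero_smul, add_zero] at this
      simp only [Module.End.mul_apply] at this
      rw [hu, map_smul, hw, this]
    · have h1 := LinearMap.congr_fun (Fo_D_pow (k + 3) μ) (u 0)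
      have h2 := LinearMap.congr_fun (eps_D_pow k) (u 0)
      rw [hpow, one_smul] at h2
      simp only [ha, mul_zero, zero_mul, zero_smul, add_zero, show k + 3 - 3 = k by omega,
        LinearMap.add_apply, LinearMap.smul_apply, Module.End.mul_apply] at h1 h2
      simp only [Matrix.cons_val_zero, Matrix.cons_val_one]
      rw [hu, map_smul, hw, h1, hk, StablePair.Dp_apply, h2, smul_add, smul_smul, add_assoc,
        ← add_smul]
      have : t * ka (k + 3) μ + b 1 0 = 0 := by rw [ht, div_mul_cancel₀ _ hka]; ring
      rw [this, zero_smul, add_zero]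
  · refine ⟨![bv 0, t • (D ^ (k + 3)) (bv 0)], ?_, bv_ne_zero 0⟩
    exact sub_eq_zero.2 rfl
  · refine ⟨bv 0, fun h0 => bv_ne_zero 0 ?_⟩
    have : bv 0 = t • (D ^ (k + 3)) 0 := sub_eq_zero.1 h0
    rw [this, map_zero, smul_zero]

open StablePair in
/-- For lengths `3/2`, `2` and `5/2`, the weight of a uniserial two-step extension is good. -/
lemma IsTri.good_of_isChain (h : σ.IsTri l N b) (hc : σ.IsChain)
    (hn : N 1 - N 0 = 3 ∨ N 1 - N 0 = 4 ∨ N 1 - N 0 = 5) : Good (l + N 0 / 2) (N 1 - N 0) := by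
  rcases hn with hn | hn | hn
  · refine Or.inl ⟨hn, fun h0 => h.not_isChain_of_odd 0 (by simpa using hn) (by decide) ?_ ?_ hc⟩
    · rw [h0]; change al (2 * 1 + 1) _ = 0; rw [al_two_mul_add_one]; norm_num
    · rw [h0]; change ka (2 * 1 + 1) _ ≠ 0; rw [ka_two_mul_add_one]; norm_num
  · exact Or.inr (Or.inl ⟨hn, fun h0 => h.not_isChain_of_weight_zero h0 (by omega) hc⟩)
  · refine Or.inr (Or.inr (Or.inl ⟨hn, fun h0 => h.not_isChain_of_weight_zero h0 (by omega) hc,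
      fun h0 => h.not_isChain_of_odd 2 (by simpa using hn) (by decide) ?_ ?_ hc⟩))
    · rw [h0]; change al (2 * 2 + 1) _ = 0; rw [al_two_mul_add_one]; norm_num
    · rw [h0]; change ka (2 * 2 + 1) _ ≠ 0; rw [ka_two_mul_add_one]; norm_num

end Two

end KRep

/-! ## The Jacobi identity and the action on operators -/

/-- The super Jacobi identity with signs `x`, `y`, `z`, and with two copies of the two acting elements
(acting on the left and on the right of `t`). -/
lemma superJacobi {A : Type*} [Ring A] [Algebra ℂ A] {x y z u v w : ℂ} (hx : x * x = 1)
    (hu : u = y * z) (hv : v = x * y) (hw : w = x * z) (a a' b b' t : A) :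
    (a * b - x • (b * a)) * t - u • (t * (a' * b' - x • (b' * a'))) =
      (a * (b * t - z • (t * b')) - v • ((b * t - z • (t * b')) * a')) -
      x • (b * (a * t - y • (t * a')) - w • ((a * t - y • (t * a')) * b')) := by
  subst hu hv hw
  simp only [mul_sub, sub_mul, smul_mul_assoc, mul_smul_comm, ← mul_assoc, smul_sub, smul_smul,
    show x * (x * z) = z by rw [← mul_assoc, hx, one_mul],
    show x * (x * z * y) = y * z by rw [← mul_assoc, ← mul_assoc, hx, one_mul, mul_comm]]
  module

lemma sgn_add_mul (i j k : ZMod 2) : sgn ((i + j) * k) = sgn (i * k) * sgn (j * k) := by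
  have e : (1 : ZMod 2) + 1 = 0 := rfl
  rcases zmod_cases i with rfl | rfl <;> rcases zmod_cases j with rfl | rfl <;>
  rcases zmod_cases k with rfl | rfl <;> simp [e]

lemma sgn_mul_add (i j k : ZMod 2) : sgn (i * (j + k)) = sgn (i * j) * sgn (i * k) := by
  rw [mul_comm, sgn_add_mul, mul_comm j, mul_comm k]

lemma cbracket_jacobi {i j k : ZMod 2} {F G H : SFun} (hF : Homog i F) (hG : Homog j G)
    (hH : Homog k H) : cbracket (cbracket F G) H =
      cbracket F (cbracket G H) - sgn (i * j) • cbracket G (cbracket F H) := by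
  apply vf_injective
  have v0 : ∀ F, vf F = densityOp 0 F := fun F => by simp [densityOp_apply]
  have vs : ∀ (c : ℂ) F, vf (c • F) = c • vf F := fun c F => by rw [v0, v0, map_smul]
  have vsub : ∀ F G, vf (F - G) = vf F - vf G := fun F G => by rw [v0, v0, v0, map_sub]
  rw [vsub, vs, vf_bracket _ _ _ _ (homog_cbracket hF hG) hH,
    vf_bracket _ _ _ _ hF (homog_cbracket hG hH), vf_bracket _ _ _ _ hG (homog_cbracket hF hH),
    vf_bracket _ _ _ _ hF hG, vf_bracket _ _ _ _ hF hH, vf_bracket _ _ _ _ hG hH]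
  have hw : sgn (j * (i + k)) = sgn (i * j) * sgn (j * k) := by rw [sgn_mul_add, mul_comm j i]
  generalize vf F = a, vf G = b, vf H = c
  exact superJacobi (sgn_mul_self _) (sgn_add_mul i j k) (sgn_mul_add i j k) hw a a b b c

/-- The action of a Hamiltonian of parity `i` on operators of degree `j` from `𝔽(l)` to `𝔽(μ)`. -/
def hact (l μ : ℂ) (i j : ZMod 2) (F : SFun) (T : Module.End ℂ SFun) : Module.End ℂ SFun :=
  densityOp μ F * T - sgn (i * j) • (T * densityOp l F)

lemma hact_bracket (l μ : ℂ) {i i' : ZMod 2} (j : ZMod 2) {F F' : SFun} (hF : Homog i F)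
    (hF' : Homog i' F') (T : Module.End ℂ SFun) :
    hact l μ (i + i') j (cbracket F F') T =
      hact l μ i (i' + j) F (hact l μ i' j F' T) -
        sgn (i * i') • hact l μ i' (i + j) F' (hact l μ i j F T) := by
  unfold hact
  rw [densityOp_bracket _ i i' F F' hF hF', densityOp_bracket _ i i' F F' hF hF']
  have hw : sgn (i' * (i + j)) = sgn (i * i') * sgn (i' * j) := by rw [sgn_mul_add, mul_comm i' i]
  generalize densityOp μ F = a, densityOp l F = a', densityOp μ F' = b, densityOp l F' = b'
  exact superJacobi (sgn_mul_self _) (sgn_add_mul i i' j) (sgn_mul_add i i' j) hw a a' b b' T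

lemma hact_smul_left (l μ : ℂ) (i j : ZMod 2) (c : ℂ) (F : SFun) (T : Module.End ℂ SFun) :
    hact l μ i j (c • F) T = c • hact l μ i j F T := by
  simp only [hact, map_smul, smul_mul_assoc, mul_smul_comm, smul_sub, smul_comm c]

lemma hact_smul_right (l μ : ℂ) (i j : ZMod 2) (c : ℂ) (F : SFun) (T : Module.End ℂ SFun) :
    hact l μ i j F (c • T) = c • hact l μ i j F T := by
  simp only [hact, smul_mul_assoc, mul_smul_comm, smul_sub, smul_comm c]

lemma hact_sub_right (l μ : ℂ) (i j : ZMod 2) (F : SFun) (S T : Module.End ℂ SFun) :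
    hact l μ i j F (S - T) = hact l μ i j F S - hact l μ i j F T := by
  simp only [hact, mul_sub, sub_mul, smul_sub]; abel

lemma homog_conformal_induction {i : ZMod 2} (p : Submodule ℂ SFun)
    (hb : ∀ k : ℕ, k < 5 → (k : ZMod 2) = i → bv k ∈ p) {F : SFun} (h : Homog i F) (hF : F ∈ conformal) :
    F ∈ p := by
  let q : SFun →ₗ[ℂ] SFun := (1 / 2 : ℂ) • (LinearMap.id + sgn i • parity)
  have hq : ∀ {j : ZMod 2} {G : SFun}, Homog j G → q G = ((1 + sgn i * sgn j) / 2) • G := by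
    intro j G hG
    change (1 / 2 : ℂ) • (G + sgn i • parity G) = _
    rw [parity_homog hG]; module
  have h1 : conformal ≤ p.comap q := by
    refine conformal_le fun k hk => ?_
    rw [Submodule.mem_comap, hq (homog_bv k)]
    by_cases hki : (k : ZMod 2) = i
    · exact p.smul_mem _ (hb k hk hki)
    · have : sgn i * sgn (k : ZMod 2) = -1 := by
        rcases zmod_cases i with rfl | rfl <;> rcases zmod_cases (k : ZMod 2) with h | h <;>
          rw [h] at hki ⊢ <;> simp at hki ⊢
      rw [this]; simp
  have h2 := h1 hF
  rw [Submodule.mem_comap, hq h, sgn_mul_self] at h2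
  simpa using h2

/-- Equivariance of a linear map under a Hamiltonian. -/
def EquivariantAt (l μ : ℂ) (φ : SFun →ₗ[ℂ] Module.End ℂ SFun) (i j : ZMod 2) (F G : SFun) : Prop :=
  hact l μ i j F (φ G) = φ (cbracket F G)

section Equivariance

variable {l μ : ℂ} {φ : SFun →ₗ[ℂ] Module.End ℂ SFun}

lemma EquivariantAt.bracket_left {i i' j : ZMod 2} {F F' G : SFun} (hF : Homog i F)
    (hF' : Homog i' F') (hG : Homog j G) (h1 : EquivariantAt l μ φ i j F G)
    (h2 : EquivariantAt l μ φ i' j F' G) (h3 : EquivariantAt l μ φ i (i' + j) F (cbracket F' G))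
    (h4 : EquivariantAt l μ φ i' (i + j) F' (cbracket F G)) :
    EquivariantAt l μ φ (i + i') j (cbracket F F') G := by
  unfold EquivariantAt at *
  rw [hact_bracket l μ j hF hF', h2, h3, h1, h4, cbracket_jacobi hF hF' hG, map_sub, map_smul]

lemma EquivariantAt.bracket_right {i i' j : ZMod 2} {F F' G : SFun} (hF : Homog i F)
    (hF' : Homog i' F') (hG : Homog j G) (h1 : EquivariantAt l μ φ i j F G)
    (h2 : EquivariantAt l μ φ i' j F' G) (h3 : EquivariantAt l μ φ (i + i') j (cbracket F F') G)
    (h4 : EquivariantAt l μ φ i' (i + j) F' (cbracket F G)) :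
    EquivariantAt l μ φ i (i' + j) F (cbracket F' G) := by
  unfold EquivariantAt at *
  rw [hact_bracket l μ j hF hF', h2, h1, h4, cbracket_jacobi hF hF' hG, map_sub, map_smul] at h3
  exact sub_left_injective h3

lemma EquivariantAt.smul_right {i j : ZMod 2} {F G : SFun} (h : EquivariantAt l μ φ i j F G)
    (c : ℂ) : EquivariantAt l μ φ i j F (c • G) := by
  unfold EquivariantAt at *
  rw [map_smul, hact_smul_right, h, cbracket_smul_right, map_smul]

lemma EquivariantAt.of_smul_right {i j : ZMod 2} {F G : SFun} {c : ℂ} (hc : c ≠ 0)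
    (h : EquivariantAt l μ φ i j F (c • G)) : EquivariantAt l μ φ i j F G := by
  have := h.smul_right c⁻¹
  rwa [smul_smul, inv_mul_cancel₀ hc, one_smul] at this

lemma EquivariantAt.smul_left {i j : ZMod 2} {F G : SFun} (h : EquivariantAt l μ φ i j F G)
    (c : ℂ) : EquivariantAt l μ φ i j (c • F) G := by
  unfold EquivariantAt at *
  rw [hact_smul_left, h, cbracket_smul_left, map_smul]

lemma EquivariantAt.of_smul_left {i j : ZMod 2} {F G : SFun} {c : ℂ} (hc : c ≠ 0)
    (h : EquivariantAt l μ φ i j (c • F) G) : EquivariantAt l μ φ i j F G := by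
  have := h.smul_left c⁻¹
  rwa [smul_smul, inv_mul_cancel₀ hc, one_smul] at this

lemma equivariantAt_of_bv {i j : ZMod 2} {F : SFun}
    (h : ∀ k : ℕ, (k : ZMod 2) = j → EquivariantAt l μ φ i j F (bv k)) {G : SFun}
    (hG : Homog j G) : EquivariantAt l μ φ i j F G := by
  let p : Submodule ℂ SFun :=
    { carrier := {G | EquivariantAt l μ φ i j F G}
      zero_mem' := by simp [EquivariantAt, hact, cbracket]
      add_mem' := fun {G H} hG hH => by
        simp only [Set.mem_ofPred_eq, EquivariantAt, hact, map_add, cbracket_add_right, mul_add,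
          add_mul, smul_add] at hG hH ⊢
        rw [← hG, ← hH]; abel
      smul_mem' := fun c G hG => EquivariantAt.smul_right hG c }
  exact homog_induction p h hG

end Equivariance

/-- The coefficient in `{ξ, v_k} = c v_{k-1}`. -/
lemma exists_cbracket_bv1 (k : ℕ) : ∃ c : ℂ, cbracket (bv 1) (bv (k + 1)) = c • bv k := by
  rcases Nat.even_or_odd' k with ⟨q, rfl | rfl⟩
  · exact ⟨_, cbracket_bv1_odd q⟩
  · exact ⟨_, cbracket_bv1_even q⟩

lemma cbracket_bv1_bv0 : cbracket (bv 1) (bv 0) = 0 := by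
  rw [bv_one, bv_zero]; simpa using cbracket_odd_even 0 0

/-- The coefficient in `{ξ x, v_k} = c v_{k+1}`. -/
def ec (k : ℕ) : ℂ := if Even k then (k : ℂ) / 4 - 1 else 1 / 2

lemma cbracket_bv3 (k : ℕ) : cbracket (bv 3) (bv k) = ec k • bv (k + 1) := by
  rcases Nat.even_or_odd' k with ⟨q, rfl | rfl⟩
  · rw [cbracket_bv3_even, ec, if_pos (by simp)]; congr 1; push_cast; ring
  · rw [cbracket_bv3_odd, ec, if_neg (by simp)]; rfl

lemma ec_ne_zero {k : ℕ} (hk : 5 ≤ k) : ec k ≠ 0 := by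
  unfold ec
  split_ifs
  · intro h
    have : (k : ℂ) = 4 := by linear_combination 4 * h
    have : k = 4 := by exact_mod_cast this
    omega
  · norm_num

lemma natCast_succ_zmod (k : ℕ) : ((k + 1 : ℕ) : ZMod 2) = 1 + (k : ZMod 2) := by
  push_cast; ring

/-- A linear map which vanishes on `𝔰` is an `𝔰`-relative cochain as soon as it is equivariant under
`𝕏(ξ x)`, and its value on `𝕏(ξ x²)` is a lowest weight vector. -/
theorem isRelCochain_of_generator {l : ℂ} {n : ℤ} {φ : SFun →ₗ[ℂ] Module.End ℂ SFun}
    (hp : ∀ F v, sgnZ n • parity (φ F v) = φ (parity F) (parity v)) (h0 : ∀ k < 5, φ (bv k) = 0)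
    (h3 : ∀ k : ℕ, EquivariantAt l (l + n / 2) φ 1 k (bv 3) (bv k))
    (hD : D * φ (bv 5) = -(φ (bv 5) * D))
    (hN : Nop * φ (bv 5) = φ (bv 5) * Nop + ((3 - n : ℂ) / 2) • φ (bv 5)) :
    IsRelCochain l (l + n / 2) n φ := by
  have hlow : ∀ (i j : ZMod 2) (F : SFun) (k : ℕ), k < 5 → φ (cbracket F (bv k)) = 0 →
      EquivariantAt l (l + n / 2) φ i j F (bv k) := by
    intro i j F k hk h
    rw [EquivariantAt, h0 k hk, h]; simp [hact]
  have h3' : ∀ (j : ZMod 2) {G : SFun}, Homog j G → EquivariantAt l (l + n / 2) φ 1 j (bv 3) G :=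
    fun j G hG => equivariantAt_of_bv (fun k hk => hk ▸ h3 k) hG
  -- `𝕏(x)`
  have h2 : ∀ k : ℕ, EquivariantAt l (l + n / 2) φ 0 k (bv 2) (bv k) := by
    intro k
    by_cases hk : k < 5
    · exact hlow _ _ _ _ hk (by rw [cbracket_bv2, map_smul, h0 k hk, smul_zero])
    · obtain ⟨m, rfl⟩ : ∃ m, k = m + 5 := ⟨k - 5, by omega⟩
      clear hk
      induction m with
      | zero =>
        unfold EquivariantAt hact
        rw [cbracket_bv2, zero_mul, sgn_zero, one_smul, densityOp_bv2, densityOp_bv2, add_mul,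
          mul_add, smul_mul_assoc, mul_smul_comm, one_mul, mul_one, hN, map_smul]
        push_cast; module
      | succ m ih =>
        refine EquivariantAt.of_smul_right (c := ec (m + 5)) (ec_ne_zero (by omega)) ?_
        rw [show m + 1 + 5 = m + 5 + 1 by ring, ← cbracket_bv3, natCast_succ_zmod]
        refine EquivariantAt.bracket_right homog_zero_bv2 homog_one_bv3 (homog_bv _) ih (h3 _) ?_ ?_
        · rw [cbracket_bv2, zero_add]; exact (h3 _).smul_left _
        · rw [cbracket_bv2, zero_add]; exact (h3 _).smul_right _
  have h2' : ∀ (j : ZMod 2) {G : SFun}, Homog j G → EquivariantAt l (l + n / 2) φ 0 j (bv 2) G :=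
    fun j G hG => equivariantAt_of_bv (fun k hk => hk ▸ h2 k) hG
  have h1 : ∀ k : ℕ, EquivariantAt l (l + n / 2) φ 1 k (bv 1) (bv k) := by
    intro k
    by_cases hk : k < 5
    · refine hlow _ _ _ _ hk ?_
      rcases k with _ | k
      · rw [cbracket_bv1_bv0, map_zero]
      · obtain ⟨c, hc⟩ := exists_cbracket_bv1 k
        rw [hc, map_smul, h0 k (by omega), smul_zero]
    · obtain ⟨m, rfl⟩ : ∃ m, k = m + 5 := ⟨k - 5, by omega⟩
      clear hk
      induction m with
      | zero =>
        unfold EquivariantAt hact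
        rw [zero_add, cbracket_bv1_bv5, map_smul, h0 4 (by norm_num), smul_zero, densityOp_bv1,
          densityOp_bv1, smul_mul_assoc, mul_smul_comm, hD,
          show ((5 : ℕ) : ZMod 2) = 1 from zmod_two_mul_add_one 2,
          sgn_one_mul_one]
        module
      | succ m ih =>
        refine EquivariantAt.of_smul_right (c := ec (m + 5)) (ec_ne_zero (by omega)) ?_
        rw [show m + 1 + 5 = m + 5 + 1 by ring, ← cbracket_bv3, natCast_succ_zmod]
        refine EquivariantAt.bracket_right homog_one_bv1 homog_one_bv3 (homog_bv _) ih (h3 _) ?_ ?_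
        · rw [cbracket_bv1_bv3]; exact (h2 _).smul_left _
        · exact h3' _ (homog_cbracket homog_one_bv1 (homog_bv _))
  have h1' : ∀ (j : ZMod 2) {G : SFun}, Homog j G → EquivariantAt l (l + n / 2) φ 1 j (bv 1) G :=
    fun j G hG => equivariantAt_of_bv (fun k hk => hk ▸ h1 k) hG
  have br : ∀ {F F' : SFun}, Homog 1 F → Homog 1 F' →
      (∀ (j : ZMod 2) {G : SFun}, Homog j G → EquivariantAt l (l + n / 2) φ 1 j F G) →
      (∀ (j : ZMod 2) {G : SFun}, Homog j G → EquivariantAt l (l + n / 2) φ 1 j F' G) →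
      ∀ (j : ZMod 2) {G : SFun}, Homog j G → EquivariantAt l (l + n / 2) φ 0 j (cbracket F F') G :=
    fun {F F'} hF hF' h h' j G hG => by
      have e : (1 : ZMod 2) + 1 = 0 := by decide
      rw [← e]
      exact EquivariantAt.bracket_left hF hF' hG (h j hG) (h' j hG)
        (h _ (homog_cbracket hF' hG)) (h' _ (homog_cbracket hF hG))
  refine ⟨hp, fun F hF => ?_, fun i j F G hF hG hFc => ?_⟩
  · have : conformal ≤ LinearMap.ker φ := conformal_le h0
    exact this hF
  · let p : Submodule ℂ SFun :=
      { carrier := {F | EquivariantAt l (l + n / 2) φ i j F G}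
        zero_mem' := by simp [EquivariantAt, hact, cbracket]
        add_mem' := fun {F F'} hF hF' => by
          simp only [Set.mem_ofPred_eq, EquivariantAt, hact, map_add, cbracket_add_left, mul_add,
            add_mul, smul_add] at hF hF' ⊢
          rw [← hF, ← hF']; abel
        smul_mem' := fun c F hF => EquivariantAt.smul_left hF c }
    have nz : (1 / 2 : ℂ) ≠ 0 := by norm_num
    have z0 : ((0 : ℕ) : ZMod 2) = 0 := by decide
    have z1 : ((1 : ℕ) : ZMod 2) = 1 := by decide
    have z2 : ((2 : ℕ) : ZMod 2) = 0 := by decide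
    have z3 : ((3 : ℕ) : ZMod 2) = 1 := by decide
    have z4 : ((4 : ℕ) : ZMod 2) = 0 := by decide
    refine homog_conformal_induction (i := i) p (fun k hk hki => ?_) hF hFc
    change EquivariantAt l (l + n / 2) φ i j (bv k) G
    interval_cases k
    · rw [← hki, z0]
      have := br homog_one_bv1 homog_one_bv1 h1' h1' j hG
      rw [cbracket_bv1_bv1] at this
      exact EquivariantAt.of_smul_left nz this
    · rw [← hki, z1]; exact h1' j hG
    · rw [← hki, z2]; exact h2' j hG
    · rw [← hki, z3]; exact h3' j hG
    · rw [← hki, z4]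
      have := br homog_one_bv3 homog_one_bv3 h3' h3' j hG
      rw [cbracket_bv3_bv3] at this
      exact EquivariantAt.of_smul_left nz this

/-! ## The cochains `β` -/

lemma sigmaHalf_eq (l : ℂ) (n : ℕ) (T : Module.End ℂ SFun) :
    sigmaHalf l n T = Eo (l + n / 2) * T - opParity T * Eo l := by
  have : ∀ l : ℂ, densityOp l (inr (2 * X)) = Eo l := fun l => by
    have e : (inr (2 * X) : SFun) = (2 : ℂ) • bv 3 := by
      rw [bv_three, ← inr_smul]; congr 1; rw [smul_eq_C_mul]; rfl
    rw [e, map_smul, densityOp_bv3, smul_smul]; norm_num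
  rw [sigmaHalf, this, this]

lemma opParity_eq (T : Module.End ℂ SFun) : opParity T = eps * T * eps := rfl

lemma opParity_mul (S T : Module.End ℂ SFun) : opParity (S * T) = opParity S * opParity T := by
  rw [opParity_eq, opParity_eq, opParity_eq,
    show eps * S * eps * (eps * T * eps) = eps * S * (eps * eps) * T * eps by
    simp only [mul_assoc], eps_eps]; simp only [mul_assoc, one_mul]

lemma opParity_Eo (l : ℂ) : opParity (Eo l) = (-1 : ℂ) • Eo l := by
  rw [opParity_eq, eps_Eo, ← neg_one_smul ℂ, smul_mul_assoc, mul_assoc, eps_eps, mul_one]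

lemma opParity_smul (c : ℂ) (T : Module.End ℂ SFun) : opParity (c • T) = c • opParity T := by
  rw [opParity_eq, opParity_eq, mul_smul_comm, smul_mul_assoc]

lemma opParity_sub (S T : Module.End ℂ SFun) : opParity (S - T) = opParity S - opParity T := by
  rw [opParity_eq, opParity_eq, opParity_eq, mul_sub, sub_mul]

lemma opParity_sigmaHalf (l : ℂ) (n : ℕ) (T : Module.End ℂ SFun) :
    opParity (sigmaHalf l n T) = (-1 : ℂ) • sigmaHalf l n (opParity T) := by
  rw [sigmaHalf_eq, sigmaHalf_eq, opParity_sub, opParity_mul, opParity_mul, opParity_Eo,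
    opParity_Eo, smul_mul_assoc, mul_smul_comm, smul_sub]

lemma sigmaHalf_smul (l : ℂ) (n : ℕ) (c : ℂ) (T : Module.End ℂ SFun) :
    sigmaHalf l n (c • T) = c • sigmaHalf l n T := by
  rw [sigmaHalf_eq, sigmaHalf_eq, opParity_smul, mul_smul_comm, smul_mul_assoc, smul_sub]

lemma opParity_Dbar_pow (k : ℕ) : opParity (Dbar ^ k) = ((-1 : ℂ) ^ k) • Dbar ^ k := by
  have h : opParity Dbar = (-1 : ℂ) • Dbar := by
    refine end_ext ?_ ?_ <;> intro v <;> simp [opParity]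
  induction k with
  | zero => rw [pow_zero, pow_zero, one_smul, opParity_eq, mul_one, eps_eps]
  | succ k ih => rw [pow_succ, opParity_mul, ih, h, smul_mul_assoc, mul_smul_comm, smul_smul,
      ← pow_succ]

lemma opParity_iterate (l : ℂ) (n m k : ℕ) :
    opParity ((sigmaHalf l n)^[m] (Dbar ^ k)) =
      ((-1 : ℂ) ^ (m + k)) • (sigmaHalf l n)^[m] (Dbar ^ k) := by
  induction m with
  | zero => rw [Function.iterate_zero_apply, opParity_Dbar_pow, zero_add]
  | succ m ih =>
    rw [Function.iterate_succ_apply', opParity_sigmaHalf, ih, sigmaHalf_smul, smul_smul]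
    congr 1; ring

lemma exists_Dbar_pow (k : ℕ) : ∃ c : ℂ, c ≠ 0 ∧ Dbar ^ k = c • (eps ^ k * D ^ k) := by
  have hDb : Dbar = eps * D := by rw [← eps_Dbar, ← mul_assoc, eps_eps, one_mul]
  induction k with
  | zero => exact ⟨1, one_ne_zero, by simp⟩
  | succ k ih =>
    obtain ⟨c, hc, e⟩ := ih
    refine ⟨c * (-1) ^ k, mul_ne_zero hc (pow_ne_zero _ (by norm_num)), ?_⟩
    have h := eps_D_pow k
    have h' : D ^ k * eps = ((-1 : ℂ) ^ k) • (eps * D ^ k) := by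
      rw [h, smul_smul, ← mul_pow]; norm_num
    rw [pow_succ, e, hDb, smul_mul_assoc, mul_assoc, ← mul_assoc (D ^ k), h', smul_mul_assoc,
      mul_smul_comm, smul_smul, pow_succ eps, pow_succ D]
    simp only [mul_assoc]

lemma eps_pow_two_mul (j : ℕ) : eps ^ (2 * j) = 1 := by
  rw [pow_mul, pow_two, eps_eps, one_pow]

/-- The numerical factor of `β̄` on the basis. -/
def betaFactor (n m : ℕ) : ℂ := 2 * (-1) ^ (n * m) / ((m / 2).factorial : ℂ)

lemma betaBar_apply (l : ℂ) (n : ℕ) (F : SFun) : betaBar l n F =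
    (F.fst.sum fun k c => if 3 ≤ k then c • betaBarValue l n (2 * k - 5) else 0) +
    F.snd.sum fun k c => if 2 ≤ k then (c / 2) • betaBarValue l n (2 * k - 4) else 0 := rfl

lemma betaBar_bv_low (l : ℂ) (n : ℕ) {k : ℕ} (hk : k < 5) : betaBar l n (bv k) = 0 := by
  rcases Nat.even_or_odd' k with ⟨q, rfl | rfl⟩
  · rw [bv_even]
    rw [betaBar_apply, fst_inl, snd_inl, sum_zero_index, ← monomial_one_right_eq_X_pow, sum_monomial_index,
      if_neg (by omega), add_zero]
    split_ifs <;> simp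
  · rw [bv_odd]
    rw [betaBar_apply, fst_inr, snd_inr, sum_zero_index, ← monomial_one_right_eq_X_pow, sum_monomial_index,
      if_neg (by omega), add_zero]
    split_ifs <;> simp

lemma betaBar_bv (l : ℂ) (n m : ℕ) : betaBar l n (bv (m + 5)) =
    betaFactor n m • (sigmaHalf l n)^[m] (Dbar ^ (n - 3)) := by
  rcases Nat.even_or_odd' m with ⟨q, rfl | rfl⟩
  · rw [show 2 * q + 5 = 2 * (q + 2) + 1 by ring, bv_odd]
    rw [betaBar_apply, fst_inr, snd_inr, sum_zero_index, ← monomial_one_right_eq_X_pow, sum_monomial_index,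
      if_pos (by omega), zero_add, show 2 * (q + 2) - 4 = 2 * q by omega, betaBarValue, betaFactor,
      smul_smul, Nat.mul_mod_right, Nat.mul_div_cancel_left q two_pos]
    · congr 1
      have : (q.factorial : ℂ) ≠ 0 := by exact_mod_cast q.factorial_ne_zero
      field_simp; norm_num
    · simp
  · rw [show 2 * q + 1 + 5 = 2 * (q + 3) by ring, bv_even]
    rw [betaBar_apply, fst_inl, snd_inl, sum_zero_index, ← monomial_one_right_eq_X_pow, sum_monomial_index,
      if_pos (by omega), add_zero, show 2 * (q + 3) - 5 = 2 * q + 1 by omega, betaBarValue,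
      betaFactor, one_smul, show (2 * q + 1) % 2 = 1 by omega, show (2 * q + 1) / 2 = q by omega]
    · congr 1
      have : (q.factorial : ℂ) ≠ 0 := by exact_mod_cast q.factorial_ne_zero
      field_simp; norm_num
    · simp

lemma ec_mul_betaFactor (n m : ℕ) :
    ec (m + 5) * betaFactor n (m + 1) = (-1) ^ n / 2 * betaFactor n m := by
  have hn : ((-1 : ℂ) ^ n) * (-1) ^ n = 1 := by rw [← mul_pow]; norm_num
  rcases Nat.even_or_odd' m with ⟨q, rfl | rfl⟩
  · have e1 : ((-1 : ℂ)) ^ (n * (2 * q + 1)) = (-1) ^ n * (-1) ^ (n * (2 * q)) := by ring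
    rw [ec, if_neg (by simp [parity_simps]), betaFactor, betaFactor, e1,
      show (2 * q + 1) / 2 = q by omega,
      show (2 * q) / 2 = q by omega]
    ring
  · have e1 : ((-1 : ℂ)) ^ (n * (2 * q + 1 + 1)) = (-1) ^ n * (-1) ^ (n * (2 * q + 1)) := by ring
    have h1 : ((q + 1 : ℕ) : ℂ) ≠ 0 := by exact_mod_cast Nat.succ_ne_zero q
    have h2 : (q.factorial : ℂ) ≠ 0 := by exact_mod_cast q.factorial_ne_zero
    rw [ec, if_pos (by rw [show 2 * q + 1 + 5 = 2 * (q + 3) by ring]; simp), betaFactor, betaFactor,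
      e1, show (2 * q + 1 + 1) / 2 = q + 1 by omega, show (2 * q + 1) / 2 = q by omega,
      Nat.factorial_succ]
    push_cast at h1 ⊢
    field_simp
    ring

lemma beta_eq (l : ℂ) (n : ℕ) (hn : 3 ≤ n) (F : SFun) :
    beta l (n : ℤ) F = eps ^ n * betaBar l n F := by
  unfold beta
  rw [if_neg (by omega), Int.toNat_natCast]
  rcases Nat.even_or_odd' n with ⟨q, rfl | rfl⟩
  · rw [if_pos (by simp), eps_pow_two_mul, one_mul]
  · rw [if_neg (by simp [parity_simps]), pow_succ, eps_pow_two_mul, one_mul]; rfl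

lemma Eo_eps_pow (l : ℂ) (n : ℕ) : Eo l * eps ^ n = ((-1 : ℂ) ^ n) • (eps ^ n * Eo l) := by
  have h : Eo l * eps = (-1 : ℂ) • (eps * Eo l) := by rw [eps_Eo]; module
  induction n with
  | zero => simp
  | succ n ih => rw [pow_succ, ← mul_assoc, ih, smul_mul_assoc, mul_assoc, h, mul_smul_comm,
      smul_smul, mul_assoc, pow_succ]

lemma sgn_natCast (k : ℕ) : sgn (k : ZMod 2) = (-1) ^ k := by
  rcases Nat.even_or_odd' k with ⟨q, rfl | rfl⟩
  · rw [zmod_two_mul, sgn_zero, pow_mul]; norm_num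
  · rw [zmod_two_mul_add_one, sgn_one, pow_succ, pow_mul]; norm_num

lemma sgnZ_natCast (k : ℕ) : sgnZ (k : ℤ) = (-1) ^ k := by
  rw [sgnZ]
  rcases Nat.even_or_odd' k with ⟨q, rfl | rfl⟩
  · rw [if_neg (by simp [parity_simps]), pow_mul]; norm_num
  · rw [if_pos (by simp [parity_simps]), pow_succ, pow_mul]; norm_num

lemma eps_mul_of_opParity {T : Module.End ℂ SFun} {c : ℂ} (h : opParity T = c • T) :
    eps * T = c • (T * eps) := by
  have : opParity T * eps = eps * T := by rw [opParity_eq, mul_assoc, eps_eps, mul_one]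
  rw [← this, h, smul_mul_assoc]

lemma exists_beta_bv5 (l : ℂ) {n : ℤ} (hn : 3 ≤ n) :
    ∃ c : ℂ, c ≠ 0 ∧ beta l n (bv 5) = c • Dp n := by
  obtain ⟨k, rfl⟩ : ∃ k : ℕ, n = ((k + 3 : ℕ) : ℤ) := ⟨(n - 3).toNat, by omega⟩
  obtain ⟨c, hc, e⟩ := exists_Dbar_pow k
  refine ⟨2 * c, mul_ne_zero two_ne_zero hc, ?_⟩
  rw [beta_eq l (k + 3) (by omega), show bv 5 = bv (0 + 5) from rfl, betaBar_bv,
    Function.iterate_zero_apply, show k + 3 - 3 = k by omega, e, Dp, if_neg (by omega),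
    show (((k + 3 : ℕ) : ℤ) - 3).toNat = k by omega, mul_smul_comm, mul_smul_comm, smul_smul,
    ← mul_assoc, ← pow_add, show k + 3 + k = 2 * (k + 1) + 1 by ring, pow_succ, eps_pow_two_mul,
    one_mul]
  simp [betaFactor]

/-- `β` is an `𝔰`-relative cochain. -/
theorem isRelCochain_beta (l : ℂ) (n : ℤ) : IsRelCochain l (l + n / 2) n (beta l n) := by
  by_cases hn : n < 3
  · have : beta l n = 0 := if_pos hn
    rw [this]
    exact ⟨fun F v => by simp, fun F _ => rfl, fun i j F G _ _ _ => by simp⟩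
  obtain ⟨k, rfl⟩ : ∃ k : ℕ, n = ((k + 3 : ℕ) : ℤ) := ⟨(n - 3).toNat, by omega⟩
  obtain ⟨c, -, hc⟩ := exists_beta_bv5 l (n := ((k + 3 : ℕ) : ℤ)) (by omega)
  have low : ∀ j < 5, beta l ((k + 3 : ℕ) : ℤ) (bv j) = 0 := fun j hj => by
    rw [beta_eq l (k + 3) (by omega), betaBar_bv_low l _ hj, mul_zero]
  have val : ∀ m, beta l ((k + 3 : ℕ) : ℤ) (bv (m + 5)) =
      betaFactor (k + 3) m • (eps ^ (k + 3) * (sigmaHalf l (k + 3))^[m] (Dbar ^ k)) := fun m => by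
    rw [beta_eq l (k + 3) (by omega), betaBar_bv, mul_smul_comm, show k + 3 - 3 = k by omega]
  refine isRelCochain_of_generator ?_ low ?_ ?_ ?_
  · intro F v
    let p : Submodule ℂ SFun :=
      { carrier := {F | ∀ v, sgnZ ((k + 3 : ℕ) : ℤ) • parity (beta l ((k + 3 : ℕ) : ℤ) F v) =
          beta l ((k + 3 : ℕ) : ℤ) (parity F) (parity v)}
        zero_mem' := fun v => by simp
        add_mem' := fun {F G} hF hG v => by
          rw [map_add, map_add, map_add, LinearMap.add_apply, LinearMap.add_apply, map_add,
            smul_add, hF v, hG v]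
        smul_mem' := fun c F hF v => by
          rw [map_smul, map_smul, map_smul, LinearMap.smul_apply, LinearMap.smul_apply, map_smul,
            smul_comm, hF v] }
    have : p = ⊤ := by
      refine eq_top_of_bv p fun j v => ?_
      by_cases hj : j < 5
      · rw [parity_homog (homog_bv j), map_smul, low j hj]; simp
      · obtain ⟨m, rfl⟩ : ∃ m, j = m + 5 := ⟨j - 5, by omega⟩
        rw [parity_homog (homog_bv _), map_smul, val]
        have h1 := LinearMap.congr_fun (eps_mul_of_opParity (opParity_iterate l (k + 3) m k)) v
        have h2 : eps * eps ^ (k + 3) = eps ^ (k + 3) * eps := by rw [← pow_succ, ← pow_succ']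
        have h3 := LinearMap.congr_fun h2 ((sigmaHalf l (k + 3))^[m] (Dbar ^ k) v)
        simp only [Module.End.mul_apply, LinearMap.smul_apply, eps_apply] at h1 h3 ⊢
        rw [map_smul, h3, h1, map_smul, sgn_natCast, sgnZ_natCast, smul_smul, smul_smul, smul_smul]
        congr 1
        have h5 : ((-1 : ℂ) ^ k) * (-1) ^ k = 1 := by rw [← mul_pow]; norm_num
        linear_combination (-(betaFactor (k + 3) m) * (-1) ^ m) * h5
    exact (this ▸ Submodule.mem_top : F ∈ p) v
  · intro j
    unfold EquivariantAt
    by_cases hj : j < 5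
    · rw [low j hj, cbracket_bv3, map_smul]
      by_cases h4 : j = 4
      · subst h4
        have : ec 4 = 0 := by rw [ec, if_pos (by decide)]; norm_num
        rw [this, zero_smul]; simp [hact]
      · rw [low (j + 1) (by omega)]; simp [hact]
    · obtain ⟨m, rfl⟩ : ∃ m, j = m + 5 := ⟨j - 5, by omega⟩
      have h1 := opParity_iterate l (k + 3) m k
      have h2 := sigmaHalf_eq l (k + 3) ((sigmaHalf l (k + 3))^[m] (Dbar ^ k))
      rw [h1, smul_mul_assoc] at h2
      rw [cbracket_bv3, map_smul, show m + 5 + 1 = m + 1 + 5 by ring, val, val, hact_smul_right,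
        hact, one_mul, sgn_natCast, densityOp_bv3, densityOp_bv3, smul_mul_assoc, mul_smul_comm,
        ← mul_assoc, Eo_eps_pow, smul_mul_assoc, mul_assoc, mul_assoc, smul_smul (ec (m + 5)),
        ec_mul_betaFactor, Function.iterate_succ_apply', h2, mul_sub, mul_smul_comm]
      have h5 : ((-1 : ℂ) ^ k) * (-1) ^ k = 1 := by rw [← mul_pow]; norm_num
      push_cast
      match_scalars
      · ring
      · linear_combination (-(betaFactor (k + 3) m) * (-1) ^ m / 2) * h5
  · rw [hc, mul_smul_comm, D_Dp, smul_mul_assoc]; module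
  · rw [hc, mul_smul_comm, Nop_Dp, smul_mul_assoc]; module

/-! ## Cup products and coboundaries -/

lemma cbracket_antisymm {i j : ZMod 2} {F G : SFun} (hF : Homog i F) (hG : Homog j G) :
    cbracket G F = -(sgn (i * j) • cbracket F G) := by
  apply vf_injective
  have v0 : ∀ F, vf F = densityOp 0 F := fun F => by simp [densityOp_apply]
  have e : vf (-(sgn (i * j) • cbracket F G)) = (-sgn (i * j)) • vf (cbracket F G) := by
    rw [v0, v0, ← map_smul, neg_smul]
  rw [e, vf_bracket _ _ _ _ hG hF, vf_bracket _ _ _ _ hF hG, mul_comm j i]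
  have := sgn_mul_self (i * j)
  match_scalars <;> first | ring1 | linear_combination this | linear_combination -this

/-- The sum of the cup product `α ∪ β` and of the coboundary `∂φ`. -/
def tau (l μ : ℂ) (α β φ : SFun →ₗ[ℂ] Module.End ℂ SFun) (a c : ZMod 2) (F G : SFun) :
    Module.End ℂ SFun :=
  (α F * β G - sgn (a * c) • (α G * β F)) +
    (hact l μ a c F (φ G) - sgn (a * c) • hact l μ c a G (φ F) - φ (cbracket F G))

/-- Data of relative cochains whose cup product is compared with a coboundary. -/
structure CupData (l ν μ : ℂ) (α β φ : SFun →ₗ[ℂ] Module.End ℂ SFun) : Prop where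
  α_zero : ∀ F ∈ conformal, α F = 0
  β_zero : ∀ F ∈ conformal, β F = 0
  φ_zero : ∀ F ∈ conformal, φ F = 0
  α_eq : ∀ {i j : ZMod 2} {F G : SFun}, Homog i F → Homog j G → F ∈ conformal →
    EquivariantAt ν μ α i j F G
  β_eq : ∀ {i j : ZMod 2} {F G : SFun}, Homog i F → Homog j G → F ∈ conformal →
    EquivariantAt l ν β i j F G
  φ_eq : ∀ {i j : ZMod 2} {F G : SFun}, Homog i F → Homog j G → F ∈ conformal →
    EquivariantAt l μ φ i j F G

lemma CupData.of_isRelCochain {l ν μ : ℂ} {n₁ n₂ n : ℤ}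
    {α β φ : SFun →ₗ[ℂ] Module.End ℂ SFun} (hα : IsRelCochain ν μ n₂ α)
    (hβ : IsRelCochain l ν n₁ β) (hφ : IsRelCochain l μ n φ) : CupData l ν μ α β φ :=
  ⟨hα.conformal, hβ.conformal, hφ.conformal, fun h1 h2 h3 => hα.equivariant _ _ _ _ h1 h2 h3,
    fun h1 h2 h3 => hβ.equivariant _ _ _ _ h1 h2 h3, fun h1 h2 h3 => hφ.equivariant _ _ _ _ h1 h2 h3⟩

lemma hact_mul (l ν μ : ℂ) (x a c : ZMod 2) (F : SFun) (S T : Module.End ℂ SFun) :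
    hact l μ x (a + c) F (S * T) = hact ν μ x a F S * T + sgn (x * a) • (S * hact l ν x c F T) := by
  unfold hact
  have e : (1 : ZMod 2) + 1 = 0 := rfl
  rcases zmod_cases x with rfl | rfl <;> rcases zmod_cases a with rfl | rfl <;>
  rcases zmod_cases c with rfl | rfl <;>
  simp only [mul_zero, zero_mul, mul_one, add_zero, zero_add, e, sgn_zero, sgn_one, one_smul] <;>
  simp only [mul_sub, sub_mul, smul_mul_assoc, mul_smul_comm, ← mul_assoc] <;> module

lemma hact_add_right (l μ : ℂ) (i j : ZMod 2) (F : SFun) (S T : Module.End ℂ SFun) :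
    hact l μ i j F (S + T) = hact l μ i j F S + hact l μ i j F T := by
  simp only [hact, mul_add, add_mul, smul_add]; abel

lemma hact_add_left (l μ : ℂ) (i j : ZMod 2) (F G : SFun) (T : Module.End ℂ SFun) :
    hact l μ i j (F + G) T = hact l μ i j F T + hact l μ i j G T := by
  simp only [hact, map_add, mul_add, add_mul, smul_add]; abel

namespace CupData

variable {l ν μ : ℂ} {α β φ : SFun →ₗ[ℂ] Module.End ℂ SFun}

lemma tau_antisymm (a c : ZMod 2) {F G : SFun} (hF : Homog a F) (hG : Homog c G) :
    tau l μ α β φ c a G F = -(sgn (a * c) • tau l μ α β φ a c F G) := by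
  unfold tau
  rw [cbracket_antisymm hF hG, mul_comm c a, map_neg, map_smul]
  have := sgn_mul_self (a * c)
  generalize sgn (a * c) = s at this
  match_scalars <;> first | ring1 | linear_combination this | linear_combination -this

lemma tau_conformal (h : CupData l ν μ α β φ) {x c : ZMod 2} {F G : SFun} (hF : Homog x F)
    (hG : Homog c G) (hFc : F ∈ conformal) : tau l μ α β φ x c F G = 0 := by
  unfold tau
  rw [h.α_zero F hFc, h.β_zero F hFc, h.φ_zero F hFc, ← h.φ_eq hF hG hFc]
  simp [hact]

lemma hact_tau (h : CupData l ν μ α β φ) {x a c : ZMod 2} {Z F G : SFun} (hZ : Homog x Z)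
    (hF : Homog a F) (hG : Homog c G) (hZc : Z ∈ conformal) :
    hact l μ x (a + c) Z (tau l μ α β φ a c F G) =
      tau l μ α β φ (x + a) c (cbracket Z F) G +
        sgn (x * a) • tau l μ α β φ a (x + c) F (cbracket Z G) := by
  have e1 : hact l μ x (a + c) Z (α F * β G) = α (cbracket Z F) * β G +
      sgn (x * a) • (α F * β (cbracket Z G)) := by
    rw [hact_mul l ν μ, h.α_eq hZ hF hZc, h.β_eq hZ hG hZc]
  have e2 : hact l μ x (a + c) Z (α G * β F) = α (cbracket Z G) * β F +
      sgn (x * c) • (α G * β (cbracket Z F)) := by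
    rw [add_comm a c, hact_mul l ν μ, h.α_eq hZ hG hZc, h.β_eq hZ hF hZc]
  have e3 : hact l μ x (a + c) Z (hact l μ a c F (φ G)) =
      hact l μ (x + a) c (cbracket Z F) (φ G) +
        sgn (x * a) • hact l μ a (x + c) F (φ (cbracket Z G)) := by
    rw [hact_bracket l μ c hZ hF, ← h.φ_eq hZ hG hZc]; abel
  have e4 : hact l μ x (a + c) Z (hact l μ c a G (φ F)) =
      hact l μ (x + c) a (cbracket Z G) (φ F) +
        sgn (x * c) • hact l μ c (x + a) G (φ (cbracket Z F)) := by
    rw [add_comm a c, hact_bracket l μ a hZ hG, ← h.φ_eq hZ hF hZc]; abel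
  have e5 : hact l μ x (a + c) Z (φ (cbracket F G)) = φ (cbracket (cbracket Z F) G) +
      sgn (x * a) • φ (cbracket F (cbracket Z G)) := by
    rw [h.φ_eq hZ (homog_cbracket hF hG) hZc, cbracket_jacobi hZ hF hG, map_sub, map_smul]; abel
  unfold tau
  rw [hact_add_right, hact_sub_right, hact_sub_right, hact_sub_right, hact_smul_right,
    hact_smul_right, e1, e2, e3, e4, e5]
  have s1 : sgn ((x + a) * c) = sgn (x * c) * sgn (a * c) := by
    rcases zmod_cases x with rfl | rfl <;> rcases zmod_cases a with rfl | rfl <;>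
    rcases zmod_cases c with rfl | rfl <;> simp [show (1 : ZMod 2) + 1 = 0 from rfl]
  have s2 : sgn (a * (x + c)) = sgn (x * a) * sgn (a * c) := by
    rcases zmod_cases x with rfl | rfl <;> rcases zmod_cases a with rfl | rfl <;>
    rcases zmod_cases c with rfl | rfl <;> simp [show (1 : ZMod 2) + 1 = 0 from rfl]
  rw [s1, s2]
  have hxa := sgn_mul_self (x * a)
  generalize sgn (x * a) = s at *
  generalize sgn (x * c) = t at *
  generalize sgn (a * c) = u at *
  match_scalars <;> first | ring1 | linear_combination u * hxa | linear_combination -u * hxa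

end CupData

/-- The values of `α ∪ β + ∂φ` on the basis. -/
def tauBv (l μ : ℂ) (α β φ : SFun →ₗ[ℂ] Module.End ℂ SFun) (p q : ℕ) : Module.End ℂ SFun :=
  tau l μ α β φ p q (bv p) (bv q)

lemma tau_smul_left (l μ : ℂ) (α β φ : SFun →ₗ[ℂ] Module.End ℂ SFun) (a c : ZMod 2) (z : ℂ)
    (F G : SFun) : tau l μ α β φ a c (z • F) G = z • tau l μ α β φ a c F G := by
  simp only [tau, map_smul, smul_mul_assoc, mul_smul_comm, hact_smul_left, hact_smul_right,
    cbracket_smul_left]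
  module

lemma tau_smul_right (l μ : ℂ) (α β φ : SFun →ₗ[ℂ] Module.End ℂ SFun) (a c : ZMod 2) (z : ℂ)
    (F G : SFun) : tau l μ α β φ a c F (z • G) = z • tau l μ α β φ a c F G := by
  simp only [tau, map_smul, smul_mul_assoc, mul_smul_comm, hact_smul_left, hact_smul_right,
    cbracket_smul_right]
  module

lemma tau_add_left (l μ : ℂ) (α β φ : SFun →ₗ[ℂ] Module.End ℂ SFun) (a c : ZMod 2)
    (F F' G : SFun) : tau l μ α β φ a c (F + F') G =
      tau l μ α β φ a c F G + tau l μ α β φ a c F' G := by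
  simp only [tau, map_add, add_mul, mul_add, hact_add_left, hact_add_right,
    cbracket_add_left]
  module

lemma tau_add_right (l μ : ℂ) (α β φ : SFun →ₗ[ℂ] Module.End ℂ SFun) (a c : ZMod 2)
    (F G G' : SFun) : tau l μ α β φ a c F (G + G') =
      tau l μ α β φ a c F G + tau l μ α β φ a c F G' := by
  simp only [tau, map_add, add_mul, mul_add, hact_add_left, hact_add_right,
    cbracket_add_right]
  module

namespace CupData

variable {l ν μ : ℂ} {α β φ : SFun →ₗ[ℂ] Module.End ℂ SFun}

lemma tauBv_symm (p q : ℕ) : tauBv l μ α β φ q p =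
    (-(-1) ^ (p * q) : ℂ) • tauBv l μ α β φ p q := by
  unfold tauBv
  rw [tau_antisymm _ _ (homog_bv p) (homog_bv q), ← sgn_natCast, Nat.cast_mul]
  module

lemma tauBv_low (h : CupData l ν μ α β φ) {p q : ℕ} (hpq : p < 5 ∨ q < 5) :
    tauBv l μ α β φ p q = 0 := by
  have key : ∀ p q : ℕ, p < 5 → tauBv l μ α β φ p q = 0 := fun p q hp =>
    h.tau_conformal (homog_bv p) (homog_bv q) (bv_mem_conformal hp)
  rcases hpq with hp | hq
  · exact key p q hp
  · rw [tauBv_symm, key q p hq, smul_zero]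

lemma hact_bv3_tauBv (h : CupData l ν μ α β φ) (p q : ℕ) :
    hact l μ 1 ((p : ZMod 2) + q) (bv 3) (tauBv l μ α β φ p q) = ec p • tauBv l μ α β φ (p + 1) q +
      ((-1 : ℂ) ^ p * ec q) • tauBv l μ α β φ p (q + 1) := by
  unfold tauBv
  rw [h.hact_tau homog_one_bv3 (homog_bv p) (homog_bv q) (bv_mem_conformal (by norm_num)),
    cbracket_bv3, cbracket_bv3, tau_smul_left, tau_smul_right, natCast_succ_zmod, natCast_succ_zmod,
    one_mul, sgn_natCast, smul_smul]

lemma relation (h : CupData l ν μ α β φ) {p q : ℕ} (h0 : tauBv l μ α β φ p q = 0) :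
    ec p • tauBv l μ α β φ (p + 1) q +
      ((-1 : ℂ) ^ p * ec q) • tauBv l μ α β φ p (q + 1) = 0 := by
  rw [← h.hact_bv3_tauBv, h0]; simp [hact]

lemma tauBv_step {n : ℤ} (h : CupData l ν (l + n / 2) α β φ) (p q : ℕ)
    (hlt : ∀ p' q' : ℕ, p' + q' < p + q → tauBv l (l + n / 2) α β φ p' q' = 0)
    (h0 : ∀ r : ℕ, (r : ℤ) + p + q = n + 4 → tauBv l (l + n / 2) α β φ p q (bv r) = 0) :
    tauBv l (l + n / 2) α β φ p q = 0 := by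
  refine eq_zero_of_comm (κ := sgn ((p : ZMod 2) + q)) (s := (p : ℂ) + q - 4 - n) ?_ ?_ ?_
  · have low : ∀ (p q : ℕ), (∀ p' q' : ℕ, p' + q' < p + q → tauBv l (l + n / 2) α β φ p' q' = 0) →
        tau l (l + n / 2) α β φ (1 + (p : ZMod 2)) q (cbracket (bv 1) (bv p)) (bv q) = 0 := by
      intro p q hlt
      rcases p with _ | p
      · rw [cbracket_bv1_bv0, ← zero_smul ℂ (0 : SFun), tau_smul_left, zero_smul]
      · obtain ⟨c, hc⟩ := exists_cbracket_bv1 p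
        have e : (1 : ZMod 2) + ((p + 1 : ℕ) : ZMod 2) = p := by
          push_cast
          have : (1 : ZMod 2) + 1 = 0 := rfl
          linear_combination this
        rw [hc, tau_smul_left, e]
        have := hlt p q (by omega)
        unfold tauBv at this
        rw [this, smul_zero]
    have low' : tau l (l + n / 2) α β φ p (1 + (q : ZMod 2)) (bv p) (cbracket (bv 1) (bv q)) = 0 := by
      have := tau_antisymm (l := l) (μ := l + n / 2) (α := α) (β := β) (φ := φ)
        (1 + (q : ZMod 2)) p (homog_cbracket homog_one_bv1 (homog_bv q)) (homog_bv p)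
      rw [this, low q p fun p' q' hpq => hlt p' q' (by omega), smul_zero, neg_zero]
    have e := h.hact_tau homog_one_bv1 (homog_bv p) (homog_bv q) (bv_mem_conformal (by norm_num))
    rw [low p q hlt, low', smul_zero, add_zero] at e
    unfold hact at e
    rw [one_mul, densityOp_bv1, densityOp_bv1, smul_mul_assoc, mul_smul_comm] at e
    unfold tauBv
    linear_combination (norm := module) (2 : ℂ) • e
  · have e := h.hact_tau homog_zero_bv2 (homog_bv p) (homog_bv q) (bv_mem_conformal (by norm_num))
    unfold hact at e
    rw [cbracket_bv2, cbracket_bv2, zero_mul, zero_mul, sgn_zero, one_smul, one_smul, zero_add,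
      zero_add, tau_smul_left, tau_smul_right, densityOp_bv2, densityOp_bv2, add_mul, mul_add,
      smul_mul_assoc, mul_smul_comm, one_mul, mul_one] at e
    unfold tauBv
    linear_combination (norm := module) e
  · intro r hr
    apply h0
    have : ((r + p + q : ℤ) : ℂ) = ((n + 4 : ℤ) : ℂ) := by push_cast; linear_combination hr
    exact_mod_cast this

lemma eq_zero_of_relations {E : Type*} [AddCommGroup E] [Module ℂ E] (t : ℕ → ℕ → E)
    (sy : ∀ p q, t q p = (-(-1) ^ (p * q) : ℂ) • t p q)
    (rel : ∀ {p q}, t p q = 0 →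
      ec p • t (p + 1) q + ((-1 : ℂ) ^ p * ec q) • t p (q + 1) = 0)
    (low : ∀ {p q}, p < 5 ∨ q < 5 → t p q = 0)
    (h55 : (∀ p q, p + q < 5 + 5 → t p q = 0) → t 5 5 = 0)
    (h67 : (∀ p q, p + q < 6 + 7 → t p q = 0) → t 6 7 = 0)
    (h77 : (∀ p q, p + q < 7 + 7 → t p q = 0) → t 7 7 = 0) (p q : ℕ) (hpq : p + q ≤ 14) :
    t p q = 0 := by
  have z : ∀ {c : ℂ} {T : E}, c ≠ 0 → c • T = 0 → T = 0 :=
    fun hc h0 => (smul_eq_zero.1 h0).resolve_left hc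
  have e5 : ec 5 = 1 / 2 := by rw [ec, if_neg (by decide)]
  have e6 : ec 6 = 1 / 2 := by rw [ec, if_pos (by decide)]; norm_num
  have e7 : ec 7 = 1 / 2 := by rw [ec, if_neg (by decide)]
  have e8 : ec 8 = 1 := by rw [ec, if_pos (by decide)]; norm_num
  -- total degree 10
  have t55 : t 5 5 = 0 := h55 fun p' q' hpq => low (by omega)
  have T10 : ∀ p q : ℕ, p + q ≤ 10 → t p q = 0 := by
    intro p q hpq
    by_cases h1 : p < 5 ∨ q < 5
    · exact low h1
    · obtain ⟨rfl, rfl⟩ : p = 5 ∧ q = 5 := by omega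
      exact t55
  -- total degree 11
  have t56 : t 5 6 = 0 := by
    have r := rel t55
    have s := sy 5 6
    rw [e5] at r
    norm_num at r s
    rw [s] at r
    refine z (c := -1) (by norm_num) ?_
    rw [← r]; module
  have t65 : t 6 5 = 0 := by rw [sy 5 6, t56, smul_zero]
  have T11 : ∀ p q : ℕ, p + q ≤ 11 → t p q = 0 := by
    intro p q hpq
    by_cases h1 : p < 5 ∨ q < 5
    · exact low h1
    · have : (p = 5 ∧ q = 5) ∨ (p = 5 ∧ q = 6) ∨ (p = 6 ∧ q = 5) := by omega
      rcases this with ⟨rfl, rfl⟩ | ⟨rfl, rfl⟩ | ⟨rfl, rfl⟩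
      exacts [t55, t56, t65]
  -- total degree 12
  have t66 : t 6 6 = 0 := by
    have s := sy 6 6
    norm_num at s
    refine z (c := 2) (by norm_num) ?_
    rw [two_smul]; nth_rewrite 1 [s]; exact neg_add_cancel _
  have t57 : t 5 7 = 0 := by
    have r := rel t56
    rw [e5, e6] at r
    norm_num at r
    rw [t66] at r
    refine z (c := -(1 / 2)) (by norm_num) ?_
    rw [← r]; module
  have t75 : t 7 5 = 0 := by rw [sy 5 7, t57, smul_zero]
  have T12 : ∀ p q : ℕ, p + q ≤ 12 → t p q = 0 := by
    intro p q hpq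
    by_cases h1 : p + q ≤ 11
    · exact T11 p q h1
    by_cases h1 : p < 5 ∨ q < 5
    · exact low h1
    · have : (p = 5 ∧ q = 7) ∨ (p = 6 ∧ q = 6) ∨ (p = 7 ∧ q = 5) := by omega
      rcases this with ⟨rfl, rfl⟩ | ⟨rfl, rfl⟩ | ⟨rfl, rfl⟩
      exacts [t57, t66, t75]
  -- total degree 13
  have t67 : t 6 7 = 0 := h67 fun p' q' hpq => T12 _ _ (by omega)
  have t76 : t 7 6 = 0 := by rw [sy 6 7, t67, smul_zero]
  have t58 : t 5 8 = 0 := by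
    have r := rel t57
    rw [e5, e7] at r
    norm_num at r
    rw [t67] at r
    refine z (c := -(1 / 2)) (by norm_num) ?_
    rw [← r]; module
  have t85 : t 8 5 = 0 := by rw [sy 5 8, t58, smul_zero]
  have T13 : ∀ p q : ℕ, p + q ≤ 13 → t p q = 0 := by
    intro p q hpq
    by_cases h1 : p + q ≤ 12
    · exact T12 p q h1
    by_cases h1 : p < 5 ∨ q < 5
    · exact low h1
    · have : (p = 5 ∧ q = 8) ∨ (p = 6 ∧ q = 7) ∨ (p = 7 ∧ q = 6) ∨ (p = 8 ∧ q = 5) := by omega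
      rcases this with ⟨rfl, rfl⟩ | ⟨rfl, rfl⟩ | ⟨rfl, rfl⟩ | ⟨rfl, rfl⟩
      exacts [t58, t67, t76, t85]
  -- total degree 14
  have t77 : t 7 7 = 0 := h77 fun p' q' hpq => T13 _ _ (by omega)
  have t68 : t 6 8 = 0 := by
    have r := rel t67
    rw [e6, e7] at r
    norm_num at r
    rw [t77] at r
    refine z (c := 1 / 2) (by norm_num) ?_
    rw [← r]; module
  have t86 : t 8 6 = 0 := by rw [sy 6 8, t68, smul_zero]
  have t59 : t 5 9 = 0 := by
    have r := rel t58
    rw [e5, e8] at r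
    norm_num at r
    rw [t68] at r
    refine z (c := -1) (by norm_num) ?_
    rw [← r]; module
  have t95 : t 9 5 = 0 := by rw [sy 5 9, t59, smul_zero]
  have T14 : ∀ p q : ℕ, p + q ≤ 14 → t p q = 0 := by
    intro p q hpq
    by_cases h1 : p + q ≤ 13
    · exact T13 p q h1
    by_cases h1 : p < 5 ∨ q < 5
    · exact low h1
    · have : (p = 5 ∧ q = 9) ∨ (p = 6 ∧ q = 8) ∨ (p = 7 ∧ q = 7) ∨ (p = 8 ∧ q = 6) ∨
          (p = 9 ∧ q = 5) := by omega
      rcases this with ⟨rfl, rfl⟩ | ⟨rfl, rfl⟩ | ⟨rfl, rfl⟩ | ⟨rfl, rfl⟩ | ⟨rfl, rfl⟩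
      exacts [t59, t68, t77, t86, t95]
  exact T14 p q hpq

/-- The conditions under which `α ∪ β + ∂φ` vanishes. -/
theorem tauBv_eq_zero {n : ℤ} (h : CupData l ν (l + n / 2) α β φ) (hn : n ≤ 10)
    (h55 : ∀ r : ℕ, (r : ℤ) + 6 = n → tauBv l (l + n / 2) α β φ 5 5 (bv r) = 0)
    (h67 : ∀ r : ℕ, (r : ℤ) + 9 = n → tauBv l (l + n / 2) α β φ 6 7 (bv r) = 0)
    (h77 : ∀ r : ℕ, (r : ℤ) + 10 = n → tauBv l (l + n / 2) α β φ 7 7 (bv r) = 0) (p q : ℕ) :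
    tauBv l (l + n / 2) α β φ p q = 0 := by
  have T14 := eq_zero_of_relations (tauBv l (l + n / 2) α β φ) tauBv_symm h.relation h.tauBv_low
    (fun H => h.tauBv_step 5 5 (fun _ _ => H _ _) fun r hr => h55 r (by push_cast at hr; linarith))
    (fun H => h.tauBv_step 6 7 (fun _ _ => H _ _) fun r hr => h67 r (by push_cast at hr; linarith))
    (fun H => h.tauBv_step 7 7 (fun _ _ => H _ _) fun r hr => h77 r (by push_cast at hr; linarith))
  have fin : ∀ s p q : ℕ, p + q ≤ s → tauBv l (l + n / 2) α β φ p q = 0 := by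
    intro s
    induction s with
    | zero => exact fun p q hpq => T14 p q (by omega)
    | succ s ih =>
      intro p q hpq
      by_cases hs : p + q ≤ 14
      · exact T14 p q hs
      · exact h.tauBv_step p q (fun p' q' hpq' => ih p' q' (by omega)) fun r hr => by omega
  exact fin _ p q le_rfl

end CupData

lemma eq_zero_of_bv {V : Type*} [AddCommGroup V] [Module ℂ V] {f : SFun → V}
    (hadd : ∀ F G, f (F + G) = f F + f G) (hsmul : ∀ (z : ℂ) F, f (z • F) = z • f F) {i : ZMod 2}
    (hb : ∀ k : ℕ, (k : ZMod 2) = i → f (bv k) = 0) {F : SFun} (h : Homog i F) : f F = 0 :=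
  homog_induction (LinearMap.ker (IsLinearMap.mk' f ⟨hadd, hsmul⟩)) hb h

lemma tau_eq_zero_of_tauBv {l μ : ℂ} {α β φ : SFun →ₗ[ℂ] Module.End ℂ SFun}
    (h : ∀ p q, tauBv l μ α β φ p q = 0) {a c : ZMod 2} {F G : SFun}
    (hF : Homog a F) (hG : Homog c G) : tau l μ α β φ a c F G = 0 := by
  refine eq_zero_of_bv (f := fun F => tau l μ α β φ a c F G)
    (fun F F' => tau_add_left l μ α β φ a c F F' G)
    (fun z F => tau_smul_left l μ α β φ a c z F G) (fun k hk => ?_) hF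
  refine eq_zero_of_bv (f := fun G => tau l μ α β φ a c (bv k) G)
    (fun G G' => tau_add_right l μ α β φ a c (bv k) G G')
    (fun z G => tau_smul_right l μ α β φ a c z (bv k) G) (fun k' hk' => ?_) hG
  subst hk hk'
  exact h k k'

/-! ## Matrix coefficients of relative cochains -/

/-- The coefficient in `D v_r = δ_r v_{r-1}`. -/
def dc (r : ℕ) : ℂ := if Even r then (r : ℂ) / 2 else 1

/-- The coefficient in `E v_r = η_r v_{r+1}`. -/
def etac (l : ℂ) (r : ℕ) : ℂ := if Even r then (r : ℂ) / 2 + 2 * l else 1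

/-- The coefficient in `𝕏(ξ x²) v_r = ½ ζ_r v_{r+3}`. -/
def zetac (l : ℂ) (r : ℕ) : ℂ := if Even r then (r : ℂ) / 2 + 4 * l else 1

/-- The coefficient in `D ^ k v_r = c v_{r-k}`. -/
def dpc : ℕ → ℕ → ℂ
  | 0, _ => 1
  | k + 1, r => dc r * dpc k (r - 1)

lemma D_bv (r : ℕ) : D (bv r) = dc r • bv (r - 1) := by
  rcases Nat.even_or_odd' r with ⟨q, rfl | rfl⟩
  · rcases q with _ | q
    · simp [D_bv_zero, dc]
    · rw [D_bv_even, dc, if_pos (by simp)]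
      congr 1; push_cast; ring
  · rw [D_bv_odd, dc, if_neg (by simp), one_smul]; rfl

lemma Eo_bv (l : ℂ) (r : ℕ) : Eo l (bv r) = etac l r • bv (r + 1) := by
  rcases Nat.even_or_odd' r with ⟨q, rfl | rfl⟩
  · rw [Eo_bv_even, etac, if_pos (by simp)]; congr 1; push_cast; ring
  · rw [Eo_bv_odd, etac, if_neg (by simp), one_smul]; rfl

lemma Fo_bv (l : ℂ) (r : ℕ) : Fo l (bv r) = zetac l r • bv (r + 3) := by
  rcases Nat.even_or_odd' r with ⟨q, rfl | rfl⟩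
  · rw [Fo_bv_even, zetac, if_pos (by simp)]; congr 1; push_cast; ring
  · rw [Fo_bv_odd, zetac, if_neg (by simp), one_smul]; rfl

lemma eps_bv (r : ℕ) : eps (bv r) = (-1 : ℂ) ^ r • bv r := by
  rcases Nat.even_or_odd' r with ⟨q, rfl | rfl⟩
  · rw [eps_bv_even, pow_mul]; simp
  · rw [eps_bv_odd, pow_succ, pow_mul]; simp

lemma dpc_ne_zero {k r : ℕ} (h : k ≤ r) : dpc k r ≠ 0 := by
  induction k generalizing r with
  | zero => exact one_ne_zero
  | succ k ih =>
    refine mul_ne_zero ?_ (ih (by omega))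
    unfold dc
    split_ifs
    · have : (r : ℂ) ≠ 0 := by exact_mod_cast (by omega : r ≠ 0)
      exact div_ne_zero this two_ne_zero
    · exact one_ne_zero

lemma dpc_eq_zero {k r : ℕ} (h : r < k) : dpc k r = 0 := by
  induction k generalizing r with
  | zero => omega
  | succ k ih =>
    rcases r with _ | r
    · simp [dpc, dc]
    · rw [dpc, Nat.add_sub_cancel, ih (by omega), mul_zero]

lemma D_pow_bv (k r : ℕ) : (D ^ k) (bv r) = dpc k r • bv (r - k) := by
  induction k generalizing r with
  | zero => simp [dpc]
  | succ k ih =>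
    rw [pow_succ, Module.End.mul_apply, D_bv, map_smul, ih, smul_smul, dpc, Nat.sub_sub,
      Nat.add_comm 1 k]

/-- The coefficients of the `𝔰`-relative cochain `φ` of length `(k + 3) / 2` such that
`φ(𝕏(ξ x²)) = ε D^k`: one has `φ(v_{m+5}) v_r = c v_{r+m-k}`. -/
def cf (l : ℂ) (k : ℕ) : ℕ → ℕ → ℂ
  | 0, r => (-1) ^ (r - k) * dpc k r
  | m + 1, r => (etac (l + (k + 3) / 2) (r + m - k) * cf l k m r +
      (-1) ^ m * etac l r * cf l k m (r + 1)) / (2 * ec (m + 5))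

lemma cf_eq_zero (l : ℂ) {k m r : ℕ} (h : r + m < k) : cf l k m r = 0 := by
  induction m generalizing r with
  | zero => rw [cf, dpc_eq_zero (by omega), mul_zero]
  | succ m ih => rw [cf, ih (by omega), ih (by omega)]; simp

lemma cf_zero_ne_zero (l : ℂ) {k r : ℕ} (h : k ≤ r) : cf l k 0 r ≠ 0 :=
  mul_ne_zero (pow_ne_zero _ (by norm_num)) (dpc_ne_zero h)

lemma Dp_bv (k r : ℕ) (l : ℂ) : Dp (k + 3) (bv r) = cf l k 0 r • bv (r - k) := by
  rw [StablePair.Dp_apply, D_pow_bv, map_smul, eps_bv, smul_smul, cf, mul_comm]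

lemma IsRelCochain.apply_bv {l c : ℂ} {n : ℤ} {φ : SFun →ₗ[ℂ] Module.End ℂ SFun}
    (h : IsRelCochain l (l + n / 2) n φ) {k : ℕ} (hn : n = k + 3) (hc : φ (bv 5) = c • Dp n)
    (m r : ℕ) : φ (bv (m + 5)) (bv r) = (c * cf l k m r) • bv (r + m - k) := by
  subst hn
  induction m generalizing r with
  | zero => rw [Nat.zero_add, hc, LinearMap.smul_apply, Dp_bv k r l, smul_smul]; rfl
  | succ m ih =>
    have e := LinearMap.congr_fun (h.equivariant 1 ((m + 5 : ℕ) : ZMod 2) (bv 3) (bv (m + 5))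
      homog_one_bv3 (homog_bv _) (bv_mem_conformal (by norm_num))) (bv r)
    have hs : (-1 : ℂ) ^ (m + 5) = -(-1) ^ m := by rw [pow_add]; norm_num
    rw [cbracket_bv3, map_smul, densityOp_bv3, densityOp_bv3, one_mul, sgn_natCast, hs] at e
    simp only [LinearMap.sub_apply, LinearMap.smul_apply, Module.End.mul_apply, map_smul, Eo_bv,
      ih, smul_smul] at e
    have he := ec_ne_zero (k := m + 5) (by omega)
    refine smul_right_injective _ he ?_
    change ec (m + 5) • _ = ec (m + 5) • _
    rw [show m + 1 + 5 = m + 5 + 1 by ring, ← e, smul_smul, cf]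
    rcases lt_or_ge (r + m) k with hk | hk
    · rw [cf_eq_zero l hk, show r + 1 + m - k = r + (m + 1) - k by
        congr 1; ring]
      match_scalars <;> field_simp <;> ring
    · rw [show r + 1 + m - k = r + m - k + 1 by omega, show r + (m + 1) - k = r + m - k + 1 by
        omega]
      match_scalars
      push_cast
      field_simp
      ring

lemma cbracket_bv5_bv5 : cbracket (bv 5) (bv 5) = (1 / 2 : ℂ) • bv 8 := by
  have := cbracket_odd_odd 2 2
  rwa [← bv_odd, ← bv_even] at this

lemma cbracket_bv7_bv7 : cbracket (bv 7) (bv 7) = (1 / 2 : ℂ) • bv 12 := by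
  have := cbracket_odd_odd 3 3
  rwa [← bv_odd, ← bv_even] at this

lemma cbracket_bv6_bv7 : cbracket (bv 6) (bv 7) = (3 / 2 : ℂ) • bv 11 := by
  have := cbracket_even_odd 3 3
  rw [← bv_odd, ← bv_even, ← bv_odd] at this
  rw [this]; congr 1; norm_num

lemma densityOp_bv6_even (l : ℂ) (k : ℕ) :
    densityOp l (bv 6) (bv (2 * k)) = (k + 3 * l) • bv (2 * (k + 2)) := by
  rw [show bv 6 = inl (X ^ 3) from bv_even 3, bv_even, bv_even]
  refine TrivSqZeroExt.ext ?_ ?_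
  · rcases k with _ | k <;> simp [densityOp_apply, vf, derivative_X_pow] <;>
      (apply Polynomial.funext; intro r; simp [pow_succ]; ring)
  · simp [densityOp_apply, vf]

lemma densityOp_bv6_odd (l : ℂ) (k : ℕ) :
    densityOp l (bv 6) (bv (2 * k + 1)) = (k + 3 / 2 + 3 * l) • bv (2 * (k + 2) + 1) := by
  rw [show bv 6 = inl (X ^ 3) from bv_even 3, bv_odd, bv_odd]
  refine TrivSqZeroExt.ext ?_ ?_
  · simp [densityOp_apply, vf]
  · rcases k with _ | k <;> simp [densityOp_apply, vf, derivative_X_pow] <;>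
      (apply Polynomial.funext; intro r; simp [pow_succ]; ring)

lemma densityOp_bv7_even (l : ℂ) (k : ℕ) :
    densityOp l (bv 7) (bv (2 * k)) = (k / 2 + 3 * l) • bv (2 * (k + 2) + 1) := by
  rw [show bv 7 = inr (X ^ 3) from bv_odd 3, bv_odd, bv_even]
  refine TrivSqZeroExt.ext ?_ ?_
  · simp [densityOp_apply, vf]
  · rcases k with _ | k <;> simp [densityOp_apply, vf, derivative_X_pow] <;>
      (apply Polynomial.funext; intro r; simp [pow_succ]; ring)

lemma densityOp_bv7_odd (l : ℂ) (k : ℕ) :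
    densityOp l (bv 7) (bv (2 * k + 1)) = (1 / 2 : ℂ) • bv (2 * (k + 3)) := by
  rw [show bv 7 = inr (X ^ 3) from bv_odd 3, bv_odd, bv_even]
  refine TrivSqZeroExt.ext ?_ ?_
  · simp [densityOp_apply, vf, pow_succ]
    ring_nf
  · simp [densityOp_apply, vf]

/-! ## Lowest coefficients of cup products and coboundaries -/

section

variable {l a b c : ℂ} {n₁ n₂ n : ℤ} {α β φ : SFun →ₗ[ℂ] Module.End ℂ SFun}

/-- The lowest coefficient of `(α ∪ β)(𝕏(ξ x²), 𝕏(ξ x²))`. -/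
def cupc (k₁ k₂ : ℕ) : ℂ := 2 * (cf 0 k₁ 0 (k₁ + k₂) * cf 0 k₂ 0 k₂)

/-- The lowest coefficient of `∂φ(𝕏(ξ x²), 𝕏(ξ x²))`. -/
def obc (l : ℂ) (k : ℕ) : ℂ := zetac l (k - 3) * cf l k 0 k - cf l k 3 (k - 3) / 2

lemma cupc_ne_zero (k₁ k₂ : ℕ) : cupc k₁ k₂ ≠ 0 :=
  mul_ne_zero two_ne_zero (mul_ne_zero (cf_zero_ne_zero _ (by omega)) (cf_zero_ne_zero _ le_rfl))

lemma tau55 {k₁ k₂ k : ℕ} (hα : α (bv 5) = a • Dp (k₂ + 3)) (hβ : β (bv 5) = b • Dp (k₁ + 3))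
    (hφ : IsRelCochain l (l + n / 2) n φ) (hc : φ (bv 5) = c • Dp n) (hn : n = k + 3)
    (hk : k₁ + k₂ + 3 = k) : tauBv l (l + n / 2) α β φ 5 5 (bv (k - 3)) =
      (a * b * cupc k₁ k₂ + c * obc l k) • bv 0 := by
  have A0 := fun r => hφ.apply_bv hn hc 0 r
  have A3 := hφ.apply_bv hn hc 3 (k - 3)
  rw [show 3 + 5 = 8 from rfl, show k - 3 + 3 - k = 0 by omega] at A3
  simp only [Nat.zero_add, Nat.add_zero] at A0
  unfold tauBv tau
  have s1 : sgn (((5 : ℕ) : ZMod 2) * ((5 : ℕ) : ZMod 2)) = -1 := by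
    rw [← Nat.cast_mul, sgn_natCast]; norm_num
  unfold hact
  rw [s1, cbracket_bv5_bv5, map_smul, hα, hβ, densityOp_bv5, densityOp_bv5]
  simp only [LinearMap.sub_apply, LinearMap.add_apply, LinearMap.smul_apply, Module.End.mul_apply,
    map_smul, Fo_bv, A0, A3, smul_smul]
  rw [cf_eq_zero l (show k - 3 + 0 < k by omega), show k - 3 + 3 = k by omega,
    Dp_bv k₁ _ 0, map_smul, show k - 3 - k₁ = k₂ by omega, show k - 3 = k₁ + k₂ by omega,
    Dp_bv k₂ _ 0, Nat.sub_self, Nat.sub_self, cupc, obc, show k - 3 = k₁ + k₂ by omega]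
  match_scalars <;> ring

end

/-! ## The criterion for three-step extensions -/

section

variable {l μ : ℂ} {α β φ : SFun →ₗ[ℂ] Module.End ℂ SFun}

lemma tau_eq_zero_iff {a c : ZMod 2} {F G : SFun} : tau l μ α β φ a c F G = 0 ↔
    φ (cbracket F G) = (densityOp μ F * φ G + α F * β G + φ F * densityOp l G) -
      sgn (a * c) • (densityOp μ G * φ F + α G * β F + φ G * densityOp l F) := by
  have e : tau l μ α β φ a c F G = (densityOp μ F * φ G + α F * β G + φ F * densityOp l G) -
      sgn (a * c) • (densityOp μ G * φ F + α G * β F + φ G * densityOp l F) -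
        φ (cbracket F G) := by
    unfold tau hact
    rw [mul_comm c a, smul_sub, smul_smul, sgn_mul_self, one_smul]
    module
  rw [e, sub_eq_zero, eq_comm]

lemma tau_smul_cochains (s t : ℂ) {a c : ZMod 2} {F G : SFun} :
    tau l μ (s • α) (t • β) ((s * t) • φ) a c F G = (s * t) • tau l μ α β φ a c F G := by
  simp only [tau, LinearMap.smul_apply, hact_smul_right, smul_mul_assoc, mul_smul_comm, smul_smul]
  module

lemma IsRelCochain.eq_smul {n : ℤ} {ψ : SFun →ₗ[ℂ] Module.End ℂ SFun} {c c' : ℂ}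
    (h : IsRelCochain l μ n φ) (h' : IsRelCochain l μ n ψ) (hc : φ (bv 5) = c • Dp n)
    (hc' : ψ (bv 5) = c' • Dp n) (hc0 : c' ≠ 0) : φ = (c / c') • ψ :=
  h.ext (h'.smul _) (by rw [LinearMap.smul_apply, hc, hc', smul_smul, div_mul_cancel₀ _ hc0])

lemma exists_isRelCochain (l : ℂ) {n : ℤ} (hn : 3 ≤ n) (c : ℂ) :
    ∃ φ, IsRelCochain l (l + n / 2) n φ ∧ φ (bv 5) = c • Dp n := by
  obtain ⟨c', hc', e⟩ := exists_beta_bv5 l hn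
  refine ⟨(c / c') • beta l n, (isRelCochain_beta l n).smul _, ?_⟩
  rw [LinearMap.smul_apply, e, smul_smul, div_mul_cancel₀ _ hc']

end

lemma cupIsCoboundary_iff {l : ℂ} {n₁ n₂ : ℤ} : CupIsCoboundary l n₁ n₂ ↔
    ∃ φ, IsRelCochain l (l + ((n₁ + n₂ : ℤ) : ℂ) / 2) (n₁ + n₂) φ ∧
      ∀ (a c : ZMod 2) (F G : SFun), Homog a F → Homog c G →
        tau l (l + ((n₁ + n₂ : ℤ) : ℂ) / 2) (beta (l + n₁ / 2) n₂) (beta l n₁) φ a c F G = 0 := by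
  have e : ∀ φ (a c : ZMod 2) (F G : SFun),
      tau l (l + ((n₁ + n₂ : ℤ) : ℂ) / 2) (beta (l + n₁ / 2) n₂) (beta l n₁) ((-1 : ℂ) • φ) a c F G =
        cup (beta (l + (n₁ : ℂ) / 2) n₂) (beta l n₁) a c F G -
        coboundary (density l) (dens (l + ((n₁ + n₂ : ℤ) : ℂ) / 2) (n₁ + n₂)) φ a c F G := by
    intro φ a c F G
    have c1 : cup (beta (l + (n₁ : ℂ) / 2) n₂) (beta l n₁) a c F G =
      beta (l + n₁ / 2) n₂ F * beta l n₁ G -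
        sgn (a * c) • (beta (l + n₁ / 2) n₂ G * beta l n₁ F) := rfl
    have c2 : coboundary (density l) (dens (l + ((n₁ + n₂ : ℤ) : ℂ) / 2) (n₁ + n₂)) φ a c F G =
        (densityOp (l + ((n₁ + n₂ : ℤ) : ℂ) / 2) F * φ G - sgn (a * c) • (φ G * densityOp l F)) -
        sgn (a * c) • (densityOp (l + ((n₁ + n₂ : ℤ) : ℂ) / 2) G * φ F -
          sgn (c * a) • (φ F * densityOp l G)) - φ (cbracket F G) := by
      unfold coboundary homAct
      rw [dens_act]; rfl
    unfold tau hact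
    rw [c1, c2]
    simp only [LinearMap.smul_apply, mul_smul_comm, smul_mul_assoc]
    module
  constructor
  · rintro ⟨φ, h1, h2⟩
    refine ⟨(-1 : ℂ) • φ, (isEvenRelCochain_iff.1 h1).smul _, fun a c F G hF hG => ?_⟩
    rw [e, h2 a c F G hF hG]
    exact sub_self _
  · rintro ⟨φ, h1, h2⟩
    refine ⟨(-1 : ℂ) • φ, isEvenRelCochain_iff.2 (h1.smul _), fun a c F G hF hG => ?_⟩
    have := e ((-1 : ℂ) • φ) a c F G
    rw [smul_smul, show (-1 : ℂ) * -1 = 1 by norm_num, one_smul, h2 a c F G hF hG] at this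
    exact sub_eq_zero.1 this.symm

/-- The cochains `β` may be replaced by any non-zero multiples. -/
lemma cupIsCoboundary_iff_of {l a b : ℂ} {n₁ n₂ : ℤ} {α β : SFun →ₗ[ℂ] Module.End ℂ SFun}
    (h₁ : 3 ≤ n₁) (h₂ : 3 ≤ n₂)
    (hα : IsRelCochain (l + n₁ / 2) (l + ((n₁ + n₂ : ℤ) : ℂ) / 2) n₂ α)
    (hβ : IsRelCochain l (l + n₁ / 2) n₁ β) (ha : α (bv 5) = a • Dp n₂) (hb : β (bv 5) = b • Dp n₁)
    (ha0 : a ≠ 0) (hb0 : b ≠ 0) : CupIsCoboundary l n₁ n₂ ↔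
    ∃ φ, IsRelCochain l (l + ((n₁ + n₂ : ℤ) : ℂ) / 2) (n₁ + n₂) φ ∧
      ∀ (a c : ZMod 2) (F G : SFun), Homog a F → Homog c G →
        tau l (l + ((n₁ + n₂ : ℤ) : ℂ) / 2) α β φ a c F G = 0 := by
  obtain ⟨a', ha', ea⟩ := exists_beta_bv5 (l + n₁ / 2) h₂
  obtain ⟨b', hb', eb⟩ := exists_beta_bv5 l h₁
  have w : l + (n₁ : ℂ) / 2 + n₂ / 2 = l + ((n₁ + n₂ : ℤ) : ℂ) / 2 := by push_cast; ring
  have e1 : α = (a / a') • beta (l + n₁ / 2) n₂ :=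
    hα.eq_smul (w ▸ isRelCochain_beta _ _) ha ea ha'
  have e2 : β = (b / b') • beta l n₁ := hβ.eq_smul (isRelCochain_beta _ _) hb eb hb'
  have hs : a / a' * (b / b') ≠ 0 := mul_ne_zero (div_ne_zero ha0 ha') (div_ne_zero hb0 hb')
  rw [cupIsCoboundary_iff, e1, e2]
  constructor
  · rintro ⟨φ, h1, h2⟩
    refine ⟨(a / a' * (b / b')) • φ, h1.smul _, fun a c F G hF hG => ?_⟩
    rw [tau_smul_cochains, h2 a c F G hF hG, smul_zero]
  · rintro ⟨φ, h1, h2⟩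
    refine ⟨(a / a' * (b / b'))⁻¹ • φ, h1.smul _, fun i j F G hF hG => ?_⟩
    have := h2 i j F G hF hG
    rw [← one_smul ℂ φ, ← mul_inv_cancel₀ hs, mul_smul, tau_smul_cochains] at this
    exact (smul_eq_zero.1 this).resolve_left hs

section

variable {l : ℂ}

lemma existsUniserialExt_one {n : ℤ} : ExistsUniserialExt l [n] ↔
    ∃ (σ : KRep (Fin 2 → SFun)) (b : Fin 2 → Fin 2 → ℂ), σ.IsTri l ![0, n] b ∧ σ.IsChain := by
  have e : partialSum [n] = ![0, n] := by
    funext i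
    change Fin 2 at i
    fin_cases i <;> simp [partialSum]
  rw [existsUniserialExt_iff, e]; rfl

lemma partialSum_two (n₁ n₂ : ℤ) : partialSum [n₁, n₂] = ![0, n₁, n₁ + n₂] := by
  funext i
  change Fin 3 at i
  fin_cases i <;> simp [partialSum]

lemma existsUniserialExt_two {n₁ n₂ : ℤ} : ExistsUniserialExt l [n₁, n₂] ↔
    ∃ (σ : KRep (Fin 3 → SFun)) (b : Fin 3 → Fin 3 → ℂ),
      σ.IsTri l ![0, n₁, n₁ + n₂] b ∧ σ.IsChain := by
  rw [existsUniserialExt_iff, partialSum_two]; rfl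

lemma IsRelCochain.parity_eq {μ : ℂ} {n N N' : ℤ} {φ : SFun →ₗ[ℂ] Module.End ℂ SFun}
    (h : IsRelCochain l μ n φ) (hn : N = N' + n) (F v : SFun) :
    sgnZ N • SuperK.parity (φ F v) = φ (SuperK.parity F) (sgnZ N' • SuperK.parity v) := by
  rw [hn, sgnZ_add, mul_smul, h.parity, map_smul]

lemma densityOp_parity_eq (N : ℤ) (F v : SFun) : sgnZ N • parity (densityOp l F v) =
    densityOp l (parity F) (sgnZ N • parity v) := by
  rw [map_smul]; congr 1; exact densityOp_parity l F v

lemma zero_parity_eq (x y : ℂ) (F v : SFun) :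
    x • parity ((0 : SFun →ₗ[ℂ] Module.End ℂ SFun) F v) =
    (0 : SFun →ₗ[ℂ] Module.End ℂ SFun) (parity F) (y • parity v) := by simp

/-- Two-step extensions given by a cocycle. -/
lemma exists_isTri_two {n : ℤ} {b : ℂ} {β : SFun →ₗ[ℂ] Module.End ℂ SFun}
    (hβ : IsRelCochain l (l + n / 2) n β) (hb : β (bv 5) = b • Dp n)
    (ht : ∀ (a c : ZMod 2) (F G : SFun), Homog a F → Homog c G →
        tau l (l + n / 2) 0 0 β a c F G = 0) :
    ∃ (σ : KRep (Fin 2 → SFun)) (b' : Fin 2 → Fin 2 → ℂ), σ.IsTri l ![0, n] b' ∧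
      b' 1 0 = 2 * b := by
  let N : Fin 2 → ℤ := ![0, n]
  let Φ : Fin 2 → Fin 2 → SFun →ₗ[ℂ] Module.End ℂ SFun :=
    ![![densityOp (l + ((0 : ℤ) : ℂ) / 2), 0], ![β, densityOp (l + n / 2)]]
  have w0 : l + ((0 : ℤ) : ℂ) / 2 = l := by push_cast; ring
  refine ⟨KRep.ofEntries N Φ ?_ ?_, fun _ _ => 2 * b, KRep.isTri_ofEntries ?_ ?_ ?_ ?_, rfl⟩
  · intro i j F v
    fin_cases i <;> fin_cases j
    · exact densityOp_parity_eq 0 F v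
    · exact zero_parity_eq _ _ F v
    · exact hβ.parity_eq (zero_add n).symm F v
    · exact densityOp_parity_eq n F v
  · intro i k a c F G hF hG
    rw [Fin.sum_univ_two, Fin.sum_univ_two]
    fin_cases i <;> fin_cases k <;> simp [Φ]
    · exact densityOp_bracket _ a c F G hF hG
    · have := tau_eq_zero_iff.1 (ht a c F G hF hG)
      simp only [LinearMap.zero_apply, zero_mul, add_zero] at this
      rw [this]; module
    · exact densityOp_bracket _ a c F G hF hG
  · intro i j hij
    fin_cases i <;> fin_cases j <;> first | rfl | exact absurd hij (by decide)
  · intro i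
    fin_cases i <;> rfl
  · intro i j hij F hF
    fin_cases i <;> fin_cases j <;> first | exact hβ.conformal F hF | exact absurd hij (by decide)
  · intro i j hij
    fin_cases i <;> fin_cases j <;> first | exact absurd hij (by decide) | skip
    change β (bv 5) = (2 * b / 2) • Dp (n - 0)
    rw [hb, sub_zero, mul_div_cancel_left₀ _ two_ne_zero]

/-- Three-step extensions given by cochains. -/
lemma exists_isTri_three {n₁ n₂ : ℤ} {a b c : ℂ} {α β φ : SFun →ₗ[ℂ] Module.End ℂ SFun}
    (hα : IsRelCochain (l + n₁ / 2) (l + ((n₁ + n₂ : ℤ) : ℂ) / 2) n₂ α)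
    (hβ : IsRelCochain l (l + n₁ / 2) n₁ β)
    (hφ : IsRelCochain l (l + ((n₁ + n₂ : ℤ) : ℂ) / 2) (n₁ + n₂) φ) (ha : α (bv 5) = a • Dp n₂)
    (hb : β (bv 5) = b • Dp n₁) (hc : φ (bv 5) = c • Dp (n₁ + n₂))
    (htα : ∀ (a c : ZMod 2) (F G : SFun), Homog a F → Homog c G →
        tau (l + n₁ / 2) (l + ((n₁ + n₂ : ℤ) : ℂ) / 2) 0 0 α a c F G = 0)
    (htβ : ∀ (a c : ZMod 2) (F G : SFun), Homog a F → Homog c G →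
        tau l (l + n₁ / 2) 0 0 β a c F G = 0)
    (ht : ∀ (a c : ZMod 2) (F G : SFun), Homog a F → Homog c G →
        tau l (l + ((n₁ + n₂ : ℤ) : ℂ) / 2) α β φ a c F G = 0) :
    ∃ (σ : KRep (Fin 3 → SFun)), σ.IsTri l ![0, n₁, n₁ + n₂]
      ![![0, 0, 0], ![2 * b, 0, 0], ![2 * c, 2 * a, 0]] := by
  let N : Fin 3 → ℤ := ![0, n₁, n₁ + n₂]
  let Φ : Fin 3 → Fin 3 → SFun →ₗ[ℂ] Module.End ℂ SFun :=
    ![![densityOp (l + ((0 : ℤ) : ℂ) / 2), 0, 0], ![β, densityOp (l + n₁ / 2), 0],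
      ![φ, α, densityOp (l + ((n₁ + n₂ : ℤ) : ℂ) / 2)]]
  have w0 : l + ((0 : ℤ) : ℂ) / 2 = l := by push_cast; ring
  refine ⟨KRep.ofEntries N Φ ?_ ?_, KRep.isTri_ofEntries ?_ ?_ ?_ ?_⟩
  · intro i j F v
    fin_cases i <;> fin_cases j
    · exact densityOp_parity_eq 0 F v
    · exact zero_parity_eq _ _ F v
    · exact zero_parity_eq _ _ F v
    · exact hβ.parity_eq (zero_add n₁).symm F v
    · exact densityOp_parity_eq n₁ F v
    · exact zero_parity_eq _ _ F v
    · exact hφ.parity_eq (zero_add (n₁ + n₂)).symm F v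
    · exact hα.parity_eq rfl F v
    · exact densityOp_parity_eq (n₁ + n₂) F v
  · intro i k a c F G hF hG
    rw [Fin.sum_univ_three, Fin.sum_univ_three]
    fin_cases i <;> fin_cases k <;> simp [Φ, -Int.cast_add]
    · exact densityOp_bracket _ a c F G hF hG
    · have := tau_eq_zero_iff.1 (htβ a c F G hF hG)
      simp only [LinearMap.zero_apply, zero_mul, add_zero] at this
      rw [this]; module
    · exact densityOp_bracket _ a c F G hF hG
    · have := tau_eq_zero_iff.1 (ht a c F G hF hG)
      rw [this]; module
    · have := tau_eq_zero_iff.1 (htα a c F G hF hG)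
      simp only [LinearMap.zero_apply, zero_mul, add_zero] at this
      rw [this]; module
    · exact densityOp_bracket _ a c F G hF hG
  · intro i j hij
    fin_cases i <;> fin_cases j <;> first | rfl | exact absurd hij (by decide)
  · intro i
    fin_cases i <;> rfl
  · intro i j hij F hF
    fin_cases i <;> fin_cases j <;> first
      | exact absurd hij (by decide)
      | exact hβ.conformal F hF
      | exact hφ.conformal F hF
      | exact hα.conformal F hF
  · intro i j hij
    fin_cases i <;> fin_cases j <;> first | exact absurd hij (by decide) | skip
    · change β (bv 5) = (2 * b / 2) • Dp (n₁ - 0)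
      rw [hb, sub_zero, mul_div_cancel_left₀ _ two_ne_zero]
    · change φ (bv 5) = (2 * c / 2) • Dp (n₁ + n₂ - 0)
      rw [hc, sub_zero, mul_div_cancel_left₀ _ two_ne_zero]
    · change α (bv 5) = (2 * a / 2) • Dp (n₁ + n₂ - n₁)
      rw [ha, add_sub_cancel_left, mul_div_cancel_left₀ _ two_ne_zero]

end

namespace KRep.IsTri

variable {l : ℂ}

lemma tau_two {σ : KRep (Fin 2 → SFun)} {n : ℤ} {b : Fin 2 → Fin 2 → ℂ}
    (h : σ.IsTri l ![0, n] b) {a c : ZMod 2} {F G : SFun} (hF : Homog a F) (hG : Homog c G) :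
    tau l (l + n / 2) 0 0 (σ.entry 1 0) a c F G = 0 := by
  rw [tau_eq_zero_iff, σ.entry_bracket 1 0 hF hG, Fin.sum_univ_two, Fin.sum_univ_two,
    h.entry_self, h.entry_self, h.entry_self, h.entry_self]
  simp
  module

lemma tau_three {σ : KRep (Fin 3 → SFun)} {n₁ n₂ : ℤ} {b : Fin 3 → Fin 3 → ℂ}
    (h : σ.IsTri l ![0, n₁, n₁ + n₂] b) {a c : ZMod 2} {F G : SFun} (hF : Homog a F)
    (hG : Homog c G) : tau l (l + ((n₁ + n₂ : ℤ) : ℂ) / 2) (σ.entry 2 1) (σ.entry 1 0)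
      (σ.entry 2 0) a c F G = 0 := by
  rw [tau_eq_zero_iff, σ.entry_bracket 2 0 hF hG, Fin.sum_univ_three, Fin.sum_univ_three,
    h.entry_self, h.entry_self, h.entry_self, h.entry_self]
  simp
  module

lemma rel_two {σ : KRep (Fin 2 → SFun)} {n : ℤ} {b : Fin 2 → Fin 2 → ℂ}
    (h : σ.IsTri l ![0, n] b) : IsRelCochain l (l + n / 2) n (σ.entry 1 0) ∧
      σ.entry 1 0 (bv 5) = (b 1 0 / 2) • Dp n := by
  have h1 := h.isRelCochain_entry (show (0 : Fin 2) < 1 by decide)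
  have h2 := h.entry_bv5 (show (0 : Fin 2) < 1 by decide)
  simp at h1 h2
  exact ⟨h1, h2⟩

lemma rel_three {σ : KRep (Fin 3 → SFun)} {n₁ n₂ : ℤ} {b : Fin 3 → Fin 3 → ℂ}
    (h : σ.IsTri l ![0, n₁, n₁ + n₂] b) :
    (IsRelCochain l (l + n₁ / 2) n₁ (σ.entry 1 0) ∧
      σ.entry 1 0 (bv 5) = (b 1 0 / 2) • Dp n₁) ∧
    (IsRelCochain (l + n₁ / 2) (l + ((n₁ + n₂ : ℤ) : ℂ) / 2) n₂ (σ.entry 2 1) ∧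
      σ.entry 2 1 (bv 5) = (b 2 1 / 2) • Dp n₂) ∧
    (IsRelCochain l (l + ((n₁ + n₂ : ℤ) : ℂ) / 2) (n₁ + n₂) (σ.entry 2 0) ∧
      σ.entry 2 0 (bv 5) = (b 2 0 / 2) • Dp (n₁ + n₂)) := by
  have h1 := h.isRelCochain_entry (show (0 : Fin 3) < 1 by decide)
  have h2 := h.entry_bv5 (show (0 : Fin 3) < 1 by decide)
  have h3 := h.isRelCochain_entry (show (1 : Fin 3) < 2 by decide)
  have h4 := h.entry_bv5 (show (1 : Fin 3) < 2 by decide)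
  have h5 := h.isRelCochain_entry (show (0 : Fin 3) < 2 by decide)
  have h6 := h.entry_bv5 (show (0 : Fin 3) < 2 by decide)
  simp [-Int.cast_add] at h1 h2 h3 h4 h5 h6
  exact ⟨⟨h1, h2⟩, ⟨h3, h4⟩, ⟨h5, h6⟩⟩

/-- The truncations of a three-step extension. -/
lemma truncations {σ : KRep (Fin 3 → SFun)} {n₁ n₂ : ℤ} {b : Fin 3 → Fin 3 → ℂ}
    (h : σ.IsTri l ![0, n₁, n₁ + n₂] b) : ∃ (τ τ' : KRep (Fin 2 → SFun)) (c c' : Fin 2 → Fin 2 → ℂ),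
      τ.IsTri l ![0, n₁] c ∧ τ'.IsTri (l + n₁ / 2) ![0, n₂] c' ∧ c 1 0 = b 1 0 ∧ c' 1 0 = b 2 1 ∧
        (σ.IsChain ↔ τ.IsChain ∧ τ'.IsChain) := by
  obtain ⟨τ, h1, h2⟩ := h.exists_quotient
  obtain ⟨τ', h3, h4⟩ := h.exists_sub
  have e1 : (fun i : Fin 2 => (![0, n₁, n₁ + n₂] : Fin 3 → ℤ) i.castSucc) = ![0, n₁] := by
    funext i; fin_cases i <;> rfl
  rw [e1] at h1
  have h5 := h3.piShift (-n₁) (l + n₁ / 2) (by push_cast; ring) ![0, n₂] fun i => by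
    fin_cases i <;> simp
  refine ⟨τ, τ'.piShift (-n₁), _, _, h1, h5, rfl, rfl, fun hc => ⟨?_, ?_⟩, fun hc => ?_⟩
  · exact hc.of_surjective h2 (LinearMap.funLeft_surjective_of_injective _ _ _
      (Fin.castSucc_injective 2))
  · refine (isChain_piShift _).2 (hc.of_injective h4 fun u v huv => funext fun i => ?_)
    exact congrFun huv i.succ
  · exact isChain_three h2 h4 hc.1 ((isChain_piShift _).1 hc.2)

end KRep.IsTri

/-- The existence criterion for three-step extensions. -/
theorem existsUniserialExt_two_iff (l : ℂ) (n₁ n₂ : ℤ) : ExistsUniserialExt l [n₁, n₂] ↔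
    ExistsUniserialExt l [n₁] ∧ ExistsUniserialExt (l + (n₁ : ℂ) / 2) [n₂] ∧
      CupIsCoboundary l n₁ n₂ := by
  rw [existsUniserialExt_two, existsUniserialExt_one, existsUniserialExt_one]
  have w : l + (n₁ : ℂ) / 2 + n₂ / 2 = l + ((n₁ + n₂ : ℤ) : ℂ) / 2 := by push_cast; ring
  constructor
  · rintro ⟨σ, b, h, hc⟩
    obtain ⟨τ, τ', c, c', h1, h2, e1, e2, h3⟩ := h.truncations
    obtain ⟨hc1, hc2⟩ := h3.1 hc
    obtain ⟨k1, k2⟩ := h1.ne_zero_of_isChain hc1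
    obtain ⟨k3, k4⟩ := h2.ne_zero_of_isChain hc2
    rw [e1] at k1
    rw [e2] at k3
    obtain ⟨⟨r1, r2⟩, ⟨r3, r4⟩, r5, -⟩ := h.rel_three
    refine ⟨⟨τ, c, h1, hc1⟩, ⟨τ', c', h2, hc2⟩, (cupIsCoboundary_iff_of (by simpa using k2)
      (by simpa using k4) r3 r1 r4 r2 (div_ne_zero k3 two_ne_zero)
      (div_ne_zero k1 two_ne_zero)).2 ⟨_, r5, fun a c F G hF hG => h.tau_three hF hG⟩⟩
  · rintro ⟨⟨τ, c, h1, hc1⟩, ⟨τ', c', h2, hc2⟩, hcup⟩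
    obtain ⟨k1, k2⟩ := h1.ne_zero_of_isChain hc1
    obtain ⟨k3, k4⟩ := h2.ne_zero_of_isChain hc2
    obtain ⟨r1, r2⟩ := h1.rel_two
    obtain ⟨r3, r4⟩ := h2.rel_two
    rw [w] at r3
    obtain ⟨φ, hφ, ht⟩ := (cupIsCoboundary_iff_of (by simpa using k2)
      (by simpa using k4) r3 r1 r4 r2 (div_ne_zero k3 two_ne_zero)
      (div_ne_zero k1 two_ne_zero)).1 hcup
    obtain ⟨z, hz⟩ := hφ.exists_eq_smul_Dp
    obtain ⟨σ, hσ⟩ := exists_isTri_three r3 r1 hφ r4 r2 hz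
      (fun a c F G hF hG => w ▸ h2.tau_two hF hG) (fun a c F G hF hG => h1.tau_two hF hG) ht
    refine ⟨σ, _, hσ, ?_⟩
    obtain ⟨ρ, ρ', d, d', h1', h2', e1, e2, h3⟩ := hσ.truncations
    refine h3.2 ⟨h1.isChain_congr h1' (fun i j hij => ?_) hc1,
      h2.isChain_congr h2' (fun i j hij => ?_) hc2⟩
    · obtain ⟨rfl, rfl⟩ : i = 1 ∧ j = 0 := by omega
      rw [e1]
      exact mul_div_cancel₀ _ two_ne_zero
    · obtain ⟨rfl, rfl⟩ : i = 1 ∧ j = 0 := by omega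
      rw [e2]
      exact mul_div_cancel₀ _ two_ne_zero

/-! ## Uniqueness -/

/-- The relation between the constants of a three-step extension. -/
lemma KRep.IsTri.relation_three {l : ℂ} {k₁ k₂ : ℕ} {σ : KRep (Fin 3 → SFun)} {n₁ n₂ : ℤ}
    {b : Fin 3 → Fin 3 → ℂ} (h : σ.IsTri l ![0, n₁, n₁ + n₂] b) (h₁ : n₁ = k₁ + 3)
    (h₂ : n₂ = k₂ + 3) :
    b 2 1 / 2 * (b 1 0 / 2) * cupc k₁ k₂ + b 2 0 / 2 * obc l (k₁ + k₂ + 3) = 0 := by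
  obtain ⟨⟨r1, r2⟩, ⟨r3, r4⟩, r5, r6⟩ := h.rel_three
  have e := tau55 (h₂ ▸ r4) (h₁ ▸ r2) r5 r6 (k := k₁ + k₂ + 3) (by rw [h₁, h₂]; push_cast; ring) rfl
  rw [tauBv, h.tau_three (homog_bv 5) (homog_bv 5)] at e
  exact (smul_eq_zero.1 e.symm).resolve_right (bv_ne_zero 0)

theorem KRep.IsUniserialExt.equiv {W W' : Type} [AddCommGroup W] [Module ℂ W] [AddCommGroup W']
    [Module ℂ W'] {ρ : KRep W} {ρ' : KRep W'} {l : ℂ} {n₁ n₂ : ℤ}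
    (h : ρ.IsUniserialExt l [n₁, n₂]) (h' : ρ'.IsUniserialExt l [n₁, n₂]) : ρ.Equiv ρ' := by
  have key : ∀ {W : Type} [AddCommGroup W] [Module ℂ W] {ρ : KRep W},
      ρ.IsUniserialExt l [n₁, n₂] → ∃ (σ : KRep (Fin 3 → SFun)) (b : Fin 3 → Fin 3 → ℂ),
        σ.IsTri l ![0, n₁, n₁ + n₂] b ∧ ρ.Equiv σ ∧ b 1 0 ≠ 0 ∧ b 2 1 ≠ 0 ∧ 3 ≤ n₁ ∧ 3 ≤ n₂ := by
    intro W _ _ ρ h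
    obtain ⟨σ, b, hσ, he⟩ := KRep.IsSplitExtension.exists_isTri (N := partialSum [n₁, n₂]) h.1
    rw [partialSum_two] at hσ
    have hc : KRep.IsChain (V := Fin 3 → SFun) σ :=
      ((KRep.isUniserial_iff_isChain ρ).1 h.2).equiv he
    have hσ : KRep.IsTri (m := 3) σ l ![0, n₁, n₁ + n₂] b := hσ
    obtain ⟨τ, τ', c, c', h1, h2, e1, e2, h3⟩ := hσ.truncations
    obtain ⟨k1, k2⟩ := h1.ne_zero_of_isChain (h3.1 hc).1
    obtain ⟨k3, k4⟩ := h2.ne_zero_of_isChain (h3.1 hc).2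
    exact ⟨σ, b, hσ, he, e1 ▸ k1, e2 ▸ k3, by simpa using k2, by simpa using k4⟩
  obtain ⟨σ, b, hσ, he, k1, k2, k3, k4⟩ := key h
  obtain ⟨σ', b', hσ', he', k1', k2', -, -⟩ := key h'
  refine (he.trans ?_).trans he'.symm
  obtain ⟨m₁, hm₁⟩ : ∃ m : ℕ, n₁ = m + 3 := ⟨(n₁ - 3).toNat, by omega⟩
  obtain ⟨m₂, hm₂⟩ : ∃ m : ℕ, n₂ = m + 3 := ⟨(n₂ - 3).toNat, by omega⟩
  have r := hσ.relation_three hm₁ hm₂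
  have r' := hσ'.relation_three hm₁ hm₂
  have hcup := cupc_ne_zero m₁ m₂
  have hq : obc l (m₁ + m₂ + 3) ≠ 0 := fun h0 => by
    rw [h0, mul_zero, add_zero] at r
    exact mul_ne_zero (mul_ne_zero (div_ne_zero k2 two_ne_zero) (div_ne_zero k1 two_ne_zero)) hcup r
  have hb : b' 2 0 * (b 2 1 * b 1 0) = b 2 0 * (b' 2 1 * b' 1 0) := by
    refine mul_right_cancel₀ hq ?_
    linear_combination 2 * (b 2 1 * b 1 0) * r' - 2 * (b' 2 1 * b' 1 0) * r
  refine hσ.equiv_of_scale hσ' ![1, b' 1 0 / b 1 0, b' 1 0 / b 1 0 * (b' 2 1 / b 2 1)]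
    (fun i => ?_) fun i j hij => ?_
  · fin_cases i
    · exact one_ne_zero
    · exact div_ne_zero k1' k1
    · exact mul_ne_zero (div_ne_zero k1' k1) (div_ne_zero k2' k2)
  · have : (i = 1 ∧ j = 0) ∨ (i = 2 ∧ j = 0) ∨ (i = 2 ∧ j = 1) := by omega
    rcases this with ⟨rfl, rfl⟩ | ⟨rfl, rfl⟩ | ⟨rfl, rfl⟩
    · change b' 1 0 * 1 = b' 1 0 / b 1 0 * b 1 0
      field_simp
    · change b' 2 0 * 1 = b' 1 0 / b 1 0 * (b' 2 1 / b 2 1) * b 2 0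
      field_simp
      linear_combination hb
    · change b' 2 1 * (b' 1 0 / b 1 0) = b' 1 0 / b 1 0 * (b' 2 1 / b 2 1) * b 2 1
      field_simp

/-! ## Existence of two-step extensions -/

lemma isRelCochain_zero (l μ : ℂ) (n : ℤ) : IsRelCochain l μ n 0 :=
  ⟨fun F v => by simp, fun F _ => rfl, fun i j F G _ _ _ => by simp⟩

open StablePair in
lemma existsUniserialExt_one_of_good {l : ℂ} {n : ℤ} (hg : Good l n) : ExistsUniserialExt l [n] := by
  have hn : 3 ≤ n ∧ n ≤ 6 := by
    rcases hg with h | h | h | h <;> omega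
  obtain ⟨β, h1, h2⟩ := exists_isRelCochain l hn.1 1
  have ht : ∀ p q, tauBv l (l + n / 2) 0 0 β p q = 0 := by
    refine (CupData.of_isRelCochain (isRelCochain_zero l _ 0) (isRelCochain_zero l l 0)
      h1).tauBv_eq_zero (by omega) (fun r hr => ?_) (fun r hr => by omega) fun r hr => by omega
    obtain rfl : r = 0 := by omega
    obtain rfl : n = 6 := by omega
    have hl : l = -5 / 2 := by
      rcases hg with h | h | h | h <;> first | omega | exact h.2
    have := tau55 (α := 0) (β := 0) (a := 0) (b := 0) (k₁ := 0) (k₂ := 0) (k := 3)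
      (by simp) (by simp) h1 h2 (by norm_num) rfl
    rw [show 3 - 3 = 0 from rfl] at this
    rw [this, hl]
    simp [obc, cf, zetac, etac, dpc, ec, dc]
    norm_num
  obtain ⟨σ, b, hσ, hb⟩ := exists_isTri_two h1 h2
    fun a c F G hF hG => tau_eq_zero_of_tauBv ht hF hG
  refine existsUniserialExt_one.2 ⟨σ, b, hσ, hσ.isChain_of_good (by rw [hb]; norm_num) ?_⟩
  simpa using hg

open StablePair in
lemma existsUniserialExt_one_iff {l : ℂ} {n : ℤ} (hn : n = 3 ∨ n = 4 ∨ n = 5) :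
    ExistsUniserialExt l [n] ↔ Good l n := by
  refine ⟨fun h => ?_, existsUniserialExt_one_of_good⟩
  obtain ⟨σ, b, hσ, hc⟩ := existsUniserialExt_one.1 h
  simpa using hσ.good_of_isChain hc (by simpa using hn)

/-! ## Existence of three-step extensions -/

/-- Coefficients of the cup product of two normalised cochains at `(v_6, v_7)`. -/
def cup67 (l : ℂ) (k₁ k₂ r : ℕ) : ℂ :=
  cf (l + (k₁ + 3) / 2) k₂ 1 (r + 2 - k₁) * cf l k₁ 2 r -
    cf (l + (k₁ + 3) / 2) k₂ 2 (r + 1 - k₁) * cf l k₁ 1 r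

/-- Coefficients of the cup product of two normalised cochains at `(v_7, v_7)`. -/
def cup77 (l : ℂ) (k₁ k₂ r : ℕ) : ℂ :=
  2 * (cf (l + (k₁ + 3) / 2) k₂ 2 (r + 2 - k₁) * cf l k₁ 2 r)

section

variable {l c : ℂ} {n₁ n₂ n : ℤ} {α β φ : SFun →ₗ[ℂ] Module.End ℂ SFun}

lemma apply_apply_bv {k₁ k₂ : ℕ} (h₁ : n₁ = k₁ + 3) (h₂ : n₂ = k₂ + 3)
    (hα : IsRelCochain (l + n₁ / 2) (l + ((n₁ + n₂ : ℤ) : ℂ) / 2) n₂ α)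
    (hβ : IsRelCochain l (l + n₁ / 2) n₁ β) (ha : α (bv 5) = (1 : ℂ) • Dp n₂)
    (hb : β (bv 5) = (1 : ℂ) • Dp n₁) (p q r : ℕ) (hr : r + q + p = k₁ + k₂) :
    α (bv (p + 5)) (β (bv (q + 5)) (bv r)) =
      (cf (l + (k₁ + 3) / 2) k₂ p (r + q - k₁) * cf l k₁ q r) • bv 0 := by
  have w : l + (n₁ : ℂ) / 2 + n₂ / 2 = l + ((n₁ + n₂ : ℤ) : ℂ) / 2 := by push_cast; ring
  have w' : l + ((k₁ : ℂ) + 3) / 2 = l + n₁ / 2 := by rw [h₁]; push_cast; ring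
  have hα' : IsRelCochain (l + n₁ / 2) (l + n₁ / 2 + n₂ / 2) n₂ α := by rw [w]; exact hα
  rw [hβ.apply_bv h₁ hb, map_smul, hα'.apply_bv h₂ ha, smul_smul, w', one_mul, one_mul, mul_comm]
  rcases lt_or_ge (r + q) k₁ with h | h
  · rw [cf_eq_zero l h, mul_zero, zero_smul, zero_smul]
  · rw [show r + q - k₁ + p - k₂ = 0 by omega]

lemma tau67_nine {k₁ k₂ : ℕ}
    (hα : IsRelCochain (l + n₁ / 2) (l + ((n₁ + n₂ : ℤ) : ℂ) / 2) n₂ α)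
    (hβ : IsRelCochain l (l + n₁ / 2) n₁ β) (ha : α (bv 5) = (1 : ℂ) • Dp n₂)
    (hb : β (bv 5) = (1 : ℂ) • Dp n₁)
    (hφ : IsRelCochain l (l + ((n₁ + n₂ : ℤ) : ℂ) / 2) (n₁ + n₂) φ)
    (hc : φ (bv 5) = c • Dp (n₁ + n₂))
    (h₁ : n₁ = k₁ + 3) (h₂ : n₂ = k₂ + 3) (hk : k₁ + k₂ = 3) :
    tauBv l (l + ((n₁ + n₂ : ℤ) : ℂ) / 2) α β φ 6 7 (bv 0) = (cup67 l k₁ k₂ 0 + c *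
      (3 * l * cf l 6 1 5 - 3 * l * cf l 6 2 4 - 3 / 2 * cf l 6 6 0)) • bv 0 := by
  have hn : n₁ + n₂ = ((6 : ℕ) : ℤ) + 3 := by rw [h₁, h₂]; push_cast; omega
  have A1 := hφ.apply_bv hn hc 1
  have A2 := hφ.apply_bv hn hc 2
  have A6 := hφ.apply_bv hn hc 6
  have B1 := apply_apply_bv h₁ h₂ hα hβ ha hb 1 2 0 hk.symm
  have B2 := apply_apply_bv h₁ h₂ hα hβ ha hb 2 1 0 hk.symm
  have o6 := densityOp_bv6_even l 0
  have o7 := densityOp_bv7_even l 0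
  have s1 : sgn (((6 : ℕ) : ZMod 2) * ((7 : ℕ) : ZMod 2)) = 1 := by
    rw [← Nat.cast_mul, sgn_natCast]; norm_num
  have s2 : sgn (((7 : ℕ) : ZMod 2) * ((6 : ℕ) : ZMod 2)) = 1 := by
    rw [← Nat.cast_mul, sgn_natCast]; norm_num
  have s3 : sgn (((6 : ℕ) : ZMod 2) * ((7 : ℕ) : ZMod 2)) = 1 := s1
  unfold tauBv tau hact
  rw [s1, s2, cbracket_bv6_bv7, map_smul]
  simp only [Nat.reduceAdd, Nat.reduceMul, Nat.cast_zero, Nat.zero_add] at A1 A2 A6 B1 B2 o6 o7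
  simp only [LinearMap.sub_apply, LinearMap.add_apply, LinearMap.smul_apply, Module.End.mul_apply,
    map_smul, A1, A2, A6, B1, B2, smul_smul, o6, o7, cf_eq_zero l (show 0 + 1 < 6 by norm_num),
    cf_eq_zero l (show 0 + 2 < 6 by norm_num), cup67, Nat.zero_add, Nat.reduceSub, Nat.reduceAdd]
  match_scalars <;> ring

lemma tau67_ten {k₁ k₂ : ℕ}
    (hα : IsRelCochain (l + n₁ / 2) (l + ((n₁ + n₂ : ℤ) : ℂ) / 2) n₂ α)
    (hβ : IsRelCochain l (l + n₁ / 2) n₁ β) (ha : α (bv 5) = (1 : ℂ) • Dp n₂)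
    (hb : β (bv 5) = (1 : ℂ) • Dp n₁)
    (hφ : IsRelCochain l (l + ((n₁ + n₂ : ℤ) : ℂ) / 2) (n₁ + n₂) φ)
    (hc : φ (bv 5) = c • Dp (n₁ + n₂))
    (h₁ : n₁ = k₁ + 3) (h₂ : n₂ = k₂ + 3) (hk : k₁ + k₂ = 4) :
    tauBv l (l + ((n₁ + n₂ : ℤ) : ℂ) / 2) α β φ 6 7 (bv 1) = (cup67 l k₁ k₂ 1 + c *
      (1 / 2 * cf l 7 1 6 - (3 / 2 + 3 * l) * cf l 7 2 5 - 3 / 2 * cf l 7 6 1)) • bv 0 := by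
  have hn : n₁ + n₂ = ((7 : ℕ) : ℤ) + 3 := by rw [h₁, h₂]; push_cast; omega
  have A1 := hφ.apply_bv hn hc 1
  have A2 := hφ.apply_bv hn hc 2
  have A6 := hφ.apply_bv hn hc 6
  have B1 := apply_apply_bv h₁ h₂ hα hβ ha hb 1 2 1 (by omega)
  have B2 := apply_apply_bv h₁ h₂ hα hβ ha hb 2 1 1 (by omega)
  have o6 := densityOp_bv6_odd l 0
  have o7 := densityOp_bv7_odd l 0
  have s1 : sgn (((6 : ℕ) : ZMod 2) * ((7 : ℕ) : ZMod 2)) = 1 := by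
    rw [← Nat.cast_mul, sgn_natCast]; norm_num
  have s2 : sgn (((7 : ℕ) : ZMod 2) * ((6 : ℕ) : ZMod 2)) = 1 := by
    rw [← Nat.cast_mul, sgn_natCast]; norm_num
  unfold tauBv tau hact
  rw [s1, s2, cbracket_bv6_bv7, map_smul]
  simp only [Nat.reduceAdd, Nat.reduceMul, Nat.cast_zero, Nat.zero_add] at A1 A2 A6 B1 B2 o6 o7
  simp only [LinearMap.sub_apply, LinearMap.add_apply, LinearMap.smul_apply, Module.End.mul_apply,
    map_smul, A1, A2, A6, B1, B2, smul_smul, o6, o7, cf_eq_zero l (show 1 + 1 < 7 by norm_num),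
    cf_eq_zero l (show 1 + 2 < 7 by norm_num), cup67, Nat.reduceSub, Nat.reduceAdd]
  match_scalars <;> ring

lemma tau77_ten {k₁ k₂ : ℕ}
    (hα : IsRelCochain (l + n₁ / 2) (l + ((n₁ + n₂ : ℤ) : ℂ) / 2) n₂ α)
    (hβ : IsRelCochain l (l + n₁ / 2) n₁ β) (ha : α (bv 5) = (1 : ℂ) • Dp n₂)
    (hb : β (bv 5) = (1 : ℂ) • Dp n₁)
    (hφ : IsRelCochain l (l + ((n₁ + n₂ : ℤ) : ℂ) / 2) (n₁ + n₂) φ)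
    (hc : φ (bv 5) = c • Dp (n₁ + n₂))
    (h₁ : n₁ = k₁ + 3) (h₂ : n₂ = k₂ + 3) (hk : k₁ + k₂ = 4) :
    tauBv l (l + ((n₁ + n₂ : ℤ) : ℂ) / 2) α β φ 7 7 (bv 0) = (cup77 l k₁ k₂ 0 + c *
      (6 * l * cf l 7 2 5 - 1 / 2 * cf l 7 7 0)) • bv 0 := by
  have hn : n₁ + n₂ = ((7 : ℕ) : ℤ) + 3 := by rw [h₁, h₂]; push_cast; omega
  have A2 := hφ.apply_bv hn hc 2
  have A7 := hφ.apply_bv hn hc 7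
  have B1 := apply_apply_bv h₁ h₂ hα hβ ha hb 2 2 0 (by omega)
  have o7 := densityOp_bv7_even l 0
  have s1 : sgn (((7 : ℕ) : ZMod 2) * ((7 : ℕ) : ZMod 2)) = -1 := by
    rw [← Nat.cast_mul, sgn_natCast]; norm_num
  unfold tauBv tau hact
  rw [s1, cbracket_bv7_bv7, map_smul]
  simp only [Nat.reduceAdd, Nat.reduceMul, Nat.cast_zero, Nat.zero_add] at A2 A7 B1 o7
  simp only [LinearMap.sub_apply, LinearMap.add_apply, LinearMap.smul_apply, Module.End.mul_apply,
    map_smul, A2, A7, B1, smul_smul, o7,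
    cf_eq_zero l (show 0 + 2 < 7 by norm_num), cup77, Nat.reduceSub, Nat.reduceAdd, Nat.zero_add]
  match_scalars <;> ring

end

/-- The cup product of the cochains of lengths `n₁/2` and `n₂/2` is a coboundary if and only if the
lowest coefficients match. -/
lemma cupIsCoboundary_iff_coeffs {l : ℂ} {n₁ n₂ : ℤ} {k₁ k₂ : ℕ} (h₁ : n₁ = k₁ + 3)
    (h₂ : n₂ = k₂ + 3) (hk : k₁ + k₂ ≤ 4) : CupIsCoboundary l n₁ n₂ ↔
      ∃ c : ℂ, cupc k₁ k₂ + c * obc l (k₁ + k₂ + 3) = 0 ∧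
        (k₁ + k₂ = 3 → cup67 l k₁ k₂ 0 + c *
          (3 * l * cf l 6 1 5 - 3 * l * cf l 6 2 4 - 3 / 2 * cf l 6 6 0) = 0) ∧
        (k₁ + k₂ = 4 → cup67 l k₁ k₂ 1 + c *
          (1 / 2 * cf l 7 1 6 - (3 / 2 + 3 * l) * cf l 7 2 5 - 3 / 2 * cf l 7 6 1) = 0 ∧
          cup77 l k₁ k₂ 0 + c * (6 * l * cf l 7 2 5 - 1 / 2 * cf l 7 7 0) = 0) := by
  obtain ⟨β, hβ, hb⟩ := exists_isRelCochain l (n := n₁) (by omega) 1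
  obtain ⟨α, hα, ha⟩ := exists_isRelCochain (l + n₁ / 2) (n := n₂) (by omega) 1
  have w : l + (n₁ : ℂ) / 2 + n₂ / 2 = l + ((n₁ + n₂ : ℤ) : ℂ) / 2 := by push_cast; ring
  rw [w] at hα
  have hn : n₁ + n₂ = ((k₁ + k₂ + 3 : ℕ) : ℤ) + 3 := by rw [h₁, h₂]; push_cast; ring
  have t55 : ∀ {c : ℂ} {φ}, IsRelCochain l (l + ((n₁ + n₂ : ℤ) : ℂ) / 2) (n₁ + n₂) φ →
      φ (bv 5) = c • Dp (n₁ + n₂) →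
      tauBv l (l + ((n₁ + n₂ : ℤ) : ℂ) / 2) α β φ 5 5 (bv (k₁ + k₂)) =
        (cupc k₁ k₂ + c * obc l (k₁ + k₂ + 3)) • bv 0 := fun hφ hc => by
    have := tau55 (h₂ ▸ ha) (h₁ ▸ hb) hφ hc hn rfl
    rwa [one_mul, one_mul] at this
  have z : ∀ {c : ℂ}, c • bv 0 = 0 → c = 0 := fun h => (smul_eq_zero.1 h).resolve_right (bv_ne_zero 0)
  rw [cupIsCoboundary_iff_of (by omega) (by omega) hα hβ ha hb one_ne_zero one_ne_zero]
  constructor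
  · rintro ⟨φ, hφ, ht⟩
    obtain ⟨c, hc⟩ := hφ.exists_eq_smul_Dp
    have ht' : ∀ p q r, tauBv l (l + ((n₁ + n₂ : ℤ) : ℂ) / 2) α β φ p q (bv r) = 0 := fun p q r => by
      rw [tauBv, ht _ _ _ _ (homog_bv p) (homog_bv q)]; rfl
    refine ⟨c, z ?_, fun h3 => z ?_, fun h4 => ⟨z ?_, z ?_⟩⟩
    · rw [← t55 hφ hc, ht']
    · rw [← tau67_nine hα hβ ha hb hφ hc h₁ h₂ h3, ht']
    · rw [← tau67_ten hα hβ ha hb hφ hc h₁ h₂ h4, ht']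
    · rw [← tau77_ten hα hβ ha hb hφ hc h₁ h₂ h4, ht']
  · rintro ⟨c, e1, e2, e3⟩
    obtain ⟨φ, hφ, hc⟩ := exists_isRelCochain l (n := n₁ + n₂) (by omega) c
    refine ⟨φ, hφ, fun a c F G hF hG => tau_eq_zero_of_tauBv ?_ hF hG⟩
    refine (CupData.of_isRelCochain hα hβ hφ).tauBv_eq_zero (by omega) (fun r hr => ?_)
      (fun r hr => ?_) fun r hr => ?_
    · obtain rfl : r = k₁ + k₂ := by omega
      rw [t55 hφ hc, e1, zero_smul]
    · by_cases h3 : k₁ + k₂ = 3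
      · obtain rfl : r = 0 := by omega
        rw [tau67_nine hα hβ ha hb hφ hc h₁ h₂ h3, e2 h3, zero_smul]
      · obtain rfl : r = 1 := by omega
        rw [tau67_ten hα hβ ha hb hφ hc h₁ h₂ (by omega), (e3 (by omega)).1, zero_smul]
    · obtain rfl : r = 0 := by omega
      rw [tau77_ten hα hβ ha hb hφ hc h₁ h₂ (by omega), (e3 (by omega)).2, zero_smul]

lemma cupIsCoboundary_iff_ne_zero {l : ℂ} {n₁ n₂ : ℤ} {k₁ k₂ : ℕ} (h₁ : n₁ = k₁ + 3)
    (h₂ : n₂ = k₂ + 3) (hk : k₁ + k₂ ≤ 2) :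
    CupIsCoboundary l n₁ n₂ ↔ obc l (k₁ + k₂ + 3) ≠ 0 := by
  rw [cupIsCoboundary_iff_coeffs h₁ h₂ (by omega)]
  constructor
  · rintro ⟨c, e, -⟩ h0
    rw [h0, mul_zero, add_zero] at e
    exact cupc_ne_zero k₁ k₂ e
  · intro h
    exact ⟨-cupc k₁ k₂ / obc l (k₁ + k₂ + 3), by rw [div_mul_cancel₀ _ h]; ring,
      fun h3 => by omega, fun h4 => by omega⟩

lemma cupIsCoboundary_iff_ne_zero_of_nine {l : ℂ} {n₁ n₂ : ℤ} {k₁ k₂ : ℕ} (h₁ : n₁ = k₁ + 3)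
    (h₂ : n₂ = k₂ + 3) (hk : k₁ + k₂ = 3) (e : cup67 l k₁ k₂ 0 * obc l 6 = cupc k₁ k₂ *
      (3 * l * cf l 6 1 5 - 3 * l * cf l 6 2 4 - 3 / 2 * cf l 6 6 0)) :
    CupIsCoboundary l n₁ n₂ ↔ obc l 6 ≠ 0 := by
  rw [cupIsCoboundary_iff_coeffs h₁ h₂ (by omega), hk]
  constructor
  · rintro ⟨c, e, -⟩ h0
    rw [h0, mul_zero, add_zero] at e
    exact cupc_ne_zero k₁ k₂ e
  · intro h
    refine ⟨-cupc k₁ k₂ / obc l 6, by rw [div_mul_cancel₀ _ h]; ring, fun _ => ?_,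
      fun h4 => by omega⟩
    refine (mul_eq_zero.1 ?_).resolve_right h
    have : -cupc k₁ k₂ / obc l 6 * obc l 6 = -cupc k₁ k₂ := div_mul_cancel₀ _ h
    linear_combination e + this *
      (3 * l * cf l 6 1 5 - 3 * l * cf l 6 2 4 - 3 / 2 * cf l 6 6 0)

lemma obc_three (l : ℂ) : obc l 3 = l * (2 * l + 5) := by
  simp [obc, cf, zetac, etac, dpc, ec, dc, show ¬ Even 5 by decide, show ¬ Even 3 by decide,
    show Even 6 by decide, show ¬ Even 7 by decide]; ring

lemma obc_four (l : ℂ) : obc l 4 = 2 * l + 3 := by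
  simp [obc, cf, zetac, etac, dpc, ec, dc, show ¬ Even 5 by decide, show ¬ Even 3 by decide,
    show Even 4 by decide, show Even 6 by decide, show ¬ Even 7 by decide]; ring

lemma obc_five (l : ℂ) : obc l 5 = 2 * (2 * l ^ 2 + 7 * l + 2) := by
  simp [obc, cf, zetac, etac, dpc, ec, dc, show ¬ Even 5 by decide, show ¬ Even 3 by decide,
    show Even 4 by decide, show Even 6 by decide, show ¬ Even 7 by decide]; ring

lemma obc_six (l : ℂ) : obc l 6 = 6 * (l + 2) := by
  simp [obc, cf, zetac, etac, dpc, ec, dc, show ¬ Even 5 by decide, show ¬ Even 3 by decide,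
    show Even 4 by decide, show Even 6 by decide, show ¬ Even 7 by decide]; ring

lemma cf_six (l : ℂ) : 3 * l * cf l 6 1 5 - 3 * l * cf l 6 2 4 - 3 / 2 * cf l 6 6 0 =
    6 * l * (l + 2) * (2 * l + 5) := by
  simp [cf, etac, dpc, ec, dc, show ¬ Even 5 by decide, show ¬ Even 3 by decide,
    show Even 4 by decide, show Even 6 by decide, show ¬ Even 7 by decide, show Even 8 by decide,
    show ¬ Even 9 by decide, show Even 10 by decide]; ring

lemma cupc_two_one : cupc 2 1 = -2 := by
  simp [cupc, cf, dpc, dc, show ¬ Even 3 by decide]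
lemma cupc_one_two : cupc 1 2 = 2 := by
  simp [cupc, cf, dpc, dc, show ¬ Even 3 by decide]
lemma cupc_zero_three : cupc 0 3 = -2 := by
  simp [cupc, cf, dpc, dc, show ¬ Even 3 by decide]; norm_num
lemma cup67_two_one (l : ℂ) : cup67 l 2 1 0 = - 2 * l * (2 * l + 5) := by
  simp [cup67, cf, etac, dpc, ec, dc, show ¬ Even 3 by decide, show ¬ Even 5 by decide,
    show Even 6 by decide]; ring
lemma cup67_one_two (l : ℂ) : cup67 l 1 2 0 = 2 * l * (2 * l + 5) := by
  simp [cup67, cf, etac, dpc, ec, dc, show ¬ Even 3 by decide, show ¬ Even 5 by decide,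
    show Even 6 by decide]; ring
lemma cup67_zero_three (l : ℂ) : cup67 l 0 3 0 = 12 * l + 24 := by
  simp [cup67, cf, etac, dpc, ec, dc, show ¬ Even 3 by decide, show ¬ Even 5 by decide,
    show Even 6 by decide]; ring

open StablePair in
lemma existsUniserialExt_two_iff_good {l : ℂ} {n₁ n₂ : ℤ} (h₁ : n₁ = 3 ∨ n₁ = 4 ∨ n₁ = 5)
    (h₂ : n₂ = 3 ∨ n₂ = 4 ∨ n₂ = 5) : ExistsUniserialExt l [n₁, n₂] ↔
      Good l n₁ ∧ Good (l + n₁ / 2) n₂ ∧ CupIsCoboundary l n₁ n₂ := by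
  rw [existsUniserialExt_two_iff, existsUniserialExt_one_iff h₁, existsUniserialExt_one_iff h₂]

lemma good_three {l : ℂ} : StablePair.Good l 3 ↔ l ≠ -1 / 2 := by simp [StablePair.Good]
lemma good_four {l : ℂ} : StablePair.Good l 4 ↔ l ≠ 0 := by simp [StablePair.Good]
lemma good_five {l : ℂ} : StablePair.Good l 5 ↔ l ≠ 0 ∧ l ≠ -1 := by simp [StablePair.Good]

theorem exists_three_three (l : ℂ) :
    ExistsUniserialExt l [3, 3] ↔ -2 * l ∉ ({0, 1, 4, 5} : Set ℂ) := by
  rw [existsUniserialExt_two_iff_good (by simp) (by simp), cupIsCoboundary_iff_ne_zero (k₁ := 0)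
    (k₂ := 0) (by norm_num) (by norm_num) (by norm_num), good_three,
    good_three]
  have e1 : l + ((3 : ℤ) : ℂ) / 2 = -1 / 2 ↔ l = -2 :=
    ⟨fun h => by linear_combination (1 : ℂ) * h, fun h => by linear_combination (1 : ℂ) * h⟩
  have e2 : -2 * l = 0 ↔ l = 0 :=
    ⟨fun h => by linear_combination (-1 / 2 : ℂ) * h, fun h => by linear_combination (-2 : ℂ) * h⟩
  have e3 : -2 * l = 1 ↔ l = -1 / 2 :=
    ⟨fun h => by linear_combination (-1 / 2 : ℂ) * h, fun h => by linear_combination (-2 : ℂ) * h⟩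
  have e4 : -2 * l = 4 ↔ l = -2 :=
    ⟨fun h => by linear_combination (-1 / 2 : ℂ) * h, fun h => by linear_combination (-2 : ℂ) * h⟩
  have e5 : -2 * l = 5 ↔ l = -5 / 2 :=
    ⟨fun h => by linear_combination (-1 / 2 : ℂ) * h, fun h => by linear_combination (-2 : ℂ) * h⟩
  have e6 : obc l 3 = 0 ↔ l = 0 ∨ l = -5 / 2 := by
    rw [obc_three, mul_eq_zero]
    exact or_congr_right ⟨fun h => by linear_combination (1 / 2) * h,
      fun h => by linear_combination 2 * h⟩
  simp only [Set.mem_insert_iff, Set.mem_singleton_iff, ne_eq, Nat.reduceAdd, e1, e2, e3, e4, e5, e6]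
  tauto

theorem exists_four_three (l : ℂ) :
    ExistsUniserialExt l [4, 3] ↔ -2 * l ∉ ({0, 3, 5} : Set ℂ) := by
  rw [existsUniserialExt_two_iff_good (by simp) (by simp), cupIsCoboundary_iff_ne_zero (k₁ := 1)
    (k₂ := 0) (by norm_num) (by norm_num) (by norm_num), good_four,
    good_three]
  have e1 : l + ((4 : ℤ) : ℂ) / 2 = -1 / 2 ↔ l = -5 / 2 :=
    ⟨fun h => by linear_combination (1 : ℂ) * h, fun h => by linear_combination (1 : ℂ) * h⟩
  have e2 : -2 * l = 0 ↔ l = 0 :=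
    ⟨fun h => by linear_combination (-1 / 2 : ℂ) * h, fun h => by linear_combination (-2 : ℂ) * h⟩
  have e3 : -2 * l = 3 ↔ l = -3 / 2 :=
    ⟨fun h => by linear_combination (-1 / 2 : ℂ) * h, fun h => by linear_combination (-2 : ℂ) * h⟩
  have e4 : -2 * l = 5 ↔ l = -5 / 2 :=
    ⟨fun h => by linear_combination (-1 / 2 : ℂ) * h, fun h => by linear_combination (-2 : ℂ) * h⟩
  have e5 : obc l 4 = 0 ↔ l = -3 / 2 := by
    rw [obc_four]
    exact ⟨fun h => by linear_combination (1 / 2) * h, fun h => by linear_combination 2 * h⟩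
  simp only [Set.mem_insert_iff, Set.mem_singleton_iff, ne_eq, Nat.reduceAdd, e1, e2, e3, e4, e5]
  tauto

theorem exists_three_four (l : ℂ) :
    ExistsUniserialExt l [3, 4] ↔ -2 * l ∉ ({1, 3} : Set ℂ) := by
  rw [existsUniserialExt_two_iff_good (by simp) (by simp), cupIsCoboundary_iff_ne_zero (k₁ := 0)
    (k₂ := 1) (by norm_num) (by norm_num) (by norm_num), good_three,
    good_four]
  have e1 : l + ((3 : ℤ) : ℂ) / 2 = 0 ↔ l = -3 / 2 :=
    ⟨fun h => by linear_combination (1 : ℂ) * h, fun h => by linear_combination (1 : ℂ) * h⟩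
  have e2 : -2 * l = 1 ↔ l = -1 / 2 :=
    ⟨fun h => by linear_combination (-1 / 2 : ℂ) * h, fun h => by linear_combination (-2 : ℂ) * h⟩
  have e3 : -2 * l = 3 ↔ l = -3 / 2 :=
    ⟨fun h => by linear_combination (-1 / 2 : ℂ) * h, fun h => by linear_combination (-2 : ℂ) * h⟩
  have e4 : obc l 4 = 0 ↔ l = -3 / 2 := by
    rw [obc_four]
    exact ⟨fun h => by linear_combination (1 / 2) * h, fun h => by linear_combination 2 * h⟩
  simp only [Set.mem_insert_iff, Set.mem_singleton_iff, ne_eq, Nat.reduceAdd, e1, e2, e3, e4]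
  tauto

theorem exists_five_three (l : ℂ) :
    ExistsUniserialExt l [5, 3] ↔ -4 * l ∉ ({0, 4, 12, 7 + ((√33 : ℝ) : ℂ), 7 - ((√33 : ℝ) : ℂ)} : Set ℂ) := by
  rw [existsUniserialExt_two_iff_good (by simp) (by simp), cupIsCoboundary_iff_ne_zero (k₁ := 2)
    (k₂ := 0) (by norm_num) (by norm_num) (by norm_num), good_five,
    good_three]
  have e1 : l + ((5 : ℤ) : ℂ) / 2 = -1 / 2 ↔ l = -3 :=
    ⟨fun h => by linear_combination (1 : ℂ) * h, fun h => by linear_combination (1 : ℂ) * h⟩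
  have e2 : -4 * l = 0 ↔ l = 0 :=
    ⟨fun h => by linear_combination (-1 / 4 : ℂ) * h, fun h => by linear_combination (-4 : ℂ) * h⟩
  have e3 : -4 * l = 4 ↔ l = -1 :=
    ⟨fun h => by linear_combination (-1 / 4 : ℂ) * h, fun h => by linear_combination (-4 : ℂ) * h⟩
  have e4 : -4 * l = 12 ↔ l = -3 :=
    ⟨fun h => by linear_combination (-1 / 4 : ℂ) * h, fun h => by linear_combination (-4 : ℂ) * h⟩
  have hs : ((√33 : ℝ) : ℂ) ^ 2 = 33 := by
    rw [← Complex.ofReal_pow, Real.sq_sqrt (by norm_num)]; norm_num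
  have e5 : obc l 5 = 0 ↔ -4 * l = 7 + ((√33 : ℝ) : ℂ) ∨ -4 * l = 7 - ((√33 : ℝ) : ℂ) := by
    rw [obc_five, ← sub_eq_zero (b := 7 + ((√33 : ℝ) : ℂ)), ← sub_eq_zero (b := 7 - ((√33 : ℝ) : ℂ)), ← mul_eq_zero]
    constructor
    · intro h; linear_combination 4 * h - hs
    · intro h; linear_combination (1 / 4) * h + (1 / 4) * hs
  simp only [Set.mem_insert_iff, Set.mem_singleton_iff, ne_eq, Nat.reduceAdd, e1, e2, e3, e4, e5]
  tauto

theorem exists_three_five (l : ℂ) :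
    ExistsUniserialExt l [3, 5] ↔ -4 * l ∉ ({2, 6, 10, 7 + ((√33 : ℝ) : ℂ), 7 - ((√33 : ℝ) : ℂ)} : Set ℂ) := by
  rw [existsUniserialExt_two_iff_good (by simp) (by simp), cupIsCoboundary_iff_ne_zero (k₁ := 0)
    (k₂ := 2) (by norm_num) (by norm_num) (by norm_num), good_three,
    good_five]
  have e1 : l + ((3 : ℤ) : ℂ) / 2 = 0 ↔ l = -3 / 2 :=
    ⟨fun h => by linear_combination (1 : ℂ) * h, fun h => by linear_combination (1 : ℂ) * h⟩
  have e2 : l + ((3 : ℤ) : ℂ) / 2 = -1 ↔ l = -5 / 2 :=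
    ⟨fun h => by linear_combination (1 : ℂ) * h, fun h => by linear_combination (1 : ℂ) * h⟩
  have e3 : -4 * l = 2 ↔ l = -1 / 2 :=
    ⟨fun h => by linear_combination (-1 / 4 : ℂ) * h, fun h => by linear_combination (-4 : ℂ) * h⟩
  have e4 : -4 * l = 6 ↔ l = -3 / 2 :=
    ⟨fun h => by linear_combination (-1 / 4 : ℂ) * h, fun h => by linear_combination (-4 : ℂ) * h⟩
  have e5 : -4 * l = 10 ↔ l = -5 / 2 :=
    ⟨fun h => by linear_combination (-1 / 4 : ℂ) * h, fun h => by linear_combination (-4 : ℂ) * h⟩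
  have hs : ((√33 : ℝ) : ℂ) ^ 2 = 33 := by
    rw [← Complex.ofReal_pow, Real.sq_sqrt (by norm_num)]; norm_num
  have e6 : obc l 5 = 0 ↔ -4 * l = 7 + ((√33 : ℝ) : ℂ) ∨ -4 * l = 7 - ((√33 : ℝ) : ℂ) := by
    rw [obc_five, ← sub_eq_zero (b := 7 + ((√33 : ℝ) : ℂ)), ← sub_eq_zero (b := 7 - ((√33 : ℝ) : ℂ)), ← mul_eq_zero]
    constructor
    · intro h; linear_combination 4 * h - hs
    · intro h; linear_combination (1 / 4) * h + (1 / 4) * hs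
  simp only [Set.mem_insert_iff, Set.mem_singleton_iff, ne_eq, Nat.reduceAdd, e1, e2, e3, e4, e5, e6]
  tauto

theorem exists_four_four (l : ℂ) :
    ExistsUniserialExt l [4, 4] ↔ -4 * l ∉ ({0, 8, 7 + ((√33 : ℝ) : ℂ), 7 - ((√33 : ℝ) : ℂ)} : Set ℂ) := by
  rw [existsUniserialExt_two_iff_good (by simp) (by simp), cupIsCoboundary_iff_ne_zero (k₁ := 1)
    (k₂ := 1) (by norm_num) (by norm_num) (by norm_num), good_four,
    good_four]
  have e1 : l + ((4 : ℤ) : ℂ) / 2 = 0 ↔ l = -2 :=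
    ⟨fun h => by linear_combination (1 : ℂ) * h, fun h => by linear_combination (1 : ℂ) * h⟩
  have e2 : -4 * l = 0 ↔ l = 0 :=
    ⟨fun h => by linear_combination (-1 / 4 : ℂ) * h, fun h => by linear_combination (-4 : ℂ) * h⟩
  have e3 : -4 * l = 8 ↔ l = -2 :=
    ⟨fun h => by linear_combination (-1 / 4 : ℂ) * h, fun h => by linear_combination (-4 : ℂ) * h⟩
  have hs : ((√33 : ℝ) : ℂ) ^ 2 = 33 := by
    rw [← Complex.ofReal_pow, Real.sq_sqrt (by norm_num)]; norm_num
  have e4 : obc l 5 = 0 ↔ -4 * l = 7 + ((√33 : ℝ) : ℂ) ∨ -4 * l = 7 - ((√33 : ℝ) : ℂ) := by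
    rw [obc_five, ← sub_eq_zero (b := 7 + ((√33 : ℝ) : ℂ)), ← sub_eq_zero (b := 7 - ((√33 : ℝ) : ℂ)), ← mul_eq_zero]
    constructor
    · intro h; linear_combination 4 * h - hs
    · intro h; linear_combination (1 / 4) * h + (1 / 4) * hs
  simp only [Set.mem_insert_iff, Set.mem_singleton_iff, ne_eq, Nat.reduceAdd, e1, e2, e3, e4]
  tauto

theorem exists_five_four (l : ℂ) :
    ExistsUniserialExt l [5, 4] ↔ -4 * l ∉ ({0, 4, 8, 10} : Set ℂ) := by
  rw [existsUniserialExt_two_iff_good (by simp) (by simp), cupIsCoboundary_iff_ne_zero_of_nine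
    (k₁ := 2) (k₂ := 1) (by norm_num) (by norm_num) rfl
    (by rw [cup67_two_one, obc_six, cupc_two_one, cf_six]; ring), good_five,
    good_four]
  have e1 : l + ((5 : ℤ) : ℂ) / 2 = 0 ↔ l = -5 / 2 :=
    ⟨fun h => by linear_combination (1 : ℂ) * h, fun h => by linear_combination (1 : ℂ) * h⟩
  have e2 : -4 * l = 0 ↔ l = 0 :=
    ⟨fun h => by linear_combination (-1 / 4 : ℂ) * h, fun h => by linear_combination (-4 : ℂ) * h⟩
  have e3 : -4 * l = 4 ↔ l = -1 :=
    ⟨fun h => by linear_combination (-1 / 4 : ℂ) * h, fun h => by linear_combination (-4 : ℂ) * h⟩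
  have e4 : -4 * l = 8 ↔ l = -2 :=
    ⟨fun h => by linear_combination (-1 / 4 : ℂ) * h, fun h => by linear_combination (-4 : ℂ) * h⟩
  have e5 : -4 * l = 10 ↔ l = -5 / 2 :=
    ⟨fun h => by linear_combination (-1 / 4 : ℂ) * h, fun h => by linear_combination (-4 : ℂ) * h⟩
  have e6 : obc l 6 = 0 ↔ l = -2 := by
    rw [obc_six]
    exact ⟨fun h => by linear_combination (1 / 6) * h, fun h => by linear_combination 6 * h⟩
  simp only [Set.mem_insert_iff, Set.mem_singleton_iff, ne_eq, Nat.reduceAdd, e1, e2, e3, e4, e5, e6]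
  tauto

theorem exists_four_five (l : ℂ) :
    ExistsUniserialExt l [4, 5] ↔ -4 * l ∉ ({0, 8, 12} : Set ℂ) := by
  rw [existsUniserialExt_two_iff_good (by simp) (by simp), cupIsCoboundary_iff_ne_zero_of_nine
    (k₁ := 1) (k₂ := 2) (by norm_num) (by norm_num) rfl
    (by rw [cup67_one_two, obc_six, cupc_one_two, cf_six]; ring), good_four,
    good_five]
  have e1 : l + ((4 : ℤ) : ℂ) / 2 = 0 ↔ l = -2 :=
    ⟨fun h => by linear_combination (1 : ℂ) * h, fun h => by linear_combination (1 : ℂ) * h⟩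
  have e2 : l + ((4 : ℤ) : ℂ) / 2 = -1 ↔ l = -3 :=
    ⟨fun h => by linear_combination (1 : ℂ) * h, fun h => by linear_combination (1 : ℂ) * h⟩
  have e3 : -4 * l = 0 ↔ l = 0 :=
    ⟨fun h => by linear_combination (-1 / 4 : ℂ) * h, fun h => by linear_combination (-4 : ℂ) * h⟩
  have e4 : -4 * l = 8 ↔ l = -2 :=
    ⟨fun h => by linear_combination (-1 / 4 : ℂ) * h, fun h => by linear_combination (-4 : ℂ) * h⟩
  have e5 : -4 * l = 12 ↔ l = -3 :=
    ⟨fun h => by linear_combination (-1 / 4 : ℂ) * h, fun h => by linear_combination (-4 : ℂ) * h⟩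
  have e6 : obc l 6 = 0 ↔ l = -2 := by
    rw [obc_six]
    exact ⟨fun h => by linear_combination (1 / 6) * h, fun h => by linear_combination 6 * h⟩
  simp only [Set.mem_insert_iff, Set.mem_singleton_iff, ne_eq, Nat.reduceAdd, e1, e2, e3, e4, e5, e6]
  tauto

lemma good_six : StablePair.Good (-5 / 2) 6 := by simp [StablePair.Good]

theorem exists_three_six : ExistsUniserialExt (-4) [3, 6] := by
  rw [existsUniserialExt_two_iff]
  refine ⟨existsUniserialExt_one_of_good (good_three.2 (by norm_num)), ?_, ?_⟩
  · rw [show (-4 : ℂ) + ((3 : ℤ) : ℂ) / 2 = -5 / 2 by norm_num]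
    exact existsUniserialExt_one_of_good good_six
  · rw [cupIsCoboundary_iff_ne_zero_of_nine (k₁ := 0) (k₂ := 3) (by norm_num) (by norm_num) rfl
      (by rw [cup67_zero_three, obc_six, cupc_zero_three, cf_six]; norm_num), obc_six]
    norm_num

theorem exists_five_five : ExistsUniserialExt (-9 / 2) [5, 5] := by
  rw [existsUniserialExt_two_iff]
  refine ⟨existsUniserialExt_one_of_good (good_five.2 (by norm_num)),
    existsUniserialExt_one_of_good (good_five.2 (by norm_num)), ?_⟩
  refine (cupIsCoboundary_iff_coeffs (k₁ := 2) (k₂ := 2) (by norm_num) (by norm_num)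
    (by norm_num)).2 ⟨-4 / 30, ?_, fun h => by omega, fun _ => ⟨?_, ?_⟩⟩
  · simp [cupc, obc, cf, zetac, etac, dpc, ec, dc, show ¬ Even 3 by decide, show Even 4 by decide,
      show ¬ Even 5 by decide, show Even 6 by decide, show ¬ Even 7 by decide, show Even 8 by decide,
      show ¬ Even 9 by decide, show Even 10 by decide, show ¬ Even 11 by decide]
    norm_num
  · simp [cup67, cf, etac, dpc, ec, dc, show ¬ Even 3 by decide, show Even 4 by decide,
      show ¬ Even 5 by decide, show Even 6 by decide, show ¬ Even 7 by decide, show Even 8 by decide,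
      show ¬ Even 9 by decide, show Even 10 by decide, show ¬ Even 11 by decide]
    norm_num
  · simp [cup77, cf, etac, dpc, ec, dc, show ¬ Even 3 by decide, show Even 4 by decide,
      show ¬ Even 5 by decide, show Even 6 by decide, show ¬ Even 7 by decide, show Even 8 by decide,
      show ¬ Even 9 by decide, show Even 10 by decide, show ¬ Even 11 by decide]
    norm_num

theorem exists_four_six : ExistsUniserialExt (-9 / 2) [4, 6] := by
  rw [existsUniserialExt_two_iff]
  refine ⟨existsUniserialExt_one_of_good (good_four.2 (by norm_num)), ?_, ?_⟩
  · rw [show (-9 / 2 : ℂ) + ((4 : ℤ) : ℂ) / 2 = -5 / 2 by norm_num]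
    exact existsUniserialExt_one_of_good good_six
  refine (cupIsCoboundary_iff_coeffs (k₁ := 1) (k₂ := 3) (by norm_num) (by norm_num)
    (by norm_num)).2 ⟨4 / 30, ?_, fun h => by omega, fun _ => ⟨?_, ?_⟩⟩
  · simp [cupc, obc, cf, zetac, etac, dpc, ec, dc, show ¬ Even 3 by decide, show Even 4 by decide,
      show ¬ Even 5 by decide, show Even 6 by decide, show ¬ Even 7 by decide, show Even 8 by decide,
      show ¬ Even 9 by decide, show Even 10 by decide, show ¬ Even 11 by decide]
    norm_num
  · simp [cup67, cf, etac, dpc, ec, dc, show ¬ Even 3 by decide, show Even 4 by decide,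
      show ¬ Even 5 by decide, show Even 6 by decide, show ¬ Even 7 by decide, show Even 8 by decide,
      show ¬ Even 9 by decide, show Even 10 by decide, show ¬ Even 11 by decide]
    norm_num
  · simp [cup77, cf, etac, dpc, ec, dc, show ¬ Even 3 by decide, show Even 4 by decide,
      show ¬ Even 5 by decide, show Even 6 by decide, show ¬ Even 7 by decide, show Even 8 by decide,
      show ¬ Even 9 by decide, show Even 10 by decide, show ¬ Even 11 by decide]
    norm_num

/-! ## The action on pseudodifferential operators -/

lemma leibniz_of_dx_pow {c : ℂ → SFun} {H : SFun} (z : ℂ) {n : ℕ} (h : (dx ^ n) H = 0) :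
    leibniz c H z = ∑ j ∈ Finset.range n, binom (z + j) j • (c (z + j) * (dx ^ j) H) := by
  have hz : ∀ j, n ≤ j → (dx ^ j) H = 0 := fun j hj => by
    obtain ⟨i, rfl⟩ := Nat.exists_eq_add_of_le hj
    rw [add_comm, pow_add, Module.End.mul_apply, h, map_zero]
  rw [leibniz_eq c H z (le_max_left (degBound H) n)]
  symm
  refine Finset.sum_subset (Finset.range_mono (le_max_right _ _)) fun j _ hj => ?_
  rw [hz j (by simpa using hj), mul_zero, smul_zero]

lemma leibniz_three (c : ℂ → SFun) {H : SFun} (z : ℂ) (h : dx (dx (dx H)) = 0) :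
    leibniz c H z = c z * H + (z + 1) • (c (z + 1) * dx H) +
      ((z + 2) * (z + 1) / 2) • (c (z + 2) * dx (dx H)) := by
  rw [leibniz_of_dx_pow z (n := 3) (by simpa [pow_succ] using h), Finset.sum_range_succ,
    Finset.sum_range_succ, Finset.sum_range_one]
  have b0 : binom (z + (0 : ℕ)) 0 = 1 := by simp [binom]
  have b1 : binom (z + (1 : ℕ)) 1 = z + 1 := by simp [binom]
  have b2 : binom (z + (2 : ℕ)) 2 = (z + 2) * (z + 1) / 2 := by
    rw [binom, Finset.prod_range_succ, Finset.prod_range_one, Nat.factorial_two]; push_cast; ring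
  rw [b0, b1, b2]
  simp [pow_succ]

/-- The action of an odd Hamiltonian `ξ h`. -/
lemma psiOp_inr (ν q : ℂ) (h : ℂ[X]) (T : PsiSym) : psiOp ν q (inr h) T =
    psiLeft (ν + q) (inr h) T - psiRight ν (inr h) (psiPar T) := by
  rw [psiOp_odd ν q (homog_inr h)]; rfl

lemma psiLeft_apply (l : ℂ) (F : SFun) (T : PsiSym) (z : ℂ) : psiLeft l F T z =
    (F * (dx (T z).1 + (T (z - 1)).1) +
        (1 / 2 : ℂ) • (D F * (Dbar (T z).1 - parity (T (z - 1)).2)) + l • (dx F * (T z).1),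
      F * (dx (T z).2 + (T (z - 1)).2) +
        (1 / 2 : ℂ) • (D F * (Dbar (T z).2 + parity (T z).1)) + l • (dx F * (T z).2)) := rfl

lemma psiRight_apply (l : ℂ) (F : SFun) (T : PsiSym) (z : ℂ) : psiRight l F T z =
    ((psiMulROp F T (z - 1)).1 + (1 / 2 : ℂ) • -(psiMulROp (D F) T (z - 1)).2 +
        l • (psiMulROp (dx F) T z).1,
      (psiMulROp F T (z - 1)).2 + (1 / 2 : ℂ) • (psiMulROp (D F) T z).1 +
        l • (psiMulROp (dx F) T z).2) := rfl

lemma dx_pow_three {h : ℂ[X]} (h3 : derivative (derivative (derivative h)) = 0) :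
    dx (dx (dx (inl h : SFun))) = 0 ∧ dx (dx (dx (inr h : SFun))) = 0 :=
  ⟨TrivSqZeroExt.ext (by simpa using h3) (by simp), TrivSqZeroExt.ext (by simp) (by simpa using h3)⟩

lemma psiOp_inr_fst (ν q : ℂ) {h : ℂ[X]} (h3 : derivative (derivative (derivative h)) = 0)
    (T : PsiSym) (z : ℂ) : (2 : ℂ) • (psiOp ν q (inr h) T z).1 =
      inl h * D (T z).1 + (2 * (q - z)) • (inr (derivative h) * (T z).1) +
      (z + 2 * ν) • (inl (derivative h) * eps (T z).2) -
      ((z + 1) * (z + 2 * ν)) • (inr (derivative (derivative h)) * (T (z + 1)).1) +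
      ((z + 1) * (z + 4 * ν) / 2) • (inl (derivative (derivative h)) * eps (T (z + 1)).2) := by
  have l3 := fun c z => leibniz_three c z (dx_pow_three h3).1
  have r3 := fun c z => leibniz_three c z (dx_pow_three h3).2
  have h3' : derivative (derivative (derivative (derivative h))) = 0 := by rw [h3, map_zero]
  have l3' := fun c z => leibniz_three c z (dx_pow_three h3').1
  have r3' := fun c z => leibniz_three c z (dx_pow_three h3').2
  have d1 : D (inr h : SFun) = inl h := TrivSqZeroExt.ext (by simp) (by simp)
  have d2 : dx (inr h : SFun) = inr (derivative h) := TrivSqZeroExt.ext (by simp) (by simp)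
  have d2' : dx (inl h : SFun) = inl (derivative h) := TrivSqZeroExt.ext (by simp) (by simp)
  have d3 : Dbar (inr h : SFun) = inl h := TrivSqZeroExt.ext (by simp) (by simp)
  have d3' : Dbar (inr (derivative h) : SFun) = inl (derivative h) :=
    TrivSqZeroExt.ext (by simp) (by simp)
  have d4 : parity (inl h : SFun) = inl h := TrivSqZeroExt.ext (by simp) (by simp)
  rw [psiOp_inr]
  simp only [psi_sub_apply, psiLeft_apply, psiRight_apply, psiMulROp_fst, psiMulROp_snd, d1, d2, d3,
    d3', d4, l3, r3, l3', r3', Prod.fst_sub, psiPar_apply, sub_add_cancel, d2']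
  rw [show z - 1 + 2 = z + 1 by ring]
  refine TrivSqZeroExt.ext ?_ ?_ <;>
  simp [eps_apply, -smul_add] <;>
  (apply Polynomial.funext; intro r; simp [h3]; try ring)

lemma psiOp_inr_snd (ν q : ℂ) {h : ℂ[X]} (h3 : derivative (derivative (derivative h)) = 0)
    (T : PsiSym) (z : ℂ) : (2 : ℂ) • (psiOp ν q (inr h) T z).2 =
      inl h * D (T z).2 + (2 * (q - z) - 1) • (inr (derivative h) * (T z).2) -
      (z + 1) • (inl (derivative h) * eps (T (z + 1)).1) -
      ((z + 1 + 2 * ν) * (z + 1)) • (inr (derivative (derivative h)) * (T (z + 1)).2) -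
      ((z + 2) * (z + 1) / 2) • (inl (derivative (derivative h)) * eps (T (z + 2)).1) := by
  have l3 := fun c z => leibniz_three c z (dx_pow_three h3).1
  have r3 := fun c z => leibniz_three c z (dx_pow_three h3).2
  have h3' : derivative (derivative (derivative (derivative h))) = 0 := by rw [h3, map_zero]
  have l3' := fun c z => leibniz_three c z (dx_pow_three h3').1
  have r3' := fun c z => leibniz_three c z (dx_pow_three h3').2
  have l4 := fun c z => leibniz_three c z (h := (dx_pow_three (h := -h) (by simp [h3])).2)
  have l4' := fun c z => leibniz_three c z
    (h := (dx_pow_three (h := -derivative h) (by simp [h3])).2)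
  have d5 : parity (inr h : SFun) = inr (-h) := TrivSqZeroExt.ext (by simp) (by simp)
  have d5' : parity (inr (derivative h) : SFun) = inr (-derivative h) :=
    TrivSqZeroExt.ext (by simp) (by simp)
  have d3'' : Dbar (inl h : SFun) = inr (-derivative h) := TrivSqZeroExt.ext (by simp) (by simp)
  have d1 : D (inr h : SFun) = inl h := TrivSqZeroExt.ext (by simp) (by simp)
  have d2 : dx (inr h : SFun) = inr (derivative h) := TrivSqZeroExt.ext (by simp) (by simp)
  have d2' : dx (inl h : SFun) = inl (derivative h) := TrivSqZeroExt.ext (by simp) (by simp)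
  have d3 : Dbar (inr h : SFun) = inl h := TrivSqZeroExt.ext (by simp) (by simp)
  have d3' : Dbar (inr (derivative h) : SFun) = inl (derivative h) :=
    TrivSqZeroExt.ext (by simp) (by simp)
  have d4 : parity (inl h : SFun) = inl h := TrivSqZeroExt.ext (by simp) (by simp)
  rw [psiOp_inr]
  simp only [psi_sub_apply, psiLeft_apply, psiRight_apply, psiMulROp_fst, psiMulROp_snd, d1, d2, d3,
    d3', d4, d5, d5', d3'', l3, l4, l4', l3', r3', Prod.snd_sub, psiPar_apply, sub_add_cancel, d2']
  rw [show z - 1 + 2 = z + 1 by ring]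
  refine TrivSqZeroExt.ext ?_ ?_ <;>
  simp [eps_apply, -smul_add] <;>
  (apply Polynomial.funext; intro r; simp [h3]; try ring)

/-! ## Levels of symbols -/

lemma mem_psiSub_zero {k : ℂ} {T : PsiSym} : T ∈ psiSub k 0 ↔ ∀ z : ℂ,
    ((∀ s : ℕ, z ≠ k - s) → (T z).1 = 0) ∧ ((∀ s : ℕ, z ≠ k - s - 1) → (T z).2 = 0) := by
  have e0 : ∀ j : ℕ, (0 : ZMod 2) - j = 0 ↔ Even j := fun j => by
    rw [zero_sub, neg_eq_zero, ZMod.natCast_eq_zero_iff_even]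
  have e1 : ∀ j : ℕ, (0 : ZMod 2) - j = 1 ↔ Odd j := fun j => by
    rw [zero_sub, neg_eq_iff_eq_neg, ZModModule.neg_eq_self, ZMod.natCast_eq_one_iff_odd]
  refine forall_congr' fun z => and_congr ?_ ?_
  · refine ⟨fun h hs => by_contra fun h0 => ?_, fun h h0 => ?_⟩
    · obtain ⟨j, hj, rfl⟩ := h h0
      obtain ⟨s, rfl⟩ := (e0 j).1 hj
      exact hs s (by push_cast; ring)
    · by_contra hc
      refine h0 (h fun s hs => hc ⟨2 * s, (e0 _).2 (even_two_mul s), ?_⟩)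
      rw [hs]; push_cast; ring
  · refine ⟨fun h hs => by_contra fun h0 => ?_, fun h h0 => ?_⟩
    · obtain ⟨j, hj, rfl⟩ := h h0
      obtain ⟨s, rfl⟩ := (e1 j).1 hj
      exact hs s (by push_cast; ring)
    · by_contra hc
      refine h0 (h fun s hs => hc ⟨2 * s + 1, (e1 _).2 (odd_two_mul_add_one s), ?_⟩)
      rw [hs]; push_cast; ring

lemma psiOp_inr_mem_psiSub {ν q k : ℂ} {h : ℂ[X]} (h3 : derivative (derivative (derivative h)) = 0)
    {T : PsiSym} (hT : T ∈ psiSub k 0) : psiOp ν q (inr h) T ∈ psiSub k 0 := by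
  rw [mem_psiSub_zero] at hT ⊢
  refine fun z => ⟨fun hz => ?_, fun hz => ?_⟩
  · have a1 := (hT z).1 hz
    have a2 := (hT z).2 fun s hs => hz (s + 1) (by rw [hs]; push_cast; ring)
    have a3 := (hT (z + 1)).1 fun s hs => hz (s + 1) (by push_cast; linear_combination hs)
    have a4 := (hT (z + 1)).2 fun s hs => hz (s + 2) (by push_cast; linear_combination hs)
    have := psiOp_inr_fst ν q h3 T z
    rw [a1, a2, a3, a4] at this
    simpa using this
  · have a1 := (hT z).2 hz
    have a2 := (hT (z + 1)).1 fun s hs => hz s (by linear_combination hs)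
    have a3 := (hT (z + 1)).2 fun s hs => hz (s + 1) (by push_cast; linear_combination hs)
    have a4 := (hT (z + 2)).1 fun s hs => hz (s + 1) (by push_cast; linear_combination hs)
    have := psiOp_inr_snd ν q h3 T z
    rw [a1, a2, a3, a4] at this
    simpa using this

lemma psiPar_mem_psiSub {k : ℂ} {T : PsiSym} (hT : T ∈ psiSub k 0) : psiPar T ∈ psiSub k 0 := by
  rw [mem_psiSub_zero] at hT ⊢
  refine fun z => ⟨fun hz => ?_, fun hz => ?_⟩
  · rw [psiPar_apply, (hT z).1 hz, map_zero]
  · rw [psiPar_apply, (hT z).2 hz, map_zero, neg_zero]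

/-- The coefficient `G_j` of a symbol `∑ j, G_j D̄^{2k-j}`. -/
def level (k : ℂ) (j : ℤ) : PsiSym →ₗ[ℂ] SFun where
  toFun T := if Even j then (T (k - j / 2)).1 else (T (k - (j + 1) / 2)).2
  map_add' S T := by split_ifs <;> simp
  map_smul' c T := by split_ifs <;> simp

lemma level_even (k : ℂ) (s : ℤ) (T : PsiSym) : level k (2 * s) T = (T (k - s)).1 := by
  simp [level]

lemma level_odd (k : ℂ) (s : ℤ) (T : PsiSym) : level k (2 * s - 1) T = (T (k - s)).2 := by
  have : ¬ Even (2 * s - 1) := by rw [Int.not_even_iff_odd]; exact ⟨s - 1, by ring⟩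
  simp [level, this]

lemma level_neg {k : ℂ} {T : PsiSym} (hT : T ∈ psiSub k 0) {j : ℤ} (hj : j < 0) :
    level k j T = 0 := by
  rw [mem_psiSub_zero] at hT
  rcases Int.even_or_odd' j with ⟨s, rfl | rfl⟩
  · rw [level_even]
    refine (hT _).1 fun m hm => ?_
    have : (s : ℂ) = ((m : ℤ) : ℂ) := by push_cast; linear_combination -hm
    have := Int.cast_injective this
    omega
  · rw [show 2 * s + 1 = 2 * (s + 1) - 1 by ring, level_odd]
    refine (hT _).2 fun m hm => ?_
    have : (s : ℂ) = ((m : ℤ) : ℂ) := by push_cast at hm ⊢; linear_combination -hm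
    have := Int.cast_injective this
    omega

/-- The coefficient of `G_j` in the action of `ξ x` at level `j + 1`. -/
def theta (k ν : ℂ) (j : ℤ) : ℂ := if Even j then -(k - j / 2) else k - (j + 1) / 2 + 2 * ν

/-- The coefficient of `G_j` in the action of `ξ x²` at level `j + 3`. -/
def gam (k ν : ℂ) (j : ℤ) : ℂ :=
  if Even j then -((k - j / 2) * (k - j / 2 - 1))
  else (k - (j + 1) / 2) * (k - (j + 1) / 2 - 1 + 4 * ν)

lemma theta_even (k ν : ℂ) (s : ℤ) : theta k ν (2 * s) = -(k - s) := by simp [theta]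
lemma gam_even (k ν : ℂ) (s : ℤ) : gam k ν (2 * s) = -((k - s) * (k - s - 1)) := by simp [gam]
lemma theta_odd (k ν : ℂ) (s : ℤ) : theta k ν (2 * s - 1) = k - s + 2 * ν := by
  have : ¬ Even (2 * s - 1) := by rw [Int.not_even_iff_odd]; exact ⟨s - 1, by ring⟩
  simp [theta, this]
lemma gam_odd (k ν : ℂ) (s : ℤ) : gam k ν (2 * s - 1) = (k - s) * (k - s - 1 + 4 * ν) := by
  have : ¬ Even (2 * s - 1) := by rw [Int.not_even_iff_odd]; exact ⟨s - 1, by ring⟩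
  simp [gam, this]

lemma level_psiPar (k : ℂ) (j : ℕ) (T : PsiSym) :
    level k j (psiPar T) = sgnZ j • parity (level k j T) := by
  rcases Nat.even_or_odd' j with ⟨s, rfl | rfl⟩
  · have := level_even k s
    push_cast
    rw [this, this, psiPar_apply]; simp [sgnZ]
  · have := level_odd k (s + 1)
    push_cast at this ⊢
    rw [show (2 * s + 1 : ℤ) = 2 * (s + 1) - 1 by ring, this, this, psiPar_apply]
    have h : Odd (2 * (s + 1 : ℤ) - 1) := ⟨s, by ring⟩
    simp [sgnZ, h]

/-- The action of `ξ h`, for `h` at most quadratic, in terms of levels. -/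
lemma two_smul_level_psiOp (ν l k : ℂ) {h : ℂ[X]}
    (h3 : derivative (derivative (derivative h)) = 0) (T : PsiSym) (j : ℤ) :
    (2 : ℂ) • level k j (psiOp ν (l + k) (inr h) T) =
      inl h * D (level k j T) + (2 * (l + j / 2)) • (inr (derivative h) * level k j T) +
      theta k ν (j - 1) • (inl (derivative h) * eps (level k (j - 1) T)) +
      (theta k ν (j - 2) * theta k ν (j - 1)) •
        (inr (derivative (derivative h)) * level k (j - 2) T) +
      (gam k ν (j - 3) / 2) • (inl (derivative (derivative h)) * eps (level k (j - 3) T)) := by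
  rcases Int.even_or_odd' j with ⟨s, rfl | rfl⟩
  · rw [show 2 * s - 2 = 2 * (s - 1) by ring, show 2 * s - 3 = 2 * (s - 1) - 1 by ring]
    simp only [level_even, level_odd, theta_even, theta_odd, gam_odd]
    rw [psiOp_inr_fst ν _ h3]
    push_cast
    rw [show k - s + 1 = k - (s - 1) by ring]
    module
  · rw [show 2 * s + 1 - 1 = 2 * s by ring, show 2 * s + 1 - 3 = 2 * (s - 1) by ring,
      show 2 * s + 1 - 2 = 2 * s - 1 by ring, show 2 * s + 1 = 2 * (s + 1) - 1 by ring]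
    simp only [level_even, level_odd, theta_even, theta_odd, gam_even]
    rw [psiOp_inr_snd ν _ h3]
    push_cast
    rw [show k - (s + 1) + 1 = k - s by ring, show k - (s + 1 : ℂ) + 2 = k - (s - 1) by ring]
    module

lemma two_smul_level_bv_one (ν l k : ℂ) (T : PsiSym) (j : ℤ) :
    (2 : ℂ) • level k j (psiOp ν (l + k) (bv 1) T) = D (level k j T) := by
  have := two_smul_level_psiOp ν l k (h := 1) (by simp) T j
  simpa [bv] using this

lemma two_smul_level_bv_three (ν l k : ℂ) (T : PsiSym) (j : ℤ) :
    (2 : ℂ) • level k j (psiOp ν (l + k) (bv 3) T) =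
      Eo (l + j / 2) (level k j T) + theta k ν (j - 1) • eps (level k (j - 1) T) := by
  have := two_smul_level_psiOp ν l k (h := X) (by simp) T j
  have h3 : ¬ Even 3 := by decide
  simpa [bv, h3, Eo, xm, xim, xi] using this

lemma two_smul_level_bv_five (ν l k : ℂ) (T : PsiSym) (j : ℤ) :
    (2 : ℂ) • level k j (psiOp ν (l + k) (bv 5) T) = Fo (l + j / 2) (level k j T) +
      (2 * theta k ν (j - 1)) • xm (eps (level k (j - 1) T)) +
      (2 * (theta k ν (j - 2) * theta k ν (j - 1))) • xim (level k (j - 2) T) +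
      gam k ν (j - 3) • eps (level k (j - 3) T) := by
  have := two_smul_level_psiOp ν l k (h := X ^ 2) (by simp) T j
  have h5 : ¬ Even 5 := by decide
  have e1 : (inl (X ^ 2) : SFun) = inl X * inl X := by rw [← inl_mul, sq]
  have e2 : (inr (derivative (X ^ 2)) : SFun) = (2 : ℂ) • (inl X * inr 1) :=
    TrivSqZeroExt.ext (by simp) (Polynomial.funext fun r => by norm_num)
  have e3 : (inl (derivative (X ^ 2)) : SFun) = (2 : ℂ) • inl X :=
    TrivSqZeroExt.ext (Polynomial.funext fun r => by norm_num) (by simp)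
  have e4 : (inr (derivative (derivative (X ^ 2))) : SFun) = (2 : ℂ) • inr 1 :=
    TrivSqZeroExt.ext (by simp) (Polynomial.funext fun r => by norm_num)
  have e5 : (inl (derivative (derivative (X ^ 2))) : SFun) = (2 : ℂ) • 1 :=
    TrivSqZeroExt.ext (Polynomial.funext fun r => by norm_num) (by simp)
  rw [e1, e2, e3, e4, e5] at this
  simp only [bv, h5, if_false, show 5 / 2 = 2 from rfl]
  rw [this]
  simp only [Fo, xm, xim, xi, LinearMap.add_apply, LinearMap.smul_apply, Module.End.mul_apply,
    mul_apply', smul_mul_assoc, mul_assoc, one_mul]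
  module

/-- A symbol with prescribed levels. -/
lemma exists_level_eq (k : ℂ) (G : ℕ → SFun) :
    ∃ T ∈ psiSub k 0, ∀ j : ℕ, level k j T = G j := by
  classical
  have hi : ∀ {s s' : ℕ}, k - s = k - s' → s = s' := fun h =>
    Nat.cast_injective (R := ℂ) (by linear_combination -h)
  let T : PsiSym := fun z => (if h : ∃ s : ℕ, z = k - s then G (2 * h.choose) else 0,
    if h : ∃ s : ℕ, z = k - s - 1 then G (2 * h.choose + 1) else 0)
  have h1 : ∀ z, (T z).1 = if h : ∃ s : ℕ, z = k - s then G (2 * h.choose) else 0 := fun _ => rfl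
  have h2 : ∀ z, (T z).2 = if h : ∃ s : ℕ, z = k - s - 1 then G (2 * h.choose + 1) else 0 :=
    fun _ => rfl
  refine ⟨T, mem_psiSub_zero.2 fun z => ⟨fun h => ?_, fun h => ?_⟩, fun j => ?_⟩
  · rw [h1, dif_neg (by simpa using h)]
  · rw [h2, dif_neg (by simpa using h)]
  · rcases Nat.even_or_odd' j with ⟨s, rfl | rfl⟩
    · have := level_even k s T
      have h : ∃ s' : ℕ, k - (s : ℂ) = k - s' := ⟨s, rfl⟩
      push_cast at this ⊢
      rw [this, h1, dif_pos h]
      congr 2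
      exact hi h.choose_spec.symm
    · have := level_odd k (s + 1) T
      have h : ∃ s' : ℕ, k - (((s + 1 : ℤ)) : ℂ) = k - s' - 1 := ⟨s, by push_cast; ring⟩
      push_cast at this h ⊢
      rw [show (2 * s + 1 : ℤ) = 2 * (s + 1) - 1 by ring, this, h2, dif_pos h]
      congr 2
      refine congrArg _ (hi ?_)
      linear_combination -h.choose_spec

/-! ## Diagonalising the conformal action on symbols -/

section Ladder

lemma sum_range_shift {M : Type*} [AddCommMonoid M] (F : ℕ → ℤ → M)
    (hF : ∀ i n, n < 0 → F i n = 0) (d j : ℕ) :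
    ∑ i ∈ Finset.range (j + 1), F i (i - d) = ∑ i ∈ Finset.range (j + 1 - d), F (i + d) i := by
  rcases le_total d (j + 1) with h | h
  · obtain ⟨m, hm⟩ := Nat.exists_eq_add_of_le h
    rw [hm, Finset.sum_range_add, Finset.sum_eq_zero, zero_add, Nat.add_sub_cancel_left]
    · refine Finset.sum_congr rfl fun i _ => ?_
      rw [add_comm d i]; congr 1; push_cast; ring
    · exact fun i hi => hF _ _ (by have := Finset.mem_range.1 hi; omega)
  · rw [Nat.sub_eq_zero_of_le h, Finset.sum_range_zero]
    exact Finset.sum_eq_zero fun i hi => hF _ _ (by have := Finset.mem_range.1 hi; omega)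

lemma sum_range_truncate {M : Type*} [AddCommMonoid M] {f : ℕ → M} {m n : ℕ} (hmn : m ≤ n)
    (h : ∀ i, m ≤ i → i < n → f i = 0) :
    ∑ i ∈ Finset.range n, f i = ∑ i ∈ Finset.range m, f i :=
  (Finset.sum_subset (Finset.range_mono hmn) fun i hi hi' =>
    h i (by simpa using hi') (by simpa using hi)).symm

variable (l : ℂ) (θ γ : ℤ → ℂ)

/-- The coefficients of the change of levels which diagonalises the conformal subalgebra. -/
def rc : ℕ → ℕ → ℂ
  | 0, _ => 1
  | d + 1, i => rc d (i + 1) * θ i / al (d + 1) (l + i / 2)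

/-- The diagonalised levels. -/
def ladder (G : ℤ → SFun) (j : ℕ) : SFun :=
  ∑ i ∈ Finset.range (j + 1), rc l θ (j - i) i • (D ^ (j - i)) (G i)

/-- The coefficients of the action of `ξ x²` on diagonalised levels in terms of levels. -/
def kc (e i : ℕ) : ℂ := rc l θ e (i + 3) * γ i - rc l θ (e + 3) i * ka (e + 3) (l + i / 2)

/-- The coefficients of the action of `ξ x²` on diagonalised levels. -/
def bb (e i : ℕ) : ℂ :=
  kc l θ γ e i - ∑ m : Fin e, (-1) ^ (m.1 + 1) * bb (e - 1 - m) (i + m + 1) * rc l θ (m + 1) i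
termination_by e
decreasing_by have := m.2; omega

variable {l θ γ}

lemma rc_mul_al {d i : ℕ} (h : al (d + 1) (l + i / 2) ≠ 0) :
    rc l θ (d + 1) i * al (d + 1) (l + i / 2) = rc l θ d (i + 1) * θ i := by
  rw [rc, div_mul_cancel₀ _ h]

lemma sum_bb (e i : ℕ) :
    ∑ m ∈ Finset.range (e + 1), (-1) ^ m * bb l θ γ (e - m) (i + m) * rc l θ m i =
      kc l θ γ e i := by
  rw [Finset.sum_range_succ', Finset.sum_range]
  simp only [pow_zero, one_mul, Nat.sub_zero, add_zero, rc, mul_one]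
  rw [bb, ← sub_eq_zero]
  have : ∀ m : Fin e, (-1 : ℂ) ^ (m.1 + 1) * bb l θ γ (e - 1 - m) (i + m + 1) * rc l θ (m + 1) i =
      (-1) ^ (m.1 + 1) * bb l θ γ (e - (m + 1)) (i + (m + 1)) * rc l θ (m + 1) i := fun m => by
    rw [Nat.sub_sub, add_comm 1, add_assoc]
  rw [Finset.sum_congr rfl fun m _ => this m]
  simp only [rc]
  ring

lemma eps_D_pow_apply (m : ℕ) (v : SFun) : eps ((D ^ m) v) = (-1 : ℂ) ^ m • (D ^ m) (eps v) := by
  induction m generalizing v with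
  | zero => simp
  | succ m ih =>
    have h : eps (D v) = (-1 : ℂ) • D (eps v) := LinearMap.congr_fun eps_D_smul v
    rw [pow_succ, Module.End.mul_apply, ih, h, map_smul, smul_smul, Module.End.mul_apply, pow_succ]

lemma ladder_Eo {G H : ℤ → SFun} {j : ℕ} (hG : ∀ n < 0, G n = 0)
    (hH : ∀ i : ℕ, H i = Eo (l + i / 2) (G i) + θ (i - 1) • eps (G (i - 1)))
    (hal : ∀ d i, d + 1 + i ≤ j → al (d + 1) (l + i / 2) ≠ 0) :
    ladder l θ H j = Eo (l + j / 2) (ladder l θ G j) := by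
  have h1 := sum_range_shift (fun i n => (rc l θ (j - i) i * θ n) • (D ^ (j - i)) (eps (G n)))
    (fun i n hn => by simp [hG n hn]) 1 j
  rw [Nat.cast_one] at h1
  have h2 : ∀ i ∈ Finset.range (j + 1), rc l θ (j - i) i • Eo (l + j / 2) ((D ^ (j - i)) (G i)) =
      rc l θ (j - i) i • (D ^ (j - i)) (Eo (l + i / 2) (G i)) +
      (rc l θ (j - i) i * al (j - i) (l + i / 2)) • (D ^ (j - i - 1)) (eps (G i)) := by
    intro i hi
    have hi := Finset.mem_range.1 hi
    have := LinearMap.congr_fun (Eo_D_pow (j - i) (l + i / 2)) (G i)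
    rw [Nat.cast_sub (by omega), show l + (i : ℂ) / 2 + ((j : ℂ) - i) / 2 = l + j / 2 by ring] at this
    simp only [LinearMap.add_apply, LinearMap.smul_apply, Module.End.mul_apply] at this
    rw [this]; module
  simp only [ladder, hH, map_add, map_smul, smul_add, Finset.sum_add_distrib, map_sum, smul_smul]
  rw [Finset.sum_congr rfl h2, Finset.sum_add_distrib]
  congr 1
  refine h1.trans ?_
  rw [Finset.sum_range_succ, Nat.sub_self, al_zero, mul_zero, zero_smul, add_zero]
  refine Finset.sum_congr rfl fun i hi => ?_
  have hi := Finset.mem_range.1 hi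
  obtain ⟨d, rfl⟩ : ∃ d, j = i + (d + 1) := ⟨j - i - 1, by omega⟩
  rw [Nat.add_sub_cancel_left, show i + (d + 1) - (i + 1) = d by omega, Nat.add_sub_cancel,
    rc_mul_al (hal d i (by omega))]

lemma ladder_Fo {G H : ℤ → SFun} {j : ℕ} (hG : ∀ n < 0, G n = 0)
    (hH : ∀ i : ℕ, H i = Fo (l + i / 2) (G i) + (2 * θ (i - 1)) • xm (eps (G (i - 1))) +
      (2 * (θ (i - 2) * θ (i - 1))) • xim (G (i - 2)) + γ (i - 3) • eps (G (i - 3)))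
    (hal : ∀ d i, d + 1 + i ≤ j → al (d + 1) (l + i / 2) ≠ 0) :
    ladder l θ H j = Fo (l + j / 2) (ladder l θ G j) +
      ∑ i ∈ Finset.range (j - 2), kc l θ γ (j - 3 - i) i • (D ^ (j - 3 - i)) (eps (G i)) := by
  have h1 := sum_range_shift
    (fun i n => (rc l θ (j - i) i * (2 * θ n)) • (D ^ (j - i)) (xm (eps (G n))))
    (fun i n hn => by simp [hG n hn]) 1 j
  have h2 := sum_range_shift
    (fun i n => (rc l θ (j - i) i * (2 * (θ n * θ (n + 1)))) • (D ^ (j - i)) (xim (G n)))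
    (fun i n hn => by simp [hG n hn]) 2 j
  have h3 := sum_range_shift
    (fun i n => (rc l θ (j - i) i * γ n) • (D ^ (j - i)) (eps (G n)))
    (fun i n hn => by simp [hG n hn]) 3 j
  rw [Nat.cast_one] at h1
  rw [Nat.cast_ofNat] at h2 h3
  have h4 : ∀ i ∈ Finset.range (j + 1), rc l θ (j - i) i • Fo (l + j / 2) ((D ^ (j - i)) (G i)) =
      rc l θ (j - i) i • (D ^ (j - i)) (Fo (l + i / 2) (G i)) +
      (rc l θ (j - i) i * (2 * al (j - i) (l + i / 2))) • (D ^ (j - i - 1)) (xm (eps (G i))) +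
      (rc l θ (j - i) i * (2 * (al (j - i) (l + i / 2) * al (j - i - 1) (l + i / 2 + 1 / 2)))) •
        (D ^ (j - i - 2)) (xim (G i)) +
      (rc l θ (j - i) i * ka (j - i) (l + i / 2)) • (D ^ (j - i - 3)) (eps (G i)) := by
    intro i hi
    have hi := Finset.mem_range.1 hi
    have := LinearMap.congr_fun (Fo_D_pow (j - i) (l + i / 2)) (G i)
    rw [Nat.cast_sub (by omega), show l + (i : ℂ) / 2 + ((j : ℂ) - i) / 2 = l + j / 2 by ring] at this
    simp only [LinearMap.add_apply, LinearMap.smul_apply, Module.End.mul_apply] at this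
    rw [this]; module
  have h5 : ∀ i : ℕ, (i : ℤ) - 1 = (i : ℤ) - 2 + 1 := fun i => by ring
  simp only [ladder, hH, map_add, map_smul, smul_add, Finset.sum_add_distrib, map_sum, smul_smul]
  rw [Finset.sum_congr rfl h4, Finset.sum_add_distrib, Finset.sum_add_distrib,
    Finset.sum_add_distrib, add_assoc, add_assoc, add_assoc, add_assoc, add_assoc]
  congr 1
  rw [← add_assoc, ← add_assoc, ← add_assoc]
  have e1 : ∑ i ∈ Finset.range (j + 1), (rc l θ (j - i) i * (2 * θ (i - 1))) •
      (D ^ (j - i)) (xm (eps (G (i - 1)))) = ∑ i ∈ Finset.range (j + 1),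
      (rc l θ (j - i) i * (2 * al (j - i) (l + i / 2))) • (D ^ (j - i - 1)) (xm (eps (G i))) := by
    refine h1.trans ?_
    rw [Finset.sum_range_succ, Nat.sub_self, al_zero, mul_zero, mul_zero, zero_smul, add_zero]
    refine Finset.sum_congr rfl fun i hi => ?_
    have hi := Finset.mem_range.1 hi
    obtain ⟨d, rfl⟩ : ∃ d, j = i + (d + 1) := ⟨j - i - 1, by omega⟩
    rw [Nat.add_sub_cancel_left, show i + (d + 1) - (i + 1) = d by omega, Nat.add_sub_cancel,
      mul_left_comm, mul_left_comm (rc _ _ (d + 1) _), rc_mul_al (hal d i (by omega))]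
  have e2 : ∑ i ∈ Finset.range (j + 1), (rc l θ (j - i) i * (2 * (θ (i - 2) * θ (i - 1)))) •
      (D ^ (j - i)) (xim (G (i - 2))) = ∑ i ∈ Finset.range (j + 1),
      (rc l θ (j - i) i * (2 * (al (j - i) (l + i / 2) * al (j - i - 1) (l + i / 2 + 1 / 2)))) •
        (D ^ (j - i - 2)) (xim (G i)) := by
    simp only [h5]
    refine h2.trans ?_
    symm
    rw [sum_range_truncate (m := j + 1 - 2) (by omega)]
    · refine Finset.sum_congr rfl fun i hi => ?_
      have hi := Finset.mem_range.1 hi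
      obtain ⟨d, rfl⟩ : ∃ d, j = i + (d + 1 + 1) := ⟨j - i - 2, by omega⟩
      have k1 := rc_mul_al (θ := θ) (hal (d + 1) i (by omega))
      have k2 := rc_mul_al (θ := θ) (hal d (i + 1) (by omega))
      push_cast at k2
      rw [show l + ((i : ℂ) + 1) / 2 = l + i / 2 + 1 / 2 by ring] at k2
      rw [Nat.add_sub_cancel_left, show i + (d + 1 + 1) - (i + 2) = d by omega,
        show d + 1 + 1 - 2 = d by omega, Nat.add_sub_cancel]
      congr 1
      linear_combination 2 * al (d + 1) (l + i / 2 + 1 / 2) * k1 + 2 * θ i * k2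
    · intro i h h'
      rcases (show j - i = 0 ∨ j - i = 1 by omega) with h0 | h0 <;> rw [h0] <;> simp [al_zero]
  have e3 : ∑ i ∈ Finset.range (j + 1), (rc l θ (j - i) i * γ (i - 3)) •
      (D ^ (j - i)) (eps (G (i - 3))) = ∑ i ∈ Finset.range (j + 1),
      (rc l θ (j - i) i * ka (j - i) (l + i / 2)) • (D ^ (j - i - 3)) (eps (G i)) +
      ∑ i ∈ Finset.range (j - 2), kc l θ γ (j - 3 - i) i • (D ^ (j - 3 - i)) (eps (G i)) := by
    refine h3.trans ?_
    rw [sum_range_truncate (m := j - 2) (n := j + 1) (by omega), ← Finset.sum_add_distrib]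
    · refine Finset.sum_congr rfl fun i hi => ?_
      have hi := Finset.mem_range.1 hi
      obtain ⟨d, rfl⟩ : ∃ d, j = i + (d + 3) := ⟨j - i - 3, by omega⟩
      rw [Nat.add_sub_cancel_left, show i + (d + 3) - (i + 3) = d by omega, Nat.add_sub_cancel,
        show i + (d + 3) - 3 - i = d by omega, kc]
      module
    · intro i h h'
      rcases (show j - i = 0 ∨ j - i = 1 ∨ j - i = 2 by omega) with h0 | h0 | h0 <;> rw [h0] <;>
        simp [ka]
  rw [e1, e2, e3, ← add_assoc]

lemma sum_kc_eq_sum_bb (G : ℤ → SFun) (j : ℕ) :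
    ∑ i ∈ Finset.range (j - 2), kc l θ γ (j - 3 - i) i • (D ^ (j - 3 - i)) (eps (G i)) =
      ∑ i ∈ Finset.range (j - 2), bb l θ γ (j - 3 - i) i •
        (D ^ (j - 3 - i)) (eps (ladder l θ G i)) := by
  have h1 : ∀ i ∈ Finset.range (j - 2), bb l θ γ (j - 3 - i) i •
        (D ^ (j - 3 - i)) (eps (ladder l θ G i)) = ∑ s ∈ Finset.range (i + 1),
      ((-1) ^ (i - s) * bb l θ γ (j - 3 - i) i * rc l θ (i - s) s) •
        (D ^ (j - 3 - s)) (eps (G s)) := by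
    intro i hi
    have hi := Finset.mem_range.1 hi
    rw [ladder, map_sum, map_sum, Finset.smul_sum]
    refine Finset.sum_congr rfl fun s hs => ?_
    have hs := Finset.mem_range.1 hs
    rw [map_smul, eps_D_pow_apply, map_smul, map_smul, ← Module.End.mul_apply, ← pow_add,
      show j - 3 - i + (i - s) = j - 3 - s by omega]
    module
  rw [Finset.sum_congr rfl h1, Finset.sum_comm' (t' := Finset.range (j - 2))
    (s' := fun s => Finset.Ico s (j - 2)) (by intro x y; simp; omega)]
  refine Finset.sum_congr rfl fun s hs => ?_
  have hs := Finset.mem_range.1 hs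
  rw [Finset.sum_Ico_eq_sum_range, ← Finset.sum_smul, ← sum_bb,
    show j - 2 - s = j - 3 - s + 1 by omega]
  congr 1
  refine Finset.sum_congr rfl fun m _ => ?_
  rw [Nat.add_sub_cancel_left, Nat.sub_sub _ s m]

lemma ladder_D {G H : ℤ → SFun} {j : ℕ} (hH : ∀ i : ℕ, H i = D (G i)) :
    ladder l θ H j = D (ladder l θ G j) := by
  rw [ladder, ladder, map_sum]
  refine Finset.sum_congr rfl fun i _ => ?_
  rw [hH, map_smul, ← Module.End.mul_apply, ← Module.End.mul_apply, D_pow_D]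

lemma ladder_parity {G H : ℤ → SFun} {j : ℕ} (hH : ∀ i : ℕ, H i = sgnZ i • parity (G i)) :
    ladder l θ H j = sgnZ j • parity (ladder l θ G j) := by
  rw [ladder, ladder, map_sum, Finset.smul_sum]
  refine Finset.sum_congr rfl fun i hi => ?_
  have hi := Finset.mem_range.1 hi
  have h := eps_D_pow_apply (j - i) (G i)
  rw [eps_apply, eps_apply] at h
  have e : sgnZ j * (-1) ^ (j - i) = sgnZ i := by
    obtain ⟨d, rfl⟩ : ∃ d, j = i + d := ⟨j - i, by omega⟩
    rw [Nat.add_sub_cancel_left]; push_cast; rw [sgnZ_add]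
    have : sgnZ (d : ℤ) = (-1) ^ d := by
      rcases Nat.even_or_odd d with h | h
      · have h' : ¬ Odd (d : ℤ) := by simpa using h
        rw [h.neg_one_pow, sgnZ, if_neg h']
      · have h' : Odd (d : ℤ) := by simpa using h
        rw [h.neg_one_pow, sgnZ, if_pos h']
    rw [this, mul_assoc, ← mul_pow]; simp
  rw [hH, map_smul, map_smul parity, h, ← e]
  module

lemma ladder_congr {G H : ℤ → SFun} {j : ℕ} (h : ∀ i : ℕ, i ≤ j → G i = H i) :
    ladder l θ G j = ladder l θ H j :=
  Finset.sum_congr rfl fun i hi => by rw [h i (by have := Finset.mem_range.1 hi; omega)]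

/-- The diagonalised levels can be prescribed. -/
lemma exists_ladder_eq (r : ℕ → SFun) (n : ℕ) :
    ∃ G : ℤ → SFun, ∀ j < n, ladder l θ G j = r j := by
  induction n with
  | zero => exact ⟨0, fun j hj => absurd hj (by omega)⟩
  | succ n ih =>
    obtain ⟨G, hG⟩ := ih
    refine ⟨Function.update G n (r n - (ladder l θ G n - G n)), fun j hj => ?_⟩
    rcases Nat.lt_succ_iff_lt_or_eq.1 hj with h | rfl
    · rw [← hG j h]
      refine ladder_congr fun i hi => Function.update_of_ne (by omega) _ _
    · rw [ladder, Finset.sum_range_succ, ladder, Finset.sum_range_succ, Function.update_self,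
        Finset.sum_congr rfl (g := fun i => rc l θ (j - i) i • (D ^ (j - i)) (G i)) fun i hi => by
          rw [Function.update_of_ne (by have := Finset.mem_range.1 hi; omega)]]
      simp [rc]

end Ladder

/-! ## Extensions realised by pseudodifferential operators -/

namespace KRep

/-- A surjection which transforms the generators as in `IsTri` is an intertwiner onto a model. -/
lemma exists_isTri_of_surjective {V : Type*} [AddCommGroup V] [Module ℂ V] {ρ : KRep V} {m : ℕ}
    {l : ℂ} {N : Fin m → ℤ} {b : Fin m → Fin m → ℂ} (T : V →ₗ[ℂ] (Fin m → SFun))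
    (hT : Function.Surjective T) (hp : ∀ v i, T (ρ.par v) i = sgnZ (N i) • parity (T v i))
    (h1 : ∀ v i, T (ρ.act (bv 1) v) i = (1 / 2 : ℂ) • D (T v i))
    (h3 : ∀ v i, T (ρ.act (bv 3) v) i = (1 / 2 : ℂ) • Eo (l + N i / 2) (T v i))
    (h5 : ∀ v i, T (ρ.act (bv 5) v) i = (1 / 2 : ℂ) • (Fo (l + N i / 2) (T v i) +
      ∑ j, if j < i then b i j • Dp (N i - N j) (T v j) else 0)) :
    ∃ σ : KRep (Fin m → SFun), σ.IsTri l N b ∧ ρ.IsIntertwiner σ 0 T := by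
  have hk : ρ.IsInvariant (LinearMap.ker T) := by
    refine isInvariant_of_generators ρ _ (fun v hv => ?_) (fun v hv => ?_) (fun v hv => ?_)
      fun v hv => ?_ <;> rw [LinearMap.mem_ker] at hv ⊢ <;> funext i
    · simp [hp, hv]
    · simp [h1, hv]
    · simp [h3, hv]
    · simp [h5, hv]
  have hI := ofSurjective_isIntertwiner ρ T hT hk
  obtain ⟨i1, i2⟩ := isIntertwiner_zero_iff.1 hI
  refine ⟨ρ.ofSurjective T hT hk, ⟨fun u i => ?_, fun u i => ?_, fun u i => ?_, fun u i => ?_⟩,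
    hI⟩ <;> obtain ⟨u, rfl⟩ := hT u
  · rw [i1, hp]
  · rw [i2, h1]
  · rw [i2, h3]
  · rw [i2, h5]

end KRep

/-- The diagonalised levels of a symbol. -/
def psiLadder (l k ν : ℂ) (j : ℕ) : PsiSym →ₗ[ℂ] SFun :=
  ∑ i ∈ Finset.range (j + 1), rc l (theta k ν) (j - i) i • ((D ^ (j - i)) ∘ₗ level k i)

section

variable {l k ν : ℂ} {j n : ℕ}

lemma psiLadder_apply (T : PsiSym) :
    psiLadder l k ν j T = ladder l (theta k ν) (fun i => level k i T) j := by
  simp [psiLadder, ladder]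

lemma al_ne_zero (hl : ∀ m : ℕ, m < n → -2 * l ≠ m) {d i : ℕ} (h : d + 1 + i ≤ n) :
    al (d + 1) (l + i / 2) ≠ 0 := by
  rcases Nat.even_or_odd' d with ⟨s, rfl | rfl⟩
  · rw [al_two_mul_add_one]
    have := hl (i + s) (by omega)
    intro h0
    refine this ?_
    push_cast; linear_combination h0
  · rw [show 2 * s + 1 + 1 = 2 * (s + 1) by ring, al_two_mul]
    exact Nat.cast_ne_zero.2 (by omega)

lemma psiLadder_eq_half {S : PsiSym} {v : SFun}
    (h : ladder l (theta k ν) (fun i => (2 : ℂ) • level k i S) j = v) :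
    psiLadder l k ν j S = (1 / 2 : ℂ) • v := by
  have e : (2 : ℂ) • psiLadder l k ν j S = v := by
    rw [← h, ← map_smul, psiLadder_apply]
    exact ladder_congr fun i _ => by rw [map_smul]
  rw [← e, smul_smul]; norm_num

lemma psiLadder_par (T : PsiSym) :
    psiLadder l k ν j (psiPar T) = sgnZ j • parity (psiLadder l k ν j T) := by
  rw [psiLadder_apply, psiLadder_apply]
  exact ladder_parity fun i => level_psiPar k i T

lemma psiLadder_bv_one (T : PsiSym) : psiLadder l k ν j (psiOp ν (l + k) (bv 1) T) =
    (1 / 2 : ℂ) • D (psiLadder l k ν j T) := by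
  refine psiLadder_eq_half ?_
  rw [psiLadder_apply]
  exact ladder_D fun i => two_smul_level_bv_one ν l k T i

lemma psiLadder_bv_three (hl : ∀ m : ℕ, m < n → -2 * l ≠ m) (hj : j ≤ n) {T : PsiSym}
    (hT : T ∈ psiSub k 0) : psiLadder l k ν j (psiOp ν (l + k) (bv 3) T) =
    (1 / 2 : ℂ) • Eo (l + j / 2) (psiLadder l k ν j T) := by
  refine psiLadder_eq_half ?_
  rw [psiLadder_apply]
  exact ladder_Eo (fun i hi => level_neg hT hi)
    (fun i => by have := two_smul_level_bv_three ν l k T i; push_cast at this; exact this)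
    fun d i h => al_ne_zero hl (h.trans hj)

lemma psiLadder_bv_five (hl : ∀ m : ℕ, m < n → -2 * l ≠ m) (hj : j ≤ n) {T : PsiSym}
    (hT : T ∈ psiSub k 0) : psiLadder l k ν j (psiOp ν (l + k) (bv 5) T) =
    (1 / 2 : ℂ) • (Fo (l + j / 2) (psiLadder l k ν j T) + ∑ i ∈ Finset.range (j - 2),
      bb l (theta k ν) (gam k ν) (j - 3 - i) i •
        (D ^ (j - 3 - i)) (eps (psiLadder l k ν i T))) := by
  refine psiLadder_eq_half ?_
  simp only [psiLadder_apply]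
  rw [← sum_kc_eq_sum_bb]
  exact ladder_Fo (fun i hi => level_neg hT hi)
    (fun i => by have := two_smul_level_bv_five ν l k T i; push_cast at this; exact this)
    fun d i h => al_ne_zero hl (h.trans hj)

lemma exists_psiLadder_eq (r : ℕ → SFun) (n : ℕ) :
    ∃ T ∈ psiSub k 0, ∀ j < n, psiLadder l k ν j T = r j := by
  obtain ⟨G, hG⟩ := exists_ladder_eq (l := l) (θ := theta k ν) r n
  obtain ⟨T, hT, h⟩ := exists_level_eq k fun j => G j
  refine ⟨T, hT, fun j hj => ?_⟩
  rw [psiLadder_apply, ← hG j hj]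
  exact ladder_congr fun i _ => h i

/-- The symbols whose diagonalised levels vanish at a given set of indices. -/
def ladderKer (l k ν : ℂ) (J : Finset ℕ) : Submodule ℂ PsiSym :=
  psiSub k 0 ⊓ ⨅ j ∈ J, LinearMap.ker (psiLadder l k ν j)

lemma mem_ladderKer {J : Finset ℕ} {T : PsiSym} :
    T ∈ ladderKer l k ν J ↔ T ∈ psiSub k 0 ∧ ∀ j ∈ J, psiLadder l k ν j T = 0 := by
  simp [ladderKer, Submodule.mem_inf, Submodule.mem_iInf]

lemma isInvariant_ladderKer {J : Finset ℕ} (hl : ∀ m : ℕ, m < n → -2 * l ≠ m)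
    (hn : ∀ j ∈ J, j ≤ n)
    (hJ : ∀ j ∈ J, ∀ i, i + 3 ≤ j → i ∉ J → bb l (theta k ν) (gam k ν) (j - 3 - i) i = 0) :
    (psiRep ν (l + k)).IsInvariant (ladderKer l k ν J) := by
  refine KRep.isInvariant_of_generators _ _ (fun T hT => ?_) (fun T hT => ?_) (fun T hT => ?_)
    fun T hT => ?_ <;> obtain ⟨h0, h⟩ := mem_ladderKer.1 hT <;> refine mem_ladderKer.2 ⟨?_, ?_⟩
  · exact psiPar_mem_psiSub h0
  · intro j hj
    exact (psiLadder_par T).trans (by rw [h j hj]; simp)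
  · rw [bv_one]; exact psiOp_inr_mem_psiSub (by simp) h0
  · intro j hj
    exact (psiLadder_bv_one T).trans (by rw [h j hj]; simp)
  · rw [bv_three]; exact psiOp_inr_mem_psiSub (by simp) h0
  · intro j hj
    exact (psiLadder_bv_three hl (hn j hj) h0).trans (by rw [h j hj]; simp)
  · rw [bv_five]; exact psiOp_inr_mem_psiSub (by simp) h0
  · intro j hj
    refine (psiLadder_bv_five hl (hn j hj) h0).trans ?_
    rw [h j hj, map_zero, zero_add, Finset.sum_eq_zero, smul_zero]
    intro i hi
    by_cases hi' : i ∈ J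
    · rw [h i hi']; simp
    · rw [hJ j hj i (by have := Finset.mem_range.1 hi; omega) hi', zero_smul]

lemma D_pow_eps_eq_Dp (e : ℕ) (v : SFun) : (D ^ e) (eps v) = (-1 : ℂ) ^ e • Dp (e + 3) v := by
  have : Dp (e + 3) v = eps ((D ^ e) v) := by
    rw [Dp, if_neg (by omega), show ((e : ℤ) + 3 - 3).toNat = e by omega]; rfl
  rw [this, eps_D_pow_apply, smul_smul, ← mul_pow]; simp

open StablePair in
/-- A criterion for the existence of a uniserial extension within the pseudodifferential
operators, in which the levels in `J` are discarded. -/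
theorem existsPsiDOUniserialExt_of (k ν : ℂ) {n₁ n₂ : ℕ} (J : Finset ℕ)
    (hl : ∀ m : ℕ, m < n₁ + n₂ → -2 * l ≠ m) (h0 : 0 ∉ J) (h1 : n₁ ∉ J) (h2 : n₁ + n₂ ∉ J)
    (hn : ∀ j ∈ J, j ≤ n₁ + n₂)
    (hJ : ∀ j ∈ J, ∀ i, i + 3 ≤ j → i ∉ J → bb l (theta k ν) (gam k ν) (j - 3 - i) i = 0)
    (hn₁ : ∀ i, i + 3 ≤ n₁ → i ∉ J → i ≠ 0 → bb l (theta k ν) (gam k ν) (n₁ - 3 - i) i = 0)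
    (hn₂ : ∀ i, i + 3 ≤ n₁ + n₂ → i ∉ J → i ≠ 0 → i ≠ n₁ →
      bb l (theta k ν) (gam k ν) (n₁ + n₂ - 3 - i) i = 0)
    (hb₁ : bb l (theta k ν) (gam k ν) (n₁ - 3) 0 ≠ 0)
    (hb₂ : bb l (theta k ν) (gam k ν) (n₂ - 3) n₁ ≠ 0)
    (hg₁ : Good l n₁) (hg₂ : Good (l + n₁ / 2) n₂) : ExistsPsiDOUniserialExt l [(n₁ : ℤ), n₂] := by
  obtain ⟨e₁, rfl⟩ : ∃ e, n₁ = e + 3 :=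
    ⟨n₁ - 3, by rcases hg₁ with h | h | h | h <;> obtain ⟨h, -⟩ := h <;> omega⟩
  obtain ⟨e₂, rfl⟩ : ∃ e, n₂ = e + 3 :=
    ⟨n₂ - 3, by rcases hg₂ with h | h | h | h <;> obtain ⟨h, -⟩ := h <;> omega⟩
  have hM := isInvariant_ladderKer hl hn hJ
  set M := ladderKer l k ν J
  let L : Fin 3 → ℕ := ![0, e₁ + 3, e₁ + 3 + (e₂ + 3)]
  have hL : ∀ i, L i ≤ e₁ + 3 + (e₂ + 3) := fun i => by fin_cases i <;> simp [L]
  let N : Fin 3 → ℤ := ![0, ((e₁ + 3 : ℕ) : ℤ), ((e₁ + 3 : ℕ) : ℤ) + ((e₂ + 3 : ℕ) : ℤ)]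
  have hLN : ∀ i, N i = L i := fun i => by fin_cases i <;> simp [L, N]
  let T : M →ₗ[ℂ] (Fin 3 → SFun) := LinearMap.pi fun i => psiLadder l k ν (L i) ∘ₗ M.subtype
  have hT : Function.Surjective T := by
    intro u
    obtain ⟨P, hP, h⟩ := exists_psiLadder_eq (l := l) (k := k) (ν := ν)
      (fun j => if j = L 0 then u 0 else if j = L 1 then u 1 else if j = L 2 then u 2 else 0)
      (e₁ + 3 + (e₂ + 3) + 1)
    refine ⟨⟨P, mem_ladderKer.2 ⟨hP, fun j hj => ?_⟩⟩, funext fun i => ?_⟩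
    · have a0 : j ≠ L 0 := fun h => h0 (by rw [h] at hj; exact hj)
      have a1 : j ≠ L 1 := fun h => h1 (by rw [h] at hj; exact hj)
      have a2 : j ≠ L 2 := fun h => h2 (by rw [h] at hj; exact hj)
      rw [h j (Nat.lt_succ_of_le (hn j hj)), if_neg a0, if_neg a1, if_neg a2]
    · change psiLadder l k ν (L i) P = u i
      rw [h _ (Nat.lt_succ_of_le (hL i))]
      fin_cases i <;> simp [L]
  let b : Fin 3 → Fin 3 → ℂ := fun i j =>
    (-1) ^ (L i - 3 - L j) * bb l (theta k ν) (gam k ν) (L i - 3 - L j) (L j)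
  obtain ⟨σ, hσ, hI⟩ := KRep.exists_isTri_of_surjective (ρ := (psiRep ν (l + k)).sub M hM) (l := l)
    (N := N) (b := b) T hT
    (fun v i => by rw [hLN]; exact psiLadder_par v.1)
    (fun v i => psiLadder_bv_one v.1)
    (fun v i => by
      rw [hLN, Int.cast_natCast]
      exact psiLadder_bv_three hl (hL i) (mem_ladderKer.1 v.2).1)
    (fun v i => by
      rw [hLN, Int.cast_natCast]
      refine (psiLadder_bv_five hl (hL i) (mem_ladderKer.1 v.2).1).trans ?_
      have hv := (mem_ladderKer.1 v.2).2
      refine congrArg (fun w => (1 / 2 : ℂ) •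
        (Fo (l + (L i : ℂ) / 2) (psiLadder l k ν (L i) v.1) + w)) ?_
      have hD : ∀ j, L j + 3 ≤ L i → bb l (theta k ν) (gam k ν) (L i - 3 - L j) (L j) •
          (D ^ (L i - 3 - L j)) (eps (psiLadder l k ν (L j) v.1)) =
          b i j • Dp ((L i : ℤ) - N j) (T v j) := fun j hj => by
        rw [D_pow_eps_eq_Dp, smul_smul, hLN,
          show ((L i - 3 - L j : ℕ) : ℤ) + 3 = L i - L j by omega, mul_comm]
        rfl
      rw [Fin.sum_univ_three]
      fin_cases i
      · simp [L]
      · refine (Finset.sum_eq_single 0 (fun i hi hi' => ?_) fun h => ?_).trans ?_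
        · by_cases hiJ : i ∈ J
          · rw [hv i hiJ]; simp
          · have := hn₁ i (by
              have : i < e₁ + 3 - 2 := Finset.mem_range.1 hi
              omega) hiJ hi'
            exact (congrArg (· • _) this).trans (zero_smul _ _)
        · exact absurd (Finset.mem_range.2 (show 0 < e₁ + 3 - 2 by omega)) h
        · refine (hD 0 (show 0 + 3 ≤ e₁ + 3 by omega)).trans ?_
          simp
      · have hsub : ({0, e₁ + 3} : Finset ℕ) ⊆ Finset.range (e₁ + 3 + (e₂ + 3) - 2) := by
          intro x; simp; omega
        refine (Finset.sum_subset hsub fun i hi hi' => ?_).symm.trans ?_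
        · have hi' : i ≠ 0 ∧ i ≠ e₁ + 3 := by simpa using hi'
          by_cases hiJ : i ∈ J
          · rw [hv i hiJ]; simp
          · have := hn₂ i (by have := Finset.mem_range.1 hi; omega) hiJ hi'.1 hi'.2
            exact (congrArg (· • _) this).trans (zero_smul _ _)
        · rw [Finset.sum_pair (by omega)]
          have q0 := hD 0 (show 0 + 3 ≤ e₁ + 3 + (e₂ + 3) by omega)
          have q1 := hD 1 (show e₁ + 3 + 3 ≤ e₁ + 3 + (e₂ + 3) by omega)
          refine (congrArg₂ (· + ·) q0 q1).trans ?_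
          simp)
  have hc : σ.IsChain := by
    obtain ⟨τ, τ', c, c', t1, t2, r1, r2, h3⟩ := hσ.truncations
    refine h3.2 ⟨t1.isChain_of_good ?_ (by simpa using hg₁),
      t2.isChain_of_good ?_ (by simpa using hg₂)⟩
    · rw [r1]
      exact mul_ne_zero (pow_ne_zero _ (by norm_num)) hb₁
    · rw [r2]
      refine mul_ne_zero (pow_ne_zero _ (by norm_num)) ?_
      have : L 2 - 3 - L 1 = e₂ + 3 - 3 := by simp [L]; omega
      rw [this]
      exact hb₂
  have hN : N = partialSum [((e₁ + 3 : ℕ) : ℤ), ((e₂ + 3 : ℕ) : ℤ)] := (partialSum_two _ _).symm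
  refine ⟨_, _, _, σ, ⟨?_, (KRep.isUniserial_iff_isChain σ).2 hc⟩,
    ν, l + k, k, 0, 0, M, hM, T, inf_le_left, hT, hI⟩
  rw [hN] at hσ
  exact hσ.isSplitExtension

end

/-! ## Explicit coefficients on pseudodifferential operators -/

section

variable {l : ℂ} {θ γ : ℤ → ℂ} {i : ℕ}

lemma al_four (l : ℂ) : al 4 l = 2 := by simpa using al_two_mul 2 l
lemma al_five (l : ℂ) : al 5 l = -(2 * l + 2) := by simpa using al_two_mul_add_one 2 l
lemma ka_three (l : ℂ) : ka 3 l = 4 * l + 4 := by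
  have := ka_two_mul_add_one 1 l; norm_num at this; rw [this]; ring
lemma ka_four (l : ℂ) : ka 4 l = -2 := by
  have := ka_two_mul 2 l; norm_num at this; exact this
lemma ka_five (l : ℂ) : ka 5 l = 8 * l + 14 := by
  have := ka_two_mul_add_one 2 l; norm_num at this; rw [this]; ring

lemma bb_zero_eq : bb l θ γ 0 i = kc l θ γ 0 i := by rw [bb]; simp
lemma bb_one_eq : bb l θ γ 1 i = kc l θ γ 1 i + bb l θ γ 0 (i + 1) * rc l θ 1 i := by
  rw [bb, Fin.sum_univ_one]; simp
lemma bb_two_eq : bb l θ γ 2 i = kc l θ γ 2 i + bb l θ γ 1 (i + 1) * rc l θ 1 i -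
    bb l θ γ 0 (i + 2) * rc l θ 2 i := by
  rw [bb, Fin.sum_univ_two]; simp; ring

variable {m x₀ x₁ x₂ x₃ x₄ g₀ g₁ g₂ : ℂ}

lemma bb_zero_of (hm : l + i / 2 = m) (h₀ : θ i = x₀) (h₁ : θ ((i + 1 : ℕ) : ℤ) = x₁)
    (h₂ : θ ((i + 2 : ℕ) : ℤ) = x₂) (k₀ : γ i = g₀) (d₁ : 2 * m + 1 ≠ 0) (d₂ : m + 1 ≠ 0) :
    bb l θ γ 0 i = g₀ - 2 * (x₀ * x₁ * x₂) / (2 * m + 1) := by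
  have e₂ : l + ((i + 2 : ℕ) : ℂ) / 2 = m + 1 := by rw [← hm]; push_cast; ring
  simp only [bb_zero_eq, kc, rc, zero_add, add_assoc, Nat.reduceAdd, al_one, al_two, al_three,
    ka_three, h₀, h₁, h₂, k₀, e₂, hm]
  field_simp
  ring

lemma bb_one_of (hm : l + i / 2 = m) (h₀ : θ i = x₀) (h₁ : θ ((i + 1 : ℕ) : ℤ) = x₁)
    (h₂ : θ ((i + 2 : ℕ) : ℤ) = x₂) (h₃ : θ ((i + 3 : ℕ) : ℤ) = x₃) (k₀ : γ i = g₀)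
    (k₁ : γ ((i + 1 : ℕ) : ℤ) = g₁) (d₀ : m ≠ 0) (d₂ : m + 1 ≠ 0) (d₃ : 2 * m + 3 ≠ 0) :
    bb l θ γ 1 i = -(x₃ * g₀ / (2 * m + 3)) + x₀ * x₁ * x₂ * x₃ / (2 * (m + 1) * (2 * m + 3)) -
      (g₁ - x₁ * x₂ * x₃ / (m + 1)) * x₀ / (2 * m) := by
  have e₁ : l + ((i + 1 : ℕ) : ℂ) / 2 = m + 1 / 2 := by rw [← hm]; push_cast; ring
  have e₂ : l + ((i + 2 : ℕ) : ℂ) / 2 = m + 1 := by rw [← hm]; push_cast; ring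
  have e₃ : l + ((i + 3 : ℕ) : ℂ) / 2 = m + 3 / 2 := by rw [← hm]; push_cast; ring
  have q₁ : 2 * (m + 1 / 2) + 1 ≠ 0 := fun h => d₂ (by linear_combination (1 / 2 : ℂ) * h)
  have q₂ : m + 1 / 2 + 1 ≠ 0 := fun h => d₃ (by linear_combination (2 : ℂ) * h)
  rw [bb_one_eq, bb_zero_of e₁ h₁ h₂ h₃ k₁ q₁ q₂]
  simp only [kc, rc, zero_add, add_assoc, Nat.reduceAdd, al_one, al_two, al_three, al_four,
    ka_four, h₀, h₁, h₂, h₃, k₀, e₁, e₂, e₃, hm]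
  rw [show 2 * (m + 1 / 2) + 1 = 2 * (m + 1) by ring, show 2 * (m + 3 / 2) = 2 * m + 3 by ring]
  field_simp
  ring

lemma bb_two_of (hm : l + i / 2 = m) (h₀ : θ i = x₀) (h₁ : θ ((i + 1 : ℕ) : ℤ) = x₁)
    (h₂ : θ ((i + 2 : ℕ) : ℤ) = x₂) (h₃ : θ ((i + 3 : ℕ) : ℤ) = x₃)
    (h₄ : θ ((i + 4 : ℕ) : ℤ) = x₄) (k₀ : γ i = g₀)
    (k₁ : γ ((i + 1 : ℕ) : ℤ) = g₁) (k₂ : γ ((i + 2 : ℕ) : ℤ) = g₂)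
    (d₀ : m ≠ 0) (d₁ : 2 * m + 1 ≠ 0) (d₂ : m + 1 ≠ 0) (d₃ : 2 * m + 3 ≠ 0) (d₄ : m + 2 ≠ 0) :
    bb l θ γ 2 i = -(x₃ * x₄ * g₀ / (2 * (m + 2))) +
      x₀ * x₁ * x₂ * x₃ * x₄ * (4 * m + 7) / (4 * (m + 1) * (2 * m + 3) * (m + 2)) +
      (x₄ * g₁ / (2 * (m + 2)) - x₁ * x₂ * x₃ * x₄ / (2 * (2 * m + 3) * (m + 2)) +
        (g₂ - 2 * (x₂ * x₃ * x₄) / (2 * m + 3)) * x₁ / (2 * m + 1)) * x₀ / (2 * m) +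
      (g₂ - 2 * (x₂ * x₃ * x₄) / (2 * m + 3)) * (x₀ * x₁) / (2 * m + 1) := by
  have e₁ : l + ((i + 1 : ℕ) : ℂ) / 2 = m + 1 / 2 := by rw [← hm]; push_cast; ring
  have e₂ : l + ((i + 2 : ℕ) : ℂ) / 2 = m + 1 := by rw [← hm]; push_cast; ring
  have e₃ : l + ((i + 3 : ℕ) : ℂ) / 2 = m + 3 / 2 := by rw [← hm]; push_cast; ring
  have e₄ : l + ((i + 4 : ℕ) : ℂ) / 2 = m + 2 := by rw [← hm]; push_cast; ring
  have q₁ : m + 1 / 2 ≠ 0 := fun h => d₁ (by linear_combination (2 : ℂ) * h)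
  have q₂ : m + 1 / 2 + 1 ≠ 0 := fun h => d₃ (by linear_combination (2 : ℂ) * h)
  have q₃ : 2 * (m + 1 / 2) + 3 ≠ 0 := fun h => d₄ (by linear_combination (1 / 2 : ℂ) * h)
  have q₄ : 2 * (m + 1) + 1 ≠ 0 := fun h => d₃ (by linear_combination h)
  have q₅ : m + 1 + 1 ≠ 0 := fun h => d₄ (by linear_combination h)
  rw [bb_two_eq, bb_zero_of e₂ h₂ h₃ h₄ k₂ q₄ q₅, bb_one_of e₁ h₁ h₂ h₃ h₄ k₁ k₂ q₁ q₂ q₃]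
  simp only [kc, rc, zero_add, add_assoc, Nat.reduceAdd, al_one, al_two, al_three, al_four, al_five,
    ka_five, h₀, h₁, h₂, h₃, h₄, k₀, e₁, e₂, e₃, e₄, hm]
  rw [show 2 * (m + 1 / 2) + 3 = 2 * (m + 2) by ring, show 2 * (m + 1) + 1 = 2 * m + 3 by ring,
    show m + (1 / 2 + 1) = (2 * m + 3) / 2 by ring, show 2 * (m + 1 / 2) = 2 * m + 1 by ring]
  field_simp
  ring

end

/-- The weight for which the symmetric parameter of the levels is `t`. -/
def nuOf (l k t : ℂ) : ℂ := (1 / 2 - k - l - t) / 2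

/-- The coefficient of `ξ x²` from level `i` to level `i + e + 3`. -/
abbrev pb (l k t : ℂ) (e i : ℕ) : ℂ := bb l (theta k (nuOf l k t)) (gam k (nuOf l k t)) e i

section

variable {l k t : ℂ} {n s : ℕ}

lemma theta_two_mul (s : ℕ) : theta k (nuOf l k t) ((2 * s : ℕ) : ℤ) = -(k - s) := by
  have := theta_even k (nuOf l k t) s
  push_cast at this ⊢; exact this

lemma theta_two_mul_add_one (s : ℕ) :
    theta k (nuOf l k t) ((2 * s + 1 : ℕ) : ℤ) = -(l + s + 1 / 2 + t) := by
  have := theta_odd k (nuOf l k t) (s + 1)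
  push_cast at this ⊢
  rw [show (2 * s + 1 : ℤ) = 2 * (s + 1) - 1 by ring, this, nuOf]; ring

lemma gam_two_mul (s : ℕ) :
    gam k (nuOf l k t) ((2 * s : ℕ) : ℤ) = -((k - s) * (k - s - 1)) := by
  have := gam_even k (nuOf l k t) s
  push_cast at this ⊢; exact this

lemma gam_two_mul_add_one (s : ℕ) : gam k (nuOf l k t) ((2 * s + 1 : ℕ) : ℤ) =
    -((k - s - 1) * (k + s + 1 + 2 * l + 2 * t)) := by
  have := gam_odd k (nuOf l k t) (s + 1)
  push_cast at this ⊢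
  rw [show (2 * s + 1 : ℤ) = 2 * (s + 1) - 1 by ring, this, nuOf]; ring

lemma two_mul_add_ne_zero (hl : ∀ m : ℕ, m < n → -2 * l ≠ m) {m : ℕ} (h : m < n) :
    2 * l + m ≠ 0 := fun h0 => hl m h (by linear_combination -h0)

lemma pb_zero_even (hl : ∀ m : ℕ, m < n → -2 * l ≠ m) (h : 2 * s + 3 ≤ n) :
    pb l k t 0 (2 * s) = 2 * (k - s) * (k - s - 1) * t / (2 * (l + s) + 1) := by
  have d₁ := two_mul_add_ne_zero hl (m := 2 * s + 1) (by omega)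
  have d₂ := two_mul_add_ne_zero hl (m := 2 * s + 2) (by omega)
  push_cast at d₁ d₂
  have d₁ : 2 * (l + s) + 1 ≠ 0 := fun h => d₁ (by linear_combination h)
  rw [pb, bb_zero_of (m := l + s) (by push_cast; ring) (theta_two_mul s) (theta_two_mul_add_one s)
    (theta_two_mul (s + 1)) (gam_two_mul s) d₁
    (fun h => d₂ (by linear_combination (2 : ℂ) * h))]
  push_cast
  field_simp
  ring

lemma pb_zero_odd (hl : ∀ m : ℕ, m < n → -2 * l ≠ m) (h : 2 * s + 4 ≤ n) :
    pb l k t 0 (2 * s + 1) = (k - s - 1) *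
      (2 * (t ^ 2 - (l + s + 1 / 2) ^ 2) - (k - s) * (2 * (l + s + 1))) / (2 * (l + s + 1)) := by
  have d₁ := two_mul_add_ne_zero hl (m := 2 * s + 2) (by omega)
  have d₂ := two_mul_add_ne_zero hl (m := 2 * s + 3) (by omega)
  push_cast at d₁ d₂
  have d₁ : l + s + 1 ≠ 0 := fun h => d₁ (by linear_combination (2 : ℂ) * h)
  rw [pb, bb_zero_of (m := l + s + 1 / 2) (by push_cast; ring) (theta_two_mul_add_one s)
    (theta_two_mul (s + 1)) (theta_two_mul_add_one (s + 1)) (gam_two_mul_add_one s)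
    (fun h => d₁ (by linear_combination (1 / 2 : ℂ) * h))
    (fun h => d₂ (by linear_combination (2 : ℂ) * h))]
  push_cast
  rw [show 2 * (l + s + 1 / 2) + 1 = 2 * (l + s + 1) by ring]
  field_simp
  ring

lemma pb_one_even (hl : ∀ m : ℕ, m < n → -2 * l ≠ m) (h : 2 * s + 4 ≤ n) :
    pb l k t 1 (2 * s) = -((k - s) * (k - s - 1) * ((2 * (l + s) + 3) *
      (4 * (k - s) + 6 * (l + s) + 1) - 12 * t ^ 2)) / (8 * (l + s) * (2 * (l + s) + 3)) := by
  have d₀ := two_mul_add_ne_zero hl (m := 2 * s) (by omega)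
  have d₂ := two_mul_add_ne_zero hl (m := 2 * s + 2) (by omega)
  have d₃ := two_mul_add_ne_zero hl (m := 2 * s + 3) (by omega)
  push_cast at d₀ d₂ d₃
  have d₀ : l + s ≠ 0 := fun h => d₀ (by linear_combination (2 : ℂ) * h)
  have d₂ : l + s + 1 ≠ 0 := fun h => d₂ (by linear_combination (2 : ℂ) * h)
  have d₃ : 2 * (l + s) + 3 ≠ 0 := fun h => d₃ (by linear_combination h)
  rw [pb, bb_one_of (m := l + s) (by push_cast; ring) (theta_two_mul s) (theta_two_mul_add_one s)
    (theta_two_mul (s + 1)) (theta_two_mul_add_one (s + 1)) (gam_two_mul s) (gam_two_mul_add_one s)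
    d₀ d₂ d₃]
  push_cast
  field_simp
  ring

lemma pb_one_odd (hl : ∀ m : ℕ, m < n → -2 * l ≠ m) (h : 2 * s + 5 ≤ n) :
    pb l k t 1 (2 * s + 1) = -((k - s - 1) * (k - s - 2) * (3 * ((l + s + 1 / 2) ^ 2 - t ^ 2) +
      2 * (l + s + 1 / 2) * (k - s))) / (2 * (l + s + 1 / 2) * (2 * (l + s + 2))) := by
  have d₀ := two_mul_add_ne_zero hl (m := 2 * s + 1) (by omega)
  have d₂ := two_mul_add_ne_zero hl (m := 2 * s + 3) (by omega)
  have d₃ := two_mul_add_ne_zero hl (m := 2 * s + 4) (by omega)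
  push_cast at d₀ d₂ d₃
  generalize hm : l + s + 1 / 2 = m at *
  obtain rfl : l = m - s - 1 / 2 := by rw [← hm]; ring
  obtain ⟨A, rfl⟩ : ∃ A, k = A + s := ⟨k - s, by ring⟩
  have d₀ : m ≠ 0 := fun h => d₀ (by linear_combination (2 : ℂ) * h)
  have d₂ : m + 1 ≠ 0 := fun h => d₂ (by linear_combination (2 : ℂ) * h)
  have d₃ : 2 * m + 3 ≠ 0 := fun h => d₃ (by linear_combination h)
  rw [pb, bb_one_of (m := m) (x₀ := -(m + t)) (x₁ := -(A - 1)) (x₂ := -(m + 1 + t))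
    (x₃ := -(A - 2)) (g₀ := -((A - 1) * (A + 2 * m + 2 * t))) (g₁ := -((A - 1) * (A - 2)))
    (by push_cast; ring) (by rw [theta_two_mul_add_one]; ring)
    (by have := theta_two_mul (l := m - s - 1 / 2) (k := A + s) (t := t) (s + 1)
        exact this.trans (by push_cast; ring))
    (by have := theta_two_mul_add_one (l := m - s - 1 / 2) (k := A + s) (t := t) (s + 1)
        exact this.trans (by push_cast; ring))
    (by have := theta_two_mul (l := m - s - 1 / 2) (k := A + s) (t := t) (s + 2)
        exact this.trans (by push_cast; ring))
    (by rw [gam_two_mul_add_one]; ring)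
    (by have := gam_two_mul (l := m - s - 1 / 2) (k := A + s) (t := t) (s + 1)
        exact this.trans (by push_cast; ring)) d₀ d₂ d₃,
    show 2 * (m - s - 1 / 2 + s + 2) = 2 * m + 3 by ring, add_sub_cancel_right]
  field_simp
  ring

lemma two_even_identity {A m t x₀ x₁ x₂ x₃ x₄ g₀ g₁ g₂ : ℂ}
    (d₀ : m ≠ 0) (d₁ : 2 * m + 1 ≠ 0) (d₂ : m + 1 ≠ 0) (d₃ : 2 * m + 3 ≠ 0) (d₄ : m + 2 ≠ 0)
    (h0 : x₀ = -A) (h1 : x₁ = -(m + 1 / 2 + t)) (h2 : x₂ = -(A - 1)) (h3 : x₃ = -(m + 3 / 2 + t))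
    (h4 : x₄ = -(A - 2)) (h5 : g₀ = -(A * (A - 1))) (h6 : g₁ = -((A - 1) * (A + 1 + 2 * m + 2 * t)))
    (h7 : g₂ = -((A - 1) * (A - 2))) :
    -(x₃ * x₄ * g₀ / (2 * (m + 2))) +
      x₀ * x₁ * x₂ * x₃ * x₄ * (4 * m + 7) / (4 * (m + 1) * (2 * m + 3) * (m + 2)) +
      (x₄ * g₁ / (2 * (m + 2)) - x₁ * x₂ * x₃ * x₄ / (2 * (2 * m + 3) * (m + 2)) +
        (g₂ - 2 * (x₂ * x₃ * x₄) / (2 * m + 3)) * x₁ / (2 * m + 1)) * x₀ / (2 * m) +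
      (g₂ - 2 * (x₂ * x₃ * x₄) / (2 * m + 3)) * (x₀ * x₁) / (2 * m + 1) =
        A * (A - 1) * (A - 2) * (12 * t ^ 2 - 4 * (m + 1) * A - (4 * m ^ 2 + 4 * m + 3)) /
          (16 * m * (m + 1) * (m + 2)) := by
  field_simp
  subst_vars
  ring

lemma pb_two_even (hl : ∀ m : ℕ, m < n → -2 * l ≠ m) (h : 2 * s + 5 ≤ n) :
    pb l k t 2 (2 * s) = (k - s) * (k - s - 1) * (k - s - 2) * (12 * t ^ 2 -
      4 * (l + s + 1) * (k - s) - (4 * (l + s) ^ 2 + 4 * (l + s) + 3)) /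
        (16 * (l + s) * (l + s + 1) * (l + s + 2)) := by
  have d₀ := two_mul_add_ne_zero hl (m := 2 * s) (by omega)
  have d₁ := two_mul_add_ne_zero hl (m := 2 * s + 1) (by omega)
  have d₂ := two_mul_add_ne_zero hl (m := 2 * s + 2) (by omega)
  have d₃ := two_mul_add_ne_zero hl (m := 2 * s + 3) (by omega)
  have d₄ := two_mul_add_ne_zero hl (m := 2 * s + 4) (by omega)
  push_cast at d₀ d₁ d₂ d₃ d₄
  have d₀ : l + s ≠ 0 := fun h => d₀ (by linear_combination (2 : ℂ) * h)
  have d₁ : 2 * (l + s) + 1 ≠ 0 := fun h => d₁ (by linear_combination h)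
  have d₂ : l + s + 1 ≠ 0 := fun h => d₂ (by linear_combination (2 : ℂ) * h)
  have d₃ : 2 * (l + s) + 3 ≠ 0 := fun h => d₃ (by linear_combination h)
  have d₄ : l + s + 2 ≠ 0 := fun h => d₄ (by linear_combination (2 : ℂ) * h)
  refine (bb_two_of (m := l + s) (by push_cast; ring) rfl rfl rfl rfl rfl rfl rfl rfl
    d₀ d₁ d₂ d₃ d₄).trans ?_
  refine two_even_identity d₀ d₁ d₂ d₃ d₄ ?_ ?_ ?_ ?_ ?_ ?_ ?_ ?_
  · rw [theta_two_mul]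
  · rw [theta_two_mul_add_one]
  · exact (theta_two_mul (s + 1)).trans (by push_cast; ring)
  · exact (theta_two_mul_add_one (s + 1)).trans (by push_cast; ring)
  · exact (theta_two_mul (s + 2)).trans (by push_cast; ring)
  · rw [gam_two_mul]
  · rw [gam_two_mul_add_one]; ring
  · exact (gam_two_mul (s + 1)).trans (by push_cast; ring)

lemma two_odd_identity {A m t x₀ x₁ x₂ x₃ x₄ g₀ g₁ g₂ : ℂ}
    (d₀ : m ≠ 0) (d₁ : 2 * m + 1 ≠ 0) (d₂ : m + 1 ≠ 0) (d₃ : 2 * m + 3 ≠ 0) (d₄ : m + 2 ≠ 0)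
    (h0 : x₀ = -(m + t)) (h1 : x₁ = -(A - 1)) (h2 : x₂ = -(m + 1 + t))
    (h3 : x₃ = -(A - 2)) (h4 : x₄ = -(m + 2 + t)) (h5 : g₀ = -((A - 1) * (A + 2 * m + 2 * t)))
    (h6 : g₁ = -((A - 1) * (A - 2))) (h7 : g₂ = -((A - 2) * (A + 1 + 2 * m + 2 * t))) :
    -(x₃ * x₄ * g₀ / (2 * (m + 2))) +
      x₀ * x₁ * x₂ * x₃ * x₄ * (4 * m + 7) / (4 * (m + 1) * (2 * m + 3) * (m + 2)) +
      (x₄ * g₁ / (2 * (m + 2)) - x₁ * x₂ * x₃ * x₄ / (2 * (2 * m + 3) * (m + 2)) +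
        (g₂ - 2 * (x₂ * x₃ * x₄) / (2 * m + 3)) * x₁ / (2 * m + 1)) * x₀ / (2 * m) +
      (g₂ - 2 * (x₂ * x₃ * x₄) / (2 * m + 3)) * (x₀ * x₁) / (2 * m + 1) =
        (A - 1) * (A - 2) * t * (3 * (t ^ 2 - m ^ 2) - 4 * (m + 1) * A) /
          (4 * m * (m + 1) * (m + 2)) := by
  field_simp
  subst_vars
  ring

lemma pb_two_odd (hl : ∀ m : ℕ, m < n → -2 * l ≠ m) (h : 2 * s + 6 ≤ n) :
    pb l k t 2 (2 * s + 1) = (k - s - 1) * (k - s - 2) * t * (3 * (t ^ 2 - (l + s + 1 / 2) ^ 2) -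
      4 * (l + s + 3 / 2) * (k - s)) /
        (4 * (l + s + 1 / 2) * (l + s + 3 / 2) * (l + s + 5 / 2)) := by
  have d₀ := two_mul_add_ne_zero hl (m := 2 * s + 1) (by omega)
  have d₁ := two_mul_add_ne_zero hl (m := 2 * s + 2) (by omega)
  have d₂ := two_mul_add_ne_zero hl (m := 2 * s + 3) (by omega)
  have d₃ := two_mul_add_ne_zero hl (m := 2 * s + 4) (by omega)
  have d₄ := two_mul_add_ne_zero hl (m := 2 * s + 5) (by omega)
  push_cast at d₀ d₁ d₂ d₃ d₄
  generalize hm : l + s + 1 / 2 = m at *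
  obtain rfl : l = m - s - 1 / 2 := by rw [← hm]; ring
  have d₀ : m ≠ 0 := fun h => d₀ (by linear_combination (2 : ℂ) * h)
  have d₁ : 2 * m + 1 ≠ 0 := fun h => d₁ (by linear_combination h)
  have d₂ : m + 1 ≠ 0 := fun h => d₂ (by linear_combination (2 : ℂ) * h)
  have d₃ : 2 * m + 3 ≠ 0 := fun h => d₃ (by linear_combination h)
  have d₄ : m + 2 ≠ 0 := fun h => d₄ (by linear_combination (2 : ℂ) * h)
  obtain ⟨A, rfl⟩ : ∃ A, k = A + s := ⟨k - s, by ring⟩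
  refine (bb_two_of (m := m) (by push_cast; ring) rfl rfl rfl rfl rfl rfl rfl rfl
    d₀ d₁ d₂ d₃ d₄).trans ?_
  rw [show m - s - 1 / 2 + s + 3 / 2 = m + 1 by ring, show m - s - 1 / 2 + s + 5 / 2 = m + 2 by ring,
    add_sub_cancel_right]
  refine two_odd_identity d₀ d₁ d₂ d₃ d₄ ?_ ?_ ?_ ?_ ?_ ?_ ?_ ?_
  · rw [theta_two_mul_add_one]; ring
  · exact (theta_two_mul (s + 1)).trans (by push_cast; ring)
  · exact (theta_two_mul_add_one (s + 1)).trans (by push_cast; ring)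
  · exact (theta_two_mul (s + 2)).trans (by push_cast; ring)
  · exact (theta_two_mul_add_one (s + 2)).trans (by push_cast; ring)
  · rw [gam_two_mul_add_one]; ring
  · exact (gam_two_mul (s + 1)).trans (by push_cast; ring)
  · exact (gam_two_mul_add_one (s + 1)).trans (by push_cast; ring)

lemma pb_zero_even_iff (hl : ∀ m : ℕ, m < n → -2 * l ≠ m) (h : 2 * s + 3 ≤ n) :
    pb l k t 0 (2 * s) = 0 ↔ (k - s) * (k - s - 1) * t = 0 := by
  have d₁ := two_mul_add_ne_zero hl (m := 2 * s + 1) (by omega)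
  push_cast at d₁
  have d₁ : 2 * (l + s) + 1 ≠ 0 := fun h => d₁ (by linear_combination h)
  rw [pb_zero_even hl h, div_eq_zero_iff, or_iff_left d₁]
  simp [mul_eq_zero]

lemma pb_zero_odd_iff (hl : ∀ m : ℕ, m < n → -2 * l ≠ m) (h : 2 * s + 4 ≤ n) :
    pb l k t 0 (2 * s + 1) = 0 ↔ (k - s - 1) *
      (2 * (t ^ 2 - (l + s + 1 / 2) ^ 2) - (k - s) * (2 * (l + s + 1))) = 0 := by
  have d₁ := two_mul_add_ne_zero hl (m := 2 * s + 2) (by omega)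
  push_cast at d₁
  have d₁ : 2 * (l + s + 1) ≠ 0 := fun h => d₁ (by linear_combination h)
  rw [pb_zero_odd hl h, div_eq_zero_iff, or_iff_left d₁]

lemma pb_one_even_iff (hl : ∀ m : ℕ, m < n → -2 * l ≠ m) (h : 2 * s + 4 ≤ n) :
    pb l k t 1 (2 * s) = 0 ↔ (k - s) * (k - s - 1) * ((2 * (l + s) + 3) *
      (4 * (k - s) + 6 * (l + s) + 1) - 12 * t ^ 2) = 0 := by
  have d₀ := two_mul_add_ne_zero hl (m := 2 * s) (by omega)
  have d₃ := two_mul_add_ne_zero hl (m := 2 * s + 3) (by omega)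
  push_cast at d₀ d₃
  have d₀ : 8 * (l + s) ≠ 0 := fun h => d₀ (by linear_combination (1 / 4 : ℂ) * h)
  have d₃ : 2 * (l + s) + 3 ≠ 0 := fun h => d₃ (by linear_combination h)
  rw [pb_one_even hl h, div_eq_zero_iff, or_iff_left (mul_ne_zero d₀ d₃), neg_eq_zero]

lemma pb_one_odd_iff (hl : ∀ m : ℕ, m < n → -2 * l ≠ m) (h : 2 * s + 5 ≤ n) :
    pb l k t 1 (2 * s + 1) = 0 ↔ (k - s - 1) * (k - s - 2) *
      (3 * ((l + s + 1 / 2) ^ 2 - t ^ 2) + 2 * (l + s + 1 / 2) * (k - s)) = 0 := by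
  have d₀ := two_mul_add_ne_zero hl (m := 2 * s + 1) (by omega)
  have d₃ := two_mul_add_ne_zero hl (m := 2 * s + 4) (by omega)
  push_cast at d₀ d₃
  have d₀ : 2 * (l + s + 1 / 2) ≠ 0 := fun h => d₀ (by linear_combination h)
  have d₃ : 2 * (l + s + 2) ≠ 0 := fun h => d₃ (by linear_combination h)
  rw [pb_one_odd hl h, div_eq_zero_iff, or_iff_left (mul_ne_zero d₀ d₃), neg_eq_zero]

lemma pb_two_even_iff (hl : ∀ m : ℕ, m < n → -2 * l ≠ m) (h : 2 * s + 5 ≤ n) :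
    pb l k t 2 (2 * s) = 0 ↔ (k - s) * (k - s - 1) * (k - s - 2) * (12 * t ^ 2 -
      4 * (l + s + 1) * (k - s) - (4 * (l + s) ^ 2 + 4 * (l + s) + 3)) = 0 := by
  have d₀ := two_mul_add_ne_zero hl (m := 2 * s) (by omega)
  have d₂ := two_mul_add_ne_zero hl (m := 2 * s + 2) (by omega)
  have d₄ := two_mul_add_ne_zero hl (m := 2 * s + 4) (by omega)
  push_cast at d₀ d₂ d₄
  have d₀ : 16 * (l + s) ≠ 0 := fun h => d₀ (by linear_combination (1 / 8 : ℂ) * h)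
  have d₂ : l + s + 1 ≠ 0 := fun h => d₂ (by linear_combination (2 : ℂ) * h)
  have d₄ : l + s + 2 ≠ 0 := fun h => d₄ (by linear_combination (2 : ℂ) * h)
  rw [pb_two_even hl h, div_eq_zero_iff, or_iff_left (mul_ne_zero (mul_ne_zero d₀ d₂) d₄)]

lemma pb_two_odd_iff (hl : ∀ m : ℕ, m < n → -2 * l ≠ m) (h : 2 * s + 6 ≤ n) :
    pb l k t 2 (2 * s + 1) = 0 ↔ (k - s - 1) * (k - s - 2) * t *
      (3 * (t ^ 2 - (l + s + 1 / 2) ^ 2) - 4 * (l + s + 3 / 2) * (k - s)) = 0 := by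
  have d₀ := two_mul_add_ne_zero hl (m := 2 * s + 1) (by omega)
  have d₂ := two_mul_add_ne_zero hl (m := 2 * s + 3) (by omega)
  have d₄ := two_mul_add_ne_zero hl (m := 2 * s + 5) (by omega)
  push_cast at d₀ d₂ d₄
  have d₀ : 4 * (l + s + 1 / 2) ≠ 0 := fun h => d₀ (by linear_combination (1 / 2 : ℂ) * h)
  have d₂ : l + s + 3 / 2 ≠ 0 := fun h => d₂ (by linear_combination (2 : ℂ) * h)
  have d₄ : l + s + 5 / 2 ≠ 0 := fun h => d₄ (by linear_combination (2 : ℂ) * h)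
  rw [pb_two_odd hl h, div_eq_zero_iff, or_iff_left (mul_ne_zero (mul_ne_zero d₀ d₂) d₄)]

end

/-! ## Existence within the pseudodifferential operators -/

lemma exists_sq_eq (a : ℂ) : ∃ t : ℂ, t ^ 2 = a := IsAlgClosed.exists_pow_nat_eq a two_pos

theorem exists_psiDO_three_three (l : ℂ) (h : -2 * l ∉ ({0, 1, 2, 3, 4, 5} : Set ℂ)) :
    ExistsPsiDOUniserialExt l [3, 3] := by
  have hl : ∀ m : ℕ, m < 3 + 3 → -2 * l ≠ m := fun m hm h' => h (by
    rw [h']; interval_cases m <;> simp)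
  refine existsPsiDOUniserialExt_of (n₁ := 3) (n₂ := 3) (-1) (nuOf l (-1) (l + 3 / 2)) {1, 2} hl
    (by decide) (by decide) (by decide) (by decide) (fun j hj i hi hi' => ?_)
    (fun i hi hi' h0 => ?_) (fun i hi hi' h0 h1 => ?_)
    (mt (pb_zero_even_iff (s := 0) hl (by norm_num)).1 ?_)
    (mt (pb_zero_odd_iff (s := 1) hl (by norm_num)).1 ?_) (good_three.2 fun e => ?_)
    (good_three.2 fun e => ?_)
  · simp at hj; omega
  · omega
  · simp at hi'; omega
  · have := two_mul_add_ne_zero hl (m := 3) (by norm_num)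
    intro h0; push_cast at this h0
    exact this (by linear_combination h0)
  · have := two_mul_add_ne_zero hl (m := 4) (by norm_num)
    intro h0; push_cast at this h0
    exact this (by linear_combination (-1 / 6 : ℂ) * h0)
  · exact two_mul_add_ne_zero hl (m := 1) (by norm_num) (by rw [e]; norm_num)
  · exact two_mul_add_ne_zero hl (m := 4) (by norm_num) (by push_cast at e ⊢; linear_combination 2 * e)

theorem exists_psiDO_four_three (l : ℂ) (h : -2 * l ∉ ({0, 1, 2, 3, 4, 5, 6} : Set ℂ)) :
    ExistsPsiDOUniserialExt l [4, 3] := by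
  have hl : ∀ m : ℕ, m < 4 + 3 → -2 * l ≠ m := fun m hm h' => h (by
    rw [h']; interval_cases m <;> simp)
  have d₃ := two_mul_add_ne_zero hl (m := 3) (by norm_num)
  push_cast at d₃
  have key : ∀ k t : ℂ, t ^ 2 = (2 * l + 3) * (6 * l + 5 + 4 * k) / 12 → k ≠ 0 → k ≠ 1 → k ≠ 2 →
      k ≠ 3 → 6 * l + 5 + 4 * k ≠ 0 → ExistsPsiDOUniserialExt l [4, 3] := by
    intro k t ht k0 k1 k2 k3 h6
    have t0 : t ≠ 0 := by
      rintro rfl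
      refine mul_ne_zero d₃ h6 ?_
      linear_combination -12 * ht
    refine existsPsiDOUniserialExt_of (n₁ := 4) (n₂ := 3) k (nuOf l k t) {1, 2} hl
      (by decide) (by decide) (by decide) (by decide) (fun j hj i hi hi' => ?_)
      (fun i hi hi' h0 => ?_) (fun i hi hi' h0 h1 => ?_)
      (mt (pb_one_even_iff (s := 0) hl (by norm_num)).1 ?_)
      (mt (pb_zero_even_iff (s := 2) hl (by norm_num)).1 ?_) (good_four.2 fun e => ?_)
      (good_three.2 fun e => ?_)
    · simp at hj; omega
    · simp at hi'; omega
    · obtain rfl : i = 3 := by simp at hi'; omega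
      refine (pb_one_odd_iff (s := 1) hl (by norm_num)).2 ?_
      push_cast; rw [ht]; ring
    · push_cast
      refine mul_ne_zero (mul_ne_zero (by simpa using k0) fun h => k1 (by linear_combination h))
        fun h => d₃ ?_
      rw [ht] at h
      linear_combination (-1 / 4 : ℂ) * h
    · push_cast
      exact mul_ne_zero (mul_ne_zero (sub_ne_zero.2 k2) fun h => k3 (by linear_combination h)) t0
    · exact two_mul_add_ne_zero hl (m := 0) (by norm_num) (by rw [e]; norm_num)
    · exact two_mul_add_ne_zero hl (m := 5) (by norm_num)
        (by push_cast at e ⊢; linear_combination 2 * e)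
  by_cases hc : 6 * l + 1 = 0
  · obtain ⟨t, ht⟩ := exists_sq_eq ((2 * l + 3) * (6 * l + 5 + 4 * (-2)) / 12)
    refine key (-2) t ht ?_ ?_ ?_ ?_ fun h => ?_ <;> norm_num
    have : (4 : ℂ) = 0 := by linear_combination hc - h
    norm_num at this
  · obtain ⟨t, ht⟩ := exists_sq_eq ((2 * l + 3) * (6 * l + 5 + 4 * (-1)) / 12)
    refine key (-1) t ht ?_ ?_ ?_ ?_ fun h => ?_ <;> norm_num
    exact hc (by linear_combination h)

theorem exists_psiDO_three_four (l : ℂ) (h : -2 * l ∉ ({0, 1, 2, 3, 4, 5, 6} : Set ℂ)) :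
    ExistsPsiDOUniserialExt l [3, 4] := by
  have hl : ∀ m : ℕ, m < 3 + 4 → -2 * l ≠ m := fun m hm h' => h (by
    rw [h']; interval_cases m <;> simp)
  have d₃ := two_mul_add_ne_zero hl (m := 3) (by norm_num)
  push_cast at d₃
  have key : ∀ k t : ℂ, t ^ 2 = (2 * l + 3) * (6 * l + 1 + 4 * k) / 12 → k ≠ 0 → k ≠ 1 → k ≠ 2 →
      k ≠ 3 → 6 * l + 1 + 4 * k ≠ 0 → ExistsPsiDOUniserialExt l [3, 4] := by
    intro k t ht k0 k1 k2 k3 h6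
    have t0 : t ≠ 0 := by
      rintro rfl
      refine mul_ne_zero d₃ h6 ?_
      linear_combination -12 * ht
    refine existsPsiDOUniserialExt_of (n₁ := 3) (n₂ := 4) k (nuOf l k t) {1, 2, 4} hl
      (by decide) (by decide) (by decide) (by decide) (fun j hj i hi hi' => ?_)
      (fun i hi hi' h0 => ?_) (fun i hi hi' h0 h1 => ?_)
      (mt (pb_zero_even_iff (s := 0) hl (by norm_num)).1 ?_)
      (mt (pb_one_odd_iff (s := 1) hl (by norm_num)).1 ?_) (good_three.2 fun e => ?_)
      (good_four.2 fun e => ?_)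
    · obtain ⟨rfl, rfl⟩ : j = 4 ∧ i = 0 := by simp at hj hi'; omega
      refine (pb_one_even_iff (s := 0) hl (by norm_num)).2 ?_
      push_cast; rw [ht]; ring
    · omega
    · simp at hi'; omega
    · push_cast
      exact mul_ne_zero (mul_ne_zero (by simpa using k0) fun h => k1 (by linear_combination h)) t0
    · push_cast
      refine mul_ne_zero (mul_ne_zero (fun h => k2 (by linear_combination h))
        fun h => k3 (by linear_combination h)) fun h => d₃ ?_
      rw [ht] at h
      linear_combination h
    · exact two_mul_add_ne_zero hl (m := 1) (by norm_num) (by rw [e]; norm_num)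
    · exact two_mul_add_ne_zero hl (m := 3) (by norm_num)
        (by push_cast at e ⊢; linear_combination 2 * e)
  by_cases hc : 6 * l - 3 = 0
  · obtain ⟨t, ht⟩ := exists_sq_eq ((2 * l + 3) * (6 * l + 1 + 4 * (-2)) / 12)
    refine key (-2) t ht ?_ ?_ ?_ ?_ fun h => ?_ <;> norm_num
    have : (4 : ℂ) = 0 := by linear_combination hc - h
    norm_num at this
  · obtain ⟨t, ht⟩ := exists_sq_eq ((2 * l + 3) * (6 * l + 1 + 4 * (-1)) / 12)
    refine key (-1) t ht ?_ ?_ ?_ ?_ fun h => ?_ <;> norm_num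
    exact hc (by linear_combination h)

lemma quadratic_ne_zero_of {l : ℂ}
    (h : 4 * l ∉ ({-7 + ((√33 : ℝ) : ℂ), -7 - ((√33 : ℝ) : ℂ)} : Set ℂ)) :
    2 * l ^ 2 + 7 * l + 2 ≠ 0 := by
  have hs : ((√33 : ℝ) : ℂ) ^ 2 = 33 := by
    rw [← Complex.ofReal_pow, Real.sq_sqrt (by norm_num)]; norm_num
  intro h0
  have : (4 * l - (-7 + ((√33 : ℝ) : ℂ))) * (4 * l - (-7 - ((√33 : ℝ) : ℂ))) = 0 := by
    linear_combination 8 * h0 - hs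
  refine h ((mul_eq_zero.1 this).imp (fun h => ?_) fun h => ?_)
  · exact sub_eq_zero.1 h
  · exact sub_eq_zero.1 h

theorem exists_psiDO_five_three (l : ℂ) (h : -2 * l ∉ ({0, 1, 2, 3, 4, 5, 6, 7} : Set ℂ))
    (h33 : 4 * l ∉ ({-7 + ((√33 : ℝ) : ℂ), -7 - ((√33 : ℝ) : ℂ)} : Set ℂ)) :
    ExistsPsiDOUniserialExt l [5, 3] := by
  have hl : ∀ m : ℕ, m < 5 + 3 → -2 * l ≠ m := fun m hm h' => h (by
    rw [h']; interval_cases m <;> simp)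
  have hq := quadratic_ne_zero_of h33
  have hd : ∀ m : ℕ, m < 5 + 3 → 2 * l + m ≠ 0 := fun m hm => two_mul_add_ne_zero hl hm
  have key : ∀ t : ℂ, l ∈ ({-1 / 6, -5 / 6, -13 / 6, 1 / 2} : Set ℂ) →
      t ^ 2 = (2 * l + 3) * (4 * (4 / (2 * l + 7)) + 6 * l + 1) / 12 →
      ExistsPsiDOUniserialExt l [5, 3] := by
    intro t hc ht
    refine existsPsiDOUniserialExt_of (n₁ := 5) (n₂ := 3) (4 / (2 * l + 7))
      (nuOf l (4 / (2 * l + 7)) t) {1, 2, 4} hl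
      (by decide) (by decide) (by decide) (by decide) (fun j hj i hi hi' => ?_)
      (fun i hi hi' h0 => ?_) (fun i hi hi' h0 h1 => ?_)
      (mt (pb_two_even_iff (s := 0) hl (by norm_num)).1 ?_)
      (mt (pb_zero_odd_iff (s := 2) hl (by norm_num)).1 ?_) (good_five.2 ⟨fun e => ?_, fun e => ?_⟩)
      (good_three.2 fun e => ?_)
    · obtain ⟨rfl, rfl⟩ : j = 4 ∧ i = 0 := by simp at hj hi'; omega
      refine (pb_one_even_iff (s := 0) hl (by norm_num)).2 ?_
      rw [ht]; push_cast; ring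
    · simp at hi'; omega
    · obtain rfl : i = 3 := by simp at hi'; omega
      refine (pb_two_odd_iff (s := 1) hl (by norm_num)).2 ?_
      have h7 := hd 7 (by norm_num)
      rw [ht]
      push_cast at h7 ⊢
      refine mul_eq_zero_of_right _ ?_
      field_simp
      ring
    · rw [ht]; rcases hc with rfl | rfl | rfl | rfl <;> norm_num
    · rw [ht]; rcases hc with rfl | rfl | rfl | rfl <;> norm_num
    · exact hd 0 (by norm_num) (by rw [e]; norm_num)
    · exact hd 2 (by norm_num) (by rw [e]; norm_num)
    · exact hd 6 (by norm_num) (by push_cast at e ⊢; linear_combination 2 * e)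
  by_cases hc : l ∈ ({-1 / 6, -5 / 6, -13 / 6, 1 / 2} : Set ℂ)
  · obtain ⟨t, ht⟩ := exists_sq_eq ((2 * l + 3) * (4 * (4 / (2 * l + 7)) + 6 * l + 1) / 12)
    exact key t hc ht
  simp only [Set.mem_insert_iff, Set.mem_singleton_iff, not_or] at hc
  obtain ⟨c1, c2, c3, c4⟩ := hc
  refine existsPsiDOUniserialExt_of (n₁ := 5) (n₂ := 3) (-(6 * l + 1) / 4)
    (nuOf l (-(6 * l + 1) / 4) 0) {1, 2, 3, 4} hl
    (by decide) (by decide) (by decide) (by decide) (fun j hj i hi hi' => ?_)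
    (fun i hi hi' h0 => ?_) (fun i hi hi' h0 h1 => ?_)
    (mt (pb_two_even_iff (s := 0) hl (by norm_num)).1 ?_)
    (mt (pb_zero_odd_iff (s := 2) hl (by norm_num)).1 ?_) (good_five.2 ⟨fun e => ?_, fun e => ?_⟩)
    (good_three.2 fun e => ?_)
  · obtain ⟨rfl, rfl⟩ | ⟨rfl, rfl⟩ : (j = 3 ∧ i = 0) ∨ j = 4 ∧ i = 0 := by simp at hj hi'; omega
    · exact (pb_zero_even_iff (s := 0) hl (by norm_num)).2 (by ring)
    · exact (pb_one_even_iff (s := 0) hl (by norm_num)).2 (by push_cast; ring)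
  · simp at hi'; omega
  · simp at hi'; omega
  · push_cast
    refine mul_ne_zero (mul_ne_zero (mul_ne_zero (fun h => c1 ?_) fun h => c2 ?_) fun h =>
      hd 3 (by norm_num) ?_) fun h => mul_ne_zero (sub_ne_zero.2 c4) (hd 4 (by norm_num)) ?_
    · linear_combination (-2 / 3 : ℂ) * h
    · linear_combination (-2 / 3 : ℂ) * h
    · push_cast; linear_combination (-4 / 3 : ℂ) * h
    · push_cast; linear_combination h
  · push_cast
    refine mul_ne_zero (fun h => c3 ?_) fun h => hq ?_
    · linear_combination (-2 / 3 : ℂ) * h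
    · linear_combination 2 * h
  · exact hd 0 (by norm_num) (by rw [e]; norm_num)
  · exact hd 2 (by norm_num) (by rw [e]; norm_num)
  · exact hd 6 (by norm_num) (by push_cast at e ⊢; linear_combination 2 * e)

theorem exists_psiDO_three_five (l : ℂ) (h : -2 * l ∉ ({0, 1, 2, 3, 4, 5, 6, 7} : Set ℂ))
    (h33 : 4 * l ∉ ({-7 + ((√33 : ℝ) : ℂ), -7 - ((√33 : ℝ) : ℂ)} : Set ℂ)) :
    ExistsPsiDOUniserialExt l [3, 5] := by
  have hl : ∀ m : ℕ, m < 3 + 5 → -2 * l ≠ m := fun m hm h' => h (by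
    rw [h']; interval_cases m <;> simp)
  have hq := quadratic_ne_zero_of h33
  have hd : ∀ m : ℕ, m < 3 + 5 → 2 * l + m ≠ 0 := fun m hm => two_mul_add_ne_zero hl hm
  by_cases hc : l = 1 / 2
  · obtain ⟨t, ht⟩ := exists_sq_eq (12 / 13)
    have t0 : t ≠ 0 := by rintro rfl; norm_num at ht
    refine existsPsiDOUniserialExt_of (n₁ := 3) (n₂ := 5) (-4 / 13)
      (nuOf l (-4 / 13) t) {1, 2, 4} hl
      (by decide) (by decide) (by decide) (by decide) (fun j hj i hi hi' => ?_)
      (fun i hi hi' h0 => ?_) (fun i hi hi' h0 h1 => ?_)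
      (mt (pb_zero_even_iff (s := 0) hl (by norm_num)).1 ?_)
      (mt (pb_two_odd_iff (s := 1) hl (by norm_num)).1 ?_) (good_three.2 fun e => ?_)
      (good_five.2 ⟨fun e => ?_, fun e => ?_⟩)
    · obtain ⟨rfl, rfl⟩ : j = 4 ∧ i = 0 := by simp at hj hi'; omega
      refine (pb_one_even_iff (s := 0) hl (by norm_num)).2 ?_
      rw [ht, hc]; norm_num
    · omega
    · obtain rfl : i = 5 := by simp at hi'; omega
      refine (pb_zero_odd_iff (s := 2) hl (by norm_num)).2 ?_
      rw [ht, hc]; norm_num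
    · exact mul_ne_zero (by norm_num) t0
    · rw [ht, hc]
      exact mul_ne_zero (mul_ne_zero (by norm_num) t0) (by norm_num)
    · exact hd 1 (by norm_num) (by rw [e]; norm_num)
    · exact hd 3 (by norm_num) (by push_cast at e ⊢; linear_combination 2 * e)
    · exact hd 5 (by norm_num) (by push_cast at e ⊢; linear_combination 2 * e)
  · obtain ⟨t, ht⟩ := exists_sq_eq (-((2 * l - 1) * (2 * l + 3)) / 12)
    have d₃ := hd 3 (by norm_num)
    have t0 : t ≠ 0 := by
      rintro rfl
      push_cast at d₃
      refine mul_ne_zero (fun h => hc ?_) d₃ (?_ : (2 * l - 1) * (2 * l + 3) = 0)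
      · linear_combination (1 / 2 : ℂ) * h
      · linear_combination 12 * ht
    refine existsPsiDOUniserialExt_of (n₁ := 3) (n₂ := 5) (-2 * l)
      (nuOf l (-2 * l) t) {1, 2, 4, 5} hl
      (by decide) (by decide) (by decide) (by decide) (fun j hj i hi hi' => ?_)
      (fun i hi hi' h0 => ?_) (fun i hi hi' h0 h1 => ?_)
      (mt (pb_zero_even_iff (s := 0) hl (by norm_num)).1 ?_)
      (mt (pb_two_odd_iff (s := 1) hl (by norm_num)).1 ?_) (good_three.2 fun e => ?_)
      (good_five.2 ⟨fun e => ?_, fun e => ?_⟩)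
    · obtain ⟨rfl, rfl⟩ | ⟨rfl, rfl⟩ : (j = 4 ∧ i = 0) ∨ j = 5 ∧ i = 0 := by
        simp at hj hi'; omega
      · refine (pb_one_even_iff (s := 0) hl (by norm_num)).2 ?_
        rw [ht]; push_cast; ring
      · refine (pb_two_even_iff (s := 0) hl (by norm_num)).2 ?_
        rw [ht]; push_cast; ring
    · omega
    · simp at hi'; omega
    · push_cast
      refine mul_ne_zero (mul_ne_zero (fun h => hd 0 (by norm_num) ?_) fun h =>
        hd 1 (by norm_num) ?_) t0
      · push_cast; linear_combination -h
      · push_cast; linear_combination -h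
    · rw [ht]; push_cast
      refine mul_ne_zero (mul_ne_zero (mul_ne_zero (fun h => hd 2 (by norm_num) ?_) fun h =>
        hd 3 (by norm_num) ?_) t0) fun h => hq ?_
      · push_cast; linear_combination -h
      · push_cast; linear_combination -h
      · linear_combination (1 / 2 : ℂ) * h
    · exact hd 1 (by norm_num) (by rw [e]; norm_num)
    · exact hd 3 (by norm_num) (by push_cast at e ⊢; linear_combination 2 * e)
    · exact hd 5 (by norm_num) (by push_cast at e ⊢; linear_combination 2 * e)

lemma resultant_of_common_root {x b c d e : ℂ} (h₁ : 4 * x ^ 2 + b * x + c = 0)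
    (h₂ : 4 * x ^ 2 + d * x + e = 0) :
    4 * (c - e) ^ 2 + b * (c - e) * (d - b) + c * (d - b) ^ 2 = 0 := by
  have h : (d - b) * x = c - e := by linear_combination h₂ - h₁
  rw [← h]
  linear_combination (d - b) ^ 2 * h₁

theorem exists_psiDO_four_four (l : ℂ) (h : -2 * l ∉ ({0, 1, 2, 3, 4, 5, 6, 7} : Set ℂ))
    (h33 : 4 * l ∉ ({-7 + ((√33 : ℝ) : ℂ), -7 - ((√33 : ℝ) : ℂ)} : Set ℂ)) :
    ExistsPsiDOUniserialExt l [4, 4] := by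
  have hl : ∀ m : ℕ, m < 4 + 4 → -2 * l ≠ m := fun m hm h' => h (by
    rw [h']; interval_cases m <;> simp)
  have hq := quadratic_ne_zero_of h33
  have hd : ∀ m : ℕ, m < 4 + 4 → 2 * l + m ≠ 0 := fun m hm => two_mul_add_ne_zero hl hm
  have d₂ := hd 2 (by norm_num)
  have d₃ := hd 3 (by norm_num)
  have d₅ := hd 5 (by norm_num)
  have d₇ := hd 7 (by norm_num)
  have d₆ := hd 6 (by norm_num)
  have d₄ := hd 4 (by norm_num)
  push_cast at d₂ d₃ d₄ d₅ d₆ d₇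
  have key : ∀ (k : ℂ) (J : Finset ℕ), 0 ∉ J → 1 ∈ J → 2 ∈ J → 3 ∈ J → 4 ∉ J → (∀ j ∈ J, j ≤ 5) →
      (5 ∈ J → k * (4 * (l + 1)) = -(4 * l ^ 2 + 4 * l + 3)) →
      (5 ∉ J → k * (4 * (l + 3)) = -(4 * l ^ 2 + 12 * l + 1)) →
      k ≠ 0 → k ≠ 1 → k ≠ 2 → k ≠ 3 → 4 * k + 6 * l + 1 ≠ 0 → 4 * k + 6 * l + 5 ≠ 0 →
      ExistsPsiDOUniserialExt l [4, 4] := by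
    intro k J j0 j1 j2 j3 j4 j5 h5 h5' k0 k1 k2 k3 q1 q2
    refine existsPsiDOUniserialExt_of (n₁ := 4) (n₂ := 4) k (nuOf l k 0) J hl
      j0 j4 (fun h => absurd (j5 _ h) (by norm_num)) (fun j hj => (j5 j hj).trans (by norm_num))
      (fun j hj i hi hi' => ?_) (fun i hi hi' h0 => ?_) (fun i hi hi' h0 h1 => ?_)
      (mt (pb_one_even_iff (s := 0) hl (by norm_num)).1 ?_)
      (mt (pb_one_even_iff (s := 2) hl (by norm_num)).1 ?_) (good_four.2 fun e => ?_)
      (good_four.2 fun e => ?_)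
    · have a0 : i = 0 := by
        have := j5 j hj
        have i1 : i ≠ 1 := fun h => hi' (h ▸ j1)
        have i2 : i ≠ 2 := fun h => hi' (h ▸ j2)
        omega
      subst a0
      obtain rfl | rfl : j = 3 ∨ j = 5 := by
        have := j5 j hj
        have i4 : j ≠ 4 := fun h => j4 (h ▸ hj)
        omega
      · exact (pb_zero_even_iff (s := 0) hl (by norm_num)).2 (by ring)
      · refine (pb_two_even_iff (s := 0) hl (by norm_num)).2 ?_
        push_cast
        linear_combination -(k * (k - 1) * (k - 2)) * h5 hj
    · have i1 : i ≠ 1 := fun h => hi' (h ▸ j1)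
      omega
    · obtain rfl : i = 5 := by
        have i1 : i ≠ 1 := fun h => hi' (h ▸ j1)
        have i2 : i ≠ 2 := fun h => hi' (h ▸ j2)
        have i3 : i ≠ 3 := fun h => hi' (h ▸ j3)
        omega
      refine (pb_zero_odd_iff (s := 2) hl (by norm_num)).2 ?_
      push_cast
      linear_combination (-(k - 3) / 2) * h5' hi'
    · push_cast
      refine mul_ne_zero (mul_ne_zero (by simpa using k0) fun h => k1 (by linear_combination h))
        fun h => mul_ne_zero d₃ q1 (by linear_combination h)
    · push_cast
      refine mul_ne_zero (mul_ne_zero (sub_ne_zero.2 k2) fun h => k3 (by linear_combination h))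
        fun h => mul_ne_zero d₇ q2 (by linear_combination h)
    · exact hd 0 (by norm_num) (by rw [e]; norm_num)
    · exact hd 4 (by norm_num) (by push_cast at e ⊢; linear_combination 2 * e)
  have l1 : 4 * (l + 1) ≠ 0 := fun h => d₂ (by linear_combination (1 / 2 : ℂ) * h)
  have l3 : 4 * (l + 3) ≠ 0 := fun h => d₆ (by linear_combination (1 / 2 : ℂ) * h)
  by_cases hc : l ≠ 1 / 2 ∧ 4 * l ^ 2 + 4 * l + 3 ≠ 0 ∧ 4 * l ^ 2 + 8 * l + 7 ≠ 0 ∧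
      4 * l ^ 2 + 12 * l + 11 ≠ 0
  · obtain ⟨c0, c1, c2, c3⟩ := hc
    obtain ⟨k, hk⟩ : ∃ k : ℂ, k * (4 * (l + 1)) = -(4 * l ^ 2 + 4 * l + 3) :=
      ⟨_, div_mul_cancel₀ _ l1⟩
    refine key k {1, 2, 3, 5} (by decide) (by decide) (by decide) (by decide) (by decide)
      (by decide) (fun _ => hk) (fun h => absurd h (by decide)) ?_ ?_ ?_ ?_ (fun h => ?_) fun h => ?_
    · rintro rfl; exact c1 (by linear_combination hk)
    · rintro rfl; exact c2 (by linear_combination hk)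
    · rintro rfl; exact c3 (by linear_combination hk)
    · rintro rfl; exact mul_ne_zero d₃ d₅ (by linear_combination hk)
    · exact mul_ne_zero (sub_ne_zero.2 c0) d₄ (by linear_combination (l + 1) * h - hk)
    · exact hq (by linear_combination (l + 1) * h - hk)
  · obtain ⟨k, hk⟩ : ∃ k : ℂ, k * (4 * (l + 3)) = -(4 * l ^ 2 + 12 * l + 1) :=
      ⟨_, div_mul_cancel₀ _ l3⟩
    have hx : l = 1 / 2 ∨ 4 * l ^ 2 + 4 * l + 3 = 0 ∨ 4 * l ^ 2 + 8 * l + 7 = 0 ∨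
        4 * l ^ 2 + 12 * l + 11 = 0 := by tauto
    have hroot : ∀ b c : ℂ, 4 * l ^ 2 + b * l + c = 0 → 1 + b / 2 + c ≠ 0 →
        4 * (3 - c) ^ 2 + 4 * (3 - c) * (b - 4) + 3 * (b - 4) ^ 2 ≠ 0 →
        4 * (7 - c) ^ 2 + 8 * (7 - c) * (b - 8) + 7 * (b - 8) ^ 2 ≠ 0 →
        4 * (11 - c) ^ 2 + 12 * (11 - c) * (b - 12) + 11 * (b - 12) ^ 2 ≠ 0 → False := by
      intro b c hb b0 b1 b2 b3
      rcases hx with rfl | hx | hx | hx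
      · exact b0 (by linear_combination hb)
      · exact b1 (resultant_of_common_root hx hb)
      · exact b2 (resultant_of_common_root hx hb)
      · exact b3 (resultant_of_common_root hx hb)
    refine key k {1, 2, 3} (by decide) (by decide) (by decide) (by decide) (by decide)
      (by decide) (fun h => absurd h (by decide)) (fun _ => hk) ?_ ?_ ?_ ?_ (fun h => ?_) fun h => ?_
    · rintro rfl
      exact hroot 12 1 (by linear_combination hk) (by norm_num) (by norm_num) (by norm_num)
        (by norm_num)
    · rintro rfl
      exact hroot 16 13 (by linear_combination hk) (by norm_num) (by norm_num) (by norm_num)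
        (by norm_num)
    · rintro rfl
      exact mul_ne_zero d₅ d₅ (by linear_combination hk)
    · rintro rfl
      exact hroot 24 37 (by linear_combination hk) (by norm_num) (by norm_num) (by norm_num)
        (by norm_num)
    · exact hq (by linear_combination (l + 3) * h - hk)
    · exact mul_ne_zero d₇ d₄ (by linear_combination 2 * ((l + 3) * h - hk))

theorem exists_psiDO_five_four (l : ℂ) (h : -2 * l ∉ ({0, 1, 2, 3, 4, 5, 6, 7, 8} : Set ℂ)) :
    ExistsPsiDOUniserialExt l [5, 4] := by
  have hl : ∀ m : ℕ, m < 5 + 4 → -2 * l ≠ m := fun m hm h' => h (by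
    rw [h']; interval_cases m <;> simp)
  have hd : ∀ m : ℕ, m < 5 + 4 → 2 * l + m ≠ 0 := fun m hm => two_mul_add_ne_zero hl hm
  have d₅ := hd 5 (by norm_num)
  have d₆ := hd 6 (by norm_num)
  push_cast at d₅ d₆
  by_cases hc : l ∈ ({1 / 2, -1 / 6, -5 / 6, -13 / 6, -17 / 6} : Set ℂ)
  · have l3 : 4 * (l + 3) ≠ 0 := fun h => d₆ (by linear_combination (1 / 2 : ℂ) * h)
    obtain ⟨k, hk⟩ : ∃ k : ℂ, k = -(4 * l ^ 2 + 12 * l + 3) / (4 * (l + 3)) := ⟨_, rfl⟩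
    refine existsPsiDOUniserialExt_of (n₁ := 5) (n₂ := 4) k (nuOf l k 0) {1, 2, 3} hl
      (by decide) (by decide) (by decide) (by decide) (fun j hj i hi hi' => ?_)
      (fun i hi hi' h0 => ?_) (fun i hi hi' h0 h1 => ?_)
      (mt (pb_two_even_iff (s := 0) hl (by norm_num)).1 ?_)
      (mt (pb_one_odd_iff (s := 2) hl (by norm_num)).1 ?_)
      (good_five.2 ⟨fun e => ?_, fun e => ?_⟩) (good_four.2 fun e => ?_)
    · obtain ⟨rfl, rfl⟩ : j = 3 ∧ i = 0 := by simp at hj hi'; omega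
      exact (pb_zero_even_iff (s := 0) hl (by norm_num)).2 (by ring)
    · simp at hi'; omega
    · obtain rfl | rfl : i = 4 ∨ i = 6 := by simp at hi'; omega
      · refine (pb_two_even_iff (s := 2) hl (by norm_num)).2 ?_
        rw [eq_div_iff l3] at hk
        push_cast
        linear_combination -((k - 2) * (k - 2 - 1) * (k - 2 - 2)) * hk
      · exact (pb_zero_even_iff (s := 3) hl (by norm_num)).2 (by ring)
    · rw [hk]; rcases hc with rfl | rfl | rfl | rfl | rfl <;> norm_num
    · rw [hk]; rcases hc with rfl | rfl | rfl | rfl | rfl <;> norm_num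
    · exact hd 0 (by norm_num) (by rw [e]; norm_num)
    · exact hd 2 (by norm_num) (by rw [e]; norm_num)
    · exact hd 5 (by norm_num) (by push_cast at e ⊢; linear_combination 2 * e)
  simp only [Set.mem_insert_iff, Set.mem_singleton_iff, not_or] at hc
  obtain ⟨c4, c1, c2, c3, c5⟩ := hc
  refine existsPsiDOUniserialExt_of (n₁ := 5) (n₂ := 4) (-(6 * l + 1) / 4)
    (nuOf l (-(6 * l + 1) / 4) 0) {1, 2, 3, 4} hl
    (by decide) (by decide) (by decide) (by decide) (fun j hj i hi hi' => ?_)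
    (fun i hi hi' h0 => ?_) (fun i hi hi' h0 h1 => ?_)
    (mt (pb_two_even_iff (s := 0) hl (by norm_num)).1 ?_)
    (mt (pb_one_odd_iff (s := 2) hl (by norm_num)).1 ?_) (good_five.2 ⟨fun e => ?_, fun e => ?_⟩)
    (good_four.2 fun e => ?_)
  · obtain ⟨rfl, rfl⟩ | ⟨rfl, rfl⟩ : (j = 3 ∧ i = 0) ∨ j = 4 ∧ i = 0 := by simp at hj hi'; omega
    · exact (pb_zero_even_iff (s := 0) hl (by norm_num)).2 (by ring)
    · exact (pb_one_even_iff (s := 0) hl (by norm_num)).2 (by push_cast; ring)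
  · simp at hi'; omega
  · obtain rfl : i = 6 := by simp at hi'; omega
    exact (pb_zero_even_iff (s := 3) hl (by norm_num)).2 (by ring)
  · push_cast
    refine mul_ne_zero (mul_ne_zero (mul_ne_zero (fun h => c1 ?_) fun h => c2 ?_) fun h =>
      hd 3 (by norm_num) ?_) fun h => mul_ne_zero (sub_ne_zero.2 c4) (hd 4 (by norm_num)) ?_
    · linear_combination (-2 / 3 : ℂ) * h
    · linear_combination (-2 / 3 : ℂ) * h
    · push_cast; linear_combination (-4 / 3 : ℂ) * h
    · push_cast; linear_combination h
  · push_cast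
    refine mul_ne_zero (mul_ne_zero (fun h => c3 ?_) fun h => c5 ?_) fun h => d₅ ?_
    · linear_combination (-2 / 3 : ℂ) * h
    · linear_combination (-2 / 3 : ℂ) * h
    · linear_combination (2 / 3 : ℂ) * h
  · exact hd 0 (by norm_num) (by rw [e]; norm_num)
  · exact hd 2 (by norm_num) (by rw [e]; norm_num)
  · exact hd 5 (by norm_num) (by push_cast at e ⊢; linear_combination 2 * e)

theorem exists_psiDO_four_five (l : ℂ) (h : -2 * l ∉ ({0, 1, 2, 3, 4, 5, 6, 7, 8} : Set ℂ)) :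
    ExistsPsiDOUniserialExt l [4, 5] := by
  have hl : ∀ m : ℕ, m < 4 + 5 → -2 * l ≠ m := fun m hm h' => h (by
    rw [h']; interval_cases m <;> simp)
  have hd : ∀ m : ℕ, m < 4 + 5 → 2 * l + m ≠ 0 := fun m hm => two_mul_add_ne_zero hl hm
  have d₂ := hd 2 (by norm_num)
  have d₃ := hd 3 (by norm_num)
  have d₅ := hd 5 (by norm_num)
  have d₄ := hd 4 (by norm_num)
  push_cast at d₂ d₃ d₄ d₅
  by_cases hc : l ∈ ({-7 / 6, -11 / 6, -19 / 6, -23 / 6, -9 / 2} : Set ℂ)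
  · have l1 : 4 * (l + 1) ≠ 0 := fun h => d₂ (by linear_combination (1 / 2 : ℂ) * h)
    obtain ⟨k, hk⟩ : ∃ k : ℂ, k = -(4 * l ^ 2 + 4 * l + 3) / (4 * (l + 1)) := ⟨_, rfl⟩
    refine existsPsiDOUniserialExt_of (n₁ := 4) (n₂ := 5) k (nuOf l k 0) {1, 2, 3, 5} hl
      (by decide) (by decide) (by decide) (by decide) (fun j hj i hi hi' => ?_)
      (fun i hi hi' h0 => ?_) (fun i hi hi' h0 h1 => ?_)
      (mt (pb_one_even_iff (s := 0) hl (by norm_num)).1 ?_)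
      (mt (pb_two_even_iff (s := 2) hl (by norm_num)).1 ?_) (good_four.2 fun e => ?_)
      (good_five.2 ⟨fun e => ?_, fun e => ?_⟩)
    · obtain ⟨rfl, rfl⟩ | ⟨rfl, rfl⟩ : (j = 3 ∧ i = 0) ∨ j = 5 ∧ i = 0 := by
        simp at hj hi'; omega
      · exact (pb_zero_even_iff (s := 0) hl (by norm_num)).2 (by ring)
      · refine (pb_two_even_iff (s := 0) hl (by norm_num)).2 ?_
        rw [eq_div_iff l1] at hk
        push_cast
        linear_combination -(k * (k - 1) * (k - 2)) * hk
    · simp at hi'; omega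
    · obtain rfl : i = 6 := by simp at hi'; omega
      exact (pb_zero_even_iff (s := 3) hl (by norm_num)).2 (by ring)
    · rw [hk]; rcases hc with rfl | rfl | rfl | rfl | rfl <;> norm_num
    · rw [hk]; rcases hc with rfl | rfl | rfl | rfl | rfl <;> norm_num
    · exact hd 0 (by norm_num) (by rw [e]; norm_num)
    · exact hd 4 (by norm_num) (by push_cast at e ⊢; linear_combination 2 * e)
    · exact hd 6 (by norm_num) (by push_cast at e ⊢; linear_combination 2 * e)
  simp only [Set.mem_insert_iff, Set.mem_singleton_iff, not_or] at hc
  obtain ⟨c1, c2, c3, c4, c5⟩ := hc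
  refine existsPsiDOUniserialExt_of (n₁ := 4) (n₂ := 5) (-(6 * l + 7) / 4)
    (nuOf l (-(6 * l + 7) / 4) 0) {1, 2, 3} hl
    (by decide) (by decide) (by decide) (by decide) (fun j hj i hi hi' => ?_)
    (fun i hi hi' h0 => ?_) (fun i hi hi' h0 h1 => ?_)
    (mt (pb_one_even_iff (s := 0) hl (by norm_num)).1 ?_)
    (mt (pb_two_even_iff (s := 2) hl (by norm_num)).1 ?_) (good_four.2 fun e => ?_)
    (good_five.2 ⟨fun e => ?_, fun e => ?_⟩)
  · obtain ⟨rfl, rfl⟩ : j = 3 ∧ i = 0 := by simp at hj hi'; omega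
    exact (pb_zero_even_iff (s := 0) hl (by norm_num)).2 (by ring)
  · simp at hi'; omega
  · obtain rfl | rfl : i = 5 ∨ i = 6 := by simp at hi'; omega
    · exact (pb_one_odd_iff (s := 2) hl (by norm_num)).2 (by push_cast; ring)
    · exact (pb_zero_even_iff (s := 3) hl (by norm_num)).2 (by ring)
  · push_cast
    refine mul_ne_zero (mul_ne_zero (fun h => c1 ?_) fun h => c2 ?_) fun h => d₃ ?_
    · linear_combination (-2 / 3 : ℂ) * h
    · linear_combination (-2 / 3 : ℂ) * h
    · linear_combination (-1 / 6 : ℂ) * h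
  · push_cast
    refine mul_ne_zero (mul_ne_zero (mul_ne_zero (fun h => d₅ ?_) fun h => c3 ?_) fun h => c4 ?_)
      fun h => mul_ne_zero (sub_ne_zero.2 c5) d₄ ?_
    · linear_combination (-4 / 3 : ℂ) * h
    · linear_combination (-2 / 3 : ℂ) * h
    · linear_combination (-2 / 3 : ℂ) * h
    · linear_combination h
  · exact hd 0 (by norm_num) (by rw [e]; norm_num)
  · exact hd 4 (by norm_num) (by push_cast at e ⊢; linear_combination 2 * e)
  · exact hd 6 (by norm_num) (by push_cast at e ⊢; linear_combination 2 * e)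

end

end SuperK

theorem proposition6p7 :
    -- existence criterion; the integers `n₁`, `n₂` are the doubles of `p₁`, `p₂`
    (∀ (l : ℂ) (n₁ n₂ : ℤ),
      SuperK.ExistsUniserialExt l [n₁, n₂] ↔
        SuperK.ExistsUniserialExt l [n₁] ∧
        SuperK.ExistsUniserialExt (l + (n₁ : ℂ) / 2) [n₂] ∧
        SuperK.CupIsCoboundary l n₁ n₂) ∧
    -- uniqueness
    (∀ (l : ℂ) (n₁ n₂ : ℤ) (W W' : Type) [AddCommGroup W] [Module ℂ W] [AddCommGroup W']
      [Module ℂ W'] (ρ : SuperK.KRep W) (ρ' : SuperK.KRep W'),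
      ρ.IsUniserialExt l [n₁, n₂] → ρ'.IsUniserialExt l [n₁, n₂] → ρ.Equiv ρ') ∧
    -- (3/2, 3/2)
    ((∀ l : ℂ, SuperK.ExistsUniserialExt l [3, 3] ↔ -2 * l ∉ ({0, 1, 4, 5} : Set ℂ)) ∧
      ∀ l : ℂ, -2 * l ∉ ({0, 1, 2, 3, 4, 5} : Set ℂ) →
        SuperK.ExistsPsiDOUniserialExt l [3, 3]) ∧
    -- (2, 3/2)
    ((∀ l : ℂ, SuperK.ExistsUniserialExt l [4, 3] ↔ -2 * l ∉ ({0, 3, 5} : Set ℂ)) ∧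
      ∀ l : ℂ, -2 * l ∉ ({0, 1, 2, 3, 4, 5, 6} : Set ℂ) →
        SuperK.ExistsPsiDOUniserialExt l [4, 3]) ∧
    -- (3/2, 2)
    ((∀ l : ℂ, SuperK.ExistsUniserialExt l [3, 4] ↔ -2 * l ∉ ({1, 3} : Set ℂ)) ∧
      ∀ l : ℂ, -2 * l ∉ ({0, 1, 2, 3, 4, 5, 6} : Set ℂ) →
        SuperK.ExistsPsiDOUniserialExt l [3, 4]) ∧
    -- (5/2, 3/2)
    ((∀ l : ℂ, SuperK.ExistsUniserialExt l [5, 3] ↔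
        -4 * l ∉ ({0, 4, 12, 7 + ((√33 : ℝ) : ℂ), 7 - ((√33 : ℝ) : ℂ)} : Set ℂ)) ∧
      ∀ l : ℂ, -2 * l ∉ ({0, 1, 2, 3, 4, 5, 6, 7} : Set ℂ) →
        4 * l ∉ ({-7 + ((√33 : ℝ) : ℂ), -7 - ((√33 : ℝ) : ℂ)} : Set ℂ) →
        SuperK.ExistsPsiDOUniserialExt l [5, 3]) ∧
    -- (3/2, 5/2)
    ((∀ l : ℂ, SuperK.ExistsUniserialExt l [3, 5] ↔
        -4 * l ∉ ({2, 6, 10, 7 + ((√33 : ℝ) : ℂ), 7 - ((√33 : ℝ) : ℂ)} : Set ℂ)) ∧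
      ∀ l : ℂ, -2 * l ∉ ({0, 1, 2, 3, 4, 5, 6, 7} : Set ℂ) →
        4 * l ∉ ({-7 + ((√33 : ℝ) : ℂ), -7 - ((√33 : ℝ) : ℂ)} : Set ℂ) →
        SuperK.ExistsPsiDOUniserialExt l [3, 5]) ∧
    -- (2, 2)
    ((∀ l : ℂ, SuperK.ExistsUniserialExt l [4, 4] ↔
        -4 * l ∉ ({0, 8, 7 + ((√33 : ℝ) : ℂ), 7 - ((√33 : ℝ) : ℂ)} : Set ℂ)) ∧
      ∀ l : ℂ, -2 * l ∉ ({0, 1, 2, 3, 4, 5, 6, 7} : Set ℂ) →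
        4 * l ∉ ({-7 + ((√33 : ℝ) : ℂ), -7 - ((√33 : ℝ) : ℂ)} : Set ℂ) →
        SuperK.ExistsPsiDOUniserialExt l [4, 4]) ∧
    -- (5/2, 2)
    ((∀ l : ℂ, SuperK.ExistsUniserialExt l [5, 4] ↔ -4 * l ∉ ({0, 4, 8, 10} : Set ℂ)) ∧
      ∀ l : ℂ, -2 * l ∉ ({0, 1, 2, 3, 4, 5, 6, 7, 8} : Set ℂ) →
        SuperK.ExistsPsiDOUniserialExt l [5, 4]) ∧
    -- (2, 5/2)
    ((∀ l : ℂ, SuperK.ExistsUniserialExt l [4, 5] ↔ -4 * l ∉ ({0, 8, 12} : Set ℂ)) ∧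
      ∀ l : ℂ, -2 * l ∉ ({0, 1, 2, 3, 4, 5, 6, 7, 8} : Set ℂ) →
        SuperK.ExistsPsiDOUniserialExt l [4, 5]) ∧
    -- (3/2, 3), (5/2, 5/2) and (2, 3)
    (SuperK.ExistsUniserialExt (-4) [3, 6] ∧ SuperK.ExistsUniserialExt (-9 / 2) [5, 5] ∧
      SuperK.ExistsUniserialExt (-9 / 2) [4, 6]) := by
  exact ⟨SuperK.existsUniserialExt_two_iff,
    fun l n₁ n₂ W W' _ _ _ _ ρ ρ' h h' => h.equiv h',
    ⟨SuperK.exists_three_three, SuperK.exists_psiDO_three_three⟩,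
    ⟨SuperK.exists_four_three, SuperK.exists_psiDO_four_three⟩,
    ⟨SuperK.exists_three_four, SuperK.exists_psiDO_three_four⟩,
    ⟨SuperK.exists_five_three, SuperK.exists_psiDO_five_three⟩,
    ⟨SuperK.exists_three_five, SuperK.exists_psiDO_three_five⟩,
    ⟨SuperK.exists_four_four, SuperK.exists_psiDO_four_four⟩,
    ⟨SuperK.exists_five_four, SuperK.exists_psiDO_five_four⟩,
    ⟨SuperK.exists_four_five, SuperK.exists_psiDO_four_five⟩,
    SuperK.exists_three_six, SuperK.exists_five_five, SuperK.exists_four_six⟩
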